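/- **Setup.** For $D\in\{0,1,2,\dots\}\cup\{\infty\}$ consider variables $x_r$ with $1\le r\le D$ ($r$ finite), and put $x_{i\to j}=\prod_{r=i}^{j-1}x_r$ for $1\le i<j\le D+1$ ($j$ finite). Let $\mathbb H^{\rm symb}(D)$ be the free commutative graded $\mathbb Q$-algebra on the symbols $[x_r]_0$ (weight $1$) and $[x_{i_1\to i_2},\dots,x_{i_d\to i_{d+1}}]_{n_1,\dots,n_d}$ (weight $n_1+\dots+n_d$), where $d\ge1$, $i_1<\dots<i_{d+1}$, $n_a\ge 1$; write $\mathbb H^{\rm symb}=\mathbb H^{\rm symb}(\infty)$, which contains $\mathbb H^{\rm symb}(D)$ as the subalgebra generated by the symbols involving only $x_r$ with $r\le D$. Put $[x_{i\to j}]_0=\sum_{r=i}^{j-1}[x_r]_0$. For $y_a=x_{i_a\to i_{a+1}}$ put $y_{a\to b}=\prod_{r=a}^{b-1}y_r$ and $$[y_1,\dots,y_d|t_1,\dots,t_d]=\sum_{n_a\ge1}[y_1,\dots,y_d]_{n_1,\dots,n_d}t_1^{n_1-1}\cdots t_d^{n_d-1},\qquad \exp([y]_0t)=\sum_{n\ge0}\frac{[y]_0^n}{n!}t^n,\qquad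 [\emptyset|\emptyset]=1 .$$ Define power series $I(y_1,\dots,y_d|t_1,\dots,t_d)$ over $\mathbb H^{\rm symb}(D)$ (the inversions, written $\mathrm{INV}[y_d^{-1},\dots,y_1^{-1}|-t_d,\dots,-t_1]$) by $I(\emptyset|\emptyset)=1$ and, for $d\ge1$, $$\begin{aligned}I(y_1,\dots,y_d|t_1,\dots,t_d)&=\sum_{j=0}^{d-1}(-1)^{d-1+j}I(y_1,\dots,y_j|t_1,\dots,t_j)\,[y_{j+1},\dots,y_d|t_{j+1},\dots,t_d]\\&+\sum_{j=1}^d\frac{(-1)^{d-1+j}}{t_j}\Big(I(y_1,\dots,y_{j-1}|t_1,\dots,t_{j-1})[y_{j+1},\dots,y_d|t_{j+1},\dots,t_d]\\&\qquad-I(y_1,\dots,y_{j-1}|t_1-t_j,\dots,t_{j-1}-t_j)\exp([y_{1\to d+1}]_0t_j)[y_{j+1},\dots,y_d|t_{j+1}-t_j,\dots,t_d-t_j]\Big).\end{aligned}$$ The coproduct $\Delta$ of $\mathbb H^{\rm symb}(D)$ is the algebra homomorphism to $\mathbb H^{\rm symb}(D)\otimes\mathbb H^{\rm symb}(D)$ with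 $\Delta[x_r]_0=[x_r]_0\otimes1+1\otimes[x_r]_0$ and, coefficientwise in the $t_a$, $$\begin{aligned}\Delta[y_1,\dots,y_d|t_1,\dots,t_d]=\sum\ &[y_{i_1\to i_2},\dots,y_{i_k\to i_{k+1}}|t_{j_1},\dots,t_{j_k}]\otimes[y_1,\dots,y_{i_1-1}|t_1,\dots,t_{i_1-1}]\prod_{\alpha=1}^k\Big((-1)^{j_\alpha-i_\alpha}\exp([y_{i_\alpha\to i_{\alpha+1}}]_0t_{j_\alpha})\\&I(y_{i_\alpha},\dots,y_{j_\alpha-1}|t_{i_\alpha}-t_{j_\alpha},\dots,t_{j_\alpha-1}-t_{j_\alpha})\,[y_{j_\alpha+1},\dots,y_{i_{\alpha+1}-1}|t_{j_\alpha+1}-t_{j_\alpha},\dots,t_{i_{\alpha+1}-1}-t_{j_\alpha}]\Big),\end{aligned}$$ summed over all $k\ge0$ and $1\le i_1\le j_1<i_2\le j_2<\dots<i_k\le j_k<i_{k+1}=d+1$. Let $\mathbb L^{\rm symb}(D)=\mathbb H_{>0}/\mathbb H_{>0}\mathbb H_{>0}$ for $\mathbb H=\mathbb H^{\rm symb}(D)$.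 Let $\Omega^*(D)$ be the algebraic de Rham complex of the polynomial ring over $\mathbb Q$ in variables $u_r$ $(1\le r\le D)$ and $v_{i,j}$ $(1\le i\le j\le D)$, with $r,j$ finite. Identify the weight one part $\mathbb H_1$ with the span of these variables by $u_r=[x_r]_0$, $v_{i,j}=-[\prod_{r=i}^jx_r]_1$. Let $w\colon\mathbb H^{\rm symb}(D)\to\Omega^1(D)$ be the composite of the symbol map $\Delta_{1,\dots,1}\colon\mathbb H\to T^*\mathbb H_1$ (zeroth component the projection to $\mathbb H_0=\mathbb Q$; on weight $n\ge1$, $\Delta_{1,\dots,1}=(\mathrm{id}\otimes\Delta_{1,\dots,1})\circ\Delta_{1,n-1}$) with $$f_1\otimes\dots\otimes f_n\mapsto\frac{(-1)^{n+1}}{n!}\sum_{i=1}^n(-1)^{i-1}\binom{n-1}{i-1}f_1\cdots \mathrm df_i\cdots f_n .$$ For finite $d$ let $$\widehat S_d(\mathbb C)=\Big\{(u_r,v_{i,j})\in\mathbb C^{d+\binom{d+1}2}\ \Big|\ \exp\big(\textstyle\sum_{r=i}^ju_r\big)+\exp(v_{i,j})=1\text{ for }1\le i\le j\le d\Big\},$$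 a complex manifold on which the $u_r$ are local coordinates near every point. **Theorem 1.1.** (a) For every $D$ (in particular for $D=\infty$) the map $w$ kills products: $w(ab)=0$ for $a,b\in\mathbb H_{>0}$. The coproduct induces a cobracket $\delta\colon\mathbb L^{\rm symb}(D)\to\wedge^2\mathbb L^{\rm symb}(D)$, namely $\Delta$ followed by $\mathbb H\otimes\mathbb H\to\mathbb L\otimes\mathbb L\to\wedge^2\mathbb L$; its extension to an antiderivation of $\wedge^*\mathbb L^{\rm symb}(D)$ (equal to $\delta\wedge\mathrm{id}-\mathrm{id}\wedge\delta$ on $\wedge^2$, and so on) has square zero, and it preserves the subring generated by the classes of the symbols, i.e. the exterior algebra over $\mathbb Z$ of the integral form of $\mathbb L^{\rm symb}(D)$. The maps $$w\wedge\dots\wedge w\colon\wedge^k\mathbb L^{\rm symb}(D)\to\Omega^k(D)$$ form a chain map from the Chevalley–Eilenberg complex $\wedge^*\mathbb L^{\rm symb}(D)$ to the de Rham complex $\Omega^*(D)$. (b) Let $d$ be finite and $D\le d$ (for example $D=d$). Restricting polynomial forms to $\widehat S_d(\mathbb C)$, the maps in (a) give holomorphic forms on $\widehat S_d(\mathbb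 C)$ and a chain map from $\wedge^*\mathbb L^{\rm symb}(D)$ to the holomorphic de Rham complex of $\widehat S_d(\mathbb C)$. (c) The coproduct and $w$ on $\mathbb H^{\rm symb}(D)$ are the restrictions of those on $\mathbb H^{\rm symb}$. -/

import Mathlib

open scoped TensorProduct

noncomputable section

namespace SymbPolylog

/-! ### Generators

Indices start at `0`: the variables are `x_r` with `r < D`, where `D : ℕ∞` bounds the number of
variables; `D = ⊤` is the full theory and `D = d` the part involving only the first `d` variables.
A "point" is a natural number `i ≤ D`, and `x_{i → j} = ∏_{i ≤ r < j} x_r` for points `i < j`. -/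

/-- The data of a symbol `[x_{p 0 → p 1}, …, x_{p (d-1) → p d}]_{n 0, …, n (d-1)}` of depth `d`. -/
structure LiSymbol (D : ℕ∞) where
  depth : ℕ
  depth_pos : 0 < depth
  pts : Fin (depth + 1) → ℕ
  strictMono : StrictMono pts
  le_bound : (pts (Fin.last depth) : ℕ∞) ≤ D
  wts : Fin depth → ℕ+

/-- The indices `r` of the variables `x_r`. -/
abbrev VarIdx (D : ℕ∞) : Type := {r : ℕ // (r : ℕ∞) < D}

/-- Generators: `log r` is `[x_r]_0`, and `li s` is a polylogarithm symbol. -/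
inductive Gen (D : ℕ∞) : Type
  | log (r : VarIdx D) : Gen D
  | li (s : LiSymbol D) : Gen D

/-- The weight of a generator; `[x_r]_0` has weight one. -/
def Gen.weight {D : ℕ∞} : Gen D → ℕ
  | .log _ => 1
  | .li s => ∑ a, (s.wts a : ℕ)

/-- The algebra of symbolic polylogarithms in the variables `x_r`, `r < D`: the free commutative
`ℚ`-algebra on the generators. -/
abbrev Hsymb (D : ℕ∞) : Type := MvPolynomial (Gen D) ℚ

/-! ### Generating series -/

open Classical in
/-- The symbol `[x_{p 0 → p 1}, …, x_{p (m-1) → p m}]_{n}` as an element of the algebra; the empty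
symbol is `1` (and the value is `0` if the points `p 0, …, p m` are not admissible). -/
def bracket (D : ℕ∞) (m : ℕ) (p : ℕ → ℕ) (n : Fin m → ℕ+) : Hsymb D :=
  if h0 : m = 0 then 1
  else if h : StrictMono (fun a : Fin (m + 1) => p a) ∧ (p m : ℕ∞) ≤ D then
    MvPolynomial.X (Gen.li
      { depth := m
        depth_pos := Nat.pos_of_ne_zero h0
        pts := fun a => p a
        strictMono := h.1
        le_bound := by simpa using h.2
        wts := n })
  else 0

open Classical in
/-- `[x_{i → j}]_0 = ∑_{i ≤ r < j} [x_r]_0`. -/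
def logBracket (D : ℕ∞) (i j : ℕ) : Hsymb D :=
  ∑ r ∈ Finset.Ico i j, if h : (r : ℕ∞) < D then MvPolynomial.X (Gen.log ⟨r, h⟩) else 0

/-- `[y_1, …, y_m | t_1, …, t_m] = ∑ [y_1, …, y_m]_{n_1, …, n_m} t_1^{n_1 - 1} ⋯ t_m^{n_m - 1}`,
where `y_a = x_{p (a-1) → p a}`. -/
def liSeries (D : ℕ∞) (m : ℕ) (p : ℕ → ℕ) : MvPowerSeries (Fin m) (Hsymb D) :=
  fun e => bracket D m p (fun a => (e a).succPNat)

/-- `[y_1, …, y_m | s_1, …, s_m]` for power series `s_a` without constant term. -/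
def liAt (D : ℕ∞) {τ : Type} (m : ℕ) (p : ℕ → ℕ) (s : Fin m → MvPowerSeries τ (Hsymb D)) :
    MvPowerSeries τ (Hsymb D) :=
  MvPowerSeries.subst s (liSeries D m p)

/-- `exp(c s)` for a power series `s` without constant term. -/
def expAt (D : ℕ∞) {τ : Type} (c : Hsymb D) (s : MvPowerSeries τ (Hsymb D)) :
    MvPowerSeries τ (Hsymb D) :=
  PowerSeries.subst (c • s) (PowerSeries.exp (Hsymb D))

/-- The quotient `f / t_j` for a power series `f` divisible by the variable `t_j`. -/
def divVar {R τ : Type} [CommRing R] (j : τ) (f : MvPowerSeries τ R) : MvPowerSeries τ R :=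
  fun e => MvPowerSeries.coeff (e + Finsupp.single j 1) f

/-- The variable `t_i` among `t_0, …, t_{d-1}`. -/
def tvar (D : ℕ∞) (d i : ℕ) : MvPowerSeries (Fin d) (Hsymb D) :=
  if h : i < d then MvPowerSeries.X ⟨i, h⟩ else 0

/-- The series `INV([y_m⁻¹, …, y_1⁻¹ | -t_m, …, -t_1])` in the variables `t_1, …, t_m` (here
numbered from `0`), where `y_a = x_{p (a-1) → p a}`. It is given by the inversion formula; the two
groups of terms with denominator `t_j` are put together, so that the numerator is divisible by
`t_j`. -/
def invSeries (D : ℕ∞) (m : ℕ) (p : ℕ → ℕ) : MvPowerSeries (Fin m) (Hsymb D) :=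
  if m = 0 then 1 else
    (∑ j : Fin m, (-1) ^ (m + 1 + (j : ℕ)) *
      (MvPowerSeries.subst (fun i : Fin (j : ℕ) => tvar D m (i : ℕ)) (invSeries D (j : ℕ) p) *
        liAt D (m - (j : ℕ)) (fun a => p ((j : ℕ) + a))
          (fun i => tvar D m ((j : ℕ) + (i : ℕ))))) +
    ∑ j : Fin m, (-1) ^ (m + (j : ℕ)) *
      divVar j
        (MvPowerSeries.subst (fun i : Fin (j : ℕ) => tvar D m (i : ℕ))
              (invSeries D (j : ℕ) p) *
            liAt D (m - ((j : ℕ) + 1)) (fun a => p ((j : ℕ) + 1 + a))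
              (fun i => tvar D m ((j : ℕ) + 1 + (i : ℕ))) -
          MvPowerSeries.subst (fun i : Fin (j : ℕ) => tvar D m (i : ℕ) - tvar D m (j : ℕ))
              (invSeries D (j : ℕ) p) *
            expAt D (logBracket D (p 0) (p m)) (tvar D m (j : ℕ)) *
            liAt D (m - ((j : ℕ) + 1)) (fun a => p ((j : ℕ) + 1 + a))
              (fun i => tvar D m ((j : ℕ) + 1 + (i : ℕ)) - tvar D m (j : ℕ)))
termination_by m
decreasing_by all_goals exact j.isLt

/-- `INV([y_m⁻¹, …, y_1⁻¹ | -s_m, …, -s_1])` for power series `s_a` without constant term. -/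
def invAt (D : ℕ∞) {τ : Type} (m : ℕ) (p : ℕ → ℕ) (s : Fin m → MvPowerSeries τ (Hsymb D)) :
    MvPowerSeries τ (Hsymb D) :=
  MvPowerSeries.subst s (invSeries D m p)

/-! ### The coproduct -/

/-- The factor
`(-1)^{b-a} exp([y_{a → c}]_0 t_b) INV[y_{b-1}⁻¹, …, y_a⁻¹ | t_b - t_{b-1}, …, t_b - t_a]
[y_{b+1}, …, y_{c-1} | t_{b+1} - t_b, …, t_{c-1} - t_b]` of the coproduct formula,
where `y_l = x_{p l → p (l+1)}`. -/
def blockSeries (D : ℕ∞) (d : ℕ) (p : ℕ → ℕ) (a b c : ℕ) : MvPowerSeries (Fin d) (Hsymb D) :=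
  (-1) ^ (b - a) * expAt D (logBracket D (p a) (p c)) (tvar D d b) *
    invAt D (b - a) (fun l => p (a + l)) (fun l => tvar D d (a + (l : ℕ)) - tvar D d b) *
    liAt D (c - (b + 1)) (fun l => p (b + 1 + l))
      (fun l => tvar D d (b + 1 + (l : ℕ)) - tvar D d b)

/-- The start `i_a` of the `a`-th block, where `i_k = d` is the end of the last one. -/
def blockStart {d k : ℕ} (i : Fin k → Fin d) (a : ℕ) : ℕ :=
  if h : a < k then (i ⟨a, h⟩ : ℕ) else d

open Classical in
/-- The coproduct `Δ[y_0, …, y_{d-1} | t_0, …, t_{d-1}]` (with `y_l = x_{p l → p (l+1)}`), the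
inverted symbols in the right-hand factor being replaced by their images under `INV`. The sum is
over all `k` and all `0 ≤ i_0 ≤ j_0 < i_1 ≤ j_1 < ⋯ < i_{k-1} ≤ j_{k-1} < i_k = d`, and
the first factor on the right is `[y_0, …, y_{i_0 - 1} | t_0, …, t_{i_0 - 1}]`. -/
def coproductSeries (D : ℕ∞) (d : ℕ) (p : ℕ → ℕ) :
    MvPowerSeries (Fin d) (Hsymb D ⊗[ℚ] Hsymb D) :=
  ∑ k ∈ Finset.range (d + 1),
    ∑ ij ∈ (Finset.univ : Finset ((Fin k → Fin d) × (Fin k → Fin d))).filter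
        (fun ij => (∀ a, ij.1 a ≤ ij.2 a) ∧ ∀ a b, a < b → ij.2 a < ij.1 b),
      MvPowerSeries.map
          (Algebra.TensorProduct.includeLeft : Hsymb D →ₐ[ℚ] Hsymb D ⊗[ℚ] Hsymb D).toRingHom
          (liAt D k (fun a => p (blockStart ij.1 a)) (fun a => tvar D d (ij.2 a : ℕ))) *
        MvPowerSeries.map
          (Algebra.TensorProduct.includeRight : Hsymb D →ₐ[ℚ] Hsymb D ⊗[ℚ] Hsymb D).toRingHom
          (liAt D (blockStart ij.1 0) p (fun l => tvar D d (l : ℕ)) *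
            ∏ a : Fin k, blockSeries D d p (blockStart ij.1 (a : ℕ)) (ij.2 a : ℕ)
              (blockStart ij.1 ((a : ℕ) + 1)))

/-- The points of a symbol as a function on `ℕ`. -/
def LiSymbol.pt {D : ℕ∞} (s : LiSymbol D) (a : ℕ) : ℕ :=
  if h : a < s.depth + 1 then s.pts ⟨a, h⟩ else 0

/-- The coproduct on generators: `[x_r]_0` is primitive, and the coproduct of `[y]_{n_0, …}` is the
coefficient of `t_0^{n_0 - 1} ⋯` in the coproduct of the generating series. -/
def coproductGen (D : ℕ∞) : Gen D → Hsymb D ⊗[ℚ] Hsymb D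
  | .log r => MvPolynomial.X (Gen.log r) ⊗ₜ 1 + 1 ⊗ₜ MvPolynomial.X (Gen.log r)
  | .li s => MvPowerSeries.coeff (Finsupp.equivFunOnFinite.symm (fun a => (s.wts a : ℕ) - 1))
      (coproductSeries D s.depth s.pt)

/-- The coproduct. -/
def coproduct (D : ℕ∞) : Hsymb D →ₐ[ℚ] Hsymb D ⊗[ℚ] Hsymb D :=
  MvPolynomial.aeval (coproductGen D)

/-! ### Indecomposables -/

/-- The ideal of elements of positive weight (all generators have positive weight). -/
abbrev Hpos (D : ℕ∞) : Ideal (Hsymb D) :=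
  RingHom.ker (MvPolynomial.constantCoeff : Hsymb D →+* ℚ)

/-- The space of indecomposables, the positive weight part modulo products. -/
abbrev Lsymb (D : ℕ∞) : Type := (Hpos D).Cotangent

/-- The projection onto the indecomposables, extended by zero on scalars. -/
def toLsymb (D : ℕ∞) : Hsymb D →ₗ[ℚ] Lsymb D where
  toFun x := (Hpos D).toCotangent ⟨x - MvPolynomial.C (MvPolynomial.constantCoeff x), by
    simp [RingHom.mem_ker]⟩
  map_add' x y := by
    rw [← map_add]
    congr 1
    ext1
    simp only [map_add, Submodule.coe_add]
    ring
  map_smul' c x := by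
    have : ∀ z : Hpos D, c • (Hpos D).toCotangent z
        = (Hpos D).toCotangent ((MvPolynomial.C c : Hsymb D) • z) := by
      intro z
      rw [map_smul, ← MvPolynomial.algebraMap_eq, algebraMap_smul]
    rw [RingHom.id_apply, this]
    congr 1
    ext1
    simp [MvPolynomial.smul_eq_C_mul, mul_sub]

/-- The composite of the coproduct with `H ⊗ H → L ⊗ L → ⋀² L`; it induces the cobracket. -/
def cobracketH (D : ℕ∞) : Hsymb D →ₗ[ℚ] ExteriorAlgebra ℚ (Lsymb D) :=
  LinearMap.mul' ℚ (ExteriorAlgebra ℚ (Lsymb D)) ∘ₗ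
    TensorProduct.map (ExteriorAlgebra.ι ℚ ∘ₗ toLsymb D) (ExteriorAlgebra.ι ℚ ∘ₗ toLsymb D) ∘ₗ
    (coproduct D).toLinearMap

/-- The subring of `⋀ L` generated by the classes of the generators, that is, the exterior algebra
over `ℤ` of the integral form of `L`. -/
def integralForms (D : ℕ∞) : Subring (ExteriorAlgebra ℚ (Lsymb D)) :=
  Subring.closure (Set.range fun g : Gen D =>
    ExteriorAlgebra.ι ℚ (toLsymb D (MvPolynomial.X g)))

/-! ### The Chevalley–Eilenberg differential -/

section ChevalleyEilenberg

variable {M : Type} [AddCommGroup M] [Module ℚ M]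

theorem commute_of_mem_sq (a : M) {z : ExteriorAlgebra ℚ M} (hz : z ∈ ⋀[ℚ]^2 M) :
    ExteriorAlgebra.ι ℚ a * z = z * ExteriorAlgebra.ι ℚ a := by
  have anti : ∀ b c : M, ExteriorAlgebra.ι ℚ b * ExteriorAlgebra.ι ℚ c
      = -(ExteriorAlgebra.ι ℚ c * ExteriorAlgebra.ι ℚ b) := fun b c =>
    eq_neg_of_add_eq_zero_left (ExteriorAlgebra.ι_add_mul_swap b c)
  have hz' : z ∈ LinearMap.range (ExteriorAlgebra.ι ℚ (M := M)) *
      LinearMap.range (ExteriorAlgebra.ι ℚ (M := M)) := by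
    rw [← pow_two]; exact hz
  refine Submodule.mul_induction_on hz' ?_ ?_
  · rintro _ ⟨b, rfl⟩ _ ⟨c, rfl⟩
    rw [← mul_assoc, anti a b, neg_mul, mul_assoc, anti a c, mul_neg, neg_neg, mul_assoc]
  · intro x y hx hy
    rw [mul_add, add_mul, hx, hy]

/-- The algebra map `z ↦ !![α z, D z; 0, z]` (`α` the grade involution) that encodes the
antiderivation `D` extending `δ`. -/
def ceMatrix (δ : M →ₗ[ℚ] ⋀[ℚ]^2 M) :
    ExteriorAlgebra ℚ M →ₐ[ℚ] Matrix (Fin 2) (Fin 2) (ExteriorAlgebra ℚ M) :=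
  ExteriorAlgebra.lift ℚ
    ⟨{ toFun := fun a => !![-ExteriorAlgebra.ι ℚ a, (δ a : ExteriorAlgebra ℚ M);
                            0, ExteriorAlgebra.ι ℚ a]
       map_add' := fun a b => by
         ext i j; fin_cases i <;> fin_cases j <;> simp [add_comm]
       map_smul' := fun c a => by
         ext i j; fin_cases i <;> fin_cases j <;> simp },
     fun a => by
       have h := commute_of_mem_sq a (δ a).2
       ext i j; fin_cases i <;> fin_cases j <;> simp [Matrix.mul_apply, h]⟩

/-- The Chevalley–Eilenberg differential on `⋀ M`: the antiderivation extending the cobracket `δ`,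
so `a₁ ∧ ⋯ ∧ aₙ ↦ ∑ᵢ (-1)^{i-1} a₁ ∧ ⋯ ∧ δ aᵢ ∧ ⋯ ∧ aₙ`. -/
def ceDiff (δ : M →ₗ[ℚ] ⋀[ℚ]^2 M) : ExteriorAlgebra ℚ M →ₗ[ℚ] ExteriorAlgebra ℚ M where
  toFun z := ceMatrix δ z 0 1
  map_add' _ _ := by simp
  map_smul' _ _ := by simp

theorem ceMatrix_one_one (δ : M →ₗ[ℚ] ⋀[ℚ]^2 M) (z : ExteriorAlgebra ℚ M) :
    ceMatrix δ z 1 0 = 0 ∧ ceMatrix δ z 1 1 = z := by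
  induction z using ExteriorAlgebra.induction with
  | algebraMap r => simp [AlgHom.commutes, Matrix.algebraMap_matrix_apply]
  | ι a => simp [ceMatrix]
  | mul x y hx hy => simp [Matrix.mul_apply, hx.1, hx.2, hy.1, hy.2]
  | add x y hx hy => simp [hx.1, hx.2, hy.1, hy.2]

theorem ceDiff_ι (δ : M →ₗ[ℚ] ⋀[ℚ]^2 M) (a : M) : ceDiff δ (ExteriorAlgebra.ι ℚ a) = δ a := by
  simp [ceDiff, ceMatrix]

theorem ceDiff_ι_mul (δ : M →ₗ[ℚ] ⋀[ℚ]^2 M) (a : M) (z : ExteriorAlgebra ℚ M) :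
    ceDiff δ (ExteriorAlgebra.ι ℚ a * z)
      = (δ a : ExteriorAlgebra ℚ M) * z - ExteriorAlgebra.ι ℚ a * ceDiff δ z := by
  have h : ceMatrix δ (ExteriorAlgebra.ι ℚ a)
      = !![-ExteriorAlgebra.ι ℚ a, (δ a : ExteriorAlgebra ℚ M); 0, ExteriorAlgebra.ι ℚ a] := by
    simp [ceMatrix]
  simp only [ceDiff, LinearMap.coe_mk, AddHom.coe_mk, map_mul, Matrix.mul_apply, h,
    Fin.sum_univ_two, (ceMatrix_one_one δ z).2]
  simp [sub_eq_neg_add]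

end ChevalleyEilenberg

/-! ### The algebraic de Rham complex -/

/-- The variables `u r`, and `v i j` for points `i < j`. The variable `v i j` belongs to
`x_{i → j}`. -/
inductive FormVar (D : ℕ∞) : Type
  | u (r : VarIdx D) : FormVar D
  | v (i j : ℕ) (hij : i < j) (hj : (j : ℕ∞) ≤ D) : FormVar D

/-- The polynomial ring in the variables `u r`, `v i j`. -/
abbrev FormPoly (D : ℕ∞) : Type := MvPolynomial (FormVar D) ℚ

/-- The weight one part `H_1`, which has the basis `u r = [x_r]_0`, `v i j = -[x_{i → j}]_1`. -/
abbrev Hone (D : ℕ∞) : Type := FormVar D →₀ ℚ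

/-- The algebra of polynomial differential forms: `p ⊗ (u_1 ∧ ⋯ ∧ u_k)` stands for
`p du_1 ∧ ⋯ ∧ du_k`. -/
abbrev DeRham (D : ℕ∞) : Type := FormPoly D ⊗[ℚ] ExteriorAlgebra ℚ (Hone D)

/-- The forms of degree `k`. -/
def DeRham.degree (D : ℕ∞) (k : ℕ) : Submodule ℚ (DeRham D) :=
  LinearMap.range (TensorProduct.map LinearMap.id (⋀[ℚ]^k (Hone D)).subtype :
    FormPoly D ⊗[ℚ] (⋀[ℚ]^k (Hone D)) →ₗ[ℚ] DeRham D)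

/-- The derivation `p ↦ ∑ ∂p/∂y ⊗ y` over all variables `y`. -/
def gradient (D : ℕ∞) : Derivation ℚ (FormPoly D) (FormPoly D ⊗[ℚ] Hone D) :=
  MvPolynomial.mkDerivation ℚ fun y => 1 ⊗ₜ Finsupp.single y 1

/-- The exterior derivative, `p ⊗ η ↦ ∑ ∂p/∂y ⊗ (y ∧ η)`. -/
def deRhamD (D : ℕ∞) : DeRham D →ₗ[ℚ] DeRham D :=
  LinearMap.lTensor (FormPoly D)
      (LinearMap.mul' ℚ (ExteriorAlgebra ℚ (Hone D)) ∘ₗ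
        LinearMap.rTensor (ExteriorAlgebra ℚ (Hone D)) (ExteriorAlgebra.ι ℚ)) ∘ₗ
    (TensorProduct.assoc ℚ (FormPoly D) (Hone D) (ExteriorAlgebra ℚ (Hone D))).toLinearMap ∘ₗ
    LinearMap.rTensor (ExteriorAlgebra ℚ (Hone D)) (gradient D).toLinearMap

/-- An element `f` of `H_1`, viewed as the function `f`. -/
def funOf (D : ℕ∞) : Hone D →ₗ[ℚ] DeRham D :=
  (Algebra.TensorProduct.includeLeft : FormPoly D →ₐ[ℚ] DeRham D).toLinearMap ∘ₗ
    Finsupp.linearCombination ℚ (MvPolynomial.X : FormVar D → FormPoly D)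

/-- An element `f` of `H_1`, viewed as the one-form `df`. -/
def dOf (D : ℕ∞) : Hone D →ₗ[ℚ] DeRham D :=
  (Algebra.TensorProduct.includeRight :
    ExteriorAlgebra ℚ (Hone D) →ₐ[ℚ] DeRham D).toLinearMap ∘ₗ ExteriorAlgebra.ι ℚ

/-! ### The symbol and the one-forms -/

/-- The class in `H_1` of a generator of weight one; other generators go to zero. -/
def leadGen (D : ℕ∞) : Gen D → Hone D
  | .log r => Finsupp.single (.u r) 1
  | .li s =>
    if h : s.depth = 1 ∧ ∑ a, (s.wts a : ℕ) = 1 then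
      -Finsupp.single (.v (s.pts 0) (s.pts (Fin.last s.depth))
        (s.strictMono (by
          have := s.depth_pos
          simp [Fin.lt_def, this])) s.le_bound) 1
    else 0

/-- The projection onto the weight one part. -/
def projOne (D : ℕ∞) : Hsymb D →ₗ[ℚ] Hone D :=
  (MvPolynomial.basisMonomials (Gen D) ℚ).constr ℚ fun m =>
    if Finsupp.weight Gen.weight m = 1 then m.sum fun g e => e • leadGen D g else 0

/-- On weight `n` this is the iterated coproduct `Δ_{1,…,1}`, defined by
`Δ_{1,…,1} = (id ⊗ Δ_{1,…,1}) ∘ Δ_{1,n-1}`. -/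
def symbolAux (D : ℕ∞) : ℕ → (Hsymb D →ₗ[ℚ] TensorAlgebra ℚ (Hone D))
  | 0 => Algebra.linearMap ℚ (TensorAlgebra ℚ (Hone D)) ∘ₗ MvPolynomial.lcoeff ℚ 0
  | n + 1 => LinearMap.mul' ℚ (TensorAlgebra ℚ (Hone D)) ∘ₗ
      TensorProduct.map (TensorAlgebra.ι ℚ ∘ₗ projOne D) (symbolAux D n) ∘ₗ
      (coproduct D).toLinearMap

/-- The symbol map `Δ_{1,…,1}` from the algebra to the tensor algebra of `H_1`. -/
def symbol (D : ℕ∞) : Hsymb D →ₗ[ℚ] TensorAlgebra ℚ (Hone D) :=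
  (MvPolynomial.basisMonomials (Gen D) ℚ).constr ℚ fun m =>
    symbolAux D (Finsupp.weight Gen.weight m) (MvPolynomial.monomial m 1)

/-- `f_1 ⊗ ⋯ ⊗ f_n ↦ ((-1)^{n+1} / n!) ∑_i (-1)^{i-1} binom(n-1, i-1) f_1 ⋯ df_i ⋯ f_n`. -/
def wordForm (D : ℕ∞) (n : ℕ) : MultilinearMap ℚ (fun _ : Fin n => Hone D) (DeRham D) :=
  ((-1 : ℚ) ^ (n + 1) / (n.factorial : ℚ)) •
    ∑ i : Fin n, ((-1 : ℚ) ^ (i : ℕ) * ((n - 1).choose i : ℚ)) •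
      (MultilinearMap.mkPiAlgebraFin ℚ n (DeRham D)).compLinearMap
        fun j => if j = i then dOf D else funOf D

/-- The map from the tensor algebra of `H_1` to one-forms. -/
def tensorForm (D : ℕ∞) : TensorAlgebra ℚ (Hone D) →ₗ[ℚ] DeRham D :=
  DirectSum.toModule ℚ ℕ (DeRham D) (fun n => PiTensorProduct.lift (wordForm D n)) ∘ₗ
    (TensorAlgebra.equivDirectSum (R := ℚ) (M := Hone D)).toLinearMap

/-- The map `w` that attaches a one-form to a symbolic polylogarithm. -/
def w (D : ℕ∞) : Hsymb D →ₗ[ℚ] DeRham D := tensorForm D ∘ₗ symbol D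

/-! ### Fewer variables -/

/-- The inclusion of generators when the bound on the variables is removed. -/
def Gen.incl {D : ℕ∞} : Gen D → Gen ⊤
  | .log r => .log ⟨r.1, r.2.trans_le le_top⟩
  | .li s => .li { s with le_bound := le_top }

/-- The inclusion of form variables when the bound is removed. -/
def FormVar.incl {D : ℕ∞} : FormVar D → FormVar ⊤
  | .u r => .u ⟨r.1, r.2.trans_le le_top⟩
  | .v i j hij _ => .v i j hij le_top

/-- The inclusion of the subalgebra of elements that involve only `x_r`, `r < D`. -/
def Hsymb.incl (D : ℕ∞) : Hsymb D →ₐ[ℚ] Hsymb ⊤ := MvPolynomial.rename Gen.incl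

/-- The inclusion of the forms in the variables `u r`, `v i j` with `r < D`, `j ≤ D`. -/
def DeRham.incl (D : ℕ∞) : DeRham D →ₐ[ℚ] DeRham ⊤ :=
  Algebra.TensorProduct.map (MvPolynomial.rename FormVar.incl)
    (ExteriorAlgebra.map (Finsupp.lmapDomain ℚ ℚ FormVar.incl))

/-! ### The universal abelian cover and its holomorphic forms -/

/-- The ambient space of the coordinates `u_r` and `v_{i,j}`, `i < j ≤ d`. -/
abbrev Ambient (d : ℕ) : Type :=
  (Fin d → ℂ) × ({ij : Fin (d + 1) × Fin (d + 1) // ij.1 < ij.2} → ℂ)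

/-- `∑_{i ≤ r < j} u_r`. -/
def uSum {d : ℕ} (u : Fin d → ℂ) (i j : ℕ) : ℂ :=
  ∑ r : Fin d, if i ≤ (r : ℕ) ∧ (r : ℕ) < j then u r else 0

/-- The universal abelian cover `Ŝ_d(ℂ)`. -/
def Shat (d : ℕ) : Set (Ambient d) :=
  {q | ∀ ij, Complex.exp (uSum q.1 ij.1.1 ij.1.2) + Complex.exp (q.2 ij) = 1}

/-- The holomorphic local parametrization of `Ŝ_d(ℂ)` near its point `q` by the coordinates `u`. -/
def localParam {d : ℕ} (q : Ambient d) (u : Fin d → ℂ) : Ambient d :=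
  (u, fun ij => q.2 ij +
    Complex.log ((1 - Complex.exp (uSum u ij.1.1 ij.1.2)) / Complex.exp (q.2 ij)))

theorem localParam_self {d : ℕ} {q : Ambient d} (hq : q ∈ Shat d) : localParam q q.1 = q := by
  refine Prod.ext rfl (funext fun ij => ?_)
  have h := hq ij
  have h' : 1 - Complex.exp (uSum q.1 ij.1.1 ij.1.2) = Complex.exp (q.2 ij) := by
    rw [← h]; ring
  simp [localParam, h']

theorem localParam_mem {d : ℕ} (q : Ambient d) {u : Fin d → ℂ}
    (hu : ∀ ij : {ij : Fin (d + 1) × Fin (d + 1) // ij.1 < ij.2},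
      Complex.exp (uSum u ij.1.1 ij.1.2) ≠ 1) : localParam q u ∈ Shat d := by
  intro ij
  have h : (1 - Complex.exp (uSum u ij.1.1 ij.1.2)) / Complex.exp (q.2 ij) ≠ 0 :=
    div_ne_zero (sub_ne_zero.2 (hu ij).symm) (Complex.exp_ne_zero _)
  simp only [localParam]
  rw [Complex.exp_add, Complex.exp_log h, mul_div_cancel₀ _ (Complex.exp_ne_zero _)]
  ring

/-- A `k`-form on `Ŝ_d(ℂ)`, of type `(k, 0)`. The tangent spaces are identified with `ℂ^d` through
the functions `u_r`, which are local coordinates at every point. -/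
abbrev CoverForm (d k : ℕ) : Type := Shat d → (Fin d → ℂ) [⋀^Fin k]→L[ℂ] ℂ

open Classical in
/-- The expression of a form in the local coordinates `u` near `q`. -/
def CoverForm.inCoords {d k : ℕ} (η : CoverForm d k) (q : Ambient d) (u : Fin d → ℂ) :
    (Fin d → ℂ) [⋀^Fin k]→L[ℂ] ℂ :=
  if h : localParam q u ∈ Shat d then η ⟨localParam q u, h⟩ else 0

/-- A form is holomorphic if it is so in the local coordinates near every point. -/
def CoverForm.IsHolomorphic {d k : ℕ} (η : CoverForm d k) : Prop :=
  ∀ q : Shat d, AnalyticAt ℂ (η.inCoords q.1) q.1.1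

/-- The exterior derivative of a form, computed in local coordinates. -/
def CoverForm.extD {d k : ℕ} (η : CoverForm d k) : CoverForm d (k + 1) :=
  fun q => extDeriv (η.inCoords q.1) q.1.1

/-- The coordinate function on the ambient space that belongs to a form variable. -/
def coord {D : ℕ∞} {d : ℕ} (hD : D ≤ d) (q : Ambient d) : FormVar D → ℂ
  | .u r => q.1 ⟨r.1, Nat.cast_lt.1 (r.2.trans_le hD)⟩
  | .v i j hij hj =>
    have hjd : j ≤ d := Nat.cast_le.1 (hj.trans hD)
    q.2 ⟨(⟨i, by omega⟩, ⟨j, by omega⟩), hij⟩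

/-- The differential at `q` of a coordinate function, restricted to `Ŝ_d(ℂ)`. -/
def dCoord {D : ℕ∞} {d : ℕ} (hD : D ≤ d) (q : Ambient d) (y : FormVar D) : (Fin d → ℂ) →L[ℂ] ℂ :=
  fderiv ℂ (fun u => coord hD (localParam q u) y) q.1

/-- The determinant as a continuous alternating map. -/
def detForm (k : ℕ) : (Fin k → ℂ) [⋀^Fin k]→L[ℂ] ℂ :=
  { (Matrix.detRowAlternating : (Fin k → ℂ) [⋀^Fin k]→ₗ[ℂ] ℂ) with
    cont := by
      change Continuous fun A : Fin k → Fin k → ℂ => Matrix.det (Matrix.of A)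
      exact Continuous.matrix_det continuous_id }

theorem detForm_comp_apply {d k : ℕ} (f : Fin k → ((Fin d → ℂ) →L[ℂ] ℂ)) (X : Fin k → Fin d → ℂ) :
    (detForm k).compContinuousLinearMap (ContinuousLinearMap.pi f) X
      = (Matrix.of fun i j => f i (X j)).det := by
  rw [← Matrix.det_transpose]
  rfl

theorem update_eq_updateRow {d k : ℕ} (f : Fin k → ((Fin d → ℂ) →L[ℂ] ℂ)) (X : Fin k → Fin d → ℂ)
    (i : Fin k) (z : (Fin d → ℂ) →L[ℂ] ℂ) :
    (Matrix.of fun a j => (Function.update f i z) a (X j))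
      = (Matrix.of fun a j => f a (X j)).updateRow i (fun j => z (X j)) := by
  ext a j
  by_cases ha : a = i
  · subst ha; simp
  · simp [ha]

/-- The wedge product of covectors, `(f_1 ∧ ⋯ ∧ f_k)(X_1, …, X_k) = det (f_i(X_j))`. -/
def wedgeCovectors (d k : ℕ) :
    ((Fin d → ℂ) →L[ℂ] ℂ) [⋀^Fin k]→ₗ[ℚ] ((Fin d → ℂ) [⋀^Fin k]→L[ℂ] ℂ) where
  toFun f := (detForm k).compContinuousLinearMap (ContinuousLinearMap.pi f)
  map_update_add' {inst} f i x y := by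
    obtain rfl : inst = instDecidableEqFin k := Subsingleton.elim _ _
    ext X
    rw [ContinuousAlternatingMap.add_apply, detForm_comp_apply, detForm_comp_apply,
      detForm_comp_apply, update_eq_updateRow, update_eq_updateRow, update_eq_updateRow,
      ← Matrix.det_updateRow_add]
    rfl
  map_update_smul' {inst} f i c x := by
    obtain rfl : inst = instDecidableEqFin k := Subsingleton.elim _ _
    ext X
    rw [ContinuousAlternatingMap.smul_apply, detForm_comp_apply, detForm_comp_apply,
      update_eq_updateRow, update_eq_updateRow, Rat.smul_def, ← Matrix.det_updateRow_smul]
    congr 2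
  map_eq_zero_of_eq' f i j hf hij := by
    ext X
    rw [detForm_comp_apply]
    exact Matrix.det_zero_of_row_eq hij (by ext a; simp [hf])

/-- The part of degree `k` of the value at `q` of the form with constant coefficients. -/
def constFormAt {D : ℕ∞} {d : ℕ} (hD : D ≤ d) (k : ℕ) (q : Ambient d) :
    ExteriorAlgebra ℚ (Hone D) →ₗ[ℚ] ((Fin d → ℂ) [⋀^Fin k]→L[ℂ] ℂ) :=
  ExteriorAlgebra.liftAlternating (Pi.single k
    ((wedgeCovectors d k).compLinearMap
      (Finsupp.linearCombination ℚ (dCoord hD q))))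

/-- The degree `k` part of the value at `q` of a form `p dy_1 ∧ ⋯ ∧ dy_k`, bilinear in `p` and the
form with constant coefficients. -/
def realizeBilin {D : ℕ∞} {d : ℕ} (hD : D ≤ d) (k : ℕ) (q : Ambient d) :
    FormPoly D →ₗ[ℚ] ExteriorAlgebra ℚ (Hone D) →ₗ[ℚ] ((Fin d → ℂ) [⋀^Fin k]→L[ℂ] ℂ) :=
  LinearMap.mk₂ ℚ
    (fun p η => (MvPolynomial.aeval (coord hD q) p : ℂ) • constFormAt hD k q η)
    (fun p p' η => by ext X; simp [add_mul])
    (fun c p η => by ext X; simp [Rat.smul_def, mul_assoc])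
    (fun p η η' => by ext X; simp)
    (fun c p η => by ext X; simp [Rat.smul_def, mul_left_comm])

/-- The realization on `Ŝ_d(ℂ)` of the degree `k` part of a polynomial form whose variables all
exist there: the restriction of the form from the ambient space. -/
def realize {D : ℕ∞} {d : ℕ} (hD : D ≤ d) (k : ℕ) (ω : DeRham D) : CoverForm d k := fun q =>
  TensorProduct.lift (realizeBilin hD k q.1) ω

end SymbPolylog

end

/-!
Everything except the statements over `ℂ` follows from the fact that the coproduct makes `Hsymb D` a
graded connected bialgebra, and the only deep part of that is coassociativity.

*Coassociativity.* A generating series is viewed as a function `nodeSeries` on lists in which variables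
and points alternate: the lists that begin with a variable carry the series
`[y_1, …, y_d | t_1, …, t_d]`, those that begin with a point carry the inversions, both with suitable
exponential factors. With this normalization the coproduct formula says that the coproduct is the
composition `star`, which sums over all sublists with the same ends, as in Goncharov's coproduct of
iterated integrals (`map_convHom_nodeSeries`). The composition `star` is associative for formal reasons
(`star_assoc`). What remains is that the coproduct of an inversion is given by `star` too. The recursion
that defines the inversions becomes a quadratic equation (`insertSum_nodeSeries`), which determines the
inversions from the other series (`eq_of_insertSum_eq`) and which is stable under `star`
(`insertSum_star`). Hence `listFun_convHom` holds on all lists, and coassociativity follows. The series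
are kept as points `Hsymb D →ₐ[ℚ] R` with values in a domain `R`, so that one may divide by differences
of variables; the universal triple of points lives in the triple tensor power of `Hsymb D`.

*Gradings.* Multiplication of the weight `n` part by `c ^ n`, and the inclusions for fewer variables,
rescale the generating series. As `star` respects such rescalings, the coproduct commutes with these
maps (`coproduct_weightHom`, `coproduct_incl`).

*The complexes.* Let `*` be the convolution product of linear maps on the bialgebra. For the class map
`ℓ : H → L ⊆ ⋀ L` the cobracket is `ℓ * ℓ`, and so it has square zero because
`(ℓ * ℓ) * ℓ = ℓ * (ℓ * ℓ)`. Let `p` and `q` be the weight one coordinates as functions and as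
differentials. By the definition of the symbol the part `wₙ` of `w` of weight `n` is an alternating
binomial sum of `p ^ i * q * p ^ (n - 1 - i)`, that is an iterated commutator, and
`(n + 1) w_{n+1} = p * wₙ - wₙ * p` (`commutator_wDeg`). This recursion shows that `w` kills products
(`w_mul`), and, together with `dp = q` and `dq = 0`, the Maurer–Cartan equation `dw = w * w`
(`deRhamD_w`), which is the compatibility of `w` with the differentials. The integral form is preserved
since the divided powers of logarithms in the coproduct formula are decomposable from the second one on
(`dividedPower_mem_integralElements`).

*Holomorphic forms.* In the coordinates `u`, the restriction of `p dv_1 ∧ ⋯ ∧ dv_k` to the cover is the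
pullback of `x₀ dx₁ ∧ ⋯ ∧ dx_k` along a holomorphic map to `ℂ^(k+1)`, and the exterior derivative
commutes with pullbacks (`realize_isHolomorphic_and_deRhamD`).
-/

noncomputable section

namespace SymbPolylog

/-! ### Power series over `ℚ`-algebras -/

section PowerSeriesTools

variable {R τ : Type} [CommRing R]

theorem coeff_pow_eq_zero_of_constantCoeff {x : MvPowerSeries τ R}
    (hx : MvPowerSeries.constantCoeff x = 0) {n : ℕ} {e : τ →₀ ℕ} (h : e.degree < n) :
    MvPowerSeries.coeff e (x ^ n) = 0 := by
  apply MvPowerSeries.coeff_of_lt_order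
  have h2 : (n : ℕ∞) ≤ (x ^ n).order := MvPowerSeries.le_order_pow_of_constantCoeff_eq_zero n hx
  exact lt_of_lt_of_le (by exact_mod_cast h) h2

/-- Setting the variable `t_j` to zero does not change the coefficients of monomials
without `t_j`. -/
theorem coeff_subst_kill {σ : Type} [Finite σ] [DecidableEq σ] (j : σ) (f : MvPowerSeries σ R)
    {e : σ →₀ ℕ} (he : e j = 0) :
    MvPowerSeries.coeff e (MvPowerSeries.subst
      (fun i => if i = j then (0 : MvPowerSeries σ R) else MvPowerSeries.X i) f)
      = MvPowerSeries.coeff e f := by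
  classical
  have hs : MvPowerSeries.HasSubst
      (fun i => if i = j then (0 : MvPowerSeries σ R) else MvPowerSeries.X i) :=
    MvPowerSeries.hasSubst_of_constantCoeff_zero fun i => by split_ifs <;> simp
  have key : ∀ d : σ →₀ ℕ, MvPowerSeries.coeff e (d.prod fun s n =>
      (if s = j then (0 : MvPowerSeries σ R) else MvPowerSeries.X s) ^ n)
      = if d = e then 1 else 0 := by
    intro d
    by_cases hd : d j = 0
    · have : (d.prod fun s n => (if s = j then (0 : MvPowerSeries σ R) else MvPowerSeries.X s) ^ n)
          = MvPowerSeries.monomial d 1 := by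
        rw [MvPowerSeries.monomial_one_eq]
        refine Finsupp.prod_congr fun i hi => ?_
        rw [if_neg]
        rintro rfl
        exact (Finsupp.mem_support_iff.1 hi) hd
      rw [this, MvPowerSeries.coeff_monomial]
      simp [eq_comm]
    · rw [if_neg (fun h : d = e => hd (h ▸ he)), Finsupp.prod, Finset.prod_eq_zero (i := j), map_zero]
      · simpa using hd
      · simp [hd]
  rw [MvPowerSeries.coeff_subst hs, finsum_eq_single _ e]
  · rw [key, if_pos rfl, smul_eq_mul, mul_one]
  · intro d hd
    rw [key, if_neg hd, smul_zero]

/-- `divVar j` is an honest division by `t_j` on the series that vanish for `t_j = 0`. -/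
theorem X_mul_divVar {σ : Type} [Finite σ] [DecidableEq σ] (j : σ) (f : MvPowerSeries σ R)
    (hf : MvPowerSeries.subst
      (fun i => if i = j then (0 : MvPowerSeries σ R) else MvPowerSeries.X i) f = 0) :
    MvPowerSeries.X j * divVar j f = f := by
  have hdvd : MvPowerSeries.X j ∣ f := by
    rw [MvPowerSeries.X_dvd_iff]
    intro e he
    rw [← coeff_subst_kill j f he, hf, map_zero]
  obtain ⟨g, rfl⟩ := hdvd
  congr 1
  ext e
  change MvPowerSeries.coeff (e + Finsupp.single j 1) (MvPowerSeries.X j * g) = _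
  rw [add_comm, MvPowerSeries.X_def, MvPowerSeries.coeff_add_monomial_mul, one_mul]

variable [Algebra ℚ R]

/-- The exponential `exp x` of a power series `x` without constant term. -/
def expSer (x : MvPowerSeries τ R) : MvPowerSeries τ R :=
  PowerSeries.subst x (PowerSeries.exp R)

theorem coeff_expSer {x : MvPowerSeries τ R} (hx : MvPowerSeries.constantCoeff x = 0)
    {N : ℕ} {e : τ →₀ ℕ} (h : e.degree < N) :
    MvPowerSeries.coeff e (expSer x)
      = ∑ n ∈ Finset.range N, (1 / (n.factorial : ℚ)) • MvPowerSeries.coeff e (x ^ n) := by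
  rw [expSer, PowerSeries.coeff_subst (PowerSeries.HasSubst.of_constantCoeff_zero hx)]
  rw [finsum_eq_sum_of_support_subset]
  · refine Finset.sum_congr rfl fun n _ => ?_
    rw [PowerSeries.coeff_exp, algebraMap_smul]
  · intro n hn
    by_contra hcon
    apply hn
    have hlt : e.degree < n := by simp at hcon; omega
    change _ • MvPowerSeries.coeff e (x ^ n) = 0
    rw [coeff_pow_eq_zero_of_constantCoeff hx hlt, smul_zero]

theorem expSer_add {x y : MvPowerSeries τ R} (hx : MvPowerSeries.constantCoeff x = 0)
    (hy : MvPowerSeries.constantCoeff y = 0) : expSer (x + y) = expSer x * expSer y := by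
  classical
  ext e
  set N := e.degree + 1 with hN
  rw [coeff_expSer (by simp [hx, hy]) (Nat.lt_succ_self _), MvPowerSeries.coeff_mul]
  have h1 : ∀ a ∈ Finset.HasAntidiagonal.antidiagonal e, MvPowerSeries.coeff a.1 (expSer x)
        * MvPowerSeries.coeff a.2 (expSer y)
      = ∑ i ∈ Finset.range N, ∑ j ∈ Finset.range N,
        ((1 / (i.factorial : ℚ)) * (1 / (j.factorial : ℚ))) • (MvPowerSeries.coeff a.1 (x ^ i)
          * MvPowerSeries.coeff a.2 (y ^ j)) := by
    intro a ha
    have hd : a.1.degree + a.2.degree = e.degree := by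
      rw [← Finset.HasAntidiagonal.mem_antidiagonal.1 ha, map_add]
    rw [coeff_expSer hx (N := N) (by omega), coeff_expSer hy (N := N) (by omega),
      Finset.sum_mul_sum]
    refine Finset.sum_congr rfl fun i _ => Finset.sum_congr rfl fun j _ => ?_
    rw [smul_mul_smul_comm]
  rw [Finset.sum_congr rfl h1, Finset.sum_comm]
  have h2 : ∀ i ∈ Finset.range N, ∑ a ∈ Finset.HasAntidiagonal.antidiagonal e, ∑ j ∈ Finset.range N,
        ((1 / (i.factorial : ℚ)) * (1 / (j.factorial : ℚ))) • (MvPowerSeries.coeff a.1 (x ^ i)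
          * MvPowerSeries.coeff a.2 (y ^ j))
      = ∑ j ∈ Finset.range N, ((1 / (i.factorial : ℚ)) * (1 / (j.factorial : ℚ))) •
          MvPowerSeries.coeff e (x ^ i * y ^ j) := by
    intro i _
    rw [Finset.sum_comm]
    refine Finset.sum_congr rfl fun j _ => ?_
    rw [MvPowerSeries.coeff_mul, Finset.smul_sum]
  rw [Finset.sum_congr rfl h2]
  have h3 : ∀ n ∈ Finset.range N, (1 / (n.factorial : ℚ)) • MvPowerSeries.coeff e ((x + y) ^ n)
      = ∑ ij ∈ Finset.HasAntidiagonal.antidiagonal n, ((1 / (ij.1.factorial : ℚ)) * (1 / (ij.2.factorial : ℚ))) •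
          MvPowerSeries.coeff e (x ^ ij.1 * y ^ ij.2) := by
    intro n _
    rw [Commute.add_pow' (Commute.all x y), map_sum, Finset.smul_sum]
    refine Finset.sum_congr rfl fun ij hij => ?_
    rw [map_nsmul, ← Nat.cast_smul_eq_nsmul ℚ, smul_smul]
    congr 1
    rw [← Finset.HasAntidiagonal.mem_antidiagonal.1 hij, Nat.choose_symm_add, Nat.add_choose, Nat.cast_div
      (Nat.factorial_mul_factorial_dvd_factorial_add _ _) (by positivity)]
    have : ((ij.1 + ij.2).factorial : ℚ) ≠ 0 := by positivity
    push_cast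
    field_simp
  rw [Finset.sum_congr rfl h3, ← Finset.sum_product' (Finset.range N) (Finset.range N) (f := fun i j =>
    ((1 / (i.factorial : ℚ)) * (1 / (j.factorial : ℚ))) • MvPowerSeries.coeff e (x ^ i * y ^ j)),
    Finset.sum_sigma']
  refine Finset.sum_of_injOn (fun s => s.2) ?_ ?_ ?_ ?_
  · rintro ⟨n, i, j⟩ h ⟨n', i', j'⟩ h' heq
    simp only [Finset.coe_sigma, Set.mem_sigma_iff, Finset.mem_coe, Finset.HasAntidiagonal.mem_antidiagonal] at h h'
    simp only [Prod.mk.injEq] at heq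
    obtain ⟨rfl, rfl⟩ := heq
    obtain rfl : n = n' := h.2.symm.trans h'.2
    rfl
  · rintro ⟨n, i, j⟩ h
    simp only [Finset.coe_sigma, Set.mem_sigma_iff, Finset.mem_coe, Finset.HasAntidiagonal.mem_antidiagonal,
      Finset.mem_range] at h
    simp only [Finset.coe_product, Set.mem_prod, Finset.mem_coe, Finset.mem_range]
    omega
  · rintro ⟨i, j⟩ h hn
    -- the monomials of total degree at least `N` do not contribute to the coefficient of `t^e`
    have hij : N ≤ i + j := by
      by_contra hlt
      exact hn ⟨⟨i + j, i, j⟩, by simp; omega, rfl⟩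
    have : MvPowerSeries.coeff e (x ^ i * y ^ j) = 0 := by
      rw [MvPowerSeries.coeff_mul]
      refine Finset.sum_eq_zero fun a ha => ?_
      have hd : a.1.degree + a.2.degree = e.degree := by
        rw [← Finset.HasAntidiagonal.mem_antidiagonal.1 ha, map_add]
      by_cases h1 : a.1.degree < i
      · rw [coeff_pow_eq_zero_of_constantCoeff hx h1, zero_mul]
      · rw [coeff_pow_eq_zero_of_constantCoeff hy (n := j) (by omega), mul_zero]
    simp [this]
  · rintro ⟨n, i, j⟩ h
    rfl

theorem expSer_zero : expSer (0 : MvPowerSeries τ R) = 1 := by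
  rw [expSer, PowerSeries.subst_zero_eq_C_constantCoeff]
  simp

end PowerSeriesTools

/-! ### Substitution in the generating series -/

section Substitution

variable {D : ℕ∞} {σ τ : Type}

theorem hasSubst_zero [Finite σ] {s : σ → MvPowerSeries τ (Hsymb D)}
    (hs : ∀ i, MvPowerSeries.constantCoeff (s i) = 0) : MvPowerSeries.HasSubst s :=
  MvPowerSeries.hasSubst_of_constantCoeff_zero hs

theorem constantCoeff_tvar (d i : ℕ) : MvPowerSeries.constantCoeff (tvar D d i) = 0 := by
  unfold tvar
  split_ifs <;> simp

theorem expAt_eq (c : Hsymb D) (s : MvPowerSeries τ (Hsymb D)) : expAt D c s = expSer (c • s) := rfl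

theorem expAt_add_left (c c' : Hsymb D) {s : MvPowerSeries τ (Hsymb D)}
    (hs : MvPowerSeries.constantCoeff s = 0) :
    expAt D (c + c') s = expAt D c s * expAt D c' s := by
  rw [expAt_eq, add_smul, expSer_add] <;> simp [expAt_eq, hs]

theorem expAt_add_right (c : Hsymb D) {s s' : MvPowerSeries τ (Hsymb D)}
    (hs : MvPowerSeries.constantCoeff s = 0) (hs' : MvPowerSeries.constantCoeff s' = 0) :
    expAt D c (s + s') = expAt D c s * expAt D c s' := by
  rw [expAt_eq, smul_add, expSer_add] <;> simp [expAt_eq, hs, hs']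

theorem expAt_zero_right (c : Hsymb D) : expAt D c (0 : MvPowerSeries τ (Hsymb D)) = 1 := by
  rw [expAt_eq, smul_zero, expSer_zero]

theorem expAt_zero_left (s : MvPowerSeries τ (Hsymb D)) : expAt D 0 s = 1 := by
  rw [expAt_eq, zero_smul, expSer_zero]

theorem subst_expAt [Finite σ] {t : σ → MvPowerSeries τ (Hsymb D)}
    (ht : ∀ i, MvPowerSeries.constantCoeff (t i) = 0) (c : Hsymb D)
    {s : MvPowerSeries σ (Hsymb D)} (hs : MvPowerSeries.constantCoeff s = 0) :
    MvPowerSeries.subst t (expAt D c s) = expAt D c (MvPowerSeries.subst t s) := by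
  have h : MvPowerSeries.constantCoeff (c • s) = 0 := by simp [hs]
  rw [expAt, expAt, PowerSeries.subst, PowerSeries.subst,
    MvPowerSeries.subst_comp_subst_apply (MvPowerSeries.hasSubst_of_constantCoeff_zero fun _ => h)
      (hasSubst_zero ht), MvPowerSeries.subst_smul (hasSubst_zero ht)]

theorem liSeries_congr {m : ℕ} {p q : ℕ → ℕ} (h : ∀ a ≤ m, p a = q a) :
    liSeries D m p = liSeries D m q := by
  funext e
  have h1 : (fun a : Fin (m + 1) => p a) = fun a : Fin (m + 1) => q a :=
    funext fun a => h a (Nat.lt_succ_iff.1 a.2)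
  simp only [liSeries, bracket, h1, h m le_rfl]

theorem liSeries_zero (p : ℕ → ℕ) : liSeries D 0 p = 1 := by
  ext1 e
  obtain rfl : e = 0 := Subsingleton.elim _ _
  rw [MvPowerSeries.coeff_zero_one]
  change bracket D 0 p (fun a => ((0 : Fin 0 →₀ ℕ) a).succPNat) = 1
  simp [bracket]

theorem liAt_zero (p : ℕ → ℕ) (s : Fin 0 → MvPowerSeries τ (Hsymb D)) : liAt D 0 p s = 1 := by
  rw [liAt, liSeries_zero, ← MvPowerSeries.coe_substAlgHom (hasSubst_zero fun i => i.elim0),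
    map_one]

theorem liAt_congr {m : ℕ} {p q : ℕ → ℕ} {s t : Fin m → MvPowerSeries τ (Hsymb D)}
    (h : ∀ a ≤ m, p a = q a) (hst : ∀ i, s i = t i) : liAt D m p s = liAt D m q t := by
  rw [liAt, liAt, liSeries_congr h, funext hst]

theorem subst_liAt [Finite σ] {t : σ → MvPowerSeries τ (Hsymb D)}
    (ht : ∀ i, MvPowerSeries.constantCoeff (t i) = 0) {m : ℕ} (p : ℕ → ℕ)
    {s : Fin m → MvPowerSeries σ (Hsymb D)} (hs : ∀ i, MvPowerSeries.constantCoeff (s i) = 0) :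
    MvPowerSeries.subst t (liAt D m p s) = liAt D m p fun i => MvPowerSeries.subst t (s i) :=
  MvPowerSeries.subst_comp_subst_apply (hasSubst_zero hs) (hasSubst_zero ht) _

/-- The numerator over `t_j` in the inversion formula. -/
def invNumerator (D : ℕ∞) (m : ℕ) (p : ℕ → ℕ) (s : ℕ → MvPowerSeries τ (Hsymb D)) (j : ℕ) :
    MvPowerSeries τ (Hsymb D) :=
  invAt D j p (fun i => s i) *
      liAt D (m - (j + 1)) (fun a => p (j + 1 + a)) (fun i => s (j + 1 + i)) -
    invAt D j p (fun i => s i - s j) * expAt D (logBracket D (p 0) (p m)) (s j) *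
      liAt D (m - (j + 1)) (fun a => p (j + 1 + a)) (fun i => s (j + 1 + i) - s j)

theorem invSeries_eq {m : ℕ} (hm : m ≠ 0) (p : ℕ → ℕ) :
    invSeries D m p = ∑ j : Fin m, (-1) ^ (m + 1 + (j : ℕ)) *
        (invAt D j p (fun i => tvar D m i) *
          liAt D (m - j) (fun a => p (j + a)) (fun i => tvar D m (j + i))) +
      ∑ j : Fin m, (-1) ^ (m + (j : ℕ)) * divVar j (invNumerator D m p (tvar D m) j) := by
  rw [invSeries, if_neg hm]
  rfl

theorem invSeries_congr {m : ℕ} {p q : ℕ → ℕ} (h : ∀ a ≤ m, p a = q a) :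
    invSeries D m p = invSeries D m q := by
  induction m using Nat.strong_induction_on with
  | _ m ih =>
    rcases eq_or_ne m 0 with rfl | hm
    · rw [invSeries, invSeries, if_pos rfl, if_pos rfl]
    have hi : ∀ j : Fin m, invSeries D j p = invSeries D j q := fun j =>
      ih j j.2 fun a ha => h a (by omega)
    have hl : ∀ (j k : ℕ), j + k ≤ m → ∀ s : Fin k → MvPowerSeries (Fin m) (Hsymb D),
        liAt D k (fun a => p (j + a)) s = liAt D k (fun a => q (j + a)) s := fun j k hjk s =>
      liAt_congr (fun a ha => h _ (by omega)) fun _ => rfl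
    rw [invSeries_eq hm, invSeries_eq hm]
    refine congrArg₂ (· + ·) ?_ ?_
    · refine Finset.sum_congr rfl fun j _ => ?_
      rw [invAt, invAt, hi, hl _ _ (by omega)]
    · refine Finset.sum_congr rfl fun j _ => ?_
      rw [invNumerator, invNumerator, invAt, invAt, invAt, invAt, hi, h 0 (Nat.zero_le _),
        h m le_rfl, hl _ _ (by omega), hl _ _ (by omega)]

theorem invAt_congr {m : ℕ} {p q : ℕ → ℕ} {s t : Fin m → MvPowerSeries τ (Hsymb D)}
    (h : ∀ a ≤ m, p a = q a) (hst : ∀ i, s i = t i) : invAt D m p s = invAt D m q t := by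
  rw [invAt, invAt, invSeries_congr h, funext hst]

theorem invSeries_zero (p : ℕ → ℕ) : invSeries D 0 p = 1 := by
  rw [invSeries, if_pos rfl]

theorem invAt_zero (p : ℕ → ℕ) (s : Fin 0 → MvPowerSeries τ (Hsymb D)) : invAt D 0 p s = 1 := by
  rw [invAt, invSeries_zero, ← MvPowerSeries.coe_substAlgHom (hasSubst_zero fun i => i.elim0),
    map_one]

theorem subst_invAt [Finite σ] {t : σ → MvPowerSeries τ (Hsymb D)}
    (ht : ∀ i, MvPowerSeries.constantCoeff (t i) = 0) {m : ℕ} (p : ℕ → ℕ)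
    {s : Fin m → MvPowerSeries σ (Hsymb D)} (hs : ∀ i, MvPowerSeries.constantCoeff (s i) = 0) :
    MvPowerSeries.subst t (invAt D m p s) = invAt D m p fun i => MvPowerSeries.subst t (s i) :=
  MvPowerSeries.subst_comp_subst_apply (hasSubst_zero hs) (hasSubst_zero ht) _

theorem subst_tvar {d : ℕ} {s : ℕ → MvPowerSeries τ (Hsymb D)}
    (hs : ∀ i, MvPowerSeries.constantCoeff (s i) = 0) {i : ℕ} (hi : i < d) :
    MvPowerSeries.subst (fun a : Fin d => s a) (tvar D d i) = s i := by
  rw [tvar, dif_pos hi, MvPowerSeries.subst_X (hasSubst_zero fun a : Fin d => hs a)]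

theorem subst_invNumerator {m : ℕ} (p : ℕ → ℕ) {s : ℕ → MvPowerSeries τ (Hsymb D)}
    (hs : ∀ i, MvPowerSeries.constantCoeff (s i) = 0) {j : ℕ} (hj : j < m) :
    MvPowerSeries.subst (fun a : Fin m => s a) (invNumerator D m p (tvar D m) j)
      = invNumerator D m p s j := by
  have ht := constantCoeff_tvar (D := D) m
  have hs' : ∀ a : Fin m, MvPowerSeries.constantCoeff (s a) = 0 := fun a => hs a
  have hS := hasSubst_zero hs'
  have htt : ∀ i, MvPowerSeries.constantCoeff (tvar D m i - tvar D m j) = 0 := fun i => by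
    simp [ht]
  rw [invNumerator, MvPowerSeries.subst_sub hS, MvPowerSeries.subst_mul hS,
    MvPowerSeries.subst_mul hS, MvPowerSeries.subst_mul hS, subst_invAt hs' _ (fun i => ht i),
    subst_invAt hs' _ (fun i => htt i), subst_liAt hs' _ (fun i => ht _),
    subst_liAt hs' _ (fun i => htt _), subst_expAt hs' _ (ht j), subst_tvar hs hj, invNumerator]
  refine congrArg₂ (· - ·) ?_ ?_
  · refine congrArg₂ (· * ·) ?_ ?_
    · exact invAt_congr (fun _ _ => rfl) fun i => subst_tvar hs (by omega)
    · exact liAt_congr (fun _ _ => rfl) fun i => subst_tvar hs (by omega)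
  · refine congrArg₂ (· * ·) (congrArg (· * _) ?_) ?_
    · refine invAt_congr (fun _ _ => rfl) fun i => ?_
      rw [MvPowerSeries.subst_sub hS, subst_tvar hs hj, subst_tvar hs (by omega)]
    · refine liAt_congr (fun _ _ => rfl) fun i => ?_
      rw [MvPowerSeries.subst_sub hS, subst_tvar hs hj, subst_tvar hs (by omega)]

theorem invNumerator_of_eq_zero (m : ℕ) (p : ℕ → ℕ) (s : ℕ → MvPowerSeries τ (Hsymb D)) {j : ℕ}
    (hj : s j = 0) : invNumerator D m p s j = 0 := by
  simp [invNumerator, hj, expAt_zero_right]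

/-- The inversion formula with `s_j` substituted for `t_j`, where `Q j` is the quotient of the
`j`-th numerator by `s_j`. -/
theorem exists_invAt_eq {m : ℕ} (hm : m ≠ 0) (p : ℕ → ℕ) {s : ℕ → MvPowerSeries τ (Hsymb D)}
    (hs : ∀ i, MvPowerSeries.constantCoeff (s i) = 0) :
    ∃ Q : ℕ → MvPowerSeries τ (Hsymb D), (∀ j < m, s j * Q j = invNumerator D m p s j) ∧
      invAt D m p (fun i => s i) =
        ∑ j ∈ Finset.range m, (-1) ^ (m + 1 + j) * (invAt D j p (fun i => s i) *
          liAt D (m - j) (fun a => p (j + a)) (fun i => s (j + i))) +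
        ∑ j ∈ Finset.range m, (-1) ^ (m + j) * Q j := by
  classical
  have hs' : ∀ a : Fin m, MvPowerSeries.constantCoeff (s a) = 0 := fun a => hs a
  have hS := hasSubst_zero hs'
  have ht := constantCoeff_tvar (D := D) m
  set σ := MvPowerSeries.substAlgHom (R := Hsymb D) hS with hσ
  have hσa : ∀ f, σ f = MvPowerSeries.subst (fun a : Fin m => s a) f := fun f => by
    rw [hσ, MvPowerSeries.substAlgHom_apply]
  set N : ℕ → MvPowerSeries (Fin m) (Hsymb D) := invNumerator D m p (tvar D m) with hN
  have hdiv : ∀ j : Fin m, MvPowerSeries.X j * divVar j (N j) = N j := by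
    intro j
    refine X_mul_divVar j _ ?_
    set z : ℕ → MvPowerSeries (Fin m) (Hsymb D) := fun i =>
      if i = (j : ℕ) then 0 else tvar D m i with hz
    have hz0 : ∀ i, MvPowerSeries.constantCoeff (z i) = 0 := fun i => by
      simp only [hz]; split_ifs <;> simp [ht]
    have hzz : (fun i : Fin m => if i = j then (0 : MvPowerSeries (Fin m) (Hsymb D))
        else MvPowerSeries.X i) = fun a : Fin m => z a := by
      funext i
      simp [hz, Fin.ext_iff, tvar]
    rw [hzz, hN, subst_invNumerator p hz0 j.2]
    exact invNumerator_of_eq_zero m p z (by simp [hz])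
  refine ⟨fun j => if h : j < m then σ (divVar ⟨j, h⟩ (N j)) else 0, ?_, ?_⟩
  · intro j hj
    have := congrArg σ (hdiv ⟨j, hj⟩)
    rw [map_mul, hσa (MvPowerSeries.X _), MvPowerSeries.subst_X hS, hσa (N _), hN,
      subst_invNumerator p hs hj] at this
    simpa only [dif_pos hj] using this
  · rw [invAt, invSeries_eq hm, ← hσa, map_add, map_sum, map_sum,
      Finset.sum_range (fun j => _ * _), Finset.sum_range (fun j => _ * _)]
    have h1 : ∀ n : ℕ, σ ((-1) ^ n) = (-1) ^ n := fun n => by rw [map_pow, map_neg, map_one]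
    refine congrArg₂ (· + ·) ?_ ?_
    · refine Finset.sum_congr rfl fun j _ => ?_
      rw [map_mul, map_mul, h1, hσa, hσa, subst_invAt hs' _ (fun i => ht i),
        subst_liAt hs' _ (fun i => ht _)]
      refine congrArg ((-1) ^ _ * ·) (congrArg₂ (· * ·) ?_ ?_)
      · exact invAt_congr (fun _ _ => rfl) fun i => subst_tvar hs (by omega)
      · exact liAt_congr (fun _ _ => rfl) fun i => subst_tvar hs (by omega)
    · refine Finset.sum_congr rfl fun j _ => ?_
      rw [map_mul, h1, dif_pos j.2]

end Substitution

/-! ### Sums over the cuts of a list -/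

section Chains

variable {N K : Type} [CommRing K]

/-- The sum of `f u c v` over all ways to write a list as `u ++ c :: v`. -/
def splitSum (f : List N → N → List N → K) : List N → K
  | [] => 0
  | c :: v => f [] c v + splitSum (fun u => f (c :: u)) v

theorem splitSum_congr {f g : List N → N → List N → K} {w : List N}
    (h : ∀ u c v, w = u ++ c :: v → f u c v = g u c v) : splitSum f w = splitSum g w := by
  induction w generalizing f g with
  | nil => rfl
  | cons c w ih =>
    rw [splitSum, splitSum, h [] c w rfl]
    congr 1
    exact ih fun u c' v h' => h _ _ _ (by rw [h']; rfl)

theorem splitSum_add (f g : List N → N → List N → K) (w : List N) :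
    splitSum (fun u c v => f u c v + g u c v) w = splitSum f w + splitSum g w := by
  induction w generalizing f g with
  | nil => simp [splitSum]
  | cons c w ih => rw [splitSum, splitSum, splitSum, ih]; ring

theorem splitSum_mul_left (r : K) (f : List N → N → List N → K) (w : List N) :
    splitSum (fun u c v => r * f u c v) w = r * splitSum f w := by
  induction w generalizing f with
  | nil => simp [splitSum]
  | cons c w ih => rw [splitSum, splitSum, ih]; ring

theorem splitSum_eq_sum (a : N) (f : List N → N → List N → K) (w : List N) :
    splitSum f w
      = ∑ k ∈ Finset.range w.length, f (w.take k) (w.getD k a) (w.drop (k + 1)) := by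
  induction w generalizing f with
  | nil => simp [splitSum]
  | cons c w ih =>
    rw [splitSum, ih, List.length_cons, Finset.sum_range_succ', add_comm]
    simp

/-- For a function `H` on lists, the sum over all sublists `C` of `w` that contain the last entry
of `w` of the products `H C · ψ g₁ ⋯ ψ gₘ`, where the gaps `g₁, …, gₘ` are the segments (ends
included) into which the entries of `C` cut the list `acc ++ w`, and `acc` is the initial part of
the first gap. -/
def gapSum (ψ : List N → K) : List N → (List N → K) → List N → K
  | [], H, acc => if acc.length = 1 then H [] else 0
  | c :: w, H, acc => ψ (acc ++ [c]) * gapSum ψ w (fun l => H (c :: l)) [c]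
      + gapSum ψ w H (acc ++ [c])

theorem gapSum_add (ψ : List N → K) (w : List N) (H H' : List N → K) (acc : List N) :
    gapSum ψ w (fun l => H l + H' l) acc = gapSum ψ w H acc + gapSum ψ w H' acc := by
  induction w generalizing H H' acc with
  | nil => simp only [gapSum]; split_ifs <;> simp
  | cons c w ih => simp only [gapSum, ih]; ring

theorem gapSum_mul_left (ψ : List N → K) (r : K) (w : List N) (H : List N → K) (acc : List N) :
    gapSum ψ w (fun l => r * H l) acc = r * gapSum ψ w H acc := by
  induction w generalizing H acc with
  | nil => simp only [gapSum]; split_ifs <;> simp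
  | cons c w ih => simp only [gapSum, ih]; ring

/-- The sums `gapSum` only involve the values of `H` on sublists with the right last entry, and the
values of `ψ` on segments. -/
theorem gapSum_congr {ψ ψ' : List N → K} {w : List N} {H H' : List N → K} {acc : List N}
    (hacc : acc ≠ []) (hH : ∀ l, l.Sublist w → l.getLast? = w.getLast? → H l = H' l)
    (hψ : ∀ z, z <:+: acc ++ w → ψ z = ψ' z) : gapSum ψ w H acc = gapSum ψ' w H' acc := by
  induction w generalizing H H' acc with
  | nil => rw [gapSum, gapSum, hH [] (List.Sublist.refl _) rfl]
  | cons c w ih =>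
    rw [gapSum, gapSum, hψ (acc ++ [c]) ⟨[], w, by simp⟩]
    refine congrArg₂ (· + ·) (congrArg _ ?_) ?_
    · refine ih (by simp) (fun l hl hl' => hH _ (hl.cons_cons c) ?_) fun z hz => hψ z ?_
      · rw [List.getLast?_cons, List.getLast?_cons, hl']
      · exact hz.trans ⟨acc, [], by simp⟩
    · rcases eq_or_ne w [] with rfl | hw
      · have : (acc ++ [c]).length ≠ 1 := by
          have := List.length_pos_iff.2 hacc
          simp; omega
        rw [gapSum, gapSum, if_neg this, if_neg this]
      · refine ih (by simp) (fun l hl hl' => hH _ (hl.cons c) ?_) fun z hz => hψ z (by simpa using hz)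
        rw [hl', List.getLast?_cons, List.getLast?_eq_some_getLast hw]
        simp

theorem gapSum_zero (ψ : List N → K) (w acc : List N) : gapSum ψ w (fun _ => 0) acc = 0 := by
  simpa using gapSum_mul_left ψ 0 w (fun _ => 0) acc

/-- `gapSum` is multiplicative for products that overlap in one entry. -/
theorem gapSum_splitSum (ψ : List N → K) (A : List N → K) (B : N → List N → K) (w : List N)
    {acc : List N} (hacc : acc ≠ []) :
    gapSum ψ w (splitSum fun u c v => A (u ++ [c]) * B c v) acc
      = splitSum (fun u c v => gapSum ψ (u ++ [c]) A acc * gapSum ψ v (B c) [c]) w := by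
  induction w generalizing A acc with
  | nil => simp [gapSum, splitSum]
  | cons c w ih =>
    have hlen : (acc ++ [c]).length ≠ 1 := by
      have := List.length_pos_iff.2 hacc
      simp; omega
    have h1 : (fun l => splitSum (fun u c v => A (u ++ [c]) * B c v) (c :: l))
        = fun l => A [c] * B c l + splitSum (fun u c' v => A (c :: (u ++ [c'])) * B c' v) l := rfl
    rw [gapSum, h1, gapSum_add, gapSum_mul_left,
      ih (fun l => A (c :: l)) (by simp), ih A (by simp), splitSum]
    simp only [List.nil_append, List.cons_append, gapSum, if_neg hlen, List.length_singleton,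
      if_true, add_mul, splitSum_add, mul_assoc, splitSum_mul_left]
    ring

/-- Decomposition of `gapSum` by the first gap. -/
theorem gapSum_first (ψ : List N → K) (H : List N → K) (w : List N) {acc : List N}
    (hacc : acc ≠ []) :
    gapSum ψ w H acc = (if acc.length = 1 ∧ w = [] then H [] else 0)
      + splitSum (fun u c v => ψ (acc ++ u ++ [c]) * gapSum ψ v (fun l => H (c :: l)) [c]) w := by
  induction w generalizing acc with
  | nil => simp [gapSum, splitSum]
  | cons c w ih =>
    have hlen : ¬ ((acc ++ [c]).length = 1 ∧ w = []) := by
      rintro ⟨h, -⟩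
      simp at h
      exact hacc h
    rw [gapSum, splitSum, ih (acc := acc ++ [c]) (by simp), if_neg hlen, if_neg (by simp)]
    simp

/-- Decomposition of `gapSum` by the last gap. -/
theorem gapSum_last (ψ : List N → K) (H : List N → K) (w : List N) (s : N) {acc : List N}
    (hacc : acc ≠ []) :
    gapSum ψ (w ++ [s]) H acc = H [s] * ψ (acc ++ w ++ [s])
      + splitSum (fun u c v => gapSum ψ (u ++ [c]) (fun l => H (l ++ [s])) acc
          * ψ (c :: v ++ [s])) w := by
  induction w generalizing H acc with
  | nil =>
    have := List.length_pos_iff.2 hacc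
    have hlen : (acc ++ [s]).length ≠ 1 := by simp; omega
    simp [gapSum, splitSum, hacc, mul_comm]
  | cons c w ih =>
    have hlen : (acc ++ [c]).length ≠ 1 := by
      have := List.length_pos_iff.2 hacc
      simp; omega
    rw [List.cons_append, gapSum, ih _ (by simp), ih _ (by simp), splitSum]
    simp only [List.nil_append, List.cons_append, gapSum, if_neg hlen, List.length_singleton,
      if_true, add_mul, splitSum_add, mul_assoc, splitSum_mul_left, List.append_assoc]
    ring

/-- The composition of functions on lists underlying Goncharov's coproduct of iterated integrals:
`(φ ⋆ ψ)(L)` is the sum over all sublists `C` of `L` with the same ends of `φ(C)` times the product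
of the values of `ψ` on the segments into which `C` cuts `L`. -/
def star (φ ψ : List N → K) : List N → K
  | [] => 0
  | a :: w => gapSum ψ w (fun l => φ (a :: l)) [a]

theorem gapSum_ite_nil (ψ : List N → K) (r : K) (w : List N) (a : N) :
    gapSum ψ w (fun l => if l = [] then r else 0) [a] = if w = [] then r else 0 := by
  cases w with
  | nil => simp [gapSum]
  | cons c w =>
    rw [gapSum_first _ _ _ (List.cons_ne_nil a [])]
    simp only [List.cons_ne_nil, and_false, if_false, gapSum_zero, mul_zero, zero_add]
    rw [show (fun (_ : List N) (_ : N) (_ : List N) => (0 : K)) = fun _ _ _ => 0 * 0 by simp,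
      splitSum_mul_left, zero_mul]

/-- Associativity of `star` in terms of `gapSum`: choosing a sublist `l` of `w` and then a sublist of `l`
amounts to choosing the smaller sublist first and then a sublist of each of its gaps. -/
theorem gapSum_gapSum (ψ χ : List N → K) (n : ℕ) : ∀ (w : List N), w.length < n →
    ∀ (H : List N → K) (a : N), gapSum χ w (fun l => gapSum ψ l H [a]) [a]
      = gapSum (star ψ χ) w H [a] := by
  induction n with
  | zero => intro w hw; omega
  | succ n ih =>
    intro w hw H a
    have h1 : (fun l => gapSum ψ l H [a]) = fun l => (if l = [] then H [] else 0) +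
        splitSum (fun u c v => (fun z => ψ (a :: z)) (u ++ [c]) *
          (fun c v => gapSum ψ v (fun l => H (c :: l)) [c]) c v) l := by
      funext l
      rw [gapSum_first _ _ _ (List.cons_ne_nil a [])]
      simp
    rw [h1, gapSum_add, gapSum_ite_nil, gapSum_splitSum χ (fun z => ψ (a :: z))
      (fun c v => gapSum ψ v (fun l => H (c :: l)) [c]) w (List.cons_ne_nil a []),
      gapSum_first (star ψ χ) _ _ (List.cons_ne_nil a [])]
    simp only [List.length_singleton, true_and]
    congr 1
    refine splitSum_congr fun u c v huv => ?_
    have : v.length < n := by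
      rw [huv] at hw
      simp at hw
      omega
    rw [ih v this]
    rfl

theorem star_assoc (φ ψ χ : List N → K) : star (star φ ψ) χ = star φ (star ψ χ) := by
  funext L
  cases L with
  | nil => rfl
  | cons a w => exact gapSum_gapSum ψ χ _ w (Nat.lt_succ_self _) _ a

theorem star_congr {φ φ' ψ ψ' : List N → K} {L : List N}
    (hφ : ∀ C, C.Sublist L → C.head? = L.head? → C.getLast? = L.getLast? → φ C = φ' C)
    (hψ : ∀ z, z <:+: L → ψ z = ψ' z) : star φ ψ L = star φ' ψ' L := by
  cases L with
  | nil => rfl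
  | cons a w =>
    refine gapSum_congr (by simp) (fun l hl hl' => hφ _ (hl.cons_cons a) rfl ?_) hψ
    rw [List.getLast?_cons, List.getLast?_cons, hl']

/-- Consecutive gaps share an entry, so if all gaps are chains then the whole list is a chain. -/
theorem gapSum_eq_zero_of_not_isChain {r : N → N → Prop} {ψ : List N → K}
    (hψ : ∀ z, ¬ z.IsChain r → ψ z = 0) (w : List N) (H : List N → K) (acc : List N)
    (hacc : acc ≠ []) (h : ¬ (acc ++ w).IsChain r) : gapSum ψ w H acc = 0 := by
  induction w generalizing H acc with
  | nil =>
    rw [gapSum, if_neg]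
    intro h1
    obtain ⟨x, rfl⟩ := List.length_eq_one_iff.1 h1
    exact h (by simp)
  | cons c w ih =>
    rw [gapSum, ih H (acc ++ [c]) (by simp) (by simpa using h), add_zero]
    by_cases hc : (acc ++ [c]).IsChain r
    · rw [ih _ [c] (by simp) fun h' => h ?_, mul_zero]
      rw [List.isChain_split] 
      exact ⟨hc, h'⟩
    · rw [hψ _ hc, zero_mul]

/-- If all gaps have even length, then the length of the list has the parity of the length of the chosen
sublist; `k` is the number of entries that `H` adds in front of its argument. -/
theorem even_of_gapSum_ne_zero {ψ : List N → K} (hψ : ∀ z, ψ z ≠ 0 → Even z.length) (w : List N) :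
    ∀ (H : List N → K) (acc : List N) (k : ℕ), (∀ l, H l ≠ 0 → Even (l.length + k)) →
      gapSum ψ w H acc ≠ 0 → Even (acc.length + w.length + 1 + k) := by
  induction w with
  | nil =>
    intro H acc k hH h
    rw [gapSum] at h
    split_ifs at h with h1
    · have := hH _ h
      simp only [List.length_nil, h1, Nat.even_iff] at this ⊢
      omega
    · exact absurd rfl h
  | cons c w ih =>
    intro H acc k hH h
    rw [gapSum] at h
    by_cases h2 : gapSum ψ w H (acc ++ [c]) = 0
    · rw [h2, add_zero] at h
      have h3 := hψ _ (left_ne_zero_of_mul h)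
      have h4 := ih _ [c] (k + 1) (fun l hl => by
        have := hH _ hl
        simp only [List.length_cons, Nat.even_iff] at this ⊢
        omega) (right_ne_zero_of_mul h)
      simp only [List.length_append, List.length_cons, List.length_nil, Nat.even_iff] at h3 h4 ⊢
      omega
    · have := ih H (acc ++ [c]) k hH h2
      simp only [List.length_append, List.length_cons, List.length_nil, Nat.even_iff] at this ⊢
      omega

end Chains

/-! ### The inversion equation for functions on lists -/

section InversionEquation

variable {N K : Type} [CommRing K] (P : N → Prop) [DecidablePred P] (κ : N → K) (s : N)

/-- For a list `L` whose ends satisfy `P` and a further letter `s`, the inversion equation for a function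
`φ` on lists is `insertSum P κ s φ L = cutSum P κ φ L`. Explicitly,
`∑_{c, P c} φ(L_{≤ c} s) φ(s L_{≥ c}) + ∑_{c, ¬ P c} κ c (φ(L_{< c} s) φ(s L_{> c}) - φ(L_{≤ c}) φ(L_{≥ c}))`
is `1` if `L` has one entry and `0` otherwise, where `c` runs through the entries of `L`. For the
generating series, with `κ c = 1 / (s - c)`, it is the recursion that defines the inversions. This is
the side in which the letter `s` is inserted. -/
def insertSum (φ : List N → K) (L : List N) : K :=
  splitSum (fun u c v => if P c then φ (u ++ [c, s]) * φ (s :: c :: v)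
    else κ c * (φ (u ++ [s]) * φ (s :: v))) L

/-- The side of the inversion equation in which the list `L` is cut at an entry that violates `P`. -/
def cutSum (φ : List N → K) (L : List N) : K :=
  (if L.length = 1 then 1 else 0) +
    splitSum (fun u c v => φ (u ++ [c]) * (if P c then 0 else κ c * φ (c :: v))) L

variable {P κ s}

theorem splitSum_concat (f : List N → N → List N → K) (w : List N) (b : N) :
    splitSum f (w ++ [b]) = splitSum (fun u c v => f u c (v ++ [b])) w + f w b [] := by
  induction w generalizing f with
  | nil => simp [splitSum]
  | cons c w ih => rw [List.cons_append, splitSum, ih, splitSum, add_assoc]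

/-- Cutting commutes with `star`: the sublists for the two parts of the list share the entry at which it
is cut, and so combine to one sublist of the whole list. -/
theorem cutSum_star {φ ψ : List N → K} {a : N} (ha : P a) (w : List N) :
    cutSum P κ (star φ ψ) (a :: w) = gapSum ψ w (fun l => cutSum P κ φ (a :: l)) [a] := by
  have h1 : ∀ (χ : List N → K) l, cutSum P κ χ (a :: l) = (if l = [] then 1 else 0) +
      splitSum (fun u c v => (fun z => χ (a :: z)) (u ++ [c]) *
        (fun c v => (if P c then 0 else κ c) * χ (c :: v)) c v) l := by
    intro χ l
    rw [cutSum, splitSum, if_pos ha, mul_zero, zero_add]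
    simp only [List.length_cons, Nat.add_eq_right, List.length_eq_zero_iff, List.cons_append]
    refine congrArg₂ (· + ·) rfl (splitSum_congr fun u c v _ => ?_)
    split_ifs <;> simp
  simp only [h1, gapSum_add, gapSum_ite_nil]
  rw [gapSum_splitSum ψ (fun z => φ (a :: z)) (fun c v => (if P c then 0 else κ c) * φ (c :: v)) w
    (List.cons_ne_nil a [])]
  refine congrArg₂ (· + ·) rfl (splitSum_congr fun u c v _ => ?_)
  rw [gapSum_mul_left]
  rfl

/-- The segment of a list of the entries number `i, …, j - 1`. -/
def seg (L : List N) (i j : ℕ) : List N := (L.drop i).take (j - i)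

theorem seg_append {L : List N} {i j k : ℕ} (hij : i ≤ j) (hjk : j ≤ k) :
    seg L i j ++ seg L j k = seg L i k := by
  unfold seg
  have h1 : k - i = (j - i) + (k - j) := by omega
  have h2 : L.drop j = (L.drop i).drop (j - i) := by rw [List.drop_drop]; congr 1; omega
  rw [h1, List.take_add, h2]

theorem seg_succ (a : N) {L : List N} {k : ℕ} (hk : k < L.length) :
    seg L k (k + 1) = [L.getD k a] := by
  rw [seg, List.getD_eq_getElem _ _ hk, Nat.add_sub_cancel_left, List.drop_eq_getElem_cons hk]
  rfl

theorem seg_zero (L : List N) (k : ℕ) : seg L 0 k = L.take k := by simp [seg]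

theorem seg_length_right (L : List N) (k : ℕ) : seg L k L.length = L.drop k := by
  simp [seg]

theorem seg_infix (L : List N) (i j : ℕ) : seg L i j <:+: L :=
  (List.take_prefix _ _).isInfix.trans (List.drop_suffix _ _).isInfix

theorem length_seg {L : List N} {i j : ℕ} (hj : j ≤ L.length) : (seg L i j).length = j - i := by
  simp [seg]; omega

theorem getD_seg (a : N) {L : List N} {i j k : ℕ} (hk : i + k < j) :
    (seg L i j).getD k a = L.getD (i + k) a := by
  simp only [seg, List.getD_eq_getElem?_getD]
  rw [List.getElem?_take_of_lt (by omega), List.getElem?_drop]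

theorem take_seg {L : List N} {i j k : ℕ} (hk : i + k ≤ j) :
    (seg L i j).take k = seg L i (i + k) := by
  unfold seg
  rw [List.take_take]; congr 1; omega

theorem drop_seg {L : List N} {i j k : ℕ} : (seg L i j).drop k = seg L (i + k) j := by
  unfold seg
  rw [List.drop_take, List.drop_drop]; congr 1; omega

theorem seg_cons (a : N) {L : List N} {i j : ℕ} (hi : i < L.length) (hij : i < j) :
    seg L i j = L.getD i a :: seg L (i + 1) j := by
  rw [← seg_append (Nat.le_succ i) hij, seg_succ a hi]; rfl

theorem seg_concat (a : N) {L : List N} {i j : ℕ} (hi : i ≤ j) (hij : j < L.length) :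
    seg L i (j + 1) = seg L i j ++ [L.getD j a] := by
  rw [← seg_append hi (Nat.le_succ j), seg_succ a hij]

/-- The sum over the sublists of `L = a :: w` with the ends `a` and the entry number `i`, completed
by `s`. -/
def leftSum (s : N) (φ ψ : List N → K) (a : N) (w : List N) (i : ℕ) : K :=
  gapSum ψ (w.take i) (fun l => φ (a :: l ++ [s])) [a]

/-- The sum over the sublists of `L` from the entry number `j` to the end, preceded by `s`. -/
def rightSum (s : N) (φ ψ : List N → K) (a : N) (L : List N) (j : ℕ) : K :=
  gapSum ψ (L.drop (j + 1)) (fun l => φ (s :: L.getD j a :: l)) [L.getD j a]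

theorem gapSum_take_concat {φ ψ : List N → K} {a e : N} {w : List N} {m : ℕ} (hm : m ≤ w.length)
    {H : List N → K} (hH : ∀ l, H (l ++ [e]) = φ (a :: l ++ [s])) :
    gapSum ψ (w.take m ++ [e]) H [a]
      = ∑ i ∈ Finset.range (m + 1), leftSum s φ ψ a w i * ψ (seg (a :: w) i (m + 1) ++ [e]) := by
  rw [gapSum_last _ _ _ _ (List.cons_ne_nil a []), splitSum_eq_sum a, Finset.sum_range_succ',
    List.length_take, min_eq_left hm, add_comm]
  refine congrArg₂ (· + ·) (Finset.sum_congr rfl fun k hk => ?_) ?_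
  · have hk' := Finset.mem_range.1 hk
    have h0 : (w.take m) = seg (a :: w) 1 (m + 1) := by simp [seg]
    have h1 : (w.take m).take k ++ [(w.take m).getD k a] = w.take (k + 1) := by
      rw [List.take_take, min_eq_left hk'.le, List.take_add_one, List.getD_eq_getElem?_getD,
        List.getElem?_take_of_lt hk', List.getElem?_eq_getElem (by omega)]
      simp
    have h2 : (w.take m).getD k a :: (w.take m).drop (k + 1) = seg (a :: w) (k + 1) (m + 1) := by
      rw [h0, drop_seg, getD_seg a (by omega), add_comm 1 k, add_comm 1 (k + 1),
        ← seg_cons a (by simp; omega) (by omega)]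
    rw [h1, h2, leftSum]
    simp only [hH]
  · have := hH []
    simp only [List.nil_append] at this
    simp [leftSum, gapSum, this, seg]

theorem gapSum_drop {φ ψ : List N → K} {a e : N} {L : List N} (k : ℕ)
    {H : List N → K} (hH0 : H [] = 0) (hH : ∀ c l, H (c :: l) = φ (s :: c :: l)) :
    gapSum ψ (L.drop k) H [e]
      = ∑ j ∈ Finset.Ico k L.length, ψ (e :: seg L k (j + 1)) * rightSum s φ ψ a L j := by
  rw [gapSum_first _ _ _ (List.cons_ne_nil e []), hH0, ite_self, zero_add, splitSum_eq_sum a,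
    Finset.sum_Ico_eq_sum_range, List.length_drop]
  refine Finset.sum_congr rfl fun j hj => ?_
  have hj' := Finset.mem_range.1 hj
  have hx : (L.drop k).getD j a = L.getD (k + j) a := by
    simp [List.getD_eq_getElem?_getD]
  have h0 : (L.drop k).take j ++ [L.getD (k + j) a] = seg L k (k + j + 1) := by
    rw [seg_concat a (by omega) (by omega)]
    congr 1
    unfold seg; congr 1; omega
  rw [hx, List.append_assoc, h0, rightSum, List.drop_drop]
  simp only [hH]
  rfl

/-- The inversion equation is stable under the composition `star`. With the inversion equation for `φ`
both sides become sums of terms `X i * Y j * ...`, where `X i` (`leftSum`) collects the part of the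
sublist up to the entry number `i`, and `Y j` (`rightSum`) the part from the entry number `j` on. The
coefficients of `X i * Y j` are the two sides of the inversion equation for `ψ` on the segment between
the entries `i` and `j`. -/
theorem insertSum_star {φ ψ : List N → K} {a : N} (ha : P a) {w : List N}
    (hφs : φ [s] = 0)
    (hφ1 : ∀ u c, ¬ P c → φ (u ++ [c, s]) = 0) (hφ2 : ∀ c v, ¬ P c → φ (s :: c :: v) = 0)
    (hφ : ∀ l, l.Sublist w → (a :: l).getLast? = (a :: w).getLast? →
      insertSum P κ s φ (a :: l) = cutSum P κ φ (a :: l))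
    (hψ : ∀ i j, i ≤ j → j < (a :: w).length → P ((a :: w).getD i a) → P ((a :: w).getD j a) →
      insertSum P κ s ψ (seg (a :: w) i (j + 1)) = cutSum P κ ψ (seg (a :: w) i (j + 1))) :
    insertSum P κ s (star φ ψ) (a :: w) = cutSum P κ (star φ ψ) (a :: w) := by
  rw [cutSum_star ha]
  set L := a :: w with hL
  set n := L.length with hn
  set x : ℕ → N := fun k => L.getD k a with hx
  set X := leftSum s φ ψ a w with hX
  set Y := rightSum s φ ψ a L with hY
  have hx0 : x 0 = a := rfl
  have hlen : n = w.length + 1 := rfl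
  -- the left and right sums vanish at nodes of the wrong kind
  have hX0 : ∀ i, i < n → ¬ P (x i) → X i = 0 := by
    intro i hi hPi
    rcases i with _ | i
    · exact absurd ha hPi
    · have h1 : w.take (i + 1) = w.take i ++ [x (i + 1)] := by
        rw [List.take_add_one, List.getElem?_eq_getElem (by omega)]
        simp [hx, hL, List.getD_eq_getElem?_getD, List.getElem?_eq_getElem (show i < w.length by omega)]
      rw [hX, leftSum, h1, gapSum_last _ _ _ _ (List.cons_ne_nil a [])]
      simp only [List.cons_append, List.append_assoc, List.nil_append]
      rw [show φ (a :: [x (i + 1), s]) = 0 from hφ1 [a] _ hPi, zero_mul, zero_add]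
      have h2 : ∀ l : List N, φ (a :: (l ++ [x (i + 1), s])) = 0 := fun l => hφ1 (a :: l) _ hPi
      simp only [h2, gapSum_zero, zero_mul]
      rw [show (fun (_ : List N) (_ : N) (_ : List N) => (0 : K)) = fun _ _ _ => 0 * 0 by simp,
        splitSum_mul_left, zero_mul]
  have hY0 : ∀ j, ¬ P (x j) → Y j = 0 := by
    intro j hPj
    have h2 : ∀ l : List N, φ (s :: L.getD j a :: l) = 0 := fun l => hφ2 _ _ hPj
    rw [hY, rightSum]
    simp only [h2, gapSum_zero]
  -- the two sides as sums over positions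
  have hR : gapSum ψ w (fun l => cutSum P κ φ (a :: l)) [a]
      = ∑ k ∈ Finset.range n, if P (x k) then X k * Y k else
        κ (x k) * ((∑ i ∈ Finset.range k, X i * ψ (seg L i (k + 1))) *
          ∑ j ∈ Finset.Ico (k + 1) n, ψ (seg L k (j + 1)) * Y j) := by
    have h1 : gapSum ψ w (fun l => cutSum P κ φ (a :: l)) [a]
        = gapSum ψ w (fun l => φ [a, s] * φ (s :: a :: l) +
          (splitSum (fun u c v => (fun l => φ (a :: l ++ [s])) (u ++ [c]) *
            (fun c v => if P c then φ (s :: c :: v) else 0) c v) l +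
          splitSum (fun u c v => (fun l => φ (a :: l.dropLast ++ [s])) (u ++ [c]) *
            (fun c v => if P c then 0 else κ c * φ (s :: v)) c v) l)) [a] := by
      refine gapSum_congr (List.cons_ne_nil a []) (fun l hl hl' => ?_) fun _ _ => rfl
      rw [← hφ l hl (by rw [List.getLast?_cons, List.getLast?_cons, hl']), insertSum, splitSum,
        if_pos ha, List.nil_append, ← splitSum_add]
      refine congrArg₂ (· + ·) rfl (splitSum_congr fun u c v _ => ?_)
      by_cases hP : P c
      · simp [hP]
      · simp [hP]; ring
    rw [h1, gapSum_add, gapSum_add, gapSum_mul_left,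
      gapSum_splitSum ψ (fun l => φ (a :: l ++ [s])) (fun c v => if P c then φ (s :: c :: v) else 0)
        w (List.cons_ne_nil a []),
      gapSum_splitSum ψ (fun l => φ (a :: l.dropLast ++ [s]))
        (fun c v => if P c then 0 else κ c * φ (s :: v)) w (List.cons_ne_nil a []),
      ← splitSum_add, splitSum_eq_sum a, hlen, Finset.sum_range_succ', add_comm]
    refine congrArg₂ (· + ·) (Finset.sum_congr rfl fun k hk => ?_) ?_
    · have hk' := Finset.mem_range.1 hk
      have hxk : w.getD k a = x (k + 1) := by simp [hx, hL]
      have htk : w.take k ++ [x (k + 1)] = w.take (k + 1) := by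
        rw [List.take_add_one, List.getElem?_eq_getElem hk', ← hxk, List.getD_eq_getElem _ _ hk']
        rfl
      rw [hxk]
      split_ifs with hP
      · rw [gapSum_zero, mul_zero, add_zero, htk]
        congr 1
      · rw [gapSum_zero, mul_zero, zero_add, gapSum_mul_left, gapSum_take_concat hk'.le
          (φ := φ) (s := s) (fun l => by simp), show w.drop (k + 1) = L.drop (k + 1 + 1) from rfl,
          gapSum_drop (φ := φ) (s := s) (a := a) _ hφs (fun _ _ => rfl), mul_left_comm]
        refine congrArg (κ _ * ·) (congrArg₂ (· * ·) ?_ ?_)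
        · refine Finset.sum_congr rfl fun i hi => ?_
          rw [← seg_concat a (by have := Finset.mem_range.1 hi; omega) (by simp; omega)]
        · refine Finset.sum_congr rfl fun j hj => ?_
          have := Finset.mem_Ico.1 hj
          rw [← seg_cons a (by omega) (by omega)]
    · rw [if_pos (show P (x 0) from ha)]
      congr 1
  have hS : insertSum P κ s (star φ ψ) L
      = ∑ k ∈ Finset.range n, if P (x k) then
          (∑ i ∈ Finset.range (k + 1), X i * ψ (seg L i (k + 1) ++ [s])) *
            (∑ j ∈ Finset.Ico k n, ψ (s :: seg L k (j + 1)) * Y j)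
        else κ (x k) * ((∑ i ∈ Finset.range k, X i * ψ (seg L i k ++ [s])) *
          ∑ j ∈ Finset.Ico (k + 1) n, ψ (s :: seg L (k + 1) (j + 1)) * Y j) := by
    have hl : ∀ k, k ≤ w.length → star φ ψ (L.take (k + 1) ++ [s])
        = ∑ i ∈ Finset.range (k + 1), X i * ψ (seg L i (k + 1) ++ [s]) := fun k hk =>
      gapSum_take_concat (φ := φ) (s := s) hk fun _ => rfl
    have hr : ∀ k, star φ ψ (s :: L.drop k)
        = ∑ j ∈ Finset.Ico k n, ψ (s :: seg L k (j + 1)) * Y j := fun k =>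
      gapSum_drop (φ := φ) (s := s) (a := a) k hφs fun _ _ => rfl
    rw [insertSum, splitSum_eq_sum a]
    refine Finset.sum_congr rfl fun k hk => ?_
    have hk' := Finset.mem_range.1 hk
    split_ifs with hP
    · have h1 : L.take k ++ [L.getD k a, s] = L.take (k + 1) ++ [s] := by
        rw [← seg_zero, ← seg_zero, seg_concat a (Nat.zero_le _) hk']
        simp
      have h2 : L.getD k a :: L.drop (k + 1) = L.drop k := by
        rw [← seg_length_right, ← seg_length_right, ← seg_cons a hk' hk']
      rw [h1, h2, hl k (by omega), hr]
    · rcases k with _ | k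
      · exact absurd ha hP
      · rw [hl k (by omega), hr]
  rw [hR, hS]
  have hprod : ∀ (f g : ℕ → K) (k m : ℕ), k ≤ n →
      (∑ i ∈ Finset.range k, X i * f i) * (∑ j ∈ Finset.Ico m n, g j * Y j)
        = ∑ i ∈ Finset.range n, ∑ j ∈ Finset.range n,
          X i * Y j * if i < k ∧ m ≤ j then f i * g j else 0 := by
    intro f g k m hk
    have e1 : Finset.range k = (Finset.range n).filter (· < k) := by
      ext i; simp; omega
    have e2 : Finset.Ico m n = (Finset.range n).filter (m ≤ ·) := by
      ext i; simp; omega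
    rw [e1, e2, Finset.sum_filter, Finset.sum_filter, Finset.sum_mul_sum]
    refine Finset.sum_congr rfl fun i _ => Finset.sum_congr rfl fun j _ => ?_
    by_cases h1 : i < k <;> by_cases h2 : m ≤ j <;> simp [h1, h2]
    ring
  have hdiag : ∀ k, k < n → X k * Y k = ∑ i ∈ Finset.range n, ∑ j ∈ Finset.range n,
      X i * Y j * if i = k ∧ j = k then 1 else 0 := by
    intro k hk
    rw [Finset.sum_eq_single_of_mem k (Finset.mem_range.2 hk),
      Finset.sum_eq_single_of_mem k (Finset.mem_range.2 hk)]
    · simp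
    · intro j _ hj; simp [hj]
    · intro i _ hi; simp [hi]
  have hA : ∀ k ∈ Finset.range n, (if P (x k) then
          (∑ i ∈ Finset.range (k + 1), X i * ψ (seg L i (k + 1) ++ [s])) *
            (∑ j ∈ Finset.Ico k n, ψ (s :: seg L k (j + 1)) * Y j)
        else κ (x k) * ((∑ i ∈ Finset.range k, X i * ψ (seg L i k ++ [s])) *
          ∑ j ∈ Finset.Ico (k + 1) n, ψ (s :: seg L (k + 1) (j + 1)) * Y j))
      = ∑ i ∈ Finset.range n, ∑ j ∈ Finset.range n, X i * Y j * if P (x k) then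
          (if i < k + 1 ∧ k ≤ j then ψ (seg L i (k + 1) ++ [s]) * ψ (s :: seg L k (j + 1)) else 0)
          else κ (x k) * if i < k ∧ k + 1 ≤ j then
            ψ (seg L i k ++ [s]) * ψ (s :: seg L (k + 1) (j + 1)) else 0 := by
    intro k hk
    have hk' := Finset.mem_range.1 hk
    split_ifs with hP
    · exact hprod _ _ _ _ (by omega)
    · rw [hprod _ _ _ _ (by omega), Finset.mul_sum]
      refine Finset.sum_congr rfl fun i _ => ?_
      rw [Finset.mul_sum]
      exact Finset.sum_congr rfl fun j _ => by ring
  have hB : ∀ k ∈ Finset.range n, (if P (x k) then X k * Y k else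
        κ (x k) * ((∑ i ∈ Finset.range k, X i * ψ (seg L i (k + 1))) *
          ∑ j ∈ Finset.Ico (k + 1) n, ψ (seg L k (j + 1)) * Y j))
      = ∑ i ∈ Finset.range n, ∑ j ∈ Finset.range n, X i * Y j * if P (x k) then
          (if i = k ∧ j = k then 1 else 0)
          else κ (x k) * if i < k ∧ k + 1 ≤ j then
            ψ (seg L i (k + 1)) * ψ (seg L k (j + 1)) else 0 := by
    intro k hk
    have hk' := Finset.mem_range.1 hk
    split_ifs with hP
    · exact hdiag k hk'
    · rw [hprod _ _ _ _ (by omega), Finset.mul_sum]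
      refine Finset.sum_congr rfl fun i _ => ?_
      rw [Finset.mul_sum]
      exact Finset.sum_congr rfl fun j _ => by ring
  have hswap : ∀ f : ℕ → ℕ → ℕ → K, ∑ k ∈ Finset.range n, ∑ i ∈ Finset.range n,
      ∑ j ∈ Finset.range n, f k i j
      = ∑ i ∈ Finset.range n, ∑ j ∈ Finset.range n, ∑ k ∈ Finset.range n, f k i j := fun f => by
    rw [Finset.sum_comm]
    exact Finset.sum_congr rfl fun i _ => Finset.sum_comm
  rw [Finset.sum_congr rfl hA, Finset.sum_congr rfl hB]
  refine (hswap _).trans (Eq.trans ?_ (hswap _).symm)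
  refine Finset.sum_congr rfl fun i hi => Finset.sum_congr rfl fun j hj => ?_
  have hi' := Finset.mem_range.1 hi
  have hj' := Finset.mem_range.1 hj
  rw [← Finset.mul_sum, ← Finset.mul_sum]
  by_cases hPi : P (x i)
  swap
  · rw [hX0 i hi' hPi]; simp
  by_cases hPj : P (x j)
  swap
  · rw [hY0 j hPj]; simp
  congr 1
  rcases lt_or_ge j i with hji | hij
  · rw [Finset.sum_eq_zero, Finset.sum_eq_zero]
    · intro k _
      rw [if_neg (show ¬ (i = k ∧ j = k) by omega), if_neg (show ¬ (i < k ∧ k + 1 ≤ j) by omega)]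
      simp
    · intro k _
      rw [if_neg (show ¬ (i < k + 1 ∧ k ≤ j) by omega),
        if_neg (show ¬ (i < k ∧ k + 1 ≤ j) by omega)]
      simp
  -- for fixed `i ≤ j` this is the inversion equation for the segment between them
  have hsub : Finset.Ico i (j + 1) ⊆ Finset.range n := fun k hk => by
    have := Finset.mem_Ico.1 hk
    exact Finset.mem_range.2 (by omega)
  have hlen' : (seg L i (j + 1)).length = j + 1 - i := length_seg (by omega)
  have hpos : ∀ f : List N → N → List N → K, splitSum f (seg L i (j + 1))
      = ∑ k ∈ Finset.Ico i (j + 1), f (seg L i k) (x k) (seg L (k + 1) (j + 1)) := by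
    intro f
    rw [splitSum_eq_sum a, hlen', Finset.sum_Ico_eq_sum_range]
    refine Finset.sum_congr rfl fun k hk => ?_
    have := Finset.mem_range.1 hk
    rw [take_seg (by omega), getD_seg a (by omega), drop_seg]
    rfl
  have hne : ∀ k ∈ Finset.Ico i (j + 1), ¬ P (x k) → i < k ∧ k + 1 ≤ j := by
    intro k hk hP
    have := Finset.mem_Ico.1 hk
    constructor
    · rcases eq_or_lt_of_le this.1 with rfl | h
      · exact absurd hPi hP
      · exact h
    · rcases eq_or_lt_of_le (Nat.lt_succ_iff.1 this.2) with rfl | h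
      · exact absurd hPj hP
      · exact h
  have hEq := hψ i j hij hj' hPi hPj
  rw [insertSum, cutSum, hpos, hpos, hlen'] at hEq
  rw [← Finset.sum_subset hsub, ← Finset.sum_subset hsub]
  · refine Eq.trans (Finset.sum_congr rfl fun k hk => ?_) (hEq.trans ?_)
    · have hk' := Finset.mem_Ico.1 hk
      split_ifs with hP h1 h2
      · have h3 : seg L i k ++ [x k, s] = seg L i (k + 1) ++ [s] := by
          rw [seg_concat a hk'.1 (by omega), List.append_assoc]; rfl
        rw [h3, ← seg_cons a (by omega) hk'.2]
      · omega
      · rfl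
      · exact absurd (hne k hk hP) ‹_›
    · have h4 : (if j + 1 - i = 1 then (1 : K) else 0)
          = ∑ k ∈ Finset.Ico i (j + 1), if P (x k) then (if i = k ∧ j = k then 1 else 0) else 0 := by
        rw [Finset.sum_eq_single_of_mem i (Finset.mem_Ico.2 ⟨le_rfl, by omega⟩)]
        · rw [if_pos hPi]
          congr 1
          exact propext ⟨fun h => ⟨rfl, by omega⟩, fun h => by omega⟩
        · intro k _ hk
          rw [if_neg (show ¬ (i = k ∧ j = k) by omega), ite_self]
      rw [h4, ← Finset.sum_add_distrib]
      refine Finset.sum_congr rfl fun k hk => ?_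
      have hk' := Finset.mem_Ico.1 hk
      by_cases hP : P (x k)
      · simp [hP]
      · rw [if_neg hP, if_neg hP, if_neg hP, if_pos (hne k hk hP), ← seg_concat a hk'.1 (by omega),
          ← seg_cons a (by omega) hk'.2]
        ring
  · intro k _ hk
    have hk' : ¬ (i ≤ k ∧ k < j + 1) := fun h => hk (Finset.mem_Ico.2 h)
    rw [if_neg (show ¬ (i = k ∧ j = k) by omega), if_neg (show ¬ (i < k ∧ k + 1 ≤ j) by omega)]
    simp
  · intro k _ hk
    have hk' : ¬ (i ≤ k ∧ k < j + 1) := fun h => hk (Finset.mem_Ico.2 h)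
    rw [if_neg (show ¬ (i < k + 1 ∧ k ≤ j) by omega),
      if_neg (show ¬ (i < k ∧ k + 1 ≤ j) by omega)]
    simp

/-- The inversion equation determines the values on the lists `L ++ [t]` from those on the lists
`t :: L`, where `G` is the class of lists considered: if `L` ends in `b`, then the only term with a new
value is the product `φ(L ++ [t]) * φ [t, b]`, and its second factor does not vanish. -/
theorem eq_of_insertSum_eq [IsDomain K] {κ : N → N → K} {G : List N → Prop}
    (hsub : ∀ L L', L'.Sublist L → G L → G L') (hrot : ∀ L t, ¬ P t → G (L ++ [t]) → G (t :: L))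
    {φ₁ φ₂ : List N → K} (h₁ : ∀ z, ¬ z.IsChain (fun x y => ¬ (P x ↔ P y)) ∨ ¬ Even z.length → φ₁ z = 0)
    (h₂ : ∀ z, ¬ z.IsChain (fun x y => ¬ (P x ↔ P y)) ∨ ¬ Even z.length → φ₂ z = 0)
    (hF : ∀ t L, ¬ P t → G (t :: L) → φ₁ (t :: L) = φ₂ (t :: L))
    (hne : ∀ t b, ¬ P t → P b → φ₁ [t, b] ≠ 0)
    (hE₁ : ∀ L t, L.head?.any (fun a => P a) → L.getLast?.any (fun a => P a) → ¬ P t → G (L ++ [t]) →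
      insertSum P (κ t) t φ₁ L = cutSum P (κ t) φ₁ L)
    (hE₂ : ∀ L t, L.head?.any (fun a => P a) → L.getLast?.any (fun a => P a) → ¬ P t → G (L ++ [t]) →
      insertSum P (κ t) t φ₂ L = cutSum P (κ t) φ₂ L) (n : ℕ) :
    ∀ L t, L.length < n → L.head?.any (fun a => P a) → ¬ P t → G (L ++ [t]) →
      φ₁ (L ++ [t]) = φ₂ (L ++ [t]) := by
  induction n with
  | zero => intro L t h; omega
  | succ n ih =>
    intro L t hL hP ht hG
    have ih' : ∀ u t, u.length < n → u <+: L → ¬ P t → G (u ++ [t]) →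
        φ₁ (u ++ [t]) = φ₂ (u ++ [t]) := by
      intro u t hu hpre ht hG
      rcases eq_or_ne u [] with rfl | hne
      · rw [h₁, h₂] <;> simp
      · refine ih u t hu ?_ ht hG
        obtain ⟨v, rfl⟩ := hpre
        rwa [List.head?_append_of_ne_nil _ hne] at hP
    rcases List.eq_nil_or_concat' L with rfl | ⟨L₀, b, rfl⟩
    · simp at hP
    by_cases hb : P b
    swap
    · have hch : ¬ (L₀ ++ [b] ++ [t]).IsChain (fun x y => ¬ (P x ↔ P y)) := by
        intro h
        rw [List.append_assoc, List.isChain_append] at h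
        have := h.2.1
        simp at this
        tauto
      rw [h₁ _ (Or.inl hch), h₂ _ (Or.inl hch)]
    have e₁ := hE₁ _ t hP (by simpa using hb) ht hG
    have e₂ := hE₂ _ t hP (by simpa using hb) ht hG
    rw [insertSum, cutSum, splitSum_concat, splitSum_concat] at e₁ e₂
    simp only [List.length_append, List.length_singleton] at hL
    have hsubG : ∀ {u c v}, L₀ = u ++ c :: v → G (u ++ [c, t]) ∧ G (u ++ [t]) ∧ G (u ++ [c]) ∧
        G (t :: c :: (v ++ [b])) ∧ G (t :: (v ++ [b])) := by
      rintro u c v rfl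
      refine ⟨hsub _ _ ?_ hG, hsub _ _ ?_ hG, hsub _ _ ?_ hG, hsub _ _ ?_ (hrot _ _ ht hG),
        hsub _ _ ?_ (hrot _ _ ht hG)⟩
      · simp
      · simp
      · simp
      · simp
      · simp
    have hGb : G [t, b] := hsub _ _ (by simp) (hrot _ _ ht hG)
    have hsum : splitSum (fun u c v => if P c then φ₁ (u ++ [c, t]) * φ₁ (t :: c :: (v ++ [b]))
          else κ t c * (φ₁ (u ++ [t]) * φ₁ (t :: (v ++ [b])))) L₀
        = splitSum (fun u c v => if P c then φ₂ (u ++ [c, t]) * φ₂ (t :: c :: (v ++ [b]))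
          else κ t c * (φ₂ (u ++ [t]) * φ₂ (t :: (v ++ [b])))) L₀ := by
      refine splitSum_congr fun u c v huv => ?_
      obtain ⟨g1, g2, g3, g4, g5⟩ := hsubG huv
      have hlen : u.length + v.length + 1 = L₀.length := by rw [huv]; simp; omega
      have e := ih' (u ++ [c]) t (by simp; omega) ⟨v ++ [b], by rw [huv]; simp⟩ ht (by simpa using g1)
      have e' := ih' u t (by omega) ⟨c :: v ++ [b], by rw [huv]; simp⟩ ht g2
      rw [List.append_assoc] at e
      change φ₁ (u ++ [c, t]) = φ₂ (u ++ [c, t]) at e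
      rw [e, e', hF _ _ ht g4, hF _ _ ht g5]
    have hcut : splitSum (fun u c v => φ₁ (u ++ [c]) *
          (if P c then 0 else κ t c * φ₁ (c :: (v ++ [b])))) L₀
        = splitSum (fun u c v => φ₂ (u ++ [c]) *
          (if P c then 0 else κ t c * φ₂ (c :: (v ++ [b])))) L₀ := by
      refine splitSum_congr fun u c v huv => ?_
      obtain ⟨g1, g2, g3, g4, g5⟩ := hsubG huv
      have hlen : u.length + v.length + 1 = L₀.length := by rw [huv]; simp; omega
      split_ifs with hc
      · simp
      · rw [ih' u c (by omega) ⟨c :: v ++ [b], by rw [huv]; simp⟩ hc g3,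
          hF c (v ++ [b]) hc (hsub _ _ (List.sublist_cons_self _ _) g4)]
    rw [hsum, hcut] at e₁
    rw [if_pos hb, if_pos hb] at e₁ e₂
    have e := e₁.trans (congrArg₂ _ rfl (by simp)) |>.trans e₂.symm
    have e' := add_left_cancel e
    rw [← hF t [b] ht hGb] at e'
    simpa using mul_right_cancel₀ (hne t b ht hb) e'

end InversionEquation

/-! ### Lists of nodes -/

section Nodes

/-- The letters of the lists on which the generating series are viewed as functions: `T t` stands
for a variable of the generating series (`T none` for the value zero), `P n` for a point. -/
inductive Node (σ : Type) : Type
  | T (t : Option σ) : Node σ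
  | P (n : ℕ) : Node σ

namespace Node

variable {σ : Type}

/-- Whether a node is a point. -/
def isP : Node σ → Bool
  | T _ => false
  | P _ => true

/-- The number of a point. -/
def pt : Node σ → ℕ
  | T _ => 0
  | P n => n

/-- The variable that belongs to a node. -/
def val (R : Type) [CommRing R] : Node σ → MvPowerSeries σ R
  | T (some i) => MvPowerSeries.X i
  | _ => 0

/-- The variable index in a node that is not a point. -/
def var? : Node σ → Option (Option σ)
  | T t => some t
  | P _ => none

/-- The number of a node that is a point. -/
def pt? : Node σ → Option ℕ
  | T _ => none
  | P n => some n

theorem constantCoeff_val (R : Type) [CommRing R] (x : Node σ) :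
    MvPowerSeries.constantCoeff (x.val R) = 0 := by
  rcases x with (_ | i) | n <;> simp [val]

/-- The entry number `i` of a list, as a point. -/
def ptAt (L : List (Node σ)) (i : ℕ) : ℕ := (L[i]?.map pt).getD 0

/-- The entry number `i` of a list, as a power series. -/
def valAt (R : Type) [CommRing R] (L : List (Node σ)) (i : ℕ) : MvPowerSeries σ R :=
  (L[i]?.map (val R)).getD 0

variable {R : Type} [CommRing R]

theorem constantCoeff_valAt (L : List (Node σ)) (i : ℕ) :
    MvPowerSeries.constantCoeff (valAt R L i) = 0 := by
  unfold valAt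
  cases L[i]? <;> simp [constantCoeff_val]

@[simp] theorem ptAt_cons_succ (x : Node σ) (L : List (Node σ)) (i : ℕ) :
    ptAt (x :: L) (i + 1) = ptAt L i := by simp [ptAt]

@[simp] theorem ptAt_cons_zero (x : Node σ) (L : List (Node σ)) : ptAt (x :: L) 0 = x.pt := by
  simp [ptAt]

@[simp] theorem valAt_cons_succ (x : Node σ) (L : List (Node σ)) (i : ℕ) :
    valAt R (x :: L) (i + 1) = valAt R L i := by simp [valAt]

theorem ptAt_drop (L : List (Node σ)) (k i : ℕ) : ptAt (L.drop k) i = ptAt L (k + i) := by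
  simp [ptAt, List.getElem?_drop]

theorem valAt_drop (L : List (Node σ)) (k i : ℕ) : valAt R (L.drop k) i = valAt R L (k + i) := by
  simp [valAt, List.getElem?_drop]

theorem ptAt_take_append (L M : List (Node σ)) {k i : ℕ} (hi : i < k) (hk : k ≤ L.length) :
    ptAt (L.take k ++ M) i = ptAt L i := by
  rw [ptAt, ptAt, List.getElem?_append_left (by simp; omega), List.getElem?_take_of_lt hi]

theorem valAt_take_append (L M : List (Node σ)) {k i : ℕ} (hi : i < k) (hk : k ≤ L.length) :
    valAt R (L.take k ++ M) i = valAt R L i := by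
  rw [valAt, valAt, List.getElem?_append_left (by simp; omega), List.getElem?_take_of_lt hi]

theorem valAt_take_concat (L : List (Node σ)) (x : Node σ) {k : ℕ} (hk : k ≤ L.length) :
    valAt R (L.take k ++ [x]) k = x.val R := by
  rw [valAt, List.getElem?_append_right (by simp)]
  simp [hk]

/-- Points and variables alternate in a list. -/
abbrev Alternates (L : List (Node σ)) : Prop :=
  L.IsChain fun x y => ¬ (x.isP = true ↔ y.isP = true)

/-- In an alternating list the kind of an entry depends on the parity of its position. -/
theorem Alternates.isP_getD {L : List (Node σ)} (hL : Alternates L) (a : Node σ) {k : ℕ}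
    (hk : k < L.length) : ((L.getD k a).isP = true ↔ ((L.getD 0 a).isP = true ↔ Even k)) := by
  induction k with
  | zero => simp
  | succ k ih =>
    have h1 := ih (by omega)
    have h2 := List.isChain_iff_getElem.1 hL k hk
    rw [List.getD_eq_getElem _ _ (by omega)] at h1
    rw [List.getD_eq_getElem _ _ hk, Nat.even_add_one]
    tauto

end Node
open Node

variable {σ : Type}

open Classical in
/-- The generating series as a function on alternating lists of even length. On
`T t₀, P p₀, T t₁, …, T t_k, P p_k` it is
`exp([x_{0 → p_k}]_0 t₀) [x_{p₀ → p₁}, … | t₁ - t₀, …, t_k - t₀]`, and on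
`P p₀, T t₀, …, P p_m, T t_m` it is
`(-1)^m exp(-[x_{0 → p₀}]_0 t_m) INV(x_{p₀ → p₁}, … | t₀ - t_m, …)`. With this normalization the
coproduct formula becomes `star`. -/
def nodeSeries (D : ℕ∞) (L : List (Node σ)) : MvPowerSeries σ (Hsymb D) :=
  if Alternates L ∧ Even L.length then
    match L.head? with
    | none => 0
    | some (T t) =>
      expAt D (logBracket D 0 (ptAt L (L.length - 1))) ((T t).val _) *
        liAt D (L.length / 2 - 1) (fun a => ptAt L (2 * a + 1))
          (fun i => valAt _ L (2 * ((i : ℕ) + 1)) - (T t).val _)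
    | some (P p) =>
      (-1) ^ (L.length / 2 - 1) *
        (expAt D (-logBracket D 0 p) (valAt _ L (L.length - 1)) *
        invAt D (L.length / 2 - 1) (fun a => ptAt L (2 * a))
          (fun i => valAt _ L (2 * (i : ℕ) + 1) - valAt _ L (L.length - 1)))
  else 0

theorem nodeSeries_eq_zero (D : ℕ∞) {L : List (Node σ)}
    (hL : ¬ Alternates L ∨ ¬ Even L.length) : nodeSeries D L = 0 := by
  rw [nodeSeries, if_neg]
  tauto

theorem nodeSeries_T (D : ℕ∞) (t : Option σ) {L : List (Node σ)} (hL : Alternates (T t :: L)) {k : ℕ}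
    (hk : L.length = 2 * k + 1) :
    nodeSeries D (T t :: L) = expAt D (logBracket D 0 (ptAt L (2 * k))) ((T t).val _) *
        liAt D k (fun a => ptAt L (2 * a)) (fun i => valAt _ L (2 * (i : ℕ) + 1) - (T t).val _) := by
  have h1 : (L.length + 1) / 2 - 1 = k := by omega
  have h2 : L.length + 1 - 1 = 2 * k + 1 := by omega
  rw [nodeSeries, if_pos ⟨hL, by rw [List.length_cons, hk]; exact ⟨k + 1, by ring⟩⟩]
  simp only [List.head?_cons, List.length_cons, h2, ptAt_cons_succ]
  subst h1
  rfl

theorem nodeSeries_P (D : ℕ∞) (p : ℕ) {L : List (Node σ)} {s : Option σ}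
    (hL : Alternates (P p :: L ++ [T s])) {k : ℕ} (hk : L.length = 2 * k) :
    nodeSeries D (P p :: L ++ [T s]) = (-1) ^ k * (expAt D (-logBracket D 0 p) ((T s).val _) *
        invAt D k (fun a => ptAt (P p :: L) (2 * a))
          (fun i => valAt _ L (2 * (i : ℕ)) - (T s).val _)) := by
  have h0 : (P p :: L ++ [T s]).length = 2 * k + 2 := by simp [hk]
  have h1 : (2 * k + 2) / 2 - 1 = k := by omega
  have h2 : 2 * k + 2 - 1 = 2 * k + 1 := by omega
  have h3 : valAt (Hsymb D) (P p :: L ++ [T s]) (2 * k + 1) = (T s).val _ := by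
    have := valAt_take_concat (R := Hsymb D) (P p :: L) (T s) (k := 2 * k + 1) (by simp [hk])
    rwa [List.take_of_length_le (by simp [hk])] at this
  rw [nodeSeries, if_pos ⟨hL, by rw [h0]; exact ⟨k + 1, by ring⟩⟩, h0, h1, h2, h3]
  simp only [List.cons_append, List.head?_cons]
  have h4 : (P p :: L ++ [T s]) = (P p :: L).take (2 * k + 1) ++ [T s] := by
    rw [List.take_of_length_le (by simp [hk])]
  refine congrArg (_ * ·) (congrArg (_ * ·) (invAt_congr (fun a ha => ?_) fun i => ?_))
  · rw [← List.cons_append, h4, ptAt_take_append _ _ (by omega) (by simp [hk])]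
  · rw [← List.cons_append, h4, valAt_take_append _ _ (by omega) (by simp [hk]), valAt_cons_succ]

theorem logBracket_eq_sub (D : ℕ∞) {i j : ℕ} (hij : i ≤ j) :
    logBracket D i j = logBracket D 0 j - logBracket D 0 i := by
  have h : logBracket D 0 i + logBracket D i j = logBracket D 0 j :=
    Finset.sum_Ico_consecutive _ (Nat.zero_le _) hij
  rw [← h]; ring

end Nodes

/-! ### The inversion equation for the generating series -/

section InversionEquation
open Node

variable {σ : Type}

theorem sum_range_two_mul_add_one {K : Type} [AddCommMonoid K] (f : ℕ → K) (m : ℕ) :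
    ∑ k ∈ Finset.range (2 * m + 1), f k
      = ∑ j ∈ Finset.range (m + 1), f (2 * j) + ∑ j ∈ Finset.range m, f (2 * j + 1) := by
  induction m with
  | zero => simp
  | succ m ih =>
    rw [show 2 * (m + 1) + 1 = 2 * m + 1 + 1 + 1 by ring, Finset.sum_range_succ,
      Finset.sum_range_succ, ih, Finset.sum_range_succ _ (m + 1),
      Finset.sum_range_succ (fun j => f (2 * j + 1)) m, show 2 * (m + 1) = 2 * m + 1 + 1 by ring]
    abel

namespace Node

@[simp] theorem isP_T (t : Option σ) : (T t : Node σ).isP = false := rfl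

@[simp] theorem isP_P (n : ℕ) : (P n : Node σ).isP = true := rfl

theorem eq_P_of_isP {x : Node σ} (hx : x.isP = true) : ∃ n, x = P n := by
  cases x with
  | T t => simp [isP] at hx
  | P n => exact ⟨n, rfl⟩

theorem eq_T_of_not_isP {x : Node σ} (hx : ¬ x.isP = true) : ∃ t, x = T t := by
  cases x with
  | T t => exact ⟨t, rfl⟩
  | P n => simp [isP] at hx

theorem Alternates.take {L : List (Node σ)} (hL : Alternates L) (k : ℕ) : Alternates (L.take k) :=
  List.IsChain.take hL k

theorem Alternates.drop {L : List (Node σ)} (hL : Alternates L) (k : ℕ) : Alternates (L.drop k) :=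
  List.IsChain.drop hL k

theorem Alternates.concat {L : List (Node σ)} (hL : Alternates L) {s : Option σ}
    (h : ∀ x ∈ L.getLast?, x.isP = true) : Alternates (L ++ [T s]) := by
  refine List.IsChain.append hL (List.isChain_singleton _) ?_
  intro x hx y hy
  have := h x hx
  simp at hy
  subst hy
  simp [this]

theorem Alternates.cons {L : List (Node σ)} (hL : Alternates L) {s : Option σ}
    (h : ∀ x ∈ L.head?, x.isP = true) : Alternates (T s :: L) := by
  refine List.isChain_cons.2 ⟨fun x hx => ?_, hL⟩
  simp [h x hx]

end Node

theorem nodeSeries_take_concat (D : ℕ∞) {L : List (Node σ)} (hL : Alternates L)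
    (h0 : L.head?.any isP) (s : Option σ) {j : ℕ} (hj : 2 * j + 1 ≤ L.length) :
    nodeSeries D (L.take (2 * j + 1) ++ [T s])
      = (-1) ^ j * (expAt D (-logBracket D 0 (ptAt L 0)) ((T s).val _) *
        invAt D j (fun a => ptAt L (2 * a))
          (fun i => valAt _ L (2 * (i : ℕ) + 1) - (T s).val _)) := by
  cases L with
  | nil => simp at hj
  | cons x w =>
    obtain ⟨p, rfl⟩ := eq_P_of_isP (x := x) (by simpa using h0)
    have hlen : (w.take (2 * j)).length = 2 * j := by
      simp at hj ⊢; omega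
    rw [List.take_succ_cons, nodeSeries_P D p _ hlen]
    · refine congrArg₂ (· * ·) rfl (congrArg₂ (· * ·) rfl (invAt_congr (fun a ha => ?_) fun i => ?_))
      · have := ptAt_take_append (P p :: w) [] (k := 2 * j + 1) (i := 2 * a) (by omega) hj
        simpa using this
      · have := valAt_take_append (R := Hsymb D) w [] (k := 2 * j) (i := 2 * (i : ℕ)) (by omega)
          (by simpa using hj)
        rw [List.append_nil] at this
        rw [this, valAt_cons_succ]
    · have h1 := hL.take (2 * j + 1)
      rw [List.take_succ_cons] at h1
      refine h1.concat fun x hx => ?_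
      have hne : (P p :: w.take (2 * j)) ≠ [] := by simp
      rw [List.getLast?_eq_some_getLast hne] at hx
      obtain rfl := Option.some.inj hx
      have := h1.isP_getD (P 0) (k := 2 * j) (by simp; simpa using hj)
      rw [List.getD_eq_getElem _ _ (by simp; simpa using hj)] at this
      rw [List.getLast_eq_getElem]
      have h2 : (P p :: w.take (2 * j)).length - 1 = 2 * j := by simp at hj ⊢; omega
      simp only [h2]
      rw [this]
      simp [isP]

theorem nodeSeries_cons_drop (D : ℕ∞) {L : List (Node σ)} (hL : Alternates L)
    (h0 : L.head?.any isP) (s : Option σ) {m j : ℕ} (hm : L.length = 2 * m + 1) (hj : j ≤ m) :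
    nodeSeries D (T s :: L.drop (2 * j))
      = expAt D (logBracket D 0 (ptAt L (2 * m))) ((T s).val _) *
        liAt D (m - j) (fun a => ptAt L (2 * (j + a)))
          (fun i => valAt _ L (2 * (j + (i : ℕ)) + 1) - (T s).val _) := by
  have hlen : (L.drop (2 * j)).length = 2 * (m - j) + 1 := by simp; omega
  rw [nodeSeries_T D s _ hlen, ptAt_drop]
  · rw [show 2 * j + 2 * (m - j) = 2 * m by omega]
    refine congrArg₂ (· * ·) rfl (liAt_congr (fun a ha => ?_) fun i => ?_)
    · rw [ptAt_drop, mul_add]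
    · rw [valAt_drop, mul_add, add_assoc]
  · refine (hL.drop _).cons fun x hx => ?_
    have h1 := hL.isP_getD (P 0) (k := 2 * j) (by omega)
    rw [List.head?_drop] at hx
    rw [List.getD_eq_getElem?_getD, hx, List.getD_eq_getElem?_getD, ← List.head?_eq_getElem?] at h1
    cases L with
    | nil => simp at hm
    | cons y w => simp at h0; simpa [h0] using h1

variable {K : Type} [Field K] {D : ℕ∞}

/-- The factor `1 / (s - c)` in the inversion equation. -/
def nodeInv (h : MvPowerSeries σ (Hsymb D) →+* K) (s c : Node σ) : K :=
  (h (s.val _) - h (c.val _))⁻¹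

/-- The recursion for the inversions, multiplied by the exponentials in `nodeSeries`, is the inversion
equation: its first sum comes from the points in `L`, and its second sum from the variables. -/
theorem insertSum_nodeSeries_of_alternates (h : MvPowerSeries σ (Hsymb D) →+* K)
    (hz : ∀ s t : Option σ, s ≠ t → h ((T s).val _) ≠ h ((T t).val _)) {L : List (Node σ)}
    (hL : Alternates L) (h0 : L.head?.any isP) {m : ℕ} (hm : L.length = 2 * m + 1) {t : Option σ}
    (ht : T t ∉ L) (hp : ptAt L 0 ≤ ptAt L (2 * m)) :
    insertSum (fun x => isP x = true) (nodeInv h (T t)) (T t) (fun z => h (nodeSeries D z)) L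
      = cutSum (fun x => isP x = true) (nodeInv h (T t)) (fun z => h (nodeSeries D z)) L := by
  set s : ℕ → MvPowerSeries σ (Hsymb D) := fun i => valAt _ L (2 * i + 1) - (T t).val _ with hs
  have hs0 : ∀ i, MvPowerSeries.constantCoeff (s i) = 0 := fun i => by
    simp [hs, constantCoeff_valAt, constantCoeff_val]
  have hP : ∀ j ≤ m, (L.getD (2 * j) (P 0)).isP = true := by
    intro j hj
    rw [hL.isP_getD _ (by omega)]
    cases L with
    | nil => simp at hm
    | cons y w => simpa using h0
  have hT : ∀ j < m, ∃ c, L.getD (2 * j + 1) (P 0) = T c ∧ valAt (Hsymb D) L (2 * j + 1)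
      = (T c).val _ ∧ T c ∈ L := by
    intro j hj
    have h1 : ¬ (L.getD (2 * j + 1) (P 0)).isP = true := by
      rw [hL.isP_getD _ (by omega)]
      have := hP 0 (Nat.zero_le _)
      simp only [mul_zero] at this
      rw [this]; simp
    obtain ⟨c, hc⟩ := eq_T_of_not_isP h1
    rw [List.getD_eq_getElem _ _ (by omega)] at hc
    refine ⟨c, by rw [List.getD_eq_getElem _ _ (by omega), hc], ?_, hc ▸ List.getElem_mem _⟩
    rw [valAt, List.getElem?_eq_getElem (by omega), hc]; rfl
  set p : ℕ → ℕ := fun a => ptAt L (2 * a) with hpdef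
  set E₁ := expAt D (-logBracket D 0 (ptAt L 0)) ((T t : Node σ).val (Hsymb D)) with hE₁
  set E₂ := expAt D (logBracket D 0 (ptAt L (2 * m))) ((T t : Node σ).val (Hsymb D)) with hE₂
  have htake1 : ∀ k < L.length, ∀ x : Node σ,
      L.take k ++ [L.getD k (P 0), x] = L.take (k + 1) ++ [x] := by
    intro k hk x
    rw [List.take_add_one, List.getElem?_eq_getElem hk, List.getD_eq_getElem _ _ hk,
      Option.toList_some, List.append_assoc]
    rfl
  have hdrop1 : ∀ k < L.length, L.getD k (P 0) :: L.drop (k + 1) = L.drop k := by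
    intro k hk
    rw [List.getD_eq_getElem _ _ hk, List.drop_eq_getElem_cons hk]
  rw [insertSum, cutSum, splitSum_eq_sum (P 0), splitSum_eq_sum (P 0), hm,
    sum_range_two_mul_add_one, sum_range_two_mul_add_one]
  have heven : ∀ j ∈ Finset.range (m + 1), (if (L.getD (2 * j) (P 0)).isP = true then
      h (nodeSeries D (L.take (2 * j) ++ [L.getD (2 * j) (P 0), T t])) *
        h (nodeSeries D (T t :: L.getD (2 * j) (P 0) :: L.drop (2 * j + 1))) else
      nodeInv h (T t) (L.getD (2 * j) (P 0)) * (h (nodeSeries D (L.take (2 * j) ++ [T t])) *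
        h (nodeSeries D (T t :: L.drop (2 * j + 1)))))
      = h E₁ * h E₂ * ((-1) ^ j * h (invAt D j p (fun i => s i) *
          liAt D (m - j) (fun a => p (j + a)) (fun i => s (j + i)))) := by
    intro j hj
    have hj' : j ≤ m := Nat.lt_succ_iff.1 (Finset.mem_range.1 hj)
    rw [if_pos (hP j hj'), htake1 _ (by omega), hdrop1 _ (by omega),
      nodeSeries_take_concat D hL h0 t (by omega), nodeSeries_cons_drop D hL h0 t hm hj']
    simp only [map_mul, map_pow, map_neg, map_one]
    ring
  -- a list is only cut at variables
  have heven' : ∀ j ∈ Finset.range (m + 1),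
      (h (nodeSeries D (L.take (2 * j) ++ [L.getD (2 * j) (P 0)])) *
        if (L.getD (2 * j) (P 0)).isP = true then 0 else nodeInv h (T t) (L.getD (2 * j) (P 0)) *
          h (nodeSeries D (L.getD (2 * j) (P 0) :: L.drop (2 * j + 1)))) = 0 := by
    intro j hj
    rw [if_pos (hP j (Nat.lt_succ_iff.1 (Finset.mem_range.1 hj))), mul_zero]
  -- the recursion for the inversions requires `m ≠ 0`; for `m = 0` the equation says `1 = 1`
  obtain ⟨Q, hQ, hI⟩ : ∃ Q : ℕ → MvPowerSeries σ (Hsymb D),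
      (∀ j < m, s j * Q j = invNumerator D m p s j) ∧
      (if m = 0 then 0 else invAt D m p (fun i => s i)) = if m = 0 then 0 else
        ∑ j ∈ Finset.range m, (-1) ^ (m + 1 + j) * (invAt D j p (fun i => s i) *
          liAt D (m - j) (fun a => p (j + a)) (fun i => s (j + i))) +
        ∑ j ∈ Finset.range m, (-1) ^ (m + j) * Q j := by
    rcases eq_or_ne m 0 with rfl | hm0
    · exact ⟨0, by simp, by simp⟩
    · obtain ⟨Q, h1, h2⟩ := exists_invAt_eq hm0 p hs0
      exact ⟨Q, h1, by rw [if_neg hm0, if_neg hm0, h2]⟩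
  have hodd : ∀ j ∈ Finset.range m, (if (L.getD (2 * j + 1) (P 0)).isP = true then
      h (nodeSeries D (L.take (2 * j + 1) ++ [L.getD (2 * j + 1) (P 0), T t])) *
        h (nodeSeries D (T t :: L.getD (2 * j + 1) (P 0) :: L.drop (2 * j + 1 + 1))) else
      nodeInv h (T t) (L.getD (2 * j + 1) (P 0)) *
        (h (nodeSeries D (L.take (2 * j + 1) ++ [T t])) *
          h (nodeSeries D (T t :: L.drop (2 * j + 1 + 1)))))
      = (h (nodeSeries D (L.take (2 * j + 1) ++ [L.getD (2 * j + 1) (P 0)])) *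
        if (L.getD (2 * j + 1) (P 0)).isP = true then 0 else
          nodeInv h (T t) (L.getD (2 * j + 1) (P 0)) *
          h (nodeSeries D (L.getD (2 * j + 1) (P 0) :: L.drop (2 * j + 1 + 1)))) -
        h E₁ * h E₂ * ((-1) ^ j * h (Q j)) := by
    intro j hj
    have hj' : j < m := Finset.mem_range.1 hj
    obtain ⟨c, hc, hcv, hcL⟩ := hT j hj'
    have hne : h ((T t).val _) - h ((T c).val _) ≠ 0 :=
      sub_ne_zero.2 (hz t c fun e => ht (e ▸ hcL))
    have hsj : s j = (T c).val _ - (T t).val _ := by simp only [hs, hcv]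
    have hcT : ¬ (T c : Node σ).isP = true := by simp [isP]
    rw [hc, if_neg hcT, if_neg hcT, nodeSeries_take_concat D hL h0 t (by omega),
      nodeSeries_take_concat D hL h0 c (by omega), show 2 * j + 1 + 1 = 2 * (j + 1) by ring,
      nodeSeries_cons_drop D hL h0 t hm hj', nodeSeries_cons_drop D hL h0 c hm hj']
    have hq := congrArg h (hQ j hj')
    have hcs : ∀ i, valAt (Hsymb D) L (2 * i + 1) - (T c).val _ = s i - s j := fun i => by
      rw [hsj]; simp only [hs]; ring
    have hts : ∀ i, valAt (Hsymb D) L (2 * i + 1) - (T t).val _ = s i := fun i => rfl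
    have hcc : (T c : Node σ).val (Hsymb D) = s j + (T t).val _ := by rw [hsj]; ring
    have hv0 := constantCoeff_val (Hsymb D) (T t : Node σ)
    have hexp : expAt D (logBracket D (p 0) (p m)) (s j)
        = expAt D (-logBracket D 0 (ptAt L 0)) (s j) *
          expAt D (logBracket D 0 (ptAt L (2 * m))) (s j) := by
      rw [← expAt_add_left _ _ (hs0 j), hpdef]
      simp only [mul_zero]
      rw [logBracket_eq_sub D hp, neg_add_eq_sub]
    simp only [hcs, hts]
    rw [hcc, expAt_add_right _ (hs0 j) hv0, expAt_add_right _ (hs0 j) hv0, ← hE₁, ← hE₂]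
    rw [map_mul, hsj, map_sub, invNumerator, map_sub, hexp] at hq
    rw [nodeInv]
    have hQj : h (Q j) = -(h ((T t).val _) - h ((T c).val _))⁻¹ *
        ((h ((T c).val _) - h ((T t).val _)) * h (Q j)) := by
      field_simp
      ring
    rw [hQj, hq]
    simp only [map_mul, map_pow, map_neg, map_one]
    ring
  rw [Finset.sum_congr rfl heven, Finset.sum_congr rfl heven', Finset.sum_congr rfl hodd,
    Finset.sum_const_zero, zero_add, Finset.sum_sub_distrib, ← Finset.mul_sum, ← Finset.mul_sum,
    Finset.sum_range_succ]
  rcases eq_or_ne m 0 with rfl | hm0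
  · have hE : E₁ * E₂ = 1 := by
      rw [hE₁, hE₂, ← expAt_add_left _ _ (constantCoeff_val _ _), mul_zero, neg_add_cancel,
        expAt_zero_left]
    simp [invAt_zero, liAt_zero, ← map_mul, hE]
  · rw [if_neg hm0, if_neg hm0] at hI
    rw [if_neg (by omega), zero_add]
    have hh : ∀ (n : ℕ) x, h ((-1) ^ n * x) = (-1) ^ n * h x := fun n x => by
      rw [map_mul, map_pow, map_neg, map_one]
    have hI' := congrArg h hI
    simp only [map_add, map_sum, hh] at hI'
    have hsgn : ∀ j, (-1 : K) ^ m * (-1) ^ (m + 1 + j) = -(-1) ^ j := fun j => by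
      rw [← pow_add, show m + (m + 1 + j) = 2 * m + j + 1 by ring, pow_succ, pow_add, pow_mul]
      simp
    have hsgn' : ∀ j, (-1 : K) ^ m * (-1) ^ (m + j) = (-1) ^ j := fun j => by
      rw [← pow_add, show m + (m + j) = 2 * m + j by ring, pow_add, pow_mul]
      simp
    rw [Nat.sub_self, liAt_zero, mul_one, hI']
    simp only [mul_add ((-1 : K) ^ m), Finset.mul_sum _ _ ((-1 : K) ^ m), ← mul_assoc ((-1 : K) ^ m),
      hsgn, hsgn', neg_mul, Finset.sum_neg_distrib]
    ring

/-- The lists on which the generating series are considered: the variables are distinct, and the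
points are increasing and at most `D`. -/
def IsGood (D : ℕ∞) (L : List (Node σ)) : Prop :=
  (L.filterMap var?).Nodup ∧ (L.filterMap pt?).Pairwise (· < ·) ∧
    ∀ n ∈ L.filterMap pt?, (n : ℕ∞) ≤ D

theorem IsGood.sublist {L L' : List (Node σ)} (h : L'.Sublist L) (hL : IsGood D L) :
    IsGood D L' :=
  ⟨hL.1.sublist (h.filterMap _), hL.2.1.sublist (h.filterMap _),
    fun n hn => hL.2.2 n ((h.filterMap _).subset hn)⟩

theorem IsGood.rotate {L : List (Node σ)} {t : Node σ} (ht : ¬ t.isP = true)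
    (hL : IsGood D (L ++ [t])) : IsGood D (t :: L) := by
  obtain ⟨t, rfl⟩ := eq_T_of_not_isP ht
  have hpt : (T t :: L).filterMap pt? = (L ++ [T t]).filterMap pt? := by
    rw [List.filterMap_append]
    simp [List.filterMap_cons, pt?]
  refine ⟨?_, hpt ▸ hL.2.1, hpt ▸ hL.2.2⟩
  · have h1 : ((T t :: L).filterMap var?).Perm ((L ++ [T t]).filterMap var?) :=
      (List.perm_append_singleton (T t) L).symm.filterMap _
    exact h1.nodup_iff.2 hL.1

/-- On lists that do not alternate all terms of the inversion equation vanish. -/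
theorem insertSum_eq_cutSum_of_not_alternates {φ : List (Node σ) → K} {κ : Node σ → K} {s : Node σ}
    (hs : ¬ s.isP = true) (hφ : ∀ z, ¬ Alternates z → φ z = 0) {L : List (Node σ)}
    (hL : ¬ Alternates L) :
    insertSum (fun x => isP x = true) κ s φ L = cutSum (fun x => isP x = true) κ φ L := by
  have hsplit : ∀ u c v, L = u ++ c :: v → Alternates (u ++ [c]) → Alternates (c :: v) → False := by
    intro u c v huv h1 h2
    exact hL (huv ▸ List.isChain_split.2 ⟨h1, h2⟩)
  rw [insertSum, cutSum, if_neg, zero_add]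
  · refine splitSum_congr fun u c v huv => ?_
    split_ifs with hc
    · rw [mul_zero]
      by_cases h1 : Alternates (u ++ [c, s])
      · by_cases h2 : Alternates (s :: c :: v)
        · refine (hsplit u c v huv ?_ ?_).elim
          · exact List.IsChain.left_of_append (l₂ := [s]) (by simpa using h1)
          · exact h2.tail
        · rw [hφ _ h2, mul_zero]
      · rw [hφ _ h1, zero_mul]
    · have hcs : ∀ l : List (Node σ), (Alternates (l ++ [s]) ↔ Alternates (l ++ [c])) ∧
          (Alternates (s :: l) ↔ Alternates (c :: l)) := by
        intro l
        have hmap : ∀ z : List (Node σ), Alternates z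
            ↔ (z.map isP).IsChain fun x y => ¬ (x = true ↔ y = true) := fun z => by
          rw [List.isChain_map]
        have hsc : s.isP = c.isP := by simp_all
        rw [hmap, hmap, hmap, hmap]
        simp [hsc]
      have hz : ∀ x y : K, (¬ Alternates (u ++ [c]) ∨ ¬ Alternates (c :: v)) := fun x y => by
        by_contra! h
        exact hsplit u c v huv h.1 h.2
      rcases hz 0 0 with h | h
      · rw [hφ _ h, hφ _ (fun h' => h ((hcs u).1.1 h'))]; ring
      · rw [hφ _ h, hφ _ (fun h' => h ((hcs v).2.1 h'))]; ring
  · intro h1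
    obtain ⟨x, rfl⟩ := List.length_eq_one_iff.1 h1
    exact hL (List.isChain_singleton _)

theorem insertSum_nodeSeries (h : MvPowerSeries σ (Hsymb D) →+* K)
    (hz : ∀ s t : Option σ, s ≠ t → h ((T s).val _) ≠ h ((T t).val _)) {L : List (Node σ)}
    {s : Node σ} (h0 : L.head?.any isP) (h1 : L.getLast?.any isP) (hs : ¬ s.isP = true)
    (hG : IsGood D (L ++ [s])) :
    insertSum (fun x => isP x = true) (nodeInv h s) s (fun z => h (nodeSeries D z)) L
      = cutSum (fun x => isP x = true) (nodeInv h s) (fun z => h (nodeSeries D z)) L := by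
  obtain ⟨t, rfl⟩ := eq_T_of_not_isP hs
  by_cases hL : Alternates L
  · have hne : L ≠ [] := by rintro rfl; simp at h0
    have hpos := List.length_pos_iff.2 hne
    have e0 : (L.getD 0 (P 0)).isP = true := by
      cases L with
      | nil => simp at hne
      | cons y w => simpa using h0
    have e1 : (L.getD (L.length - 1) (P 0)).isP = true := by
      rw [List.getLast?_eq_some_getLast hne] at h1
      rw [List.getD_eq_getElem _ _ (by omega), ← List.getLast_eq_getElem hne]
      simpa using h1
    have hev := (hL.isP_getD (P 0) (k := L.length - 1) (by omega)).1 e1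
    obtain ⟨m, hm⟩ := hev.1 e0
    refine insertSum_nodeSeries_of_alternates h hz hL h0 (m := m) (by omega) ?_ ?_
    · intro hmem
      have := hG.1
      rw [List.filterMap_append, List.nodup_append] at this
      exact this.2.2 t (List.mem_filterMap.2 ⟨_, hmem, rfl⟩) t (by simp [var?]) rfl
    · rcases eq_or_ne m 0 with rfl | hm0
      · simp
      obtain ⟨x, w, y, rfl⟩ : ∃ x w y, L = x :: (w ++ [y]) := by
        cases L with
        | nil => simp at hne
        | cons x w' =>
          have hw' : w' ≠ [] := by rintro rfl; simp at hm; omega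
          exact ⟨x, w'.dropLast, w'.getLast hw', by rw [List.dropLast_append_getLast]⟩
      obtain ⟨n, rfl⟩ := eq_P_of_isP (x := x) (by simpa using h0)
      obtain ⟨n', rfl⟩ := eq_P_of_isP (x := y) (by simpa [List.getLast?_cons] using h1)
      have h2 := hG.2.1
      have h3 : ptAt (P n :: (w ++ [P n'])) (2 * m) = n' := by
        have : 2 * m = w.length + 1 := by simp at hm; omega
        rw [this, ptAt_cons_succ, ptAt]
        simp [pt]
      rw [h3, ptAt_cons_zero]
      simp only [List.cons_append, List.filterMap_cons, pt?, List.filterMap_append] at h2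
      exact ((List.pairwise_cons.1 h2).1 n' (by simp)).le
  · exact insertSum_eq_cutSum_of_not_alternates (by simp)
      (fun z hz => by rw [nodeSeries_eq_zero D (.inl hz), map_zero]) hL

end InversionEquation

/-! ### Sums over interlaced tuples -/

section TupleSums

variable {N K : Type} [CommRing K]

/-- The condition on the pairs of tuples over which the coproduct formula sums. -/
def Interlaced {d k : ℕ} (i j : Fin k → Fin d) : Prop :=
  (∀ a, i a ≤ j a) ∧ ∀ a b, a < b → j a < i b

/-- The pairs `(j_a, i_{a+1})`. They locate the variables and points that the sublist keeps after its
first point. -/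
def linkPairs {d k : ℕ} (i j : Fin k → Fin d) : List (ℕ × ℕ) :=
  (List.finRange k).map fun a => ((j a : ℕ), blockStart i ((a : ℕ) + 1))

open Classical in
/-- The part with `k` blocks, starting with `i_0 = a`, of a sum over interlaced tuples. -/
def tupleSum (d : ℕ) (B : ℕ → ℕ → ℕ → K) (k a : ℕ) (H : List (ℕ × ℕ) → K) : K :=
  ∑ i : Fin k → Fin d, ∑ j : Fin k → Fin d, if Interlaced i j ∧ blockStart i 0 = a then
    H (linkPairs i j) * ∏ l : Fin k, B (blockStart i l) (j l) (blockStart i ((l : ℕ) + 1)) else 0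

theorem blockStart_cons_zero {d k : ℕ} (i₀ : Fin d) (i : Fin k → Fin d) :
    blockStart (Fin.cons i₀ i : Fin (k + 1) → Fin d) 0 = i₀ := by
  simp [blockStart]

theorem blockStart_cons_succ {d k : ℕ} (i₀ : Fin d) (i : Fin k → Fin d) (a : ℕ) :
    blockStart (Fin.cons i₀ i : Fin (k + 1) → Fin d) (a + 1) = blockStart i a := by
  unfold blockStart
  by_cases h : a < k
  · rw [dif_pos h, dif_pos (by omega)]
    exact congrArg _ (Fin.cons_succ (α := fun _ => Fin d) i₀ i ⟨a, h⟩)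
  · rw [dif_neg h, dif_neg (by omega)]

theorem blockStart_le {d k : ℕ} (i : Fin k → Fin d) (a : ℕ) : blockStart i a ≤ d := by
  unfold blockStart
  split_ifs
  · exact (i _).2.le
  · exact le_rfl

theorem linkPairs_cons {d k : ℕ} (i₀ j₀ : Fin d) (i j : Fin k → Fin d) :
    linkPairs (Fin.cons i₀ i : Fin (k + 1) → Fin d) (Fin.cons j₀ j : Fin (k + 1) → Fin d)
      = ((j₀ : ℕ), blockStart i 0) :: linkPairs i j := by
  unfold linkPairs
  rw [List.finRange_succ, List.map_cons, List.map_map]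
  refine congrArg₂ _ ?_ (List.map_congr_left fun a _ => ?_)
  · simp [blockStart_cons_succ]
  · simp [blockStart_cons_succ]

theorem interlaced_cons {d k : ℕ} (i₀ j₀ : Fin d) (i j : Fin k → Fin d) :
    Interlaced (Fin.cons i₀ i : Fin (k + 1) → Fin d) (Fin.cons j₀ j : Fin (k + 1) → Fin d)
      ↔ Interlaced i j ∧ i₀ ≤ j₀ ∧ (j₀ : ℕ) < blockStart i 0 := by
  unfold Interlaced
  simp only [Fin.forall_fin_succ, Fin.cons_zero, Fin.cons_succ,
    IsEmpty.forall_iff, Fin.succ_pos, true_imp_iff, Fin.succ_lt_succ_iff, true_and, Fin.not_lt_zero]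
  constructor
  · rintro ⟨⟨h1, h2⟩, h3, h4⟩
    refine ⟨⟨h2, h4⟩, h1, ?_⟩
    unfold blockStart
    split_ifs with h
    · exact h3 ⟨0, h⟩
    · exact j₀.2
  · rintro ⟨⟨h2, h4⟩, h1, h3⟩
    refine ⟨⟨h1, h2⟩, fun b => ?_, h4⟩
    have hk : 0 < k := b.pos
    rw [blockStart, dif_pos hk] at h3
    rcases Nat.eq_zero_or_pos (b : ℕ) with hb | hb
    · obtain rfl : b = ⟨0, hk⟩ := Fin.ext hb
      exact h3
    · exact lt_of_lt_of_le h3 ((h2 _).trans (h4 ⟨0, hk⟩ b hb).le)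

theorem tupleSum_zero (d : ℕ) (B : ℕ → ℕ → ℕ → K) (a : ℕ) (H : List (ℕ × ℕ) → K) :
    tupleSum d B 0 a H = if a = d then H [] else 0 := by
  unfold tupleSum
  simp [Interlaced, linkPairs, blockStart, eq_comm]

theorem tupleSum_succ {d : ℕ} (B : ℕ → ℕ → ℕ → K) (k a : ℕ) (H : List (ℕ × ℕ) → K) :
    tupleSum d B (k + 1) a H = ∑ b ∈ Finset.Ico a d, ∑ c ∈ Finset.Ioc b d,
      B a b c * tupleSum d B k c fun l => H ((b, c) :: l) := by
  classical
  have hcons : ∀ f : (Fin (k + 1) → Fin d) → K, ∑ i, f i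
      = ∑ i₀ : Fin d, ∑ i : Fin k → Fin d, f (Fin.cons i₀ i) := by
    intro f
    rw [← Fintype.sum_prod_type', ← (Fin.consEquiv fun _ : Fin (k + 1) => Fin d).sum_comp]
    rfl
  have hR : ∀ b ∈ Finset.Ico a d, (∑ c ∈ Finset.Ioc b d,
      B a b c * tupleSum d B k c fun l => H ((b, c) :: l))
      = ∑ i : Fin k → Fin d, ∑ j : Fin k → Fin d, if Interlaced i j ∧ b < blockStart i 0 then
        B a b (blockStart i 0) * (H ((b, blockStart i 0) :: linkPairs i j) *
          ∏ l : Fin k, B (blockStart i l) (j l) (blockStart i ((l : ℕ) + 1))) else 0 := by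
    intro b hb
    simp only [tupleSum, Finset.mul_sum]
    rw [Finset.sum_comm]
    refine Finset.sum_congr rfl fun i _ => ?_
    rw [Finset.sum_comm]
    refine Finset.sum_congr rfl fun j _ => ?_
    by_cases hij : Interlaced i j
    · simp only [hij, true_and, mul_ite, mul_zero]
      rw [Finset.sum_ite_eq]
      simp [blockStart_le]
    · simp [hij]
  rw [Finset.sum_congr rfl hR]
  simp only [tupleSum]
  rw [hcons]
  simp only [hcons (fun j => ite _ _ _), blockStart_cons_zero, interlaced_cons, linkPairs_cons,
    Fin.prod_univ_succ, Fin.cons_zero, Fin.cons_succ, Fin.val_zero, Fin.val_succ,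
    blockStart_cons_succ]
  have h2 : ∀ F : ℕ → K, ∑ b ∈ Finset.Ico a d, F b = ∑ b : Fin d, if a ≤ (b : ℕ) then F b else 0 := by
    intro F
    rw [← Finset.sum_range (fun b => if a ≤ b then F b else 0), ← Finset.sum_filter]
    refine Finset.sum_congr ?_ fun _ _ => rfl
    ext b
    simp [and_comm]
  rw [h2]
  by_cases ha : a < d
  · rw [Finset.sum_eq_single (⟨a, ha⟩ : Fin d)]
    · rw [Finset.sum_comm]
      refine Finset.sum_congr rfl fun b _ => ?_
      by_cases hab : a ≤ (b : ℕ)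
      · rw [if_pos hab]
        refine Finset.sum_congr rfl fun i _ => Finset.sum_congr rfl fun j _ => ?_
        simp only [Fin.le_def, hab, true_and, and_true]
        split_ifs <;> ring
      · rw [if_neg hab]
        refine Finset.sum_eq_zero fun i _ => Finset.sum_eq_zero fun j _ => if_neg ?_
        rintro ⟨⟨-, h, -⟩, -⟩
        exact hab h
    · intro i₀ _ hi₀
      refine Finset.sum_eq_zero fun i _ => Finset.sum_eq_zero fun b _ =>
        Finset.sum_eq_zero fun j _ => if_neg ?_
      rintro ⟨-, h⟩
      exact hi₀ (Fin.ext h)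
    · simp
  · rw [Finset.sum_eq_zero, Finset.sum_eq_zero]
    · intro b _
      rw [if_neg (by omega)]
    · intro i₀ _
      refine Finset.sum_eq_zero fun i _ => Finset.sum_eq_zero fun b _ =>
        Finset.sum_eq_zero fun j _ => if_neg ?_
      rintro ⟨-, h⟩
      omega

/-- The sum over the sublists of `w` that begin with the entry number `i` and contain the last
entry. -/
def startSum (ψ : List N → K) (a : N) (w : List N) (i : ℕ) (H : List N → K) : K :=
  gapSum ψ (w.drop (i + 1)) H [w.getD i a]

theorem startSum_eq (ψ : List N → K) (a : N) {w : List N} {i : ℕ} (hi : i < w.length)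
    (H : List N → K) :
    startSum ψ a w i H = (if i + 1 = w.length then H [] else 0)
      + ∑ k ∈ Finset.Ico (i + 1) w.length, ψ (seg w i (k + 1)) *
        startSum ψ a w k fun l => H (w.getD k a :: l) := by
  rw [startSum, gapSum_first _ _ _ (List.cons_ne_nil _ []), splitSum_eq_sum a,
    Finset.sum_Ico_eq_sum_range, List.length_drop]
  refine congrArg₂ (· + ·) ?_ (Finset.sum_congr rfl fun k hk => ?_)
  · simp only [List.length_singleton, true_and, List.drop_eq_nil_iff]
    exact if_congr (by omega) rfl rfl
  · have hk' := Finset.mem_range.1 hk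
    have h1 : (w.drop (i + 1)).getD k a = w.getD (i + 1 + k) a := by
      simp [List.getD_eq_getElem?_getD]
    rw [startSum, h1, List.drop_drop, seg_cons a hi (by omega), seg_concat a (by omega) (by omega),
      show i + 1 + (k + 1) = i + 1 + k + 1 by ring]
    refine congrArg₂ (· * ·) (congrArg ψ ?_) rfl
    simp only [List.cons_append, List.nil_append]
    refine congrArg (_ :: · ++ _) ?_
    simp [seg]

theorem sum_Ico_two_mul {f : ℕ → K} {a d : ℕ} (ha : a ≤ d)
    (hf : ∀ k, 2 * a + 1 ≤ k → k < 2 * d + 1 → Even k → f k = 0) :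
    ∑ k ∈ Finset.Ico (2 * a + 1) (2 * d + 1), f k = ∑ b ∈ Finset.Ico a d, f (2 * b + 1) := by
  induction d, ha using Nat.le_induction with
  | base => simp
  | succ d had ih =>
    rw [show 2 * (d + 1) + 1 = 2 * d + 1 + 1 + 1 by ring, Finset.sum_Ico_succ_top (by omega),
      Finset.sum_Ico_succ_top (by omega), ih fun k h1 h2 => hf k h1 (by omega),
      Finset.sum_Ico_succ_top had, hf (2 * d + 1 + 1) (by omega) (by omega) ⟨d + 1, by ring⟩,
      add_zero]

theorem sum_Ico_two_mul' {f : ℕ → K} {b d : ℕ} (hb : b < d)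
    (hf : ∀ k, 2 * b + 2 ≤ k → k < 2 * d + 1 → ¬ Even k → f k = 0) :
    ∑ k ∈ Finset.Ico (2 * b + 2) (2 * d + 1), f k = ∑ c ∈ Finset.Ioc b d, f (2 * c) := by
  obtain ⟨e, rfl⟩ : ∃ e, d = b + 1 + e := ⟨d - (b + 1), by omega⟩
  clear hb
  induction e with
  | zero =>
    rw [add_zero, show 2 * (b + 1) + 1 = 2 * b + 2 + 1 by ring, Finset.sum_Ico_succ_top (by omega)]
    simp [mul_add]
  | succ e ih =>
    rw [← add_assoc, show 2 * (b + 1 + e + 1) + 1 = 2 * (b + 1 + e) + 1 + 1 + 1 by ring,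
      Finset.sum_Ico_succ_top (by omega), Finset.sum_Ico_succ_top (by omega),
      ih fun k h1 h2 => hf k h1 (by omega),
      hf (2 * (b + 1 + e) + 1) (by omega) (by omega) (by simp [parity_simps]), add_zero,
      show b + 1 + e + 1 = (b + 1 + e) + 1 by ring,
      Finset.sum_Ioc_succ_top (by omega)]
    rfl

/-- When `ψ` lives on lists of even length, the sums over sublists become sums over interlaced
tuples. -/
theorem startSum_eq_tupleSum {ψ : List N → K} (hψ : ∀ z, ¬ Even z.length → ψ z = 0) (a : N)
    {w : List N} {d : ℕ} (hw : w.length = 2 * d + 1) (n : ℕ) :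
    ∀ (i : ℕ) (H : List N → K), i ≤ d → d - i ≤ n → startSum ψ a w (2 * i) H
      = ∑ k ∈ Finset.range (n + 1), tupleSum d
          (fun i j c => ψ (seg w (2 * i) (2 * j + 2)) * ψ (seg w (2 * j + 1) (2 * c + 1))) k i
          fun l => H (l.flatMap fun jc => [w.getD (2 * jc.1 + 1) a, w.getD (2 * jc.2) a]) := by
  induction n with
  | zero =>
    intro i H hi hn
    obtain rfl : i = d := by omega
    rw [startSum_eq ψ a (by omega), hw]
    simp [tupleSum_zero]
  | succ n ih =>
    intro i H hi hn
    rw [startSum_eq ψ a (by omega), Finset.sum_range_succ', tupleSum_zero, add_comm, hw]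
    refine congrArg₂ (· + ·) ?_ ?_
    · rw [sum_Ico_two_mul hi]
      · simp only [tupleSum_succ]
        rw [Finset.sum_comm]
        refine Finset.sum_congr rfl fun b hb => ?_
        have hb' := Finset.mem_Ico.1 hb
        rw [startSum_eq ψ a (by omega), if_neg (by omega), zero_add, hw, sum_Ico_two_mul' hb'.2,
          Finset.sum_comm, Finset.mul_sum]
        · refine Finset.sum_congr rfl fun c hc => ?_
          have hc' := Finset.mem_Ioc.1 hc
          rw [ih c _ hc'.2 (by omega), Finset.mul_sum, Finset.mul_sum]
          refine Finset.sum_congr rfl fun k _ => ?_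
          simp only [List.flatMap_cons, List.cons_append, List.nil_append]
          rw [← mul_assoc]
        · intro k hk1 hk2 hk
          rw [hψ, zero_mul]
          rw [length_seg (by omega)]
          rw [Nat.not_even_iff] at hk ⊢
          omega
      · intro k hk1 hk2 hk
        rw [hψ, zero_mul]
        rw [length_seg (by omega)]
        rw [Nat.not_even_iff]
        rw [Nat.even_iff] at hk
        omega
    · simp

end TupleSums

/-! ### The coproduct formula as a sum over interlaced tuples -/

section CoproductFormula
open Node

variable {D : ℕ∞} {σ τ R : Type} [CommRing R] [Algebra ℚ R]

/-- The factors of the coproduct formula with power series `s_a` for the variables. -/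
def blockAt (D : ℕ∞) (p : ℕ → ℕ) (s : ℕ → MvPowerSeries τ (Hsymb D)) (a b c : ℕ) :
    MvPowerSeries τ (Hsymb D) :=
  (-1) ^ (b - a) * expAt D (logBracket D (p a) (p c)) (s b) *
    invAt D (b - a) (fun l => p (a + l)) (fun l => s (a + (l : ℕ)) - s b) *
    liAt D (c - (b + 1)) (fun l => p (b + 1 + l)) (fun l => s (b + 1 + (l : ℕ)) - s b)

theorem subst_blockSeries {d : ℕ} (p : ℕ → ℕ) {s : ℕ → MvPowerSeries τ (Hsymb D)}
    (hs : ∀ i, MvPowerSeries.constantCoeff (s i) = 0) {a b c : ℕ} (hb : b < d) (hc : c ≤ d) :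
    MvPowerSeries.subst (fun i : Fin d => s i) (blockSeries D d p a b c) = blockAt D p s a b c := by
  have ht := constantCoeff_tvar (D := D) d
  have hs' : ∀ i : Fin d, MvPowerSeries.constantCoeff (s i) = 0 := fun i => hs i
  have hS := hasSubst_zero hs'
  have htt : ∀ i, MvPowerSeries.constantCoeff (tvar D d i - tvar D d b) = 0 := fun i => by
    simp [ht]
  rw [blockSeries, MvPowerSeries.subst_mul hS, MvPowerSeries.subst_mul hS,
    MvPowerSeries.subst_mul hS, subst_invAt hs' _ (fun i => htt _), subst_liAt hs' _ (fun i => htt _),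
    subst_expAt hs' _ (ht b), subst_tvar hs hb, blockAt]
  have h1 : MvPowerSeries.subst (fun i : Fin d => s i) ((-1 : MvPowerSeries (Fin d) (Hsymb D)) ^ (b - a))
      = (-1) ^ (b - a) := by
    rw [← MvPowerSeries.coe_substAlgHom hS, map_pow, map_neg, map_one]
  rw [h1]
  refine congrArg₂ (· * ·) (congrArg₂ (· * ·) rfl ?_) ?_
  · refine invAt_congr (fun _ _ => rfl) fun i => ?_
    rw [MvPowerSeries.subst_sub hS, subst_tvar hs hb, subst_tvar hs (by omega)]
  · refine liAt_congr (fun _ _ => rfl) fun i => ?_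
    rw [MvPowerSeries.subst_sub hS, subst_tvar hs hb, subst_tvar hs (by omega)]

theorem blockSeries_congr {d : ℕ} {p q : ℕ → ℕ} (h : ∀ a ≤ d, p a = q a) {a b c : ℕ} (hab : a ≤ b)
    (hbc : b < c) (hc : c ≤ d) : blockSeries D d p a b c = blockSeries D d q a b c := by
  rw [blockSeries, blockSeries, h a (by omega), h c (by omega),
    invAt_congr (fun l hl => h (a + l) (by omega)) (fun _ => rfl),
    liAt_congr (fun l hl => h (b + 1 + l) (by omega)) (fun _ => rfl)]

theorem lt_blockStart_succ {d k : ℕ} {i j : Fin k → Fin d} (h : Interlaced i j) (a : Fin k) :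
    (j a : ℕ) < blockStart i (a + 1) := by
  unfold blockStart
  split_ifs with h1
  · exact h.2 _ _ (by simp [Fin.lt_def])
  · exact (j a).2

theorem blockStart_fin {d k : ℕ} (i : Fin k → Fin d) (a : Fin k) : blockStart i a = i a := by
  simp [blockStart]

theorem coproductSeries_congr {d : ℕ} {p q : ℕ → ℕ} (h : ∀ a ≤ d, p a = q a) :
    coproductSeries D d p = coproductSeries D d q := by
  refine Finset.sum_congr rfl fun k _ => Finset.sum_congr rfl fun ij hij => ?_
  have hij' : Interlaced ij.1 ij.2 := (Finset.mem_filter.1 hij).2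
  refine congrArg₂ (· * ·) (congrArg _ ?_) (congrArg _ (congrArg₂ (· * ·) ?_ ?_))
  · exact liAt_congr (fun a _ => h _ (blockStart_le _ _)) fun _ => rfl
  · exact liAt_congr (fun a ha => h _ (ha.trans (blockStart_le _ _))) fun _ => rfl
  · refine Finset.prod_congr rfl fun a _ => blockSeries_congr h ?_ ?_ (blockStart_le _ _)
    · rw [blockStart_fin]
      exact hij'.1 a
    · exact lt_blockStart_succ hij' a

theorem map_expAt (θ : Hsymb D →ₐ[ℚ] R) (c : Hsymb D) {s : MvPowerSeries τ (Hsymb D)}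
    (hs : MvPowerSeries.constantCoeff s = 0) :
    MvPowerSeries.map (θ : Hsymb D →+* R) (expAt D c s)
      = expSer (θ c • MvPowerSeries.map (θ : Hsymb D →+* R) s) := by
  have h : MvPowerSeries.constantCoeff (c • s) = 0 := by simp [hs]
  rw [expAt, PowerSeries.map_subst (PowerSeries.HasSubst.of_constantCoeff_zero h),
    PowerSeries.map_exp, expSer]
  congr 1
  ext e
  simp

theorem coproduct_logBracket (i j : ℕ) : coproduct D (logBracket D i j)
    = logBracket D i j ⊗ₜ 1 + 1 ⊗ₜ logBracket D i j := by
  unfold logBracket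
  rw [map_sum, TensorProduct.sum_tmul, TensorProduct.tmul_sum, ← Finset.sum_add_distrib]
  refine Finset.sum_congr rfl fun r _ => ?_
  split_ifs
  · simp [coproduct, coproductGen]
  · simp

/-- The convolution product of two algebra homomorphisms. -/
def convHom (θ₁ θ₂ : Hsymb D →ₐ[ℚ] R) : Hsymb D →ₐ[ℚ] R :=
  (Algebra.TensorProduct.productMap θ₁ θ₂).comp (coproduct D)

theorem convHom_logBracket (θ₁ θ₂ : Hsymb D →ₐ[ℚ] R) (i j : ℕ) :
    convHom θ₁ θ₂ (logBracket D i j) = θ₁ (logBracket D i j) + θ₂ (logBracket D i j) := by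
  simp [convHom, coproduct_logBracket]

theorem map_convHom_expAt (θ₁ θ₂ : Hsymb D →ₐ[ℚ] R) (i j : ℕ) (s : MvPowerSeries τ ℚ)
    (hs : MvPowerSeries.constantCoeff s = 0) :
    MvPowerSeries.map (convHom θ₁ θ₂ : Hsymb D →+* R)
        (expAt D (logBracket D i j) (MvPowerSeries.map (algebraMap ℚ _) s))
      = MvPowerSeries.map (θ₁ : Hsymb D →+* R)
          (expAt D (logBracket D i j) (MvPowerSeries.map (algebraMap ℚ _) s)) *
        MvPowerSeries.map (θ₂ : Hsymb D →+* R)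
          (expAt D (logBracket D i j) (MvPowerSeries.map (algebraMap ℚ _) s)) := by
  have hmap : ∀ θ : Hsymb D →ₐ[ℚ] R, MvPowerSeries.map (θ : Hsymb D →+* R)
      (MvPowerSeries.map (algebraMap ℚ _) s) = MvPowerSeries.map (algebraMap ℚ R) s := fun θ => by
    ext e
    simp only [MvPowerSeries.coeff_map]
    exact θ.commutes _
  have h0 : MvPowerSeries.constantCoeff (MvPowerSeries.map (algebraMap ℚ (Hsymb D)) s) = 0 := by
    rw [← MvPowerSeries.coeff_zero_eq_constantCoeff_apply] at hs ⊢
    rw [MvPowerSeries.coeff_map, hs, map_zero]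
  have h1 : MvPowerSeries.constantCoeff (MvPowerSeries.map (algebraMap ℚ R) s) = 0 := by
    rw [← MvPowerSeries.coeff_zero_eq_constantCoeff_apply] at hs ⊢
    rw [MvPowerSeries.coeff_map, hs, map_zero]
  rw [map_expAt _ _ h0, map_expAt _ _ h0, map_expAt _ _ h0, hmap, hmap, hmap, convHom_logBracket,
    add_smul, expSer_add] <;> simp [h1]

theorem map_convHom_liSeries (θ₁ θ₂ : Hsymb D →ₐ[ℚ] R) {d : ℕ} {p : ℕ → ℕ}
    (hp : StrictMono fun a : Fin (d + 1) => p a) (hD : (p d : ℕ∞) ≤ D) :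
    MvPowerSeries.map (convHom θ₁ θ₂ : Hsymb D →+* R) (liSeries D d p)
      = MvPowerSeries.map (Algebra.TensorProduct.productMap θ₁ θ₂ : _ →+* R)
        (coproductSeries D d p) := by
  rcases Nat.eq_zero_or_pos d with rfl | hd
  · have h0 : coproductSeries D 0 p = 1 := by
      rw [coproductSeries]
      simp [liAt_zero, blockStart]
    rw [h0, liSeries_zero, map_one, map_one]
  · ext e
    rw [MvPowerSeries.coeff_map, MvPowerSeries.coeff_map]
    have h1 : MvPowerSeries.coeff e (liSeries D d p) = bracket D d p fun a => (e a).succPNat := rfl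
    rw [h1, bracket, dif_neg hd.ne', dif_pos ⟨hp, hD⟩]
    simp only [convHom, AlgHom.comp_apply, RingHom.coe_coe, coproduct,
      MvPolynomial.aeval_X, coproductGen, Nat.succPNat_coe, Nat.succ_sub_one]
    have h2 : Finsupp.equivFunOnFinite.symm (fun a => e a) = e := by ext; simp
    refine congrArg _ ?_
    refine congrArg₂ (fun e f => MvPowerSeries.coeff e f) h2 ?_
    refine coproductSeries_congr fun a ha => ?_
    simp [LiSymbol.pt, Nat.lt_succ_of_le ha]

/-- The coproduct formula after substituting power series for the variables and applying a
homomorphism to each factor. -/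
theorem map_convHom_liAt (θ₁ θ₂ : Hsymb D →ₐ[ℚ] R) {d : ℕ} {p : ℕ → ℕ}
    (hp : StrictMono fun a : Fin (d + 1) => p a) (hD : (p d : ℕ∞) ≤ D)
    {s : ℕ → MvPowerSeries τ ℚ} (hs : ∀ i, MvPowerSeries.constantCoeff (s i) = 0)
    {S : ℕ → MvPowerSeries τ (Hsymb D)} (hS : ∀ i, S i = MvPowerSeries.map (algebraMap ℚ _) (s i)) :
    MvPowerSeries.map (convHom θ₁ θ₂ : Hsymb D →+* R) (liAt D d p fun i => S i)
      = ∑ k ∈ Finset.range (d + 1),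
    ∑ ij ∈ (Finset.univ : Finset ((Fin k → Fin d) × (Fin k → Fin d))).filter
        (fun ij => (∀ a, ij.1 a ≤ ij.2 a) ∧ ∀ a b, a < b → ij.2 a < ij.1 b),
      MvPowerSeries.map (θ₁ : Hsymb D →+* R)
          (liAt D k (fun a => p (blockStart ij.1 a)) (fun a => S (ij.2 a : ℕ))) *
        MvPowerSeries.map (θ₂ : Hsymb D →+* R)
          (liAt D (blockStart ij.1 0) p (fun l => S l) *
            ∏ a : Fin k, blockAt D p S (blockStart ij.1 (a : ℕ)) (ij.2 a : ℕ)
              (blockStart ij.1 ((a : ℕ) + 1))) := by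
  have hS0 : ∀ i, MvPowerSeries.constantCoeff (S i) = 0 := fun i => by
    have := hs i
    rw [← MvPowerSeries.coeff_zero_eq_constantCoeff_apply] at this ⊢
    rw [hS, MvPowerSeries.coeff_map, this, map_zero]
  have hmap : ∀ (θ : Hsymb D →ₐ[ℚ] R) i, MvPowerSeries.map (θ : Hsymb D →+* R) (S i)
      = MvPowerSeries.map (algebraMap ℚ R) (s i) := fun θ i => by
    ext e
    rw [hS]
    simp only [MvPowerSeries.coeff_map]
    exact θ.commutes _
  set U : Fin d → MvPowerSeries τ R := fun i => MvPowerSeries.map (algebraMap ℚ R) (s i) with hU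
  have hU0 : ∀ i, MvPowerSeries.constantCoeff (U i) = 0 := fun i => by
    have := hs i
    rw [← MvPowerSeries.coeff_zero_eq_constantCoeff_apply] at this ⊢
    rw [hU, MvPowerSeries.coeff_map, this, map_zero]
  have hUS : MvPowerSeries.HasSubst U := MvPowerSeries.hasSubst_of_constantCoeff_zero hU0
  have hSS : MvPowerSeries.HasSubst fun i : Fin d => S i := hasSubst_zero fun i => hS0 i
  have hcomm : ∀ (θ : Hsymb D →ₐ[ℚ] R) (f : MvPowerSeries (Fin d) (Hsymb D)),
      MvPowerSeries.subst U (MvPowerSeries.map (θ : Hsymb D →+* R) f)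
        = MvPowerSeries.map (θ : Hsymb D →+* R) (MvPowerSeries.subst (fun i : Fin d => S i) f) := by
    intro θ f
    rw [MvPowerSeries.map_subst hSS]
    congr 1
    funext i
    exact (hmap θ i).symm
  rw [liAt, ← hcomm, map_convHom_liSeries θ₁ θ₂ hp hD, coproductSeries]
  simp only [map_sum, ← MvPowerSeries.coe_substAlgHom hUS]
  refine Finset.sum_congr rfl fun k _ => Finset.sum_congr rfl fun ij hij => ?_
  have hij' : Interlaced ij.1 ij.2 := (Finset.mem_filter.1 hij).2
  have hL : ∀ f : MvPowerSeries (Fin d) (Hsymb D),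
      MvPowerSeries.map (Algebra.TensorProduct.productMap θ₁ θ₂ : _ →+* R) (MvPowerSeries.map
        (Algebra.TensorProduct.includeLeft : Hsymb D →ₐ[ℚ] Hsymb D ⊗[ℚ] Hsymb D).toRingHom f)
      = MvPowerSeries.map (θ₁ : Hsymb D →+* R) f := fun f => by ext e; simp
  have hR : ∀ f : MvPowerSeries (Fin d) (Hsymb D),
      MvPowerSeries.map (Algebra.TensorProduct.productMap θ₁ θ₂ : _ →+* R) (MvPowerSeries.map
        (Algebra.TensorProduct.includeRight : Hsymb D →ₐ[ℚ] Hsymb D ⊗[ℚ] Hsymb D).toRingHom f)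
      = MvPowerSeries.map (θ₂ : Hsymb D →+* R) f := fun f => by ext e; simp
  rw [map_mul, map_mul, hL, hR, MvPowerSeries.coe_substAlgHom, hcomm, hcomm,
    MvPowerSeries.subst_mul hSS, subst_liAt (fun i : Fin d => hS0 i) _ (fun i => constantCoeff_tvar _ _),
    subst_liAt (fun i : Fin d => hS0 i) _ (fun i => constantCoeff_tvar _ _)]
  refine congrArg₂ (· * ·) (congrArg _ ?_) (congrArg _ (congrArg₂ (· * ·) ?_ ?_))
  · exact liAt_congr (fun _ _ => rfl) fun i => subst_tvar hS0 (ij.2 i).2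
  · exact liAt_congr (fun _ _ => rfl) fun i =>
      subst_tvar hS0 (i.2.trans_le (blockStart_le ij.1 0))
  · rw [← MvPowerSeries.coe_substAlgHom hSS, map_prod]
    refine Finset.prod_congr rfl fun a _ => ?_
    rw [MvPowerSeries.coe_substAlgHom, subst_blockSeries p hS0 (ij.2 a).2 (blockStart_le _ _)]

end CoproductFormula

/-! ### The coproduct of the generating series as a star product -/

section StarFormula
open Node

theorem map_gapSum {N K K' : Type} [CommRing K] [CommRing K'] (f : K →+* K') (ψ : List N → K)
    (w : List N) (H : List N → K) (acc : List N) :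
    f (gapSum ψ w H acc) = gapSum (fun z => f (ψ z)) w (fun l => f (H l)) acc := by
  induction w generalizing H acc with
  | nil => simp only [gapSum]; split_ifs <;> simp
  | cons c w ih => simp only [gapSum, map_add, map_mul, ih]

theorem map_star {N K K' : Type} [CommRing K] [CommRing K'] (f : K →+* K') (φ ψ : List N → K)
    (L : List N) : f (star φ ψ L) = star (fun z => f (φ z)) (fun z => f (ψ z)) L := by
  cases L with
  | nil => simp [star]
  | cons a w => exact map_gapSum f ψ w _ _

/-- A telescoping product, free of division: if `B l` and `C l` differ by the factor `X (l + 1) / X l`,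
then their products differ by `X k / X 0`. -/
theorem prod_telescope {K : Type} [CommMonoid K] {k : ℕ} (X : ℕ → K) (B C : Fin k → K)
    (h : ∀ l : Fin k, X l * B l = X (l + 1) * C l) : X 0 * ∏ l, B l = X k * ∏ l, C l := by
  induction k with
  | zero => simp
  | succ k ih =>
    have h1 := ih (fun l => B l.castSucc) (fun l => C l.castSucc) fun l => by
      simpa using h l.castSucc
    have h2 := h (Fin.last k)
    rw [Fin.val_last] at h2
    rw [Fin.prod_univ_castSucc, Fin.prod_univ_castSucc, ← mul_assoc, h1, mul_right_comm, h2]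
    ac_rfl

theorem getElem?_flatMap_pair {A B : Type} (f g : A → B) (l : List A) (n : ℕ) :
    (l.flatMap fun x => [f x, g x])[2 * n]? = l[n]?.map f ∧
      (l.flatMap fun x => [f x, g x])[2 * n + 1]? = l[n]?.map g := by
  induction l generalizing n with
  | nil => simp
  | cons x l ih =>
    cases n with
    | zero => simp
    | succ n =>
      have := ih n
      simpa [mul_add] using this

variable {D : ℕ∞} {σ R : Type} [CommRing R] [Algebra ℚ R]

theorem alternates_cons_flatMap {A : Type} {f g : A → Node σ} {l : List A}
    (h : ∀ x ∈ l, ¬ (f x).isP = true ∧ (g x).isP = true) {y : Node σ} (hy : y.isP = true) :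
    Alternates (y :: l.flatMap fun x => [f x, g x]) := by
  induction l generalizing y with
  | nil => simp
  | cons x l ih =>
    have hx := h x (by simp)
    have := ih (fun z hz => h z (by simp [hz])) hx.2
    simp only [List.flatMap_cons, List.cons_append, List.nil_append]
    refine List.isChain_cons_cons.2 ⟨by tauto, List.isChain_cons_cons.2 ⟨by tauto, this⟩⟩

theorem Node.val_eq_map (S : Type) [CommRing S] [Algebra ℚ S] (x : Node σ) :
    x.val S = MvPowerSeries.map (algebraMap ℚ S) (x.val ℚ) := by
  rcases x with (_ | i) | n <;> simp [val]

theorem Node.valAt_eq_map (S : Type) [CommRing S] [Algebra ℚ S] (L : List (Node σ)) (i : ℕ) :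
    valAt S L i = MvPowerSeries.map (algebraMap ℚ S) (valAt ℚ L i) := by
  unfold valAt
  cases L[i]? <;> simp [val_eq_map S]

/-- The product of the generating series of the two segments that form a block. -/
theorem nodeSeries_block {w : List (Node σ)} (hw : Alternates w) (h0 : w.head?.any isP) {d : ℕ}
    (hd : w.length = 2 * d + 1) {z : MvPowerSeries σ (Hsymb D)}
    (hz : MvPowerSeries.constantCoeff z = 0) (hp : ∀ a b, a ≤ b → b ≤ d → ptAt w (2 * a) ≤ ptAt w (2 * b))
    {a b c : ℕ} (hab : a ≤ b) (hbc : b < c) (hc : c ≤ d) :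
    expAt D (logBracket D 0 (ptAt w (2 * a))) z * (nodeSeries D (seg w (2 * a) (2 * b + 2)) *
        nodeSeries D (seg w (2 * b + 1) (2 * c + 1)))
      = expAt D (logBracket D 0 (ptAt w (2 * c))) z *
        blockAt D (fun a => ptAt w (2 * a)) (fun i => valAt _ w (2 * i + 1) - z) a b c := by
  have hP : ∀ j, 2 * j < w.length → (w.getD (2 * j) (P 0)).isP = true := by
    intro j hj
    rw [hw.isP_getD _ hj]
    cases w with
    | nil => simp at hd
    | cons y w => simpa using h0
  have hb1 : ¬ (w.getD (2 * b + 1) (P 0)).isP = true := by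
    rw [hw.isP_getD _ (by omega)]
    have := hP 0 (by omega)
    simp only [mul_zero] at this
    rw [this]; simp
  obtain ⟨t, ht⟩ := eq_T_of_not_isP hb1
  have htv : valAt (Hsymb D) w (2 * b + 1) = (T t).val _ := by
    rw [List.getD_eq_getElem _ _ (by omega)] at ht
    rw [valAt, List.getElem?_eq_getElem (by omega), ht]; rfl
  have hhead : ∀ {l : List (Node σ)} {j : ℕ}, 2 * j < w.length → l.head? = w[2 * j]? →
      l.head?.any isP := by
    intro l j hj hl
    have := hP j hj
    rw [List.getD_eq_getElem _ _ hj] at this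
    rw [hl, List.getElem?_eq_getElem hj]
    simpa using this
  have e1 : seg w (2 * a) (2 * b + 2) = (w.drop (2 * a)).take (2 * (b - a) + 1) ++ [T t] := by
    rw [seg_concat (P 0) (by omega) (by omega), ht, seg]
    congr 2; omega
  have e2 : seg w (2 * b + 1) (2 * c + 1) = T t :: (seg w (2 * b + 2) (2 * c + 1)).drop (2 * 0) := by
    rw [seg_cons (P 0) (by omega) (by omega), ht]; rfl
  have hs2 : Alternates (seg w (2 * b + 2) (2 * c + 1)) := (hw.drop _).take _
  rw [e1, e2, nodeSeries_take_concat D (hw.drop _) (hhead (j := a) (by omega) (by simp))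
      t (by simp; omega),
    nodeSeries_cons_drop D hs2 (hhead (j := b + 1) (by omega) ?_) t (m := c - (b + 1)) ?_
      (Nat.zero_le _)]
  · have hpt : ∀ k, 2 * b + 2 + k < 2 * c + 1 →
        ptAt (seg w (2 * b + 2) (2 * c + 1)) k = ptAt w (2 * b + 2 + k) := by
      intro k hk
      rw [seg, ptAt, List.getElem?_take_of_lt (by omega), List.getElem?_drop]; rfl
    have hval : ∀ k, 2 * b + 2 + k < 2 * c + 1 →
        valAt (Hsymb D) (seg w (2 * b + 2) (2 * c + 1)) k = valAt _ w (2 * b + 2 + k) := by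
      intro k hk
      rw [seg, valAt, List.getElem?_take_of_lt (by omega), List.getElem?_drop]; rfl
    rw [hpt _ (by omega), ptAt_drop, add_zero, show 2 * b + 2 + 2 * (c - (b + 1)) = 2 * c by omega,
      Nat.sub_zero]
    simp only [zero_add]
    have hi : invAt D (b - a) (fun l => ptAt (w.drop (2 * a)) (2 * l))
          (fun i => valAt _ (w.drop (2 * a)) (2 * (i : ℕ) + 1) - (T t).val _)
        = invAt D (b - a) (fun l => ptAt w (2 * (a + l)))
          (fun l => valAt _ w (2 * (a + (l : ℕ)) + 1) - z - (valAt _ w (2 * b + 1) - z)) := by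
      refine invAt_congr (fun l _ => ?_) fun i => ?_
      · rw [ptAt_drop, mul_add]
      · rw [valAt_drop, htv, mul_add, add_assoc]; ring
    have hl : liAt D (c - (b + 1)) (fun l => ptAt (seg w (2 * b + 2) (2 * c + 1)) (2 * l))
          (fun i => valAt _ (seg w (2 * b + 2) (2 * c + 1)) (2 * (i : ℕ) + 1) - (T t).val _)
        = liAt D (c - (b + 1)) (fun l => ptAt w (2 * (b + 1 + l)))
          (fun l => valAt _ w (2 * (b + 1 + (l : ℕ)) + 1) - z - (valAt _ w (2 * b + 1) - z)) := by
      refine liAt_congr (fun l hl => ?_) fun i => ?_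
      · rw [hpt _ (by omega)]; congr 1; ring
      · rw [hval _ (by omega), htv, show 2 * b + 2 + (2 * (i : ℕ) + 1)
          = 2 * (b + 1 + (i : ℕ)) + 1 by ring]
        ring
    have htz : (T t : Node σ).val (Hsymb D) = (valAt _ w (2 * b + 1) - z) + z := by rw [htv]; ring
    have hc0 : MvPowerSeries.constantCoeff (valAt (Hsymb D) w (2 * b + 1) - z) = 0 := by
      simp [constantCoeff_valAt, hz]
    have hx : ∀ x : MvPowerSeries σ (Hsymb D), MvPowerSeries.constantCoeff x = 0 →
        expAt D (-logBracket D 0 (ptAt w (2 * a))) x * expAt D (logBracket D 0 (ptAt w (2 * c))) x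
          = expAt D (logBracket D (ptAt w (2 * a)) (ptAt w (2 * c))) x := by
      intro x hx
      rw [logBracket_eq_sub D (hp a c (by omega) hc), ← expAt_add_left _ _ hx, neg_add_eq_sub]
    have hz2 : expAt D (logBracket D 0 (ptAt w (2 * a))) z *
        expAt D (-logBracket D 0 (ptAt w (2 * a))) z = 1 := by
      rw [← expAt_add_left _ _ hz, add_neg_cancel, expAt_zero_left]
    rw [hi, hl, blockAt, htz, expAt_add_right _ hc0 hz, expAt_add_right _ hc0 hz, ← hx _ hc0]
    linear_combination ((-1) ^ (b - a) *
      (expAt D (-logBracket D 0 (ptAt w (2 * a))) (valAt _ w (2 * b + 1) - z) *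
      invAt D (b - a) (fun l => ptAt w (2 * (a + l)))
          (fun l => valAt _ w (2 * (a + (l : ℕ)) + 1) - z - (valAt _ w (2 * b + 1) - z)) *
      (expAt D (logBracket D 0 (ptAt w (2 * c))) (valAt _ w (2 * b + 1) - z) *
       expAt D (logBracket D 0 (ptAt w (2 * c))) z *
       liAt D (c - (b + 1)) (fun l => ptAt w (2 * (b + 1 + l)))
          (fun l => valAt _ w (2 * (b + 1 + (l : ℕ)) + 1) - z - (valAt _ w (2 * b + 1) - z))))) * hz2
  · rw [seg, List.head?_take, if_neg (by omega), List.head?_drop]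
    congr 1
  · rw [length_seg (by omega)]; omega

end StarFormula

section StarFormula
open Node

open Classical in
/-- Unfolding `tupleSum`: a sum over the first index `a` and the remaining indices is a sum over all
interlaced tuples. -/
theorem sum_mul_tupleSum {K : Type} [CommRing K] (d : ℕ) (B : ℕ → ℕ → ℕ → K) (k : ℕ)
    (G : ℕ → K) (H : ℕ → List (ℕ × ℕ) → K) :
    ∑ a ∈ Finset.range (d + 1), G a * tupleSum d B k a (H a)
      = ∑ ij ∈ (Finset.univ : Finset ((Fin k → Fin d) × (Fin k → Fin d))).filter
        (fun ij => Interlaced ij.1 ij.2), G (blockStart ij.1 0) *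
          (H (blockStart ij.1 0) (linkPairs ij.1 ij.2) *
            ∏ l : Fin k, B (blockStart ij.1 l) (ij.2 l) (blockStart ij.1 ((l : ℕ) + 1))) := by
  rw [Finset.sum_filter, Fintype.sum_prod_type]
  simp only [tupleSum, Finset.mul_sum]
  rw [Finset.sum_comm]
  refine Finset.sum_congr rfl fun i _ => ?_
  rw [Finset.sum_comm]
  refine Finset.sum_congr rfl fun j _ => ?_
  by_cases hij : Interlaced i j
  · simp only [hij, true_and, mul_ite, mul_zero, if_true]
    rw [Finset.sum_ite_eq, if_pos (Finset.mem_range.2 (Nat.lt_succ_of_le (blockStart_le _ _)))]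
  · simp [hij]

open Classical in
/-- If `ψ` lives on lists of even length, then `star φ ψ` is a sum over interlaced tuples, of the shape of
the coproduct formula. -/
theorem star_eq_sum {N K : Type} [CommRing K] {φ ψ : List N → K}
    (hψ : ∀ z, ¬ Even z.length → ψ z = 0) (x a : N) {w : List N} {d : ℕ}
    (hw : w.length = 2 * d + 1) :
    star φ ψ (x :: w) = ∑ k ∈ Finset.range (d + 1),
      ∑ ij ∈ (Finset.univ : Finset ((Fin k → Fin d) × (Fin k → Fin d))).filter
        (fun ij => Interlaced ij.1 ij.2), ψ (x :: w.take (2 * blockStart ij.1 0 + 1)) *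
          (φ (x :: w.getD (2 * blockStart ij.1 0) a :: (linkPairs ij.1 ij.2).flatMap
              fun jc => [w.getD (2 * jc.1 + 1) a, w.getD (2 * jc.2) a]) *
            ∏ l : Fin k, (ψ (seg w (2 * blockStart ij.1 l) (2 * (ij.2 l : ℕ) + 2)) *
              ψ (seg w (2 * (ij.2 l : ℕ) + 1) (2 * blockStart ij.1 ((l : ℕ) + 1) + 1)))) := by
  have h1 : star φ ψ (x :: w) = startSum ψ a (x :: w) 0 fun l => φ (x :: l) := by
    simp [star, startSum]
  have h2 : ∀ k H, startSum ψ a (x :: w) (k + 1) H = startSum ψ a w k H := fun k H => by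
    simp [startSum]
  rw [h1, startSum_eq _ _ (by simp), if_neg (show ¬ 0 + 1 = (x :: w).length by rw [List.length_cons]; omega), zero_add,
    List.length_cons, hw,
    Finset.sum_Ico_eq_sum_range, show 2 * d + 1 + 1 - (0 + 1) = 2 * d + 1 by omega,
    sum_range_two_mul_add_one, Finset.sum_eq_zero (s := Finset.range d), add_zero]
  · have h3 : ∀ i ∈ Finset.range (d + 1), ψ (seg (x :: w) 0 (0 + 1 + 2 * i + 1)) *
        startSum ψ a (x :: w) (0 + 1 + 2 * i)
          (fun l => φ (x :: (x :: w).getD (0 + 1 + 2 * i) a :: l))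
        = ∑ k ∈ Finset.range (d + 1), ψ (x :: w.take (2 * i + 1)) * tupleSum d
          (fun i j c => ψ (seg w (2 * i) (2 * j + 2)) * ψ (seg w (2 * j + 1) (2 * c + 1))) k i
          fun l => φ (x :: w.getD (2 * i) a :: l.flatMap
            fun jc => [w.getD (2 * jc.1 + 1) a, w.getD (2 * jc.2) a]) := by
      intro i hi
      rw [seg_zero, show 0 + 1 + 2 * i = 2 * i + 1 by ring, List.take_succ_cons, h2,
        startSum_eq_tupleSum hψ a hw d _ _ (Nat.lt_succ_iff.1 (Finset.mem_range.1 hi)) (by omega),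
        Finset.mul_sum]
      rfl
    rw [Finset.sum_congr rfl h3, Finset.sum_comm]
    refine Finset.sum_congr rfl fun k _ => ?_
    rw [sum_mul_tupleSum d _ k (fun i => ψ (x :: w.take (2 * i + 1))) fun i l =>
      φ (x :: w.getD (2 * i) a :: l.flatMap
            fun jc => [w.getD (2 * jc.1 + 1) a, w.getD (2 * jc.2) a])]
  · intro j hj
    have := Finset.mem_range.1 hj
    rw [hψ, zero_mul]
    rw [length_seg (by simp; omega), Nat.not_even_iff]
    omega

variable {D : ℕ∞} {σ R : Type} [CommRing R] [Algebra ℚ R]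

theorem ptAt_lt_of_isGood {s : Option σ} {w : List (Node σ)} (hG : IsGood D (T s :: w))
    {i j n n' : ℕ} (hij : i < j) (hi : w[i]? = some (P n)) (hj : w[j]? = some (P n')) : n < n' := by
  have h := hG.2.1
  have hs : [P n, P n'].Sublist w := by
    obtain ⟨hi1, hi2⟩ := List.getElem?_eq_some_iff.1 hi
    obtain ⟨hj1, hj2⟩ := List.getElem?_eq_some_iff.1 hj
    have h1 : w = w.take i ++ w[i] :: w.drop (i + 1) := by simp
    have h2 : w[j] ∈ w.drop (i + 1) := by
      rw [List.mem_drop_iff_getElem]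
      exact ⟨j - (i + 1), by omega, by congr 1; omega⟩
    rw [hj2] at h2
    rw [hi2] at h1
    rw [h1]
    exact ((List.singleton_sublist.2 h2).cons_cons (P n)).trans (List.sublist_append_right _ _)
  have h3 := h.sublist ((hs.cons (T s)).filterMap pt?)
  simpa [pt?] using h3

/-- The coproduct formula: on lists that begin with a variable, the generating series of a convolution
product is `star` of the generating series of its factors. The exponentials in `nodeSeries` and in the
coproduct formula cancel in a telescoping product. -/
theorem map_convHom_nodeSeries (θ₁ θ₂ : Hsymb D →ₐ[ℚ] R) {s : Option σ} {w : List (Node σ)}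
    (hw : Alternates (T s :: w)) {d : ℕ} (hd : w.length = 2 * d + 1) (hG : IsGood D (T s :: w)) :
    MvPowerSeries.map (convHom θ₁ θ₂ : Hsymb D →+* R) (nodeSeries D (T s :: w))
      = star (fun z => MvPowerSeries.map (θ₁ : Hsymb D →+* R) (nodeSeries D z))
        (fun z => MvPowerSeries.map (θ₂ : Hsymb D →+* R) (nodeSeries D z)) (T s :: w) := by
  classical
  have hw' : Alternates w := List.IsChain.tail hw
  have h0 : w.head?.any isP := by
    cases w with
    | nil => simp at hd
    | cons y w =>
      have := (List.isChain_cons_cons.1 hw).1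
      simpa using this
  have hP : ∀ j ≤ d, ∃ n, w[2 * j]? = some (P n) ∧ ptAt w (2 * j) = n ∧
      w.getD (2 * j) (P 0) = P n := by
    intro j hj
    have h1 : (w.getD (2 * j) (P 0)).isP = true := by
      rw [hw'.isP_getD _ (by omega)]
      cases w with
      | nil => simp at hd
      | cons y w => simpa using h0
    obtain ⟨n, hn⟩ := eq_P_of_isP h1
    have hn' := hn
    rw [List.getD_eq_getElem _ _ (by omega)] at hn'
    refine ⟨n, by rw [List.getElem?_eq_getElem (by omega), hn'], ?_, hn⟩
    rw [ptAt, List.getElem?_eq_getElem (by omega), hn']; rfl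
  have hT : ∀ j < d, ¬ (w.getD (2 * j + 1) (P 0)).isP = true := by
    intro j hj
    rw [hw'.isP_getD _ (by omega)]
    obtain ⟨n, -, -, h⟩ := hP 0 (Nat.zero_le _)
    simp only [mul_zero] at h
    rw [h]
    simp
  set p : ℕ → ℕ := fun a => ptAt w (2 * a) with hp
  have hlt : ∀ a b, a < b → b ≤ d → p a < p b := by
    intro a b hab hb
    obtain ⟨n, hn, hn', -⟩ := hP a (by omega)
    obtain ⟨m, hm, hm', -⟩ := hP b hb
    simp only [hp, hn', hm']
    exact ptAt_lt_of_isGood hG (by omega) hn hm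
  have hle : ∀ a b, a ≤ b → b ≤ d → p a ≤ p b := fun a b hab hb => by
    rcases hab.eq_or_lt with rfl | h
    · exact le_rfl
    · exact (hlt a b h hb).le
  have hD : (p d : ℕ∞) ≤ D := by
    obtain ⟨n, hn, hn', -⟩ := hP d le_rfl
    simp only [hp, hn']
    exact hG.2.2 n (List.mem_filterMap.2 ⟨P n, List.mem_cons_of_mem _ (List.mem_of_getElem? hn), rfl⟩)
  set z : MvPowerSeries σ (Hsymb D) := (T s : Node σ).val _ with hz
  have hz0 : MvPowerSeries.constantCoeff z = 0 := constantCoeff_val _ _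
  set S : ℕ → MvPowerSeries σ (Hsymb D) := fun i => valAt _ w (2 * i + 1) - z with hS
  have hSq : ∀ i, S i = MvPowerSeries.map (algebraMap ℚ _)
      (valAt ℚ w (2 * i + 1) - (T s : Node σ).val ℚ) := fun i => by
    rw [map_sub, ← valAt_eq_map, ← val_eq_map]
  have htop : nodeSeries D (T s :: w) = expAt D (logBracket D 0 (p d)) z *
      liAt D d p fun i => S i := nodeSeries_T D s hw hd
  rw [htop, map_mul, map_convHom_liAt θ₁ θ₂ (fun a b hab => hlt _ _ hab (Nat.lt_succ_iff.1 b.2)) hD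
    (fun i => by simp [constantCoeff_valAt, constantCoeff_val]) hSq, hz, val_eq_map,
    map_convHom_expAt _ _ _ _ _ (constantCoeff_val _ _), ← val_eq_map, ← hz,
    star_eq_sum (fun l hl => by rw [nodeSeries_eq_zero D (.inr hl), map_zero]) (T s) (P 0) hd,
    Finset.mul_sum]
  refine Finset.sum_congr rfl fun k _ => ?_
  rw [Finset.mul_sum]
  refine Finset.sum_congr (by congr) fun ij hij => ?_
  have hij' : Interlaced ij.1 ij.2 := (Finset.mem_filter.1 hij).2
  -- the factor on the left
  have hleft : nodeSeries D (T s :: w.getD (2 * blockStart ij.1 0) (P 0) ::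
      (linkPairs ij.1 ij.2).flatMap
        fun jc => [w.getD (2 * jc.1 + 1) (P 0), w.getD (2 * jc.2) (P 0)])
      = expAt D (logBracket D 0 (p d)) z *
        liAt D k (fun a => p (blockStart ij.1 a)) (fun a => S (ij.2 a : ℕ)) := by
    set l := w.getD (2 * blockStart ij.1 0) (P 0) :: (linkPairs ij.1 ij.2).flatMap
        fun jc => [w.getD (2 * jc.1 + 1) (P 0), w.getD (2 * jc.2) (P 0)] with hl
    have hlen : l.length = 2 * k + 1 := by
      simp [hl, linkPairs, Function.comp_def, mul_comm]
    have hPt : ∀ j ≤ d, (w.getD (2 * j) (P 0)).pt = p j := by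
      intro j hj
      obtain ⟨n, -, h1, h2⟩ := hP j hj
      rw [h2, ← h1]; rfl
    have hTv : ∀ j < d, (w.getD (2 * j + 1) (P 0)).val (Hsymb D) = valAt _ w (2 * j + 1) := by
      intro j hj
      rw [valAt, List.getElem?_eq_getElem (by omega), List.getD_eq_getElem _ _ (by omega)]; rfl
    have hget : ∀ a : Fin k, (linkPairs ij.1 ij.2)[(a : ℕ)]?
        = some ((ij.2 a : ℕ), blockStart ij.1 (a + 1)) := by
      intro a
      simp [linkPairs]
    have hptl : ∀ a ≤ k, ptAt l (2 * a) = p (blockStart ij.1 a) := by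
      intro a ha
      cases a with
      | zero => simpa [hl] using hPt _ (blockStart_le ij.1 0)
      | succ a =>
        rw [show 2 * (a + 1) = 2 * a + 1 + 1 by ring, hl, ptAt_cons_succ, ptAt,
          (getElem?_flatMap_pair _ _ _ _).2, hget ⟨a, ha⟩]
        exact hPt _ (blockStart_le _ _)
    have halt : Alternates l := by
      refine alternates_cons_flatMap ?_ ?_
      · intro x hx
        obtain ⟨a, -, rfl⟩ := List.mem_map.1 hx
        refine ⟨hT _ (ij.2 a).2, ?_⟩
        obtain ⟨n, -, -, h⟩ := hP _ (blockStart_le ij.1 (a + 1))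
        rw [h]; rfl
      · obtain ⟨n, -, -, h⟩ := hP _ (blockStart_le ij.1 0)
        rw [h]; rfl
    rw [nodeSeries_T D s (halt.cons ?_) hlen, hptl k le_rfl]
    · refine congrArg₂ (· * ·) ?_ (liAt_congr (fun a ha => hptl a ha) fun i => ?_)
      · rw [show blockStart ij.1 k = d by simp [blockStart]]
      · rw [hl, valAt_cons_succ, valAt, (getElem?_flatMap_pair _ _ _ _).1, hget i]
        simp only [hS, ← hTv _ (ij.2 i).2]
        rfl
    · intro x hx
      simp only [hl, List.head?_cons, Option.mem_def, Option.some.injEq] at hx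
      obtain ⟨n, -, -, h⟩ := hP _ (blockStart_le ij.1 0)
      rw [← hx, h]; rfl
  -- the first segment
  have hfirst : nodeSeries D (T s :: w.take (2 * blockStart ij.1 0 + 1))
      = expAt D (logBracket D 0 (p (blockStart ij.1 0))) z *
        liAt D (blockStart ij.1 0) p fun l => S l := by
    have hb := blockStart_le ij.1 0
    have hx : ∀ i < 2 * blockStart ij.1 0 + 1,
        (w.take (2 * blockStart ij.1 0 + 1))[i]? = w[i]? := fun i hi =>
      List.getElem?_take_of_lt hi
    rw [nodeSeries_T D s (k := blockStart ij.1 0) ?_ (by simp; omega)]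
    · refine congrArg₂ (· * ·) ?_ (liAt_congr (fun a ha => ?_) fun i => ?_)
      · rw [ptAt, hx _ (by omega)]; rfl
      · rw [ptAt, hx _ (by omega)]; rfl
      · rw [valAt, hx _ (by omega)]; rfl
    · have := hw.take (2 * blockStart ij.1 0 + 2)
      rwa [List.take_succ_cons] at this
  have htel := prod_telescope (fun l => expAt D (logBracket D 0 (p (blockStart ij.1 l))) z)
    (fun l : Fin k => nodeSeries D (seg w (2 * blockStart ij.1 l) (2 * (ij.2 l : ℕ) + 2)) *
      nodeSeries D (seg w (2 * (ij.2 l : ℕ) + 1) (2 * blockStart ij.1 ((l : ℕ) + 1) + 1)))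
    (fun l : Fin k => blockAt D p S (blockStart ij.1 l) (ij.2 l) (blockStart ij.1 ((l : ℕ) + 1)))
    fun l => nodeSeries_block hw' h0 hd hz0 hle (by rw [blockStart_fin]; exact hij'.1 l)
      (lt_blockStart_succ hij' l) (blockStart_le _ _)
  rw [show blockStart ij.1 k = d by simp [blockStart]] at htel
  have htel' := congrArg (MvPowerSeries.map (θ₂ : Hsymb D →+* R)) htel
  rw [hleft, hfirst]
  simp only [map_mul, map_prod] at htel' ⊢
  linear_combination (-1 : MvPowerSeries σ R) *
    (MvPowerSeries.map (θ₁ : Hsymb D →+* R) (expAt D (logBracket D 0 (p d)) z) *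
      MvPowerSeries.map (θ₁ : Hsymb D →+* R)
        (liAt D k (fun a => p (blockStart ij.1 a)) (fun a => S (ij.2 a : ℕ))) *
      MvPowerSeries.map (θ₂ : Hsymb D →+* R) (liAt D (blockStart ij.1 0) p fun l => S l)) * htel'

end StarFormula

/-! ### Coassociativity -/

section Coassociativity
open Node

variable {D : ℕ∞} {σ R : Type} [CommRing R] [Algebra ℚ R]

/-- The generating series, as functions on lists with values in a field, after applying a
homomorphism to the coefficients. -/
def listFun (θ : Hsymb D →ₐ[ℚ] R) (z : List (Node σ)) : FractionRing (MvPowerSeries σ R) :=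
  algebraMap _ _ (MvPowerSeries.map (θ : Hsymb D →+* R) (nodeSeries D z))

theorem listFun_eq_zero (θ : Hsymb D →ₐ[ℚ] R) {z : List (Node σ)}
    (hz : ¬ Alternates z ∨ ¬ Even z.length) : listFun θ z = 0 := by
  rw [listFun, nodeSeries_eq_zero D hz, map_zero, map_zero]

theorem star_eq_zero {K : Type} [CommRing K] {φ ψ : List (Node σ) → K}
    (hφ : ∀ z, ¬ Alternates z ∨ ¬ Even z.length → φ z = 0)
    (hψ : ∀ z, ¬ Alternates z ∨ ¬ Even z.length → ψ z = 0) {z : List (Node σ)}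
    (hz : ¬ Alternates z ∨ ¬ Even z.length) : star φ ψ z = 0 := by
  cases z with
  | nil => rfl
  | cons a w =>
    rcases hz with hz | hz
    · exact gapSum_eq_zero_of_not_isChain (fun z h => hψ z (.inl h)) w _ [a] (by simp) hz
    · by_contra h
      have h1 := even_of_gapSum_ne_zero (fun z h => by_contra fun h' => h (hψ z (.inr h'))) w
        (fun l => φ (a :: l)) [a] 1 (fun l h => by_contra fun h' => h (hφ _ (.inr h'))) h
      refine hz ?_
      simp only [List.length_cons, List.length_nil, Nat.even_iff] at h1 ⊢
      omega

variable [IsDomain R]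

omit [Algebra ℚ R] in
theorem val_ne_val {s t : Option σ} (hst : s ≠ t) :
    (T s : Node σ).val R ≠ (T t : Node σ).val R := by
  classical
  have hX : ∀ i : σ, (MvPowerSeries.X i : MvPowerSeries σ R) ≠ 0 := fun i h => by
    have := congrArg (MvPowerSeries.coeff (Finsupp.single i 1)) h
    simp [MvPowerSeries.coeff_X] at this
  rcases s with _ | i <;> rcases t with _ | j
  · exact absurd rfl hst
  · exact (hX j).symm
  · exact hX i
  · intro h
    have := congrArg (MvPowerSeries.coeff (Finsupp.single i 1)) h
    rw [val, val, MvPowerSeries.coeff_X, MvPowerSeries.coeff_X, if_pos rfl] at this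
    by_cases hij : i = j
    · exact hst (congrArg some hij)
    · rw [if_neg fun h' => hij ((Finsupp.single_left_inj one_ne_zero).1 h')] at this
      exact one_ne_zero this

/-- The ring homomorphism underlying `listFun`. -/
abbrev listHom (θ : Hsymb D →ₐ[ℚ] R) :
    MvPowerSeries σ (Hsymb D) →+* FractionRing (MvPowerSeries σ R) :=
  (algebraMap (MvPowerSeries σ R) (FractionRing (MvPowerSeries σ R))).comp
    (MvPowerSeries.map (θ : Hsymb D →+* R))

omit [IsDomain R] in
theorem listHom_val (θ : Hsymb D →ₐ[ℚ] R) (x : Node σ) :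
    listHom θ (x.val _) = algebraMap _ (FractionRing (MvPowerSeries σ R)) (x.val R) := by
  rcases x with (_ | i) | n <;> simp [val]

theorem listHom_val_ne (θ : Hsymb D →ₐ[ℚ] R) {s t : Option σ} (hst : s ≠ t) :
    listHom θ ((T s : Node σ).val _) ≠ listHom θ ((T t : Node σ).val _) := by
  rw [listHom_val, listHom_val]
  exact fun h => val_ne_val hst (IsFractionRing.injective _ _ h)

theorem nodeInv_listHom (θ θ' : Hsymb D →ₐ[ℚ] R) :
    (nodeInv (listHom θ) : Node σ → Node σ → _) = nodeInv (listHom θ') := by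
  funext s c
  rw [nodeInv, nodeInv, listHom_val, listHom_val, listHom_val, listHom_val]

theorem listFun_pair_ne_zero (θ : Hsymb D →ₐ[ℚ] R) {t b : Node σ} (ht : ¬ t.isP = true)
    (hb : b.isP = true) : listFun θ [t, b] ≠ 0 := by
  obtain ⟨t, rfl⟩ := eq_T_of_not_isP ht
  obtain ⟨n, rfl⟩ := eq_P_of_isP hb
  have h0 := constantCoeff_val (Hsymb D) (T t : Node σ)
  have h1 : listHom θ (expAt D (logBracket D 0 n) ((T t : Node σ).val _)) *
      listHom θ (expAt D (-logBracket D 0 n) ((T t : Node σ).val _)) = 1 := by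
    rw [← map_mul, ← expAt_add_left _ _ h0, add_neg_cancel, expAt_zero_left, map_one]
  have h2 : nodeSeries D [T t, P n] = expAt D (logBracket D 0 n) ((T t : Node σ).val _) := by
    rw [nodeSeries_T D t (k := 0) (by simp) rfl, liAt_zero, mul_one]
    rfl
  rw [listFun, h2]
  exact left_ne_zero_of_mul_eq_one h1

/-- The convolution product of homomorphisms becomes the composition `star`, on all lists: for
lists `T … P` this is the coproduct formula, and for lists `P … T` it follows since both sides solve
the inversion equation. -/
theorem listFun_convHom (θ₁ θ₂ : Hsymb D →ₐ[ℚ] R) {L : List (Node σ)} (hL : IsGood D L) :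
    listFun (convHom θ₁ θ₂) L = star (listFun θ₁) (listFun θ₂) L := by
  have hstar0 : ∀ z : List (Node σ), ¬ Alternates z ∨ ¬ Even z.length →
      star (listFun θ₁) (listFun θ₂) z = 0 := fun z =>
    star_eq_zero (fun _ => listFun_eq_zero θ₁) (fun _ => listFun_eq_zero θ₂)
  -- the lists that begin with a variable
  have hTP : ∀ (t : Node σ) (w : List (Node σ)), ¬ t.isP = true → IsGood D (t :: w) →
      listFun (convHom θ₁ θ₂) (t :: w) = star (listFun θ₁) (listFun θ₂) (t :: w) := by
    intro t w ht hG
    obtain ⟨s, rfl⟩ := eq_T_of_not_isP ht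
    by_cases hz : Alternates (T s :: w) ∧ Even (T s :: w).length
    · obtain ⟨d, hd⟩ := hz.2
      simp only [List.length_cons] at hd
      rw [listFun, map_convHom_nodeSeries θ₁ θ₂ hz.1 (d := d - 1) (by omega) hG, map_star]
      rfl
    · rw [listFun_eq_zero _ (by tauto), hstar0 _ (by tauto)]
  by_cases hz : Alternates L ∧ Even L.length
  swap
  · rw [listFun_eq_zero _ (by tauto), hstar0 _ (by tauto)]
  cases L with
  | nil => rw [listFun, nodeSeries]; simp [star]
  | cons a w =>
    by_cases ha : a.isP = true
    swap
    · exact hTP a w ha hL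
    have hne : w ≠ [] := by
      rintro rfl
      simp at hz
    obtain ⟨L, t, hLt⟩ : ∃ L t, a :: w = L ++ [t] :=
      ⟨(a :: w).dropLast, (a :: w).getLast (by simp), by rw [List.dropLast_append_getLast]⟩
    have hhead : L.head?.any isP := by
      cases L with
      | nil => simp at hLt; exact absurd hLt.2 hne
      | cons y l =>
        simp only [List.cons_append, List.cons.injEq] at hLt
        simp [← hLt.1, ha]
    have ht : ¬ t.isP = true := by
      have hz' := hz
      rw [hLt] at hz'
      have h1 := hz'.1.isP_getD (P 0) (k := L.length) (by simp)
      have h2 : (L ++ [t]).getD 0 (P 0) = a := by rw [← hLt]; rfl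
      have h3 : (L ++ [t]).getD L.length (P 0) = t := by
        simp
      rw [h2, h3] at h1
      rw [h1]
      have h4 := hz'.2
      simp only [List.length_append, List.length_singleton, Nat.even_add_one] at h4
      simp [ha, h4]
    rw [hLt] at hL ⊢
    have hE : ∀ (θ : Hsymb D →ₐ[ℚ] R) (L : List (Node σ)) (t : Node σ), L.head?.any isP →
        L.getLast?.any isP → ¬ t.isP = true → IsGood D (L ++ [t]) →
        insertSum (fun x => isP x = true) (nodeInv (listHom θ₁) t) t (listFun θ) L
          = cutSum (fun x => isP x = true) (nodeInv (listHom θ₁) t) (listFun θ) L := by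
      intro θ L t h1 h2 h3 h4
      rw [nodeInv_listHom θ₁ θ]
      exact insertSum_nodeSeries (listHom θ) (fun s t h => listHom_val_ne θ h) h1 h2 h3 h4
    -- the lists that begin with a point: both sides satisfy the inversion equation
    refine eq_of_insertSum_eq (P := fun x => isP x = true) (κ := nodeInv (listHom θ₁))
      (G := IsGood D) (fun L L' h h' => h'.sublist h) (fun L t h h' => h'.rotate h) (fun z => listFun_eq_zero _)
      hstar0 hTP (fun t b => listFun_pair_ne_zero _) ?_ ?_ (L.length + 1) L t (by omega)
      (by simpa using hhead) ht hL
    · intro L t h1 h2 h3 h4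
      exact hE _ L t (by simpa using h1) (by simpa using h2) h3 h4
    · intro L t h1 h2 h3 h4
      cases L with
      | nil => simp at h1
      | cons a w =>
        refine insertSum_star (by simpa using h1) ?_ ?_ ?_ ?_ ?_
        · exact listFun_eq_zero _ (.inr (by simp))
        · intro u c hc
          refine listFun_eq_zero _ (.inl fun h => ?_)
          have := (List.isChain_append.1 h).2.1
          simp at this
          exact this (((Bool.not_eq_true _).mp hc).trans ((Bool.not_eq_true _).mp h3).symm)
        · intro c v hc
          refine listFun_eq_zero _ (.inl fun h => ?_)
          have := (List.isChain_cons_cons.1 h).1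
          tauto
        · intro l hl hl'
          refine hE _ _ _ (by simpa using h1) (by rw [hl']; simpa using h2) h3 ?_
          exact h4.sublist ((hl.cons_cons a).append (List.Sublist.refl _))
        · intro i j hij hj hPi hPj
          refine hE _ _ _ ?_ ?_ h3 (h4.sublist ((seg_infix _ _ _).sublist.append
            (List.Sublist.refl _)))
          · rw [seg_cons a (by omega) (by omega)]
            simpa using hPi
          · rw [seg_concat a hij hj]
            simpa using hPj

/-- The list whose generating series is `[y_1, …, y_d | t_1, …, t_d]`. -/
def baseList (d : ℕ) (p : ℕ → ℕ) : List (Node (Fin d)) :=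
  T none :: P (p 0) :: (List.finRange d).flatMap fun i : Fin d => [T (some i), P (p ((i : ℕ) + 1))]

theorem nodeSeries_baseList (d : ℕ) (p : ℕ → ℕ) :
    nodeSeries D (baseList d p) = liSeries D d p := by
  have halt : Alternates (baseList d p) := by
    refine List.isChain_cons_cons.2 ⟨by simp, alternates_cons_flatMap (fun x _ => by simp) rfl⟩
  have hg : ∀ i : Fin d, (List.finRange d)[(i : ℕ)]? = some i := fun i => by simp
  rw [baseList, nodeSeries_T D none halt (k := d) (by simp [mul_comm])]
  have h0 : (T none : Node (Fin d)).val (Hsymb D) = 0 := rfl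
  rw [h0, expAt_zero_right, one_mul]
  have h1 : ∀ a ≤ d, ptAt (P (p 0) :: (List.finRange d).flatMap
      fun i : Fin d => [T (some i), P (p ((i : ℕ) + 1))]) (2 * a) = p a := by
    intro a ha
    cases a with
    | zero => simp [pt]
    | succ a =>
      rw [show 2 * (a + 1) = 2 * a + 1 + 1 by ring, ptAt_cons_succ, ptAt,
          (getElem?_flatMap_pair _ _ _ _).2, hg ⟨a, ha⟩]
      rfl
  rw [liAt_congr (q := p) (t := fun i => MvPowerSeries.X i) h1]
  · rw [liAt]
    have := MvPowerSeries.subst_self (R := Hsymb D) (σ := Fin d)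
    exact congrFun this _
  · intro i
    rw [valAt_cons_succ, valAt, (getElem?_flatMap_pair _ _ _ _).1, hg i, sub_zero]
    rfl

theorem isGood_baseList {d : ℕ} {p : ℕ → ℕ} (hp : StrictMono fun a : Fin (d + 1) => p a)
    (hD : (p d : ℕ∞) ≤ D) : IsGood D (baseList d p) := by
  have h1 : ∀ l : List (Fin d), (l.flatMap fun i : Fin d => [T (some i), P (p ((i : ℕ) + 1))]).filterMap var?
      = l.map some := by
    intro l
    induction l with
    | nil => rfl
    | cons x l ih => simp [var?, ih, List.filterMap_cons]
  have h2 : ∀ l : List (Fin d), (l.flatMap fun i : Fin d => [T (some i), P (p ((i : ℕ) + 1))]).filterMap pt?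
      = l.map fun i : Fin d => p ((i : ℕ) + 1) := by
    intro l
    induction l with
    | nil => rfl
    | cons x l ih => simp [pt?, ih, List.filterMap_cons]
  have h3 : (baseList d p).filterMap pt? = (List.finRange (d + 1)).map fun a : Fin (d + 1) => p (a : ℕ) := by
    rw [baseList, List.finRange_succ]
    simp [List.filterMap_cons, pt?, h2, Function.comp_def]
  refine ⟨?_, ?_, ?_⟩
  · rw [baseList]
    simp only [List.filterMap_cons, var?, h1]
    simp [List.nodup_finRange, List.nodup_map_iff (Option.some_injective _)]
  · rw [h3, List.pairwise_map]
    exact (List.pairwise_lt_finRange (d + 1)).imp fun h => hp h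
  · rw [h3]
    intro n hn
    obtain ⟨a, -, rfl⟩ := List.mem_map.1 hn
    refine le_trans (Nat.cast_le.2 ?_) hD
    exact hp.monotone (Fin.le_last a)

end Coassociativity

/-! ### The counit and the coalgebra structure -/

section Counit
open Node

variable {D : ℕ∞} {σ τ R : Type} [CommRing R] [Algebra ℚ R]

/-- The augmentation. -/
def augHom (D : ℕ∞) (R : Type) [CommRing R] [Algebra ℚ R] : Hsymb D →ₐ[ℚ] R :=
  MvPolynomial.aeval fun _ => 0

theorem augHom_logBracket (i j : ℕ) : augHom D R (logBracket D i j) = 0 := by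
  rw [logBracket, map_sum]
  refine Finset.sum_eq_zero fun r _ => ?_
  split_ifs <;> simp [augHom]

theorem map_augHom_expAt (i j : ℕ) {s : MvPowerSeries τ (Hsymb D)}
    (hs : MvPowerSeries.constantCoeff s = 0) :
    MvPowerSeries.map (augHom D R : Hsymb D →+* R) (expAt D (logBracket D i j) s) = 1 := by
  rw [map_expAt _ _ hs, augHom_logBracket, zero_smul, expSer_zero]

theorem map_augHom_expAt_neg (i j : ℕ) {s : MvPowerSeries τ (Hsymb D)}
    (hs : MvPowerSeries.constantCoeff s = 0) :
    MvPowerSeries.map (augHom D R : Hsymb D →+* R) (expAt D (-logBracket D i j) s) = 1 := by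
  rw [map_expAt _ _ hs, map_neg, augHom_logBracket, neg_zero, zero_smul, expSer_zero]

theorem map_augHom_liAt (m : ℕ) (p : ℕ → ℕ) {s : Fin m → MvPowerSeries τ (Hsymb D)}
    (hs : ∀ i, MvPowerSeries.constantCoeff (s i) = 0) :
    MvPowerSeries.map (augHom D R : Hsymb D →+* R) (liAt D m p s) = if m = 0 then 1 else 0 := by
  split_ifs with h
  · subst h
    rw [liAt_zero, map_one]
  · have h0 : MvPowerSeries.map (augHom D R : Hsymb D →+* R) (liSeries D m p) = 0 := by
      ext e
      rw [MvPowerSeries.coeff_map]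
      change augHom D R (bracket D m p _) = 0
      rw [bracket, dif_neg h]
      split_ifs <;> simp [augHom]
    have hs' : MvPowerSeries.HasSubst
        fun i => MvPowerSeries.map (augHom D R : Hsymb D →+* R) (s i) :=
      (hasSubst_zero hs).map _
    rw [liAt, MvPowerSeries.map_subst (hasSubst_zero hs), h0,
      ← MvPowerSeries.coe_substAlgHom hs', map_zero]

omit [Algebra ℚ R] in
theorem map_divVar {S : Type} [CommRing S] (f : R →+* S) (j : τ) (x : MvPowerSeries τ R) :
    MvPowerSeries.map f (divVar j x) = divVar j (MvPowerSeries.map f x) := by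
  ext e
  rw [MvPowerSeries.coeff_map]
  change f (MvPowerSeries.coeff _ x) = MvPowerSeries.coeff _ (MvPowerSeries.map f x)
  rw [MvPowerSeries.coeff_map]

theorem map_augHom_invAt (m : ℕ) (p : ℕ → ℕ) {s : Fin m → MvPowerSeries τ (Hsymb D)}
    (hs : ∀ i, MvPowerSeries.constantCoeff (s i) = 0) :
    MvPowerSeries.map (augHom D R : Hsymb D →+* R) (invAt D m p s) = if m = 0 then 1 else 0 := by
  induction m using Nat.strong_induction_on generalizing τ with
  | _ m ih =>
    split_ifs with h
    · subst h
      rw [invAt_zero, map_one]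
    · have ht := constantCoeff_tvar (D := D) m
      have htt : ∀ i j, MvPowerSeries.constantCoeff (tvar D m i - tvar D m j) = 0 := fun i j => by
        simp [ht]
      have h0 : MvPowerSeries.map (augHom D R : Hsymb D →+* R) (invSeries D m p) = 0 := by
        rw [invSeries_eq h, map_add, map_sum, map_sum, Finset.sum_eq_zero, Finset.sum_eq_zero,
          add_zero]
        · intro j _
          rw [map_mul, map_divVar, invNumerator]
          simp only [map_sub, map_mul]
          rw [ih j j.2 (fun i => ht i), ih j j.2 (fun i => htt i j), map_augHom_expAt _ _ (ht j),
            map_augHom_liAt _ _ (fun i => ht _), map_augHom_liAt _ _ (fun i => htt _ _), mul_one,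
            sub_self]
          have : divVar j (0 : MvPowerSeries (Fin m) R) = 0 := by
            ext e
            rfl
          rw [this, mul_zero]
        · intro j _
          rw [map_mul, map_mul, map_augHom_liAt _ _ (fun i => ht _), if_neg (by omega), mul_zero,
            mul_zero]
      have hs' : MvPowerSeries.HasSubst
          fun i => MvPowerSeries.map (augHom D R : Hsymb D →+* R) (s i) :=
        (hasSubst_zero hs).map _
      rw [invAt, MvPowerSeries.map_subst (hasSubst_zero hs), h0,
        ← MvPowerSeries.coe_substAlgHom hs', map_zero]

open Classical in
theorem map_augHom_nodeSeries (z : List (Node σ)) :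
    MvPowerSeries.map (augHom D R : Hsymb D →+* R) (nodeSeries D z)
      = if Alternates z ∧ z.length = 2 then 1 else 0 := by
  have hv := constantCoeff_val (σ := σ) (Hsymb D)
  have hva := constantCoeff_valAt (σ := σ) (R := Hsymb D)
  rw [nodeSeries]
  by_cases hz : Alternates z ∧ Even z.length
  swap
  · rw [if_neg hz, map_zero, if_neg]
    rintro ⟨h1, h2⟩
    exact hz ⟨h1, by rw [h2]; exact even_two⟩
  rw [if_pos hz]
  have h2 : z ≠ [] → (z.length = 2 ↔ z.length / 2 - 1 = 0) := by
    intro h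
    obtain ⟨k, hk⟩ := hz.2
    have := List.length_pos_iff.2 h
    omega
  rcases z with _ | ⟨t | n, w⟩
  · simp
  · simp only [List.head?_cons]
    rw [map_mul, map_augHom_expAt _ _ (hv _), map_augHom_liAt, one_mul]
    · simp only [h2 (by simp), hz.1, true_and]
    · intro i
      rw [map_sub, hva, hv, sub_zero]
  · simp only [List.head?_cons]
    rw [map_mul, map_mul, map_augHom_expAt_neg _ _ (hva _ _), map_augHom_invAt, one_mul]
    · simp only [h2 (by simp), hz.1, true_and]
      split_ifs with h
      · rw [h]; simp
      · rw [mul_zero]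
    · intro i
      rw [map_sub, hva, hva, sub_zero]

theorem gapSum_eq_zero_of_length {N K : Type} [CommRing K] {ψ : List N → K}
    (hψ : ∀ z, z.length ≠ 2 → ψ z = 0) (w : List N) (H : List N → K) {acc : List N}
    (hacc : 2 ≤ acc.length) : gapSum ψ w H acc = 0 := by
  induction w generalizing H acc with
  | nil => rw [gapSum, if_neg (by omega)]
  | cons c w ih =>
    rw [gapSum, ih H (by simp; omega), hψ _ (by simp; omega), zero_mul, add_zero]

/-- A function that is `1` on alternating pairs and vanishes on longer lists is a right unit for `star`:
only the full list has gaps of length two. -/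
theorem star_right_unit {K : Type} [CommRing K] {φ ψ : List (Node σ) → K}
    (hψ : ∀ z, Alternates z → z.length = 2 → ψ z = 1) (hψ' : ∀ z, z.length ≠ 2 → ψ z = 0)
    {L : List (Node σ)} (hL : Alternates L) (hne : L ≠ []) : star φ ψ L = φ L := by
  cases L with
  | nil => exact absurd rfl hne
  | cons a w =>
    have : ∀ (w : List (Node σ)) (a : Node σ) (H : List (Node σ) → K), Alternates (a :: w) →
        gapSum ψ w H [a] = H w := by
      intro w
      induction w with
      | nil => intro a H _; simp [gapSum]
      | cons c w ih =>
        intro a H h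
        rw [gapSum, gapSum_eq_zero_of_length hψ' w H (by simp), ih c _ (List.IsChain.tail h),
          hψ _ _ (by simp), one_mul, add_zero]
        have := (List.isChain_cons_cons.1 h).1
        simpa using this
    exact this w a _ hL

/-- A function that is `1` on alternating pairs and vanishes on longer lists is a left unit for `star`:
only the sublist of the two ends contributes. -/
theorem star_left_unit {K : Type} [CommRing K] {φ ψ : List (Node σ) → K}
    (hφ : ∀ z, Alternates z → z.length = 2 → φ z = 1) (hφ' : ∀ z, z.length ≠ 2 → φ z = 0)
    {a b : Node σ} {w : List (Node σ)} (hab : Alternates [a, b]) :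
    star φ ψ (a :: (w ++ [b])) = ψ (a :: (w ++ [b])) := by
  have h1 : ∀ c : Node σ, (fun l => φ (a :: c :: l))
      = fun l => if l = [] then φ [a, c] else 0 := by
    intro c
    funext l
    split_ifs with h
    · rw [h]
    · refine hφ' _ ?_
      have := List.length_pos_iff.2 h
      simp; omega
  change gapSum ψ (w ++ [b]) (fun l => φ (a :: l)) [a] = _
  rw [gapSum_first _ _ _ (List.cons_ne_nil a []), if_neg (by simp), zero_add, splitSum_concat]
  simp only [h1, gapSum_ite_nil]
  rw [splitSum_congr (g := fun _ _ _ => 0 * 0), splitSum_mul_left, zero_mul, zero_add, if_pos trivial,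
    hφ _ hab rfl, mul_one]
  · rfl
  · intro u c v _
    simp

/-- A homomorphism is determined by its values on the logarithms and on the generating series. -/
theorem algHom_ext_baseList {θ θ' : Hsymb D →ₐ[ℚ] R}
    (hlog : ∀ r, θ (MvPolynomial.X (Gen.log r)) = θ' (MvPolynomial.X (Gen.log r)))
    (h : ∀ (d : ℕ) (p : ℕ → ℕ), IsGood D (baseList d p) →
      MvPowerSeries.map (θ : Hsymb D →+* R) (nodeSeries D (baseList d p))
        = MvPowerSeries.map (θ' : Hsymb D →+* R) (nodeSeries D (baseList d p))) : θ = θ' := by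
  refine MvPolynomial.algHom_ext fun g => ?_
  cases g with
  | log r => exact hlog r
  | li s =>
    set p : ℕ → ℕ := s.pt with hp
    have hps : (fun a : Fin (s.depth + 1) => p a) = s.pts := by
      funext a
      simp only [hp, LiSymbol.pt, dif_pos a.2]
    have hpd : p s.depth = s.pts (Fin.last s.depth) := by
      simp [hp, LiSymbol.pt, Fin.last]
    have hmono : StrictMono fun a : Fin (s.depth + 1) => p a := hps ▸ s.strictMono
    have hD : (p s.depth : ℕ∞) ≤ D := hpd ▸ s.le_bound
    have hM := h s.depth p (isGood_baseList hmono hD)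
    rw [nodeSeries_baseList] at hM
    have hc := congrArg
      (MvPowerSeries.coeff (Finsupp.equivFunOnFinite.symm fun a => (s.wts a : ℕ) - 1)) hM
    rw [MvPowerSeries.coeff_map, MvPowerSeries.coeff_map] at hc
    have hb : MvPowerSeries.coeff (Finsupp.equivFunOnFinite.symm fun a => (s.wts a : ℕ) - 1)
        (liSeries D s.depth p) = MvPolynomial.X (Gen.li s) := by
      change bracket D s.depth p _ = _
      rw [bracket, dif_neg s.depth_pos.ne', dif_pos ⟨hmono, hD⟩]
      congr 2
      cases s
      congr 1
      funext a
      exact PNat.eq (by simp; exact Nat.sub_add_cancel (PNat.pos _))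
    rw [hb] at hc
    exact hc

/-- Coassociativity, expressed through convolution products of homomorphisms: by `listFun_convHom` it is
the associativity of `star`. The ring `R` is a domain so that the power series over it embed into their
fraction field. -/
theorem convHom_assoc [IsDomain R] (θ₁ θ₂ θ₃ : Hsymb D →ₐ[ℚ] R) :
    convHom (convHom θ₁ θ₂) θ₃ = convHom θ₁ (convHom θ₂ θ₃) := by
  refine algHom_ext_baseList (fun r => ?_) fun d p hG => ?_
  · simp [convHom, coproduct, coproductGen, add_assoc]
  · refine IsFractionRing.injective _ (FractionRing (MvPowerSeries (Fin d) R)) ?_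
    change listFun _ _ = listFun _ _
    rw [listFun_convHom _ _ hG, listFun_convHom _ _ hG,
      star_congr (φ' := star (listFun θ₁) (listFun θ₂)) (ψ' := listFun θ₃)
        (fun C hC _ _ => listFun_convHom _ _ (hG.sublist hC)) (fun _ _ => rfl), star_assoc]
    exact star_congr (fun _ _ _ _ => rfl)
      fun z hz => (listFun_convHom _ _ (hG.sublist hz.sublist)).symm

theorem alternates_baseList (d : ℕ) (p : ℕ → ℕ) : Alternates (baseList d p) :=
  List.isChain_cons_cons.2 ⟨by simp, alternates_cons_flatMap (fun x _ => by simp) rfl⟩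

theorem length_baseList (d : ℕ) (p : ℕ → ℕ) : (baseList d p).length = 2 * d + 2 := by
  simp [baseList, mul_comm]

theorem convHom_augHom_right (θ : Hsymb D →ₐ[ℚ] R) : convHom θ (augHom D R) = θ := by
  classical
  refine algHom_ext_baseList (fun r => ?_) fun d p hG => ?_
  · simp [convHom, coproduct, coproductGen, augHom]
  · have hlen := length_baseList d p
    rw [baseList] at hG hlen ⊢
    rw [map_convHom_nodeSeries θ _ (alternates_baseList d p) (d := d) (by simpa using hlen) hG]
    refine star_right_unit (fun z h1 h2 => ?_) (fun z hz => ?_) (alternates_baseList d p) (by simp)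
    · rw [map_augHom_nodeSeries, if_pos ⟨h1, h2⟩]
    · rw [map_augHom_nodeSeries, if_neg (by tauto)]

theorem convHom_augHom_left (θ : Hsymb D →ₐ[ℚ] R) : convHom (augHom D R) θ = θ := by
  classical
  refine algHom_ext_baseList (fun r => ?_) fun d p hG => ?_
  · simp [convHom, coproduct, coproductGen, augHom]
  · have hlen := length_baseList d p
    have halt := alternates_baseList d p
    rw [baseList] at hG hlen halt ⊢
    rw [map_convHom_nodeSeries _ θ halt (d := d) (by simpa using hlen) hG]
    obtain ⟨w, b, hwb⟩ := List.eq_nil_or_concat' (P (p 0) :: (List.finRange d).flatMap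
      fun i : Fin d => [T (some i), P (p ((i : ℕ) + 1))]) |>.resolve_left (by simp)
    rw [hwb] at halt hlen ⊢
    have hb : b.isP = true := by
      have h1 := halt.isP_getD (P 0) (k := w.length + 1) (by simp)
      have h3 : (T none :: (w ++ [b])).getD (w.length + 1) (P 0) = b := by simp
      rw [h3] at h1
      rw [h1]
      simp at hlen ⊢
      rw [← Nat.not_even_iff_odd, hlen]
      simp
    refine star_left_unit (fun z h1 h2 => ?_) (fun z hz => ?_) (by simp [hb])
    · rw [map_augHom_nodeSeries, if_pos ⟨h1, h2⟩]
    · rw [map_augHom_nodeSeries, if_neg (by tauto)]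

theorem isDomain_tensor (D : ℕ∞) (A : Type) [CommRing A] [Algebra ℚ A] [IsDomain A] :
    IsDomain (Hsymb D ⊗[ℚ] A) :=
  ((Algebra.TensorProduct.comm ℚ (Hsymb D) A).trans
    ((MvPolynomial.algebraTensorAlgEquiv (σ := Gen D) ℚ A).restrictScalars ℚ)).toMulEquiv.isDomain _

theorem convHom_convHom_left (θ₁ θ₂ θ₃ : Hsymb D →ₐ[ℚ] R) :
    convHom (convHom θ₁ θ₂) θ₃ = (Algebra.TensorProduct.productMap θ₁
      (Algebra.TensorProduct.productMap θ₂ θ₃)).comp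
      (((Algebra.TensorProduct.assoc ℚ ℚ ℚ (Hsymb D) (Hsymb D) (Hsymb D)).toAlgHom.comp
      (Algebra.TensorProduct.map (coproduct D) (AlgHom.id ℚ (Hsymb D)))).comp (coproduct D)) := by
  have h : Algebra.TensorProduct.productMap θ₁ θ₂ = (Algebra.TensorProduct.productMap θ₁
      (Algebra.TensorProduct.productMap θ₂ θ₃)).comp
      ((Algebra.TensorProduct.assoc ℚ ℚ ℚ (Hsymb D) (Hsymb D) (Hsymb D)).toAlgHom.comp
        Algebra.TensorProduct.includeLeft) := by
    refine Algebra.TensorProduct.ext ?_ ?_ <;> ext x <;> simp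
  rw [← AlgHom.comp_assoc]
  refine congrArg (fun f : Hsymb D ⊗[ℚ] Hsymb D →ₐ[ℚ] R => f.comp (coproduct D)) ?_
  refine Algebra.TensorProduct.ext ?_ ?_
  · rw [Algebra.TensorProduct.productMap_left, convHom, h]
    ext x
    simp
  · ext x
    simp [Algebra.TensorProduct.one_def]

theorem convHom_convHom_right (θ₁ θ₂ θ₃ : Hsymb D →ₐ[ℚ] R) :
    convHom θ₁ (convHom θ₂ θ₃) = (Algebra.TensorProduct.productMap θ₁
      (Algebra.TensorProduct.productMap θ₂ θ₃)).comp
      ((Algebra.TensorProduct.map (AlgHom.id ℚ (Hsymb D)) (coproduct D)).comp (coproduct D)) := by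
  rw [← AlgHom.comp_assoc]
  refine congrArg (fun f : Hsymb D ⊗[ℚ] Hsymb D →ₐ[ℚ] R => f.comp (coproduct D)) ?_
  refine Algebra.TensorProduct.ext ?_ ?_ <;> ext x <;> simp [convHom]

/-- The triple tensor power of the free algebra is a domain, and its three inclusions are the universal
triple of homomorphisms. -/
theorem coassoc_algHom (D : ℕ∞) :
    ((Algebra.TensorProduct.assoc ℚ ℚ ℚ (Hsymb D) (Hsymb D) (Hsymb D)).toAlgHom.comp
      (Algebra.TensorProduct.map (coproduct D) (AlgHom.id ℚ (Hsymb D)))).comp (coproduct D)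
      = (Algebra.TensorProduct.map (AlgHom.id ℚ (Hsymb D)) (coproduct D)).comp (coproduct D) := by
  have := isDomain_tensor D (Hsymb D)
  have := isDomain_tensor D (Hsymb D ⊗[ℚ] Hsymb D)
  have h := convHom_assoc (R := Hsymb D ⊗[ℚ] (Hsymb D ⊗[ℚ] Hsymb D))
    Algebra.TensorProduct.includeLeft
    (Algebra.TensorProduct.includeRight.comp Algebra.TensorProduct.includeLeft)
    (Algebra.TensorProduct.includeRight.comp Algebra.TensorProduct.includeRight)
  rw [convHom_convHom_left, convHom_convHom_right] at h
  have hid : Algebra.TensorProduct.productMap (R := ℚ) (S := Hsymb D ⊗[ℚ] (Hsymb D ⊗[ℚ] Hsymb D))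
      Algebra.TensorProduct.includeLeft (Algebra.TensorProduct.productMap (R := ℚ)
        (S := Hsymb D ⊗[ℚ] (Hsymb D ⊗[ℚ] Hsymb D))
        (Algebra.TensorProduct.includeRight.comp Algebra.TensorProduct.includeLeft)
        (Algebra.TensorProduct.includeRight.comp Algebra.TensorProduct.includeRight))
      = AlgHom.id ℚ _ := by
    refine Algebra.TensorProduct.ext ?_ (Algebra.TensorProduct.ext ?_ ?_) <;> ext x <;>
      simp [Algebra.TensorProduct.one_def]
  rw [hid] at h
  exact h

instance instCoalgebraHsymb (D : ℕ∞) : Coalgebra ℚ (Hsymb D) where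
  comul := (coproduct D).toLinearMap
  counit := (augHom D ℚ).toLinearMap
  coassoc := by
    have := congrArg AlgHom.toLinearMap (coassoc_algHom D)
    exact this
  rTensor_counit_comp_comul := by
    have h := convHom_augHom_left (Algebra.TensorProduct.includeRight :
      Hsymb D →ₐ[ℚ] ℚ ⊗[ℚ] Hsymb D)
    have h2 : Algebra.TensorProduct.map (augHom D ℚ) (AlgHom.id ℚ (Hsymb D))
        = Algebra.TensorProduct.productMap (augHom D _) Algebra.TensorProduct.includeRight := by
      refine Algebra.TensorProduct.ext ?_ ?_ <;> ext x <;> simp [augHom]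
    rw [convHom, ← h2] at h
    exact congrArg AlgHom.toLinearMap h
  lTensor_counit_comp_comul := by
    have h := convHom_augHom_right (Algebra.TensorProduct.includeLeft :
      Hsymb D →ₐ[ℚ] Hsymb D ⊗[ℚ] ℚ)
    have h2 : Algebra.TensorProduct.map (AlgHom.id ℚ (Hsymb D)) (augHom D ℚ)
        = Algebra.TensorProduct.productMap Algebra.TensorProduct.includeLeft (augHom D _) := by
      refine Algebra.TensorProduct.ext ?_ ?_ <;> ext x <;> simp [augHom]
    rw [convHom, ← h2] at h
    exact congrArg AlgHom.toLinearMap h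

end Counit

/-! ### Rescaling the logarithms -/

section Scaling
open Node

variable {D D' : ℕ∞} {σ τ R : Type} [CommRing R] [Algebra ℚ R]

/-- The substitution `t ↦ c t` in all variables. -/
def dilate (c : ℚ) : MvPowerSeries σ R →+* MvPowerSeries σ R :=
  MvPowerSeries.rescale fun _ => algebraMap ℚ R c

theorem coeff_dilate (c : ℚ) (f : MvPowerSeries σ R) (e : σ →₀ ℕ) :
    MvPowerSeries.coeff e (dilate c f) = c ^ e.degree • MvPowerSeries.coeff e f := by
  rw [dilate, MvPowerSeries.coeff_rescale, Algebra.smul_def, map_pow]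
  congr 1
  rw [Finsupp.prod, Finset.prod_pow_eq_pow_sum]
  rfl

theorem map_dilate {S : Type} [CommRing S] [Algebra ℚ S] (h : R →ₐ[ℚ] S) (c : ℚ)
    (f : MvPowerSeries σ R) : MvPowerSeries.map (h : R →+* S) (dilate c f)
      = dilate c (MvPowerSeries.map (h : R →+* S) f) := by
  ext e
  rw [MvPowerSeries.coeff_map, coeff_dilate, coeff_dilate, MvPowerSeries.coeff_map]
  exact map_smul h _ _

theorem coeff_rat_smul (c : ℚ) (f : MvPowerSeries σ R) (e : σ →₀ ℕ) :
    MvPowerSeries.coeff e (c • f) = c • MvPowerSeries.coeff e f := rfl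

theorem dilate_X (c : ℚ) (i : σ) :
    dilate c (MvPowerSeries.X i : MvPowerSeries σ R) = c • MvPowerSeries.X i := by
  classical
  ext e
  rw [coeff_dilate, coeff_rat_smul, MvPowerSeries.coeff_X]
  split_ifs with h
  · rw [h]; simp
  · simp

theorem constantCoeff_smul_rat {c : ℚ} {x : MvPowerSeries σ R}
    (hx : MvPowerSeries.constantCoeff x = 0) : MvPowerSeries.constantCoeff (c • x) = 0 := by
  rw [← MvPowerSeries.coeff_zero_eq_constantCoeff_apply] at hx ⊢
  rw [coeff_rat_smul, hx, smul_zero]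

theorem dilate_eq_subst [Finite σ] (c : ℚ) (f : MvPowerSeries σ R) :
    dilate c f = MvPowerSeries.subst (fun i => c • (MvPowerSeries.X i : MvPowerSeries σ R)) f := by
  rw [dilate, MvPowerSeries.rescale_eq_subst]
  congr 1
  funext i
  simp only [Pi.smul_apply']
  exact algebraMap_smul R c _

theorem subst_dilate [Finite σ] {t : σ → MvPowerSeries τ R}
    (ht : ∀ i, MvPowerSeries.constantCoeff (t i) = 0) (c : ℚ) (f : MvPowerSeries σ R) :
    MvPowerSeries.subst t (dilate c f) = MvPowerSeries.subst (fun i => c • t i) f := by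
  have hT := MvPowerSeries.hasSubst_of_constantCoeff_zero ht
  rw [dilate_eq_subst, MvPowerSeries.subst_comp_subst_apply
    (MvPowerSeries.hasSubst_of_constantCoeff_zero fun i => constantCoeff_smul_rat (by simp)) hT]
  congr 1
  funext i
  rw [← MvPowerSeries.coe_substAlgHom hT, map_rat_smul, MvPowerSeries.coe_substAlgHom,
    MvPowerSeries.subst_X hT]

theorem divVar_dilate (j : σ) (c : ℚ) (f : MvPowerSeries σ R) :
    divVar j (dilate c f) = c • dilate c (divVar j f) := by
  ext e
  change MvPowerSeries.coeff _ (dilate c f) = _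
  rw [coeff_rat_smul, coeff_dilate, coeff_dilate, smul_smul]
  congr 1
  rw [map_add, pow_add]
  simp [Finsupp.degree_single, mul_comm]

theorem divVar_smul (j : σ) (c : ℚ) (f : MvPowerSeries σ R) :
    divVar j (c • f) = c • divVar j f := by
  ext e
  rfl

theorem dilate_liAt [Finite τ] (c : ℚ) (m : ℕ) (p : ℕ → ℕ) {s : Fin m → MvPowerSeries τ (Hsymb D)}
    (hs : ∀ i, MvPowerSeries.constantCoeff (s i) = 0) :
    dilate c (liAt D m p s) = liAt D m p fun i => dilate c (s i) := by
  simp only [dilate_eq_subst]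
  exact subst_liAt (fun i => constantCoeff_smul_rat (by simp)) p hs

theorem dilate_invAt [Finite τ] (c : ℚ) (m : ℕ) (p : ℕ → ℕ) {s : Fin m → MvPowerSeries τ (Hsymb D)}
    (hs : ∀ i, MvPowerSeries.constantCoeff (s i) = 0) :
    dilate c (invAt D m p s) = invAt D m p fun i => dilate c (s i) := by
  simp only [dilate_eq_subst]
  exact subst_invAt (fun i => constantCoeff_smul_rat (by simp)) p hs

theorem dilate_expAt [Finite τ] (c : ℚ) (x : Hsymb D) {s : MvPowerSeries τ (Hsymb D)}
    (hs : MvPowerSeries.constantCoeff s = 0) :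
    dilate c (expAt D x s) = expAt D x (dilate c s) := by
  simp only [dilate_eq_subst]
  exact subst_expAt (fun i => constantCoeff_smul_rat (by simp)) x hs

/-- The homomorphism `f` multiplies elements of weight `n` by `c ^ n`, up to the inclusion of the
generators. This covers both the inclusions (`c = 1`) and the grading by the weight (`D = D'`). -/
structure IsScaling (c : ℚ) (f : Hsymb D →ₐ[ℚ] Hsymb D') : Prop where
  logBracket : ∀ i j : ℕ, (j : ℕ∞) ≤ D → f (logBracket D i j) = c • logBracket D' i j
  bracket : ∀ (m : ℕ) (p : ℕ → ℕ) (n : Fin m → ℕ+), (p m : ℕ∞) ≤ D →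
    f (bracket D m p n) = c ^ (∑ a, (n a : ℕ)) • bracket D' m p n

namespace IsScaling

variable {c : ℚ} {f : Hsymb D →ₐ[ℚ] Hsymb D'} (hf : IsScaling c f)
include hf

theorem map_liSeries {m : ℕ} {p : ℕ → ℕ} (hp : (p m : ℕ∞) ≤ D) :
    MvPowerSeries.map (f : Hsymb D →+* Hsymb D') (liSeries D m p)
      = c ^ m • dilate c (liSeries D' m p) := by
  ext1 e
  rw [MvPowerSeries.coeff_map, coeff_rat_smul, coeff_dilate, smul_smul, ← pow_add]
  refine (hf.bracket m p _ hp).trans ?_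
  congr 2
  simp [Finset.sum_add_distrib, Finsupp.degree_eq_sum, add_comm]

theorem map_liAt {m : ℕ} {p : ℕ → ℕ} (hp : (p m : ℕ∞) ≤ D) {s : Fin m → MvPowerSeries τ (Hsymb D)}
    (hs : ∀ i, MvPowerSeries.constantCoeff (s i) = 0) :
    MvPowerSeries.map (f : Hsymb D →+* Hsymb D') (liAt D m p s)
      = c ^ m • liAt D' m p fun i => c • MvPowerSeries.map (f : Hsymb D →+* Hsymb D') (s i) := by
  have hs' : ∀ i, MvPowerSeries.constantCoeff
      (MvPowerSeries.map (f : Hsymb D →+* Hsymb D') (s i)) = 0 := fun i => by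
    rw [MvPowerSeries.constantCoeff_map, hs, map_zero]
  rw [liAt, MvPowerSeries.map_subst (hasSubst_zero hs), hf.map_liSeries hp,
    ← MvPowerSeries.coe_substAlgHom (hasSubst_zero hs'), map_rat_smul,
    MvPowerSeries.coe_substAlgHom, subst_dilate hs', liAt]

theorem map_expAt (i : ℕ) {j : ℕ} (hj : (j : ℕ∞) ≤ D) {s : MvPowerSeries τ (Hsymb D)}
    (hs : MvPowerSeries.constantCoeff s = 0) :
    MvPowerSeries.map (f : Hsymb D →+* Hsymb D') (expAt D (SymbPolylog.logBracket D i j) s)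
      = expAt D' (SymbPolylog.logBracket D' i j)
        (c • MvPowerSeries.map (f : Hsymb D →+* Hsymb D') s) := by
  rw [SymbPolylog.map_expAt _ _ hs, hf.logBracket i j hj, expAt_eq, smul_assoc, smul_comm]

theorem map_expAt_neg (i : ℕ) {j : ℕ} (hj : (j : ℕ∞) ≤ D) {s : MvPowerSeries τ (Hsymb D)}
    (hs : MvPowerSeries.constantCoeff s = 0) :
    MvPowerSeries.map (f : Hsymb D →+* Hsymb D') (expAt D (-SymbPolylog.logBracket D i j) s)
      = expAt D' (-SymbPolylog.logBracket D' i j)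
        (c • MvPowerSeries.map (f : Hsymb D →+* Hsymb D') s) := by
  rw [SymbPolylog.map_expAt _ _ hs, map_neg, hf.logBracket i j hj, expAt_eq, neg_smul, neg_smul,
    smul_assoc, smul_comm]

theorem map_liAt_dilate [Finite τ] {m : ℕ} {p : ℕ → ℕ} (hp : (p m : ℕ∞) ≤ D)
    {s : Fin m → MvPowerSeries τ (Hsymb D)} {s' : Fin m → MvPowerSeries τ (Hsymb D')}
    (hs : ∀ i, MvPowerSeries.constantCoeff (s i) = 0)
    (hs' : ∀ i, MvPowerSeries.constantCoeff (s' i) = 0)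
    (h : ∀ i, c • MvPowerSeries.map (f : Hsymb D →+* Hsymb D') (s i) = dilate c (s' i)) :
    MvPowerSeries.map (f : Hsymb D →+* Hsymb D') (liAt D m p s)
      = c ^ m • dilate c (liAt D' m p s') := by
  rw [hf.map_liAt hp hs, dilate_liAt _ _ _ hs', funext h]

theorem map_expAt_dilate [Finite τ] (i : ℕ) {j : ℕ} (hj : (j : ℕ∞) ≤ D)
    {s : MvPowerSeries τ (Hsymb D)} {s' : MvPowerSeries τ (Hsymb D')}
    (hs : MvPowerSeries.constantCoeff s = 0) (hs' : MvPowerSeries.constantCoeff s' = 0)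
    (h : c • MvPowerSeries.map (f : Hsymb D →+* Hsymb D') s = dilate c s') :
    MvPowerSeries.map (f : Hsymb D →+* Hsymb D') (expAt D (SymbPolylog.logBracket D i j) s)
      = dilate c (expAt D' (SymbPolylog.logBracket D' i j) s') := by
  rw [hf.map_expAt i hj hs, dilate_expAt _ _ hs', h]

theorem map_expAt_neg_dilate [Finite τ] (i : ℕ) {j : ℕ} (hj : (j : ℕ∞) ≤ D)
    {s : MvPowerSeries τ (Hsymb D)} {s' : MvPowerSeries τ (Hsymb D')}
    (hs : MvPowerSeries.constantCoeff s = 0) (hs' : MvPowerSeries.constantCoeff s' = 0)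
    (h : c • MvPowerSeries.map (f : Hsymb D →+* Hsymb D') s = dilate c s') :
    MvPowerSeries.map (f : Hsymb D →+* Hsymb D') (expAt D (-SymbPolylog.logBracket D i j) s)
      = dilate c (expAt D' (-SymbPolylog.logBracket D' i j) s') := by
  rw [hf.map_expAt_neg i hj hs, dilate_expAt _ _ hs', h]

theorem map_invAt_dilate [Finite τ] {m : ℕ} {p : ℕ → ℕ} (hp : ∀ a ≤ m, (p a : ℕ∞) ≤ D)
    {s : Fin m → MvPowerSeries τ (Hsymb D)} {s' : Fin m → MvPowerSeries τ (Hsymb D')}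
    (hs : ∀ i, MvPowerSeries.constantCoeff (s i) = 0)
    (hs' : ∀ i, MvPowerSeries.constantCoeff (s' i) = 0)
    (h : ∀ i, c • MvPowerSeries.map (f : Hsymb D →+* Hsymb D') (s i) = dilate c (s' i)) :
    MvPowerSeries.map (f : Hsymb D →+* Hsymb D') (invAt D m p s)
      = c ^ m • dilate c (invAt D' m p s') := by
  induction m using Nat.strong_induction_on generalizing τ with
  | _ m ih =>
    rcases eq_or_ne m 0 with rfl | hm
    · rw [invAt_zero, invAt_zero, map_one, map_one, pow_zero, one_smul]
    have hX : ∀ i, c • MvPowerSeries.map (f : Hsymb D →+* Hsymb D') (tvar D m i)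
        = dilate c (tvar D' m i) := fun i => by
      unfold tvar; split_ifs <;> simp [dilate_X]
    have hXX : ∀ i j, c • MvPowerSeries.map (f : Hsymb D →+* Hsymb D') (tvar D m i - tvar D m j)
        = dilate c (tvar D' m i - tvar D' m j) := fun i j => by
      rw [map_sub, map_sub, smul_sub, hX, hX]
    have ht := constantCoeff_tvar (D := D) m
    have ht' := constantCoeff_tvar (D := D') m
    have htt : ∀ i j, MvPowerSeries.constantCoeff (tvar D m i - tvar D m j) = 0 := fun i j => by
      simp [ht]
    have htt' : ∀ i j, MvPowerSeries.constantCoeff (tvar D' m i - tvar D' m j) = 0 := fun i j => by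
      simp [ht']
    have hser : MvPowerSeries.map (f : Hsymb D →+* Hsymb D') (invSeries D m p)
        = c ^ m • dilate c (invSeries D' m p) := by
      rw [invSeries_eq hm, invSeries_eq hm, map_add, map_add, smul_add, map_sum, map_sum, map_sum,
        map_sum, Finset.smul_sum, Finset.smul_sum]
      refine congrArg₂ (· + ·) (Finset.sum_congr rfl fun j _ => ?_)
        (Finset.sum_congr rfl fun j _ => ?_)
      · rw [map_mul, map_mul, map_mul, map_mul, ih j j.2 (fun a ha => hp a (by omega))
          (fun i => ht i) (fun i => ht' i) (fun i => hX i),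
          hf.map_liAt_dilate (p := fun a => p (j + a)) (by
            rw [show (j : ℕ) + (m - j) = m by omega]; exact hp m le_rfl)
          (fun i => ht _) (fun i => ht' _) (fun i => hX _), smul_mul_smul_comm, ← pow_add,
          show (j : ℕ) + (m - j) = m by omega, mul_smul_comm]
        simp
      · have hq : (p (j + 1 + (m - (j + 1))) : ℕ∞) ≤ D := by
          rw [show (j : ℕ) + 1 + (m - (j + 1)) = m by omega]; exact hp m le_rfl
        have hN : MvPowerSeries.map (f : Hsymb D →+* Hsymb D') (invNumerator D m p (tvar D m) j)
            = c ^ (m - 1) • dilate c (invNumerator D' m p (tvar D' m) j) := by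
          have e : (j : ℕ) + (m - (j + 1)) = m - 1 := by omega
          simp only [invNumerator, map_sub, map_mul]
          rw [ih j j.2 (fun a ha => hp a (by omega)) (fun i => ht i) (fun i => ht' i)
              (fun i => hX i),
            ih j j.2 (fun a ha => hp a (by omega)) (fun i => htt _ _) (fun i => htt' _ _)
              (fun i => hXX _ _),
            hf.map_liAt_dilate (p := fun a => p (j + 1 + a)) hq (fun i => ht _) (fun i => ht' _)
              (fun i => hX _),
            hf.map_liAt_dilate (p := fun a => p (j + 1 + a)) hq (fun i => htt _ _)
              (fun i => htt' _ _) (fun i => hXX _ _),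
            hf.map_expAt_dilate _ (hp m le_rfl) (ht j) (ht' j) (hX j),
            smul_mul_smul_comm, smul_mul_assoc (c ^ (j : ℕ))
              (dilate c (invAt D' j p fun i => tvar D' m i - tvar D' m j)),
            smul_mul_smul_comm, ← pow_add, e, smul_sub]
        rw [map_mul, map_mul, map_divVar, hN, divVar_smul, divVar_dilate, smul_smul, ← pow_succ,
          Nat.sub_add_cancel (Nat.pos_of_ne_zero hm), mul_smul_comm]
        simp
    have hs'' : ∀ i, MvPowerSeries.constantCoeff
        (MvPowerSeries.map (f : Hsymb D →+* Hsymb D') (s i)) = 0 := fun i => by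
      rw [MvPowerSeries.constantCoeff_map, hs, map_zero]
    rw [dilate_invAt _ _ _ hs', ← funext h, invAt, MvPowerSeries.map_subst (hasSubst_zero hs), hser,
      ← MvPowerSeries.coe_substAlgHom (hasSubst_zero hs''), map_rat_smul,
      MvPowerSeries.coe_substAlgHom, subst_dilate hs'', invAt]

end IsScaling
end Scaling

/-! ### The coproduct and rescaling -/

section ScalingCoproduct
open Node

variable {D D' : ℕ∞} {σ R : Type} [CommRing R] [Algebra ℚ R]

theorem gapSum_scale {N K : Type} [CommRing K] {μ ν : K} (hμν : ν * μ = 1) (ρ : K →+* K)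
    (hρμ : ρ μ = μ) {ψ ψ' : List N → K}
    (hψ : ∀ z, ψ' z = ν ^ 2 * μ ^ z.length * ρ (ψ z)) (w : List N) {H H' : List N → K}
    (hH : ∀ l, H' l = μ ^ l.length * ρ (H l)) (acc : List N) :
    gapSum ψ' w H' acc = ν * μ ^ (acc.length + w.length) * ρ (gapSum ψ w H acc) := by
  induction w generalizing H H' acc with
  | nil =>
    simp only [gapSum]
    split_ifs with h
    · rw [hH, h]
      simp [hμν]
    · simp
  | cons c w ih =>
    have h1 := ih (H := fun l => μ * H (c :: l)) (H' := fun l => H' (c :: l)) (fun l => by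
      rw [hH, map_mul, hρμ, List.length_cons]; ring) [c]
    rw [gapSum, gapSum, h1, hψ, ih hH, map_add, map_mul, gapSum_mul_left, map_mul, hρμ]
    simp only [List.length_append, List.length_cons, List.length_nil]
    linear_combination (ν * μ ^ (acc.length + w.length + 1) * (ν * μ + 1) * ρ (ψ (acc ++ [c])) *
      ρ (gapSum ψ w (fun l => H (c :: l)) [c])) * hμν

/-- The composition `star` respects the scaling by `ν ^ 2 * μ ^ length`, where `ν` is the inverse of `μ`: the
lengths of a sublist with `m` gaps and of its gaps add up to `length + 2 * m`. -/
theorem star_scale {N K : Type} [CommRing K] {μ ν : K} (hμν : ν * μ = 1) (ρ : K →+* K)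
    (hρμ : ρ μ = μ) (hρν : ρ ν = ν) {φ φ' ψ ψ' : List N → K}
    (hφ : ∀ z, φ' z = ν ^ 2 * μ ^ z.length * ρ (φ z))
    (hψ : ∀ z, ψ' z = ν ^ 2 * μ ^ z.length * ρ (ψ z)) (L : List N) :
    star φ' ψ' L = ν ^ 2 * μ ^ L.length * ρ (star φ ψ L) := by
  cases L with
  | nil => simp [star]
  | cons a w =>
    have h := gapSum_scale hμν ρ hρμ hψ w (H := fun l => ν ^ 2 * μ * φ (a :: l))
      (H' := fun l => φ' (a :: l)) (fun l => by
        rw [hφ, map_mul, map_mul, map_pow, hρμ, hρν, List.length_cons]; ring) [a]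
    refine h.trans ?_
    rw [gapSum_mul_left, map_mul, map_mul, map_pow, hρμ, hρν, star]
    simp only [List.length_cons, List.length_nil]
    linear_combination (ν ^ 2 * μ ^ (w.length + 1) * ρ (gapSum ψ w (fun l => φ (a :: l)) [a])) * hμν

theorem dilate_val (c : ℚ) (x : Node σ) : dilate c (x.val R) = c • x.val R := by
  rcases x with (_ | i) | n
  · simp [val]
  · simp [val, dilate_X]
  · simp [val]

theorem dilate_valAt (c : ℚ) (L : List (Node σ)) (i : ℕ) :
    dilate c (valAt R L i) = c • valAt R L i := by
  unfold valAt
  cases L[i]? <;> simp [dilate_val]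

omit [Algebra ℚ R] in
theorem map_val {S : Type} [CommRing S] (f : R →+* S) (x : Node σ) :
    MvPowerSeries.map f (x.val R) = x.val S := by
  rcases x with (_ | i) | n <;> simp [val]

omit [Algebra ℚ R] in
theorem map_valAt {S : Type} [CommRing S] (f : R →+* S) (L : List (Node σ)) (i : ℕ) :
    MvPowerSeries.map f (valAt R L i) = valAt S L i := by
  unfold valAt
  cases L[i]? <;> simp [map_val]

theorem ptAt_le {L : List (Node σ)} (hL : ∀ n, P n ∈ L → (n : ℕ∞) ≤ D) (i : ℕ) :
    (ptAt L i : ℕ∞) ≤ D := by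
  unfold ptAt
  cases h : L[i]? with
  | none => simp
  | some x =>
    cases x with
    | T t => simp [pt]
    | P n => exact hL n (List.mem_of_getElem? h)

/-- The effect of a scaling on the generating series. A list of length `2 * k + 2` has depth `k`, so the
factor is `(μ ^ 2) ^ k`; it is written in the form that `star_scale` requires, which is why the scaling
factor is a square. -/
theorem IsScaling.map_nodeSeries [Finite σ] {μ : ℚ} (hμ : μ ≠ 0) {f : Hsymb D →ₐ[ℚ] Hsymb D'}
    (hf : IsScaling (μ ^ 2) f) {L : List (Node σ)} (hL : ∀ n, P n ∈ L → (n : ℕ∞) ≤ D) :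
    MvPowerSeries.map (f : Hsymb D →+* Hsymb D') (nodeSeries D L)
      = (μ⁻¹ ^ 2 * μ ^ L.length) • dilate (μ ^ 2) (nodeSeries D' L) := by
  have hv : ∀ x : Node σ, μ ^ 2 • MvPowerSeries.map (f : Hsymb D →+* Hsymb D') (x.val _)
      = dilate (μ ^ 2) (x.val _) := fun x => by rw [map_val, dilate_val]
  have hva : ∀ i, μ ^ 2 • MvPowerSeries.map (f : Hsymb D →+* Hsymb D') (valAt _ L i)
      = dilate (μ ^ 2) (valAt _ L i) := fun i => by rw [map_valAt, dilate_valAt]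
  have c1 := constantCoeff_val (σ := σ) (Hsymb D)
  have c1' := constantCoeff_val (σ := σ) (Hsymb D')
  have c2 := constantCoeff_valAt (R := Hsymb D) L
  have c2' := constantCoeff_valAt (R := Hsymb D') L
  rw [nodeSeries, nodeSeries]
  by_cases hz : Alternates L ∧ Even L.length
  swap
  · rw [if_neg hz, if_neg hz, map_zero, map_zero, smul_zero]
  rw [if_pos hz, if_pos hz]
  have hc : L ≠ [] → μ⁻¹ ^ 2 * μ ^ L.length = (μ ^ 2) ^ (L.length / 2 - 1) := by
    intro h
    obtain ⟨k, hk⟩ := hz.2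
    have := List.length_pos_iff.2 h
    obtain ⟨j, rfl⟩ : ∃ j, k = j + 1 := ⟨k - 1, by omega⟩
    rw [show L.length / 2 - 1 = j by omega, hk, ← pow_mul, show j + 1 + (j + 1) = 2 + 2 * j by ring,
      pow_add, ← mul_assoc, ← mul_pow, inv_mul_cancel₀ hμ, one_pow, one_mul]
  rcases L with _ | ⟨t | n, w⟩
  · simp
  · simp only [List.head?_cons]
    rw [map_mul, map_mul, hc (by simp), hf.map_liAt_dilate
      (p := fun a => ptAt (T t :: w) (2 * a + 1))
      (s' := fun i => valAt _ (T t :: w) (2 * ((i : ℕ) + 1)) - (T t).val _)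
      (ptAt_le hL _) (fun i => ?_) (fun i => ?_) (fun i => ?_),
      hf.map_expAt_dilate _ (ptAt_le hL _) (c1 _) (c1' _) (hv _), mul_smul_comm]
    · rw [map_sub, c2, c1, sub_zero]
    · rw [map_sub, c2', c1', sub_zero]
    · rw [map_sub, map_sub, smul_sub, hva, hv]
  · simp only [List.head?_cons]
    rw [map_mul, map_mul, map_mul, map_mul, hc (by simp), hf.map_invAt_dilate
      (p := fun a => ptAt (P n :: w) (2 * a))
      (s' := fun i => valAt _ (P n :: w) (2 * (i : ℕ) + 1)
        - valAt _ (P n :: w) ((P n :: w).length - 1))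
      (fun a _ => ptAt_le hL _) (fun i => ?_) (fun i => ?_) (fun i => ?_),
      hf.map_expAt_neg_dilate _ (hL n (by simp)) (c2 _) (c2' _) (hva _),
      mul_smul_comm, mul_smul_comm]
    · simp
    · rw [map_sub, c2, c2, sub_zero]
    · rw [map_sub, c2', c2', sub_zero]
    · rw [map_sub, map_sub, smul_sub, hva, hva]

theorem IsGood.mono {L : List (Node σ)} (h : D ≤ D') (hL : IsGood D L) : IsGood D' L :=
  ⟨hL.1, hL.2.1, fun n hn => (hL.2.2 n hn).trans h⟩

theorem mem_filterMap_pt {L : List (Node σ)} {n : ℕ} (h : P n ∈ L) : n ∈ L.filterMap pt? :=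
  List.mem_filterMap.2 ⟨P n, h, rfl⟩

theorem IsScaling.convHom_comp (hDD : D ≤ D') {μ : ℚ} (hμ : μ ≠ 0)
    {f : Hsymb D →ₐ[ℚ] Hsymb D'} (hf : IsScaling (μ ^ 2) f) (θ₁ θ₂ : Hsymb D' →ₐ[ℚ] R) :
    (convHom θ₁ θ₂).comp f = convHom (θ₁.comp f) (θ₂.comp f) := by
  classical
  refine algHom_ext_baseList (fun r => ?_) fun d p hG => ?_
  · have hr : MvPolynomial.X (Gen.log r) = SymbPolylog.logBracket D r.1 (r.1 + 1) := by
      simp [SymbPolylog.logBracket, r.2]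
    have hr' : ((r.1 + 1 : ℕ) : ℕ∞) ≤ D := by
      simpa using Order.add_one_le_of_lt r.2
    rw [hr, AlgHom.comp_apply, hf.logBracket _ _ hr', map_smul, convHom_logBracket,
      convHom_logBracket, AlgHom.comp_apply, AlgHom.comp_apply, hf.logBracket _ _ hr', map_smul,
      map_smul, smul_add]
  · have hpt : ∀ n, P n ∈ baseList d p → (n : ℕ∞) ≤ D := fun n hn => hG.2.2 n (mem_filterMap_pt hn)
    have hmapc : ∀ (θ : Hsymb D' →ₐ[ℚ] R) (z : List (Node (Fin d))),
        (∀ n, P n ∈ z → (n : ℕ∞) ≤ D) →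
        MvPowerSeries.map (θ.comp f : Hsymb D →+* R) (nodeSeries D z)
          = algebraMap ℚ _ μ⁻¹ ^ 2 * algebraMap ℚ _ μ ^ z.length
            * dilate (μ ^ 2) (MvPowerSeries.map (θ : Hsymb D' →+* R) (nodeSeries D' z)) := by
      intro θ z hz
      have h1 : MvPowerSeries.map (θ.comp f : Hsymb D →+* R) (nodeSeries D z)
          = MvPowerSeries.map (θ : Hsymb D' →+* R)
            (MvPowerSeries.map (f : Hsymb D →+* Hsymb D') (nodeSeries D z)) := by
        ext e; simp
      rw [h1, hf.map_nodeSeries hμ hz, ← map_dilate, ← map_pow, ← map_pow, ← map_mul,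
        ← Algebra.smul_def]
      ext e
      simp
    have hlen := length_baseList d p
    have halt := alternates_baseList d p
    refine (hmapc (convHom θ₁ θ₂) _ hpt).trans ?_
    rw [baseList] at hlen hG halt hpt ⊢
    have hd : (P (p 0) :: List.flatMap (fun i : Fin d => [T (some i), P (p (i + 1))])
      (List.finRange d)).length = 2 * d + 1 := by simpa using hlen
    rw [map_convHom_nodeSeries θ₁ θ₂ halt hd (hG.mono hDD), map_convHom_nodeSeries _ _ halt hd hG]
    set L : List (Node (Fin d)) := T none :: P (p 0) ::
      List.flatMap (fun i : Fin d => [T (some i), P (p (i + 1))]) (List.finRange d) with hLdef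
    -- on lists with a point beyond `D` the scaling relation is meaningless, hence the cut-off
    let cut (g : List (Node (Fin d)) → MvPowerSeries (Fin d) R) (z : List (Node (Fin d))) :
      MvPowerSeries (Fin d) R := if ∀ n, P n ∈ z → (n : ℕ∞) ≤ D then g z else 0
    have hcut : ∀ g z, List.Sublist z L → g z = cut g z := fun g z hz =>
      (if_pos fun n hn => hpt n (hz.subset hn)).symm
    have hscale : ∀ (θ : Hsymb D' →ₐ[ℚ] R) z,
        cut (fun z => MvPowerSeries.map (θ.comp f : Hsymb D →+* R) (nodeSeries D z)) z
          = algebraMap ℚ _ μ⁻¹ ^ 2 * algebraMap ℚ _ μ ^ z.length * dilate (μ ^ 2)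
            (cut (fun z => MvPowerSeries.map (θ : Hsymb D' →+* R) (nodeSeries D' z)) z) := by
      intro θ z
      by_cases hz : ∀ n, P n ∈ z → (n : ℕ∞) ≤ D
      · simp only [cut, if_pos hz, hmapc θ z hz]
      · simp only [cut, if_neg hz, map_zero, mul_zero]
    have hdil : ∀ x : ℚ, dilate (μ ^ 2) (algebraMap ℚ (MvPowerSeries (Fin d) R) x)
        = algebraMap ℚ _ x := fun x => (dilate (μ ^ 2)).map_rat_algebraMap x
    have hstar : ∀ φ ψ, star φ ψ L = star (cut φ) (cut ψ) L := fun φ ψ =>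
      star_congr (fun C hC _ _ => hcut φ C hC) (fun z hz => hcut ψ z hz.sublist)
    refine (congrArg (fun x => _ * dilate (μ ^ 2) x) (hstar _ _)).trans (Eq.trans ?_ (hstar _ _).symm)
    have hinv : algebraMap ℚ (MvPowerSeries (Fin d) R) μ⁻¹ * algebraMap ℚ _ μ = 1 := by
      rw [← map_mul, inv_mul_cancel₀ hμ, map_one]
    exact (star_scale hinv (dilate (μ ^ 2)) (hdil _) (hdil _) (hscale θ₁) (hscale θ₂) L).symm

/-- The coproduct commutes with scalings. -/
theorem IsScaling.coproduct_comp (hDD : D ≤ D') {μ : ℚ} (hμ : μ ≠ 0)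
    {f : Hsymb D →ₐ[ℚ] Hsymb D'} (hf : IsScaling (μ ^ 2) f) :
    (coproduct D').comp f = (Algebra.TensorProduct.map f f).comp (coproduct D) := by
  have h1 : Algebra.TensorProduct.productMap (R := ℚ) (S := Hsymb D' ⊗[ℚ] Hsymb D')
      Algebra.TensorProduct.includeLeft Algebra.TensorProduct.includeRight = AlgHom.id ℚ _ := by
    refine Algebra.TensorProduct.ext ?_ ?_ <;> ext x <;> simp
  have h2 : Algebra.TensorProduct.productMap (R := ℚ) (S := Hsymb D' ⊗[ℚ] Hsymb D')
      (Algebra.TensorProduct.includeLeft.comp f) (Algebra.TensorProduct.includeRight.comp f)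
      = Algebra.TensorProduct.map f f := by
    refine Algebra.TensorProduct.ext ?_ ?_ <;> ext x <;> simp
  have h := hf.convHom_comp (R := Hsymb D' ⊗[ℚ] Hsymb D') hDD hμ
    Algebra.TensorProduct.includeLeft Algebra.TensorProduct.includeRight
  rw [convHom, convHom, h1, h2] at h
  exact h

/-- The inclusion `Hsymb.incl D` does not change the weights. -/
theorem isScaling_incl (D : ℕ∞) : IsScaling 1 (Hsymb.incl D) where
  logBracket i j hj := by
    rw [one_smul, SymbPolylog.logBracket, SymbPolylog.logBracket, map_sum]
    refine Finset.sum_congr rfl fun r hr => ?_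
    have hr' : (r : ℕ∞) < D := (Nat.cast_lt.2 (Finset.mem_Ico.1 hr).2).trans_le hj
    rw [dif_pos hr', dif_pos (by simp)]
    simp [Hsymb.incl, Gen.incl]
  bracket m p n hp := by
    rw [one_pow, one_smul, SymbPolylog.bracket, SymbPolylog.bracket]
    by_cases h0 : m = 0
    · rw [dif_pos h0, dif_pos h0, map_one]
    · rw [dif_neg h0, dif_neg h0]
      by_cases h : StrictMono fun a : Fin (m + 1) => p a
      · rw [dif_pos ⟨h, hp⟩, dif_pos ⟨h, le_top⟩]
        simp [Hsymb.incl, Gen.incl]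
      · rw [dif_neg (by tauto), dif_neg (by tauto), map_zero]

/-- The automorphism that multiplies elements of weight `n` by `c ^ n`. -/
def weightHom (D : ℕ∞) (c : ℚ) : Hsymb D →ₐ[ℚ] Hsymb D :=
  MvPolynomial.aeval fun g => c ^ g.weight • MvPolynomial.X g

theorem isScaling_weightHom (D : ℕ∞) (c : ℚ) : IsScaling c (weightHom D c) where
  logBracket i j hj := by
    rw [SymbPolylog.logBracket, map_sum, Finset.smul_sum]
    refine Finset.sum_congr rfl fun r _ => ?_
    split_ifs <;> simp [weightHom, Gen.weight]
  bracket m p n hp := by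
    rw [SymbPolylog.bracket]
    by_cases h0 : m = 0
    · subst h0
      simp
    · rw [dif_neg h0]
      split_ifs
      · simp [weightHom, Gen.weight]
      · simp

theorem coproduct_incl (D : ℕ∞) (x : Hsymb D) : coproduct ⊤ (Hsymb.incl D x)
    = Algebra.TensorProduct.map (Hsymb.incl D) (Hsymb.incl D) (coproduct D x) := by
  have h : IsScaling (1 ^ 2) (Hsymb.incl D) := by
    rw [one_pow]
    exact isScaling_incl D
  exact AlgHom.congr_fun (h.coproduct_comp le_top one_ne_zero) x

theorem coproduct_weightHom (D : ℕ∞) {μ : ℚ} (hμ : μ ≠ 0) (x : Hsymb D) :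
    coproduct D (weightHom D (μ ^ 2) x)
      = Algebra.TensorProduct.map (weightHom D (μ ^ 2)) (weightHom D (μ ^ 2)) (coproduct D x) :=
  AlgHom.congr_fun ((isScaling_weightHom D (μ ^ 2)).coproduct_comp le_rfl hμ) x

end ScalingCoproduct

/-! ### Infinitesimal maps under convolution -/

section Convolution
open Coalgebra WithConv

variable {H A : Type} [CommRing H] [Bialgebra ℚ H] [Ring A] [Algebra ℚ A]

/-- Linear maps on a bialgebra that vanish on products of elements of the augmentation ideal and
on scalars. -/
def IsInfinitesimal (f : WithConv (H →ₗ[ℚ] A)) : Prop :=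
  ∀ a b, f (a * b) = (counit a : ℚ) • f b + (counit b : ℚ) • f a

theorem IsInfinitesimal.map_one {f : WithConv (H →ₗ[ℚ] A)} (hf : IsInfinitesimal f) : f 1 = 0 := by
  have h := hf 1 1
  simpa using h

theorem IsInfinitesimal.smul {f : WithConv (H →ₗ[ℚ] A)} (hf : IsInfinitesimal f) (c : ℚ) :
    IsInfinitesimal (c • f) := fun a b => by
  simp only [ofConv_smul, LinearMap.smul_apply, hf a b, smul_add, smul_comm c]

theorem IsInfinitesimal.comp {M : Type} [AddCommGroup M] [Module ℚ M] {f : H →ₗ[ℚ] M}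
    (hf : ∀ a b, f (a * b) = (counit a : ℚ) • f b + (counit b : ℚ) • f a) (g : M →ₗ[ℚ] A) :
    IsInfinitesimal (toConv (g ∘ₗ f)) := fun a b => by
  simp [hf a b]

theorem sum_counit_smul_map (f : H →ₗ[ℚ] A) {a : H} {ι : Type} (r : Repr ℚ a ι) :
    ∑ i ∈ r.index, (counit (r.left i) : ℚ) • f (r.right i) = f a := by
  simp_rw [← map_smul, ← map_sum, sum_counit_smul r]

theorem sum_counit_smul_map' (f : H →ₗ[ℚ] A) {a : H} {ι : Type} (r : Repr ℚ a ι) :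
    ∑ i ∈ r.index, (counit (r.right i) : ℚ) • f (r.left i) = f a := by
  have h := congrArg (TensorProduct.rid ℚ H) (sum_tmul_counit_eq r)
  simp only [map_sum, TensorProduct.rid_tmul, one_smul] at h
  simp_rw [← map_smul, ← map_sum, h]

/-- The maps `f` and `g` are derivations over the augmentation and `Δ(ab) = Δ(a)Δ(b)`, so their
convolution product is a derivation up to the cross terms `f a * g b + f b * g a`. -/
theorem convMul_mul {f g : WithConv (H →ₗ[ℚ] A)} (hf : IsInfinitesimal f) (hg : IsInfinitesimal g)
    (a b : H) : (f * g) (a * b) = (counit a : ℚ) • (f * g) b + (counit b : ℚ) • (f * g) a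
      + (f a * g b + f b * g a) := by
  set r := ℛ ℚ a
  set s := ℛ ℚ b
  have hab : comul (R := ℚ) (a * b) = ∑ i ∈ r.index, ∑ j ∈ s.index,
      (r.left i * s.left j) ⊗ₜ[ℚ] (r.right i * s.right j) := by
    rw [Bialgebra.comul_mul, ← r.eq, ← s.eq, Finset.sum_mul_sum]
    simp
  have hcc : ∑ i ∈ r.index, (counit (r.left i) : ℚ) * counit (r.right i) = counit a := by
    have := sum_counit_smul_map (A := ℚ) counit r
    simpa using this
  have hcc' : ∑ j ∈ s.index, (counit (s.left j) : ℚ) * counit (s.right j) = counit b := by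
    have := sum_counit_smul_map (A := ℚ) counit s
    simpa using this
  have key : ∀ i j, f (r.left i * s.left j) * g (r.right i * s.right j)
      = ((counit (r.left i) : ℚ) * counit (r.right i)) • (f (s.left j) * g (s.right j))
        + ((counit (s.left j) : ℚ) * counit (s.right j)) • (f (r.left i) * g (r.right i))
        + (((counit (r.right i) : ℚ) • f (r.left i)) * ((counit (s.left j) : ℚ) • g (s.right j))
        + ((counit (s.right j) : ℚ) • f (s.left j)) * ((counit (r.left i) : ℚ) • g (r.right i))) := by
    intro i j
    rw [hf, hg, add_mul, mul_add, mul_add]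
    simp only [smul_mul_smul_comm]
    rw [mul_comm (counit (r.left i)) (counit (s.right j) : ℚ),
      mul_comm (counit (s.left j)) (counit (r.right i) : ℚ)]
    abel
  rw [LinearMap.convMul_apply, hab]
  simp only [map_sum, TensorProduct.map_tmul, LinearMap.mul'_apply]
  simp only [key, Finset.sum_add_distrib]
  simp only [← Finset.smul_sum, ← Finset.sum_smul, ← Finset.mul_sum, ← Finset.sum_mul]
  rw [hcc, hcc', sum_counit_smul_map' f.ofConv r, sum_counit_smul_map' f.ofConv s,
    sum_counit_smul_map g.ofConv r, sum_counit_smul_map g.ofConv s, r.convMul_apply,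
    s.convMul_apply]

theorem IsInfinitesimal.mul_self {f : WithConv (H →ₗ[ℚ] A)} (hf : IsInfinitesimal f)
    (h : ∀ a b, f a * f b + f b * f a = 0) : IsInfinitesimal (f * f) := fun a b => by
  rw [convMul_mul hf hf, h, add_zero]

theorem IsInfinitesimal.commutator {f g : WithConv (H →ₗ[ℚ] A)} (hf : IsInfinitesimal f)
    (hg : IsInfinitesimal g) (h : ∀ a b, f a * g b = g b * f a) :
    IsInfinitesimal (f * g - g * f) := fun a b => by
  rw [ofConv_sub, LinearMap.sub_apply, LinearMap.sub_apply, LinearMap.sub_apply, convMul_mul hf hg,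
    convMul_mul hg hf, h, h, smul_sub, smul_sub]
  abel

theorem convMul_comp {H' : Type} [CommRing H'] [Bialgebra ℚ H'] (φ : H' →ₗ[ℚ] H)
    (hφ : ∀ x, comul (φ x) = TensorProduct.map φ φ (comul (R := ℚ) x))
    (f g : WithConv (H →ₗ[ℚ] A)) (x : H') :
    (f * g) (φ x) = (toConv (f.ofConv ∘ₗ φ) * toConv (g.ofConv ∘ₗ φ)) x := by
  rw [LinearMap.convMul_apply, LinearMap.convMul_apply, hφ, ← LinearMap.comp_apply (TensorProduct.map _ _),
    ← TensorProduct.map_comp]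

theorem algHom_convMul {B : Type} [Ring B] [Algebra ℚ B] (φ : A →ₐ[ℚ] B)
    (f g : WithConv (H →ₗ[ℚ] A)) (x : H) :
    φ ((f * g) x) = (toConv (φ.toLinearMap ∘ₗ f.ofConv) * toConv (φ.toLinearMap ∘ₗ g.ofConv)) x := by
  rw [(ℛ ℚ x).convMul_apply, (ℛ ℚ x).convMul_apply, map_sum]
  simp

end Convolution

/-! ### The cobracket -/

section Cobracket
open Coalgebra WithConv

variable {D : ℕ∞}

instance instBialgebraHsymb (D : ℕ∞) : Bialgebra ℚ (Hsymb D) :=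
  Bialgebra.mk' ℚ (Hsymb D) (map_one (augHom D ℚ)) (fun {a b} => map_mul (augHom D ℚ) a b)
    (map_one (coproduct D)) (fun {a b} => map_mul (coproduct D) a b)

theorem counit_eq (x : Hsymb D) : counit (R := ℚ) x = MvPolynomial.constantCoeff x := by
  change augHom D ℚ x = _
  rw [augHom, MvPolynomial.aeval_zero']
  simp

theorem mem_Hpos_iff {x : Hsymb D} : x ∈ Hpos D ↔ counit (R := ℚ) x = 0 := by
  rw [counit_eq]; rfl

theorem toLsymb_coe (x : Hpos D) : toLsymb D (x : Hsymb D) = (Hpos D).toCotangent x := by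
  have hx : MvPolynomial.constantCoeff (x : Hsymb D) = 0 := x.2
  change (Hpos D).toCotangent _ = _
  congr 1
  ext1
  simp [hx]

theorem toLsymb_surjective (D : ℕ∞) : Function.Surjective (toLsymb D) := fun y => by
  obtain ⟨x, rfl⟩ := (Hpos D).toCotangent_surjective y
  exact ⟨x, toLsymb_coe x⟩

theorem toLsymb_C (c : ℚ) : toLsymb D (MvPolynomial.C c) = 0 := by
  change (Hpos D).toCotangent _ = _
  rw [← map_zero (Hpos D).toCotangent]
  congr 1
  ext1
  simp

theorem toLsymb_mul (a b : Hsymb D) :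
    toLsymb D (a * b) = (counit a : ℚ) • toLsymb D b + (counit b : ℚ) • toLsymb D a := by
  set c := MvPolynomial.constantCoeff a with hc
  set e := MvPolynomial.constantCoeff b with he
  have h : a * b = (c • b + e • a) + ((a - MvPolynomial.C c) * (b - MvPolynomial.C e)
      - MvPolynomial.C (c * e)) := by
    rw [MvPolynomial.smul_eq_C_mul, MvPolynomial.smul_eq_C_mul, map_mul]
    ring
  have h0 : toLsymb D ((a - MvPolynomial.C c) * (b - MvPolynomial.C e)) = 0 := by
    have ha : a - MvPolynomial.C c ∈ Hpos D := by simp [RingHom.mem_ker, hc]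
    have hb : b - MvPolynomial.C e ∈ Hpos D := by simp [RingHom.mem_ker, he]
    have hab : (a - MvPolynomial.C c) * (b - MvPolynomial.C e) ∈ Hpos D :=
      Ideal.mul_mem_left _ _ hb
    rw [show (a - MvPolynomial.C c) * (b - MvPolynomial.C e)
      = ((⟨_, hab⟩ : Hpos D) : Hsymb D) from rfl, toLsymb_coe, Ideal.toCotangent_eq_zero, pow_two]
    exact Ideal.mul_mem_mul ha hb
  rw [h, map_add, map_sub, h0, toLsymb_C, sub_zero, add_zero, map_add, map_smul, map_smul,
    counit_eq, counit_eq]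

/-- A map that is a derivation over the augmentation vanishes on decomposable elements and on scalars. -/
theorem ker_toLsymb_le {M : Type} [AddCommGroup M] [Module ℚ M] {f : Hsymb D →ₗ[ℚ] M}
    (hf : ∀ a b, f (a * b) = (counit a : ℚ) • f b + (counit b : ℚ) • f a) :
    LinearMap.ker (toLsymb D) ≤ LinearMap.ker f := by
  intro x hx
  have h1 : f 1 = 0 := by simpa using hf 1 1
  have hsq : ∀ y ∈ Hpos D ^ 2, f y = 0 := by
    intro y hy
    rw [pow_two] at hy
    refine Submodule.mul_induction_on hy (fun a ha b hb => ?_) fun a b ha hb => ?_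
    · rw [hf, mem_Hpos_iff.1 ha, mem_Hpos_iff.1 hb, zero_smul, zero_smul, add_zero]
    · rw [map_add, ha, hb, add_zero]
  have hx' := hsq _ ((Ideal.toCotangent_eq_zero (Hpos D) _).1 (LinearMap.mem_ker.1 hx))
  rw [map_sub, ← mul_one (MvPolynomial.C _), ← MvPolynomial.smul_eq_C_mul, map_smul, h1, smul_zero,
    sub_zero] at hx'
  exact hx'

/-- The map on indecomposables induced by an infinitesimal map. -/
def liftLsymb {M : Type} [AddCommGroup M] [Module ℚ M] (f : Hsymb D →ₗ[ℚ] M)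
    (hf : ∀ a b, f (a * b) = (counit a : ℚ) • f b + (counit b : ℚ) • f a) : Lsymb D →ₗ[ℚ] M :=
  (LinearMap.ker (toLsymb D)).liftQ f (ker_toLsymb_le hf) ∘ₗ
    ((toLsymb D).quotKerEquivOfSurjective (toLsymb_surjective D)).symm.toLinearMap

theorem liftLsymb_toLsymb {M : Type} [AddCommGroup M] [Module ℚ M] {f : Hsymb D →ₗ[ℚ] M}
    (hf : ∀ a b, f (a * b) = (counit a : ℚ) • f b + (counit b : ℚ) • f a) (x : Hsymb D) :
    liftLsymb f hf (toLsymb D x) = f x := by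
  have h : ((toLsymb D).quotKerEquivOfSurjective (toLsymb_surjective D)).symm (toLsymb D x)
      = Submodule.Quotient.mk x := by
    rw [LinearEquiv.symm_apply_eq]
    rfl
  rw [liftLsymb, LinearMap.comp_apply, LinearEquiv.coe_coe, h]
  rfl

/-- The map to the indecomposables, with values in the exterior algebra. Its convolution square is the
cobracket on `Hsymb D`. -/
def classMap (D : ℕ∞) : WithConv (Hsymb D →ₗ[ℚ] ExteriorAlgebra ℚ (Lsymb D)) :=
  toConv (ExteriorAlgebra.ι ℚ ∘ₗ toLsymb D)

theorem cobracketH_eq (x : Hsymb D) : cobracketH D x = (classMap D * classMap D) x := rfl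

theorem isInfinitesimal_classMap (D : ℕ∞) : IsInfinitesimal (classMap D) :=
  IsInfinitesimal.comp toLsymb_mul _

theorem isInfinitesimal_classMap_sq (D : ℕ∞) : IsInfinitesimal (classMap D * classMap D) :=
  (isInfinitesimal_classMap D).mul_self fun _ _ => ExteriorAlgebra.ι_add_mul_swap _ _

theorem cobracketH_mem (x : Hsymb D) : cobracketH D x ∈ ⋀[ℚ]^2 (Lsymb D) := by
  rw [cobracketH_eq, (ℛ ℚ x).convMul_apply]
  refine Submodule.sum_mem _ fun i _ => ?_
  rw [ExteriorAlgebra.exteriorPower, pow_two]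
  exact Submodule.mul_mem_mul ⟨_, rfl⟩ ⟨_, rfl⟩

/-- The cobracket on the indecomposables. -/
def cobracket (D : ℕ∞) : Lsymb D →ₗ[ℚ] ⋀[ℚ]^2 (Lsymb D) :=
  liftLsymb (LinearMap.codRestrict _ (cobracketH D) cobracketH_mem) fun a b => by
    ext1
    exact isInfinitesimal_classMap_sq D a b

theorem coe_cobracket_toLsymb (x : Hsymb D) :
    (cobracket D (toLsymb D x) : ExteriorAlgebra ℚ (Lsymb D)) = cobracketH D x := by
  rw [cobracket, liftLsymb_toLsymb]
  rfl

end Cobracket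

section ChevalleyEilenbergComplex

variable {M : Type} [AddCommGroup M] [Module ℚ M] (δ : M →ₗ[ℚ] ⋀[ℚ]^2 M)

theorem exteriorAlgebra_left_induction {p : ExteriorAlgebra ℚ M → Prop}
    (algebraMap : ∀ r : ℚ, p (algebraMap ℚ _ r)) (add : ∀ x y, p x → p y → p (x + y))
    (ι_mul : ∀ m x, p x → p (ExteriorAlgebra.ι ℚ m * x)) (x : ExteriorAlgebra ℚ M) : p x :=
  CliffordAlgebra.left_induction (Q := (0 : QuadraticForm ℚ M)) (P := p) algebraMap add
    (fun x m hx => ι_mul m x hx) x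

theorem ceDiff_algebraMap (r : ℚ) : ceDiff δ (algebraMap ℚ _ r) = 0 := by
  change ceMatrix δ (algebraMap ℚ (ExteriorAlgebra ℚ M) r) 0 1 = 0
  simp [AlgHom.commutes, Matrix.algebraMap_matrix_apply]

theorem ceDiff_mul_of_mem_sq {y : ExteriorAlgebra ℚ M} (hy : y ∈ ⋀[ℚ]^2 M)
    (z : ExteriorAlgebra ℚ M) : ceDiff δ (y * z) = ceDiff δ y * z + y * ceDiff δ z := by
  rw [ExteriorAlgebra.exteriorPower, pow_two] at hy
  refine Submodule.mul_induction_on hy ?_ fun a b ha hb => ?_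
  · rintro _ ⟨a, rfl⟩ _ ⟨b, rfl⟩
    rw [mul_assoc, ceDiff_ι_mul, ceDiff_ι_mul, ceDiff_ι_mul, ceDiff_ι]
    noncomm_ring
  · rw [add_mul, map_add, map_add, ha, hb]
    noncomm_ring

theorem ceDiff_ceDiff (h : ∀ a, ceDiff δ (δ a : ExteriorAlgebra ℚ M) = 0)
    (z : ExteriorAlgebra ℚ M) : ceDiff δ (ceDiff δ z) = 0 := by
  induction z using exteriorAlgebra_left_induction with
  | algebraMap r => rw [ceDiff_algebraMap, map_zero]
  | add x y hx hy => rw [map_add, map_add, hx, hy, add_zero]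
  | ι_mul m x hx =>
    rw [ceDiff_ι_mul, map_sub, ceDiff_mul_of_mem_sq _ (δ m).2, h, ceDiff_ι_mul, hx]
    noncomm_ring

theorem ceDiff_mem {k : ℕ} {z : ExteriorAlgebra ℚ M} (hz : z ∈ ⋀[ℚ]^k M) :
    ceDiff δ z ∈ ⋀[ℚ]^(k + 1) M := by
  induction k generalizing z with
  | zero =>
    rw [ExteriorAlgebra.exteriorPower, pow_zero, Submodule.mem_one] at hz
    obtain ⟨r, rfl⟩ := hz
    rw [ceDiff_algebraMap]
    exact Submodule.zero_mem _
  | succ k ih =>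
    rw [ExteriorAlgebra.exteriorPower, pow_succ'] at hz
    refine Submodule.mul_induction_on hz ?_ fun a b ha hb => ?_
    · rintro _ ⟨a, rfl⟩ y hy
      rw [ceDiff_ι_mul]
      refine Submodule.sub_mem _ ?_ ?_
      · rw [ExteriorAlgebra.exteriorPower, show k + 1 + 1 = 2 + k by ring, pow_add]
        exact Submodule.mul_mem_mul (δ a).2 hy
      · rw [ExteriorAlgebra.exteriorPower, pow_succ']
        exact Submodule.mul_mem_mul ⟨_, rfl⟩ (ih hy)
    · rw [map_add]
      exact Submodule.add_mem _ ha hb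

theorem ceDiff_mem_closure {s : Set M} (h : ∀ a ∈ s, (δ a : ExteriorAlgebra ℚ M) ∈
      Subring.closure (ExteriorAlgebra.ι ℚ '' s)) {z : ExteriorAlgebra ℚ M}
    (hz : z ∈ Subring.closure (ExteriorAlgebra.ι ℚ '' s)) :
    ceDiff δ z ∈ Subring.closure (ExteriorAlgebra.ι ℚ '' s) := by
  -- the entries of `ceMatrix δ z` are the grade involution of `z`, the differential of `z`, and `z`
  suffices hm : ceMatrix δ z 0 0 ∈ Subring.closure (ExteriorAlgebra.ι ℚ '' s) ∧
      ceMatrix δ z 0 1 ∈ Subring.closure (ExteriorAlgebra.ι ℚ '' s) from hm.2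
  induction hz using Subring.closure_induction with
  | mem x hx =>
    obtain ⟨a, ha, rfl⟩ := hx
    have hι := Subring.subset_closure (Set.mem_image_of_mem (ExteriorAlgebra.ι ℚ) ha)
    exact ⟨by simpa [ceMatrix] using hι, by simpa [ceMatrix] using h a ha⟩
  | zero => simp
  | one => simp
  | add x y _ _ hx hy =>
    simp only [map_add, Matrix.add_apply]
    exact ⟨Subring.add_mem _ hx.1 hy.1, Subring.add_mem _ hx.2 hy.2⟩
  | neg x _ hx =>
    simp only [map_neg, Matrix.neg_apply]
    exact ⟨Subring.neg_mem _ hx.1, Subring.neg_mem _ hx.2⟩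
  | mul x y _ hy hx' hy' =>
    simp only [map_mul, Matrix.mul_apply, Fin.sum_univ_two, (ceMatrix_one_one δ y).1,
      (ceMatrix_one_one δ y).2, mul_zero, add_zero]
    exact ⟨Subring.mul_mem _ hx'.1 hy'.1,
      Subring.add_mem _ (Subring.mul_mem _ hx'.1 hy'.2) (Subring.mul_mem _ hx'.2 hy)⟩

end ChevalleyEilenbergComplex

section CobracketSquare
open Coalgebra WithConv
variable {D : ℕ∞}

/-- Let `ℓ` be `classMap D`. As the differential of `ℓ` is `ℓ * ℓ`, the differential of `ℓ * ℓ` is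
`(ℓ * ℓ) * ℓ - ℓ * (ℓ * ℓ)`, which vanishes since the convolution product is associative. -/
theorem ceDiff_cobracket (a : Lsymb D) :
    ceDiff (cobracket D) (cobracket D a : ExteriorAlgebra ℚ (Lsymb D)) = 0 := by
  obtain ⟨x, rfl⟩ := toLsymb_surjective D a
  have h : ∀ x : Hsymb D, ceDiff (cobracket D) ((classMap D * classMap D) x)
      = (classMap D * classMap D * classMap D) x - (classMap D * (classMap D * classMap D)) x := by
    intro x
    rw [(ℛ ℚ x).convMul_apply, (ℛ ℚ x).convMul_apply, (ℛ ℚ x).convMul_apply, map_sum,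
      ← Finset.sum_sub_distrib]
    refine Finset.sum_congr rfl fun i _ => ?_
    refine (ceDiff_ι_mul _ _ _).trans ?_
    change _ - _ * ceDiff _ (ExteriorAlgebra.ι ℚ _) = _
    rw [ceDiff_ι, coe_cobracket_toLsymb, coe_cobracket_toLsymb]
    rfl
  rw [coe_cobracket_toLsymb, cobracketH_eq, h, mul_assoc, sub_self]

end CobracketSquare

/-! ### Words and weights -/

section Words

variable {V B : Type} [AddCommGroup V] [Module ℚ V] [Ring B] [Algebra ℚ B]

theorem tensorAlgebra_hom_ext {f g : TensorAlgebra ℚ V →ₗ[ℚ] B}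
    (h : ∀ (k : ℕ) (a : Fin k → V), f (TensorAlgebra.tprod ℚ V k a) = g (TensorAlgebra.tprod ℚ V k a)) :
    f = g := by
  have h' : f ∘ₗ (TensorAlgebra.equivDirectSum (R := ℚ) (M := V)).symm.toLinearMap
      = g ∘ₗ (TensorAlgebra.equivDirectSum (R := ℚ) (M := V)).symm.toLinearMap := by
    refine DirectSum.linearMap_ext ℚ fun k => PiTensorProduct.ext (MultilinearMap.ext fun a => ?_)
    have hk := TensorAlgebra.ofDirectSum_of_tprod (R := ℚ) (M := V) a
    change f (TensorAlgebra.ofDirectSum (DirectSum.of _ k (PiTensorProduct.tprod ℚ a)))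
      = g (TensorAlgebra.ofDirectSum (DirectSum.of _ k (PiTensorProduct.tprod ℚ a)))
    rw [hk]
    exact h k a
  refine LinearMap.ext fun t => ?_
  have := LinearMap.congr_fun h' ((TensorAlgebra.equivDirectSum (R := ℚ) (M := V)) t)
  simpa using this

/-- The linear map on the tensor algebra that is given by `φ k` on words of length `k`. -/
def tensorLift (φ : ∀ k : ℕ, MultilinearMap ℚ (fun _ : Fin k => V) B) :
    TensorAlgebra ℚ V →ₗ[ℚ] B :=
  DirectSum.toModule ℚ ℕ B (fun k => PiTensorProduct.lift (φ k)) ∘ₗ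
    (TensorAlgebra.equivDirectSum (R := ℚ) (M := V)).toLinearMap

theorem tensorLift_tprod (φ : ∀ k : ℕ, MultilinearMap ℚ (fun _ : Fin k => V) B) (k : ℕ)
    (a : Fin k → V) : tensorLift φ (TensorAlgebra.tprod ℚ V k a) = φ k a := by
  change DirectSum.toModule ℚ ℕ B (fun k => PiTensorProduct.lift (φ k))
    (TensorAlgebra.toDirectSum (TensorAlgebra.tprod ℚ V k a)) = _
  rw [TensorAlgebra.toDirectSum_tensorPower_tprod]
  refine (DirectSum.toModule_lof ℚ k _).trans ?_
  exact PiTensorProduct.lift.tprod _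

theorem tensorLift_ι_mul (φ : ∀ k : ℕ, MultilinearMap ℚ (fun _ : Fin k => V) B) (v : V)
    (t : TensorAlgebra ℚ V) : tensorLift φ (TensorAlgebra.ι ℚ v * t)
      = tensorLift (fun k => (φ (k + 1)).curryLeft v) t := by
  have h : tensorLift φ ∘ₗ LinearMap.mulLeft ℚ (TensorAlgebra.ι ℚ v)
      = tensorLift (fun k => (φ (k + 1)).curryLeft v) := by
    refine tensorAlgebra_hom_ext fun k a => ?_
    have h := tensorLift_tprod φ (k + 1) (Fin.cons v a)
    rw [tensorLift_tprod, MultilinearMap.curryLeft_apply, ← h]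
    simp [TensorAlgebra.tprod_apply, List.ofFn_succ]
  exact LinearMap.congr_fun h t

theorem tensorLift_one (φ : ∀ k : ℕ, MultilinearMap ℚ (fun _ : Fin k => V) B) :
    tensorLift φ 1 = φ 0 ![] := by
  rw [← tensorLift_tprod]
  simp [TensorAlgebra.tprod_apply]

end Words

section ConvolutionWords
open Coalgebra WithConv

variable {H V B : Type} [CommRing H] [Bialgebra ℚ H] [AddCommGroup V] [Module ℚ V] [Ring B]
  [Algebra ℚ B]

/-- The convolution product of `g 0 ∘ π, …, g (n - 1) ∘ π`. -/
def convSeq (π : H →ₗ[ℚ] V) : (ℕ → V →ₗ[ℚ] B) → ℕ → WithConv (H →ₗ[ℚ] B)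
  | _, 0 => 1
  | g, n + 1 => toConv (g 0 ∘ₗ π) * convSeq π (fun j => g (j + 1)) n

/-- A map on words that is a sum of products of linear maps of the letters, composed with the iterated
coproduct, is a sum of convolution products. -/
theorem tensorLift_pow (π : H →ₗ[ℚ] V) {I : Type} [Fintype I] (n : ℕ)
    (φ : ∀ k : ℕ, MultilinearMap ℚ (fun _ : Fin k => V) B) (b : I → B) (g : I → ℕ → V →ₗ[ℚ] B)
    (h : ∀ a, φ n a = ∑ i, b i * (List.ofFn fun j : Fin n => g i j (a j)).prod) (x : H) :
    tensorLift φ ((toConv (TensorAlgebra.ι ℚ ∘ₗ π) ^ n : WithConv (H →ₗ[ℚ] TensorAlgebra ℚ V)) x)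
      = ∑ i, b i * convSeq π (g i) n x := by
  induction n generalizing φ b g x with
  | zero =>
    rw [pow_zero, LinearMap.convOne_apply, Algebra.algebraMap_eq_smul_one, map_smul, tensorLift_one,
      h, Finset.smul_sum]
    refine Finset.sum_congr rfl fun i _ => ?_
    change _ = b i * algebraMap ℚ B _
    simp [Algebra.algebraMap_eq_smul_one]
  | succ n ih =>
    rw [pow_succ', (ℛ ℚ x).convMul_apply, map_sum]
    have h1 : ∀ v y, tensorLift φ (TensorAlgebra.ι ℚ v *
        (toConv (TensorAlgebra.ι ℚ ∘ₗ π) ^ n : WithConv (H →ₗ[ℚ] TensorAlgebra ℚ V)) y)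
        = ∑ i, b i * g i 0 v * convSeq π (fun j => g i (j + 1)) n y := by
      intro v y
      rw [tensorLift_ι_mul]
      refine ih _ (fun i => b i * g i 0 v) (fun i j => g i (j + 1)) (fun a => ?_) y
      rw [MultilinearMap.curryLeft_apply, h]
      refine Finset.sum_congr rfl fun i _ => ?_
      simp [List.ofFn_succ, mul_assoc]
    refine (Finset.sum_congr rfl fun j _ => h1 _ _).trans ?_
    rw [Finset.sum_comm]
    refine Finset.sum_congr rfl fun i _ => ?_
    rw [convSeq, (ℛ ℚ x).convMul_apply, Finset.mul_sum]
    refine Finset.sum_congr rfl fun j _ => ?_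
    rw [mul_assoc]
    rfl

theorem convSeq_const (π : H →ₗ[ℚ] V) (f : V →ₗ[ℚ] B) (n : ℕ) :
    convSeq π (fun _ => f) n = toConv (f ∘ₗ π) ^ n := by
  induction n with
  | zero => rfl
  | succ n ih => rw [convSeq, ih, pow_succ']

theorem convSeq_ite (π : H →ₗ[ℚ] V) (f f' : V →ₗ[ℚ] B) {i n : ℕ} (hi : i < n) :
    convSeq π (fun j => if j = i then f' else f) n
      = toConv (f ∘ₗ π) ^ i * toConv (f' ∘ₗ π) * toConv (f ∘ₗ π) ^ (n - 1 - i) := by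
  induction n generalizing i with
  | zero => omega
  | succ n ih =>
    cases i with
    | zero => simp [convSeq, convSeq_const]
    | succ i =>
      have := ih (i := i) (by omega)
      rw [convSeq]
      simp only [Nat.add_right_cancel_iff, this]
      rw [if_neg (by omega), pow_succ', show n + 1 - 1 - (i + 1) = n - 1 - i by omega]
      simp only [mul_assoc]

end ConvolutionWords

section Weights
open Coalgebra WithConv

variable {D : ℕ∞} {A : Type} [Ring A] [Algebra ℚ A]

theorem Gen.weight_ne_zero (g : Gen D) : g.weight ≠ 0 := by
  cases g with
  | log r => exact one_ne_zero
  | li s =>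
    have h := s.depth_pos
    exact (Finset.sum_pos (fun a _ => (s.wts a).pos) ⟨⟨0, h⟩, Finset.mem_univ _⟩).ne'

theorem weight_ne_zero {m : Gen D →₀ ℕ} (hm : m ≠ 0) : Finsupp.weight Gen.weight m ≠ 0 := by
  have := Finsupp.nonTorsionWeight_of ℕ (w := Gen.weight (D := D)) Gen.weight_ne_zero
  rwa [Ne, Finsupp.weight_eq_zero_iff_eq_zero]

theorem projOne_monomial (m : Gen D →₀ ℕ) : projOne D (MvPolynomial.monomial m 1)
    = if Finsupp.weight Gen.weight m = 1 then m.sum fun g e => e • leadGen D g else 0 := by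
  have h := (MvPolynomial.basisMonomials (Gen D) ℚ).constr_basis ℚ (fun m =>
    if Finsupp.weight Gen.weight m = 1 then m.sum fun g e => e • leadGen D g else 0) m
  rwa [MvPolynomial.coe_basisMonomials] at h

theorem symbol_monomial (m : Gen D →₀ ℕ) : symbol D (MvPolynomial.monomial m 1)
    = symbolAux D (Finsupp.weight Gen.weight m) (MvPolynomial.monomial m 1) := by
  have h := (MvPolynomial.basisMonomials (Gen D) ℚ).constr_basis ℚ (fun m =>
    symbolAux D (Finsupp.weight Gen.weight m) (MvPolynomial.monomial m 1)) m
  rwa [MvPolynomial.coe_basisMonomials] at h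

/-- A linear map is determined by its values on monomials. -/
theorem hsymb_hom_ext {M : Type} [AddCommGroup M] [Module ℚ M] {f g : Hsymb D →ₗ[ℚ] M}
    (h : ∀ m, f (MvPolynomial.monomial m 1) = g (MvPolynomial.monomial m 1)) : f = g :=
  (MvPolynomial.basisMonomials (Gen D) ℚ).ext fun m => by
    rw [MvPolynomial.coe_basisMonomials]; exact h m

open Classical in
theorem counit_monomial (m : Gen D →₀ ℕ) :
    counit (R := ℚ) (MvPolynomial.monomial m 1 : Hsymb D) = if m = 0 then 1 else 0 := by
  rw [counit_eq, MvPolynomial.constantCoeff_monomial]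

theorem projOne_mul (a b : Hsymb D) :
    projOne D (a * b) = (counit a : ℚ) • projOne D b + (counit b : ℚ) • projOne D a := by
  have h1 : projOne D 1 = 0 := by
    have := projOne_monomial (D := D) 0
    simpa using this
  have h : LinearMap.compr₂ (LinearMap.mul ℚ (Hsymb D)) (projOne D)
      = (LinearMap.lsmul ℚ (Hone D)).compl₁₂ (counit (R := ℚ)) (projOne D)
        + ((LinearMap.lsmul ℚ (Hone D)).compl₁₂ (counit (R := ℚ)) (projOne D)).flip := by
    refine hsymb_hom_ext fun m => hsymb_hom_ext fun n => ?_
    simp only [LinearMap.compr₂_apply, LinearMap.mul_apply', LinearMap.add_apply,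
      LinearMap.compl₁₂_apply, LinearMap.flip_apply,
      LinearMap.lsmul_apply, counit_monomial]
    rcases eq_or_ne m 0 with rfl | hm
    · simp [MvPolynomial.monomial_zero', h1]
    rcases eq_or_ne n 0 with rfl | hn
    · simp [MvPolynomial.monomial_zero', h1]
    have hm' := weight_ne_zero hm
    have hn' := weight_ne_zero hn
    rw [MvPolynomial.monomial_mul, mul_one, projOne_monomial, map_add, if_neg (by omega),
      if_neg hm, if_neg hn]
    simp
  exact LinearMap.congr_fun₂ h a b

theorem weightHom_monomial (c : ℚ) (m : Gen D →₀ ℕ) :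
    weightHom D c (MvPolynomial.monomial m 1)
      = c ^ Finsupp.weight Gen.weight m • MvPolynomial.monomial m 1 := by
  rw [weightHom, MvPolynomial.aeval_monomial, map_one, one_mul, MvPolynomial.smul_eq_C_mul,
    MvPolynomial.monomial_eq, Finsupp.weight_apply, map_one, one_mul]
  simp only [MvPolynomial.smul_eq_C_mul, mul_pow, Finsupp.prod_mul, ← map_pow]
  congr 1
  rw [Finsupp.sum, Finsupp.prod, ← map_prod, ← Finset.prod_pow_eq_pow_sum]
  simp only [smul_eq_mul, mul_comm _ (Gen.weight _), pow_mul]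

/-- The map `f` vanishes on the elements of weight different from `n`; this is expressed through
the automorphism that multiplies elements of weight `k` by `4 ^ k`. The base `4` is the square of a
rational number, as `coproduct_weightHom` requires, and its powers are distinct. -/
def HasWeight (n : ℕ) (f : WithConv (Hsymb D →ₗ[ℚ] A)) : Prop :=
  ∀ x, f (weightHom D (2 ^ 2) x) = ((2 : ℚ) ^ 2) ^ n • f x

theorem HasWeight.mul {m n : ℕ} {f g : WithConv (Hsymb D →ₗ[ℚ] A)} (hf : HasWeight m f)
    (hg : HasWeight n g) : HasWeight (m + n) (f * g) := fun x => by
  have hF : toConv (f.ofConv ∘ₗ (weightHom D (2 ^ 2)).toLinearMap) = ((2 : ℚ) ^ 2) ^ m • f := by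
    ext1; exact LinearMap.ext hf
  have hG : toConv (g.ofConv ∘ₗ (weightHom D (2 ^ 2)).toLinearMap) = ((2 : ℚ) ^ 2) ^ n • g := by
    ext1; exact LinearMap.ext hg
  have h := convMul_comp (weightHom D (2 ^ 2)).toLinearMap
    (fun x => coproduct_weightHom D two_ne_zero x) f g x
  rw [hF, hG, smul_mul_smul_comm, ← pow_add] at h
  exact h

theorem HasWeight.one : HasWeight 0 (1 : WithConv (Hsymb D →ₗ[ℚ] A)) := by
  have h : counit (R := ℚ) ∘ₗ (weightHom D (2 ^ 2)).toLinearMap = counit (R := ℚ) := by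
    refine hsymb_hom_ext fun m => ?_
    change counit (weightHom D (2 ^ 2) _) = _
    rw [weightHom_monomial, map_smul, counit_monomial]
    split_ifs with hm <;> simp [hm]
  intro x
  rw [LinearMap.convOne_apply, LinearMap.convOne_apply, pow_zero, one_smul]
  exact congrArg _ (LinearMap.congr_fun h x)

theorem HasWeight.pow {n : ℕ} {f : WithConv (Hsymb D →ₗ[ℚ] A)} (hf : HasWeight n f) (k : ℕ) :
    HasWeight (n * k) (f ^ k) := by
  induction k with
  | zero => exact HasWeight.one
  | succ k ih => rw [pow_succ]; exact ih.mul hf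

theorem HasWeight.apply_monomial {n : ℕ} {f : WithConv (Hsymb D →ₗ[ℚ] A)} (hf : HasWeight n f)
    {m : Gen D →₀ ℕ} (hm : Finsupp.weight Gen.weight m ≠ n) : f (MvPolynomial.monomial m 1) = 0 := by
  have h := hf (MvPolynomial.monomial m 1)
  rw [weightHom_monomial, map_smul, ← sub_eq_zero, ← sub_smul, smul_eq_zero, sub_eq_zero] at h
  refine h.resolve_left fun h => hm ?_
  exact pow_right_injective₀ (by norm_num) (by norm_num) h

theorem projOne_weightHom (x : Hsymb D) :
    projOne D (weightHom D (2 ^ 2) x) = ((2 : ℚ) ^ 2) • projOne D x := by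
  have h : projOne D ∘ₗ (weightHom D (2 ^ 2)).toLinearMap = ((2 : ℚ) ^ 2) • projOne D := by
    refine hsymb_hom_ext fun m => ?_
    rw [LinearMap.comp_apply, AlgHom.toLinearMap_apply, weightHom_monomial, map_smul,
      LinearMap.smul_apply, projOne_monomial]
    split_ifs with hm
    · rw [hm, pow_one]
    · simp
  exact LinearMap.congr_fun h x

theorem hasWeight_projOne (f : Hone D →ₗ[ℚ] A) : HasWeight 1 (toConv (f ∘ₗ projOne D)) := by
  intro x
  rw [pow_one, ofConv_toConv, LinearMap.comp_apply, LinearMap.comp_apply, projOne_weightHom, map_smul]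

end Weights

/-! ### Ring identities and the de Rham complex -/

section RingIdentities

variable {K : Type} [Ring K] [Algebra ℚ K]

theorem iterate_commutator (p q : K) (n : ℕ) :
    ∑ i : Fin (n + 1), ((-1 : ℚ) ^ (i : ℕ) * (n.choose i : ℚ)) • (p ^ (i : ℕ) * q * p ^ (n - i))
      = ((-LinearMap.mulLeft ℚ p + LinearMap.mulRight ℚ p) ^ n : Module.End ℚ K) q := by
  have hc : Commute (-LinearMap.mulLeft ℚ p : Module.End ℚ K) (LinearMap.mulRight ℚ p) :=
    (LinearMap.commute_mulLeft_right (R := ℚ) p p).neg_left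
  rw [hc.add_pow, LinearMap.sum_apply,
    ← Fin.sum_univ_eq_sum_range (fun i => ((-LinearMap.mulLeft ℚ p) ^ i * LinearMap.mulRight ℚ p ^ (n - i) *
      (n.choose i : Module.End ℚ K)) q) (n + 1)]
  refine Finset.sum_congr rfl fun i _ => ?_
  have h1 : ((n.choose i : Module.End ℚ K)) q = (n.choose i : ℚ) • q := by
    rw [Module.End.natCast_apply, Nat.cast_smul_eq_nsmul]
  have h2 : ((-1 : Module.End ℚ K)) ^ (i : ℕ) = algebraMap ℚ _ ((-1 : ℚ) ^ (i : ℕ)) := by simp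
  rw [neg_pow (LinearMap.mulLeft ℚ p), Module.End.mul_apply, h1, Module.End.mul_apply, Module.End.mul_apply,
    LinearMap.pow_mulLeft, LinearMap.pow_mulRight, h2, Module.algebraMap_end_apply]
  simp [smul_smul, mul_assoc]

/-- The alternating binomial sums of `p ^ i * q * p ^ (n - i)` are the iterated commutators of `q` with `p`. -/
theorem sum_choose_commutator_succ (p q : K) (n : ℕ) :
    ∑ i : Fin (n + 1 + 1), ((-1 : ℚ) ^ (i : ℕ) * ((n + 1).choose i : ℚ)) •
        (p ^ (i : ℕ) * q * p ^ (n + 1 - i))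
      = (∑ i : Fin (n + 1), ((-1 : ℚ) ^ (i : ℕ) * (n.choose i : ℚ)) •
          (p ^ (i : ℕ) * q * p ^ (n - i))) * p
        - p * ∑ i : Fin (n + 1), ((-1 : ℚ) ^ (i : ℕ) * (n.choose i : ℚ)) •
          (p ^ (i : ℕ) * q * p ^ (n - i)) := by
  rw [iterate_commutator, iterate_commutator, pow_succ', Module.End.mul_apply, LinearMap.add_apply,
    LinearMap.neg_apply, LinearMap.mulLeft_apply, LinearMap.mulRight_apply, neg_add_eq_sub]

theorem commutator_smul (p s : K) {c c' e : ℚ} (h : c = -(e * c')) :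
    p * (c • s) - c • s * p = e • c' • (s * p - p * s) := by
  rw [h, mul_smul_comm, smul_mul_assoc, ← smul_sub, smul_smul, neg_smul, ← smul_neg, neg_sub]

/-- If `a (n + 1)` is `1 / (n + 1)` times the commutator of `p` with `a n`, then the sums
`∑_{i + j = N} a i * a j` satisfy a similar recursion, as the commutator with `p` is a derivation. -/
theorem sum_antidiagonal_commutator (p : K) (a : ℕ → K) (h0 : a 0 = 0)
    (h : ∀ n, 1 ≤ n → p * a n - a n * p = ((n : ℚ) + 1) • a (n + 1)) {N : ℕ} :
    ((N : ℚ) + 1) • ∑ ij ∈ Finset.HasAntidiagonal.antidiagonal (N + 1), a ij.1 * a ij.2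
      = a 1 * a N + a N * a 1 + (p * ∑ ij ∈ Finset.HasAntidiagonal.antidiagonal N, a ij.1 * a ij.2
        - (∑ ij ∈ Finset.HasAntidiagonal.antidiagonal N, a ij.1 * a ij.2) * p) := by
  have e : ∀ n, p * a n - a n * p = ((n : ℚ) + 1) • a (n + 1) - if n = 0 then a 1 else 0 := by
    intro n
    rcases eq_or_ne n 0 with rfl | hn
    · simp [h0]
    · rw [h n (Nat.pos_of_ne_zero hn), if_neg hn, sub_zero]
  have h1 : ∑ ij ∈ Finset.HasAntidiagonal.antidiagonal (N + 1), (ij.1 : ℚ) • (a ij.1 * a ij.2)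
      = ∑ ij ∈ Finset.HasAntidiagonal.antidiagonal N, ((ij.1 : ℚ) + 1) • (a (ij.1 + 1) * a ij.2) := by
    rw [Finset.Nat.sum_antidiagonal_succ]
    simp
  have h2 : ∑ ij ∈ Finset.HasAntidiagonal.antidiagonal (N + 1), (ij.2 : ℚ) • (a ij.1 * a ij.2)
      = ∑ ij ∈ Finset.HasAntidiagonal.antidiagonal N, ((ij.2 : ℚ) + 1) • (a ij.1 * a (ij.2 + 1)) := by
    rw [Finset.Nat.sum_antidiagonal_succ']
    simp
  have h3 : ((N : ℚ) + 1) • ∑ ij ∈ Finset.HasAntidiagonal.antidiagonal (N + 1), a ij.1 * a ij.2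
      = ∑ ij ∈ Finset.HasAntidiagonal.antidiagonal (N + 1), (ij.1 : ℚ) • (a ij.1 * a ij.2)
        + ∑ ij ∈ Finset.HasAntidiagonal.antidiagonal (N + 1), (ij.2 : ℚ) • (a ij.1 * a ij.2) := by
    rw [← Finset.sum_add_distrib, Finset.smul_sum]
    refine Finset.sum_congr rfl fun ij hij => ?_
    rw [← add_smul]
    congr 1
    rw [Finset.HasAntidiagonal.mem_antidiagonal] at hij
    exact_mod_cast hij.symm
  have h4 : ∑ ij ∈ Finset.HasAntidiagonal.antidiagonal N, (if ij.1 = 0 then a 1 else 0) * a ij.2 = a 1 * a N := by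
    rw [Finset.sum_eq_single (0, N)]
    · simp
    · rintro ⟨i, j⟩ hij hne
      rw [Finset.HasAntidiagonal.mem_antidiagonal] at hij
      rw [if_neg, zero_mul]
      rintro rfl
      exact hne (Prod.ext rfl (by simpa using hij))
    · simp
  have h5 : ∑ ij ∈ Finset.HasAntidiagonal.antidiagonal N, a ij.1 * (if ij.2 = 0 then a 1 else 0) = a N * a 1 := by
    rw [Finset.sum_eq_single (N, 0)]
    · simp
    · rintro ⟨i, j⟩ hij hne
      rw [Finset.HasAntidiagonal.mem_antidiagonal] at hij
      rw [if_neg, mul_zero]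
      rintro rfl
      exact hne (Prod.ext (by simpa using hij) rfl)
    · simp
  have h6 : p * ∑ ij ∈ Finset.HasAntidiagonal.antidiagonal N, a ij.1 * a ij.2
        - (∑ ij ∈ Finset.HasAntidiagonal.antidiagonal N, a ij.1 * a ij.2) * p
      = ∑ ij ∈ Finset.HasAntidiagonal.antidiagonal N, ((p * a ij.1 - a ij.1 * p) * a ij.2
        + a ij.1 * (p * a ij.2 - a ij.2 * p)) := by
    rw [Finset.mul_sum, Finset.sum_mul, ← Finset.sum_sub_distrib]
    refine Finset.sum_congr rfl fun ij _ => ?_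
    noncomm_ring
  rw [h6, h3, h1, h2]
  simp only [e, sub_mul, mul_sub, Finset.sum_add_distrib, Finset.sum_sub_distrib, h4, h5,
    smul_mul_assoc, mul_smul_comm]
  abel

end RingIdentities

section DeRham

variable {D : ℕ∞}

/-- The inclusion of one-forms, `p ⊗ y ↦ p dy`. -/
def oneForm (D : ℕ∞) : FormPoly D ⊗[ℚ] Hone D →ₗ[ℚ] DeRham D :=
  TensorProduct.map LinearMap.id (ExteriorAlgebra.ι ℚ)

theorem oneForm_smul (p : FormPoly D) (t : FormPoly D ⊗[ℚ] Hone D) :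
    oneForm D (p • t) = (p ⊗ₜ 1 : DeRham D) * oneForm D t := by
  induction t with
  | zero => simp
  | add x y hx hy => rw [smul_add, map_add, hx, hy, map_add, mul_add]
  | tmul r v => simp [oneForm, TensorProduct.smul_tmul']

theorem deRhamD_tmul (p : FormPoly D) (η : ExteriorAlgebra ℚ (Hone D)) :
    deRhamD D (p ⊗ₜ η) = oneForm D (gradient D p) * (1 ⊗ₜ η) := by
  simp only [deRhamD, LinearMap.comp_apply, LinearMap.rTensor_tmul, Derivation.coeFn_coe,
    LinearEquiv.coe_coe]
  induction gradient D p with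
  | zero => simp
  | add x y hx hy => simp only [TensorProduct.add_tmul, map_add, hx, hy, add_mul]
  | tmul r v => simp [oneForm]

theorem degree_eq_span (k : ℕ) : DeRham.degree D k = Submodule.span ℚ
    {ω | ∃ (p : FormPoly D) (η : ExteriorAlgebra ℚ (Hone D)), η ∈ ⋀[ℚ]^k (Hone D) ∧ p ⊗ₜ η = ω} := by
  rw [DeRham.degree]
  refine le_antisymm ?_ (Submodule.span_le.2 ?_)
  · rintro _ ⟨t, rfl⟩
    induction t with
    | zero => simp
    | add x y hx hy => rw [map_add]; exact Submodule.add_mem _ hx hy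
    | tmul p η => exact Submodule.subset_span ⟨p, η, η.2, rfl⟩
  · rintro _ ⟨p, η, hη, rfl⟩
    exact ⟨p ⊗ₜ ⟨η, hη⟩, rfl⟩

theorem tmul_mem_degree {k : ℕ} (p : FormPoly D) {η : ExteriorAlgebra ℚ (Hone D)}
    (hη : η ∈ ⋀[ℚ]^k (Hone D)) : (p ⊗ₜ η : DeRham D) ∈ DeRham.degree D k :=
  ⟨p ⊗ₜ ⟨η, hη⟩, rfl⟩

theorem mul_mem_degree {k l : ℕ} {ω ω' : DeRham D} (h : ω ∈ DeRham.degree D k)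
    (h' : ω' ∈ DeRham.degree D l) : ω * ω' ∈ DeRham.degree D (k + l) := by
  rw [degree_eq_span] at h h'
  induction h, h' using Submodule.span_induction₂ with
  | mem_mem x y hx hy =>
    obtain ⟨p, η, hη, rfl⟩ := hx
    obtain ⟨p', η', hη', rfl⟩ := hy
    rw [Algebra.TensorProduct.tmul_mul_tmul]
    refine tmul_mem_degree _ ?_
    rw [ExteriorAlgebra.exteriorPower, pow_add]
    exact Submodule.mul_mem_mul hη hη'
  | zero_left => simp
  | zero_right => simp
  | add_left x y z _ _ _ hx hy => rw [add_mul]; exact Submodule.add_mem _ hx hy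
  | add_right x y z _ _ _ hx hy => rw [mul_add]; exact Submodule.add_mem _ hx hy
  | smul_left r x y _ _ h => rw [smul_mul_assoc]; exact Submodule.smul_mem _ _ h
  | smul_right r x y _ _ h => rw [mul_smul_comm]; exact Submodule.smul_mem _ _ h

theorem oneForm_mem (t : FormPoly D ⊗[ℚ] Hone D) : oneForm D t ∈ DeRham.degree D 1 := by
  induction t with
  | zero => simp
  | add x y hx hy => rw [map_add]; exact Submodule.add_mem _ hx hy
  | tmul p v => exact tmul_mem_degree p (by rw [ExteriorAlgebra.exteriorPower, pow_one]; exact ⟨v, rfl⟩)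

theorem exists_oneForm {ω : DeRham D} (h : ω ∈ DeRham.degree D 1) : ∃ t, oneForm D t = ω := by
  rw [degree_eq_span] at h
  induction h using Submodule.span_induction with
  | mem x hx =>
    obtain ⟨p, η, hη, rfl⟩ := hx
    rw [ExteriorAlgebra.exteriorPower, pow_one] at hη
    obtain ⟨v, rfl⟩ := hη
    exact ⟨p ⊗ₜ v, rfl⟩
  | zero => exact ⟨0, map_zero _⟩
  | add x y _ _ hx hy =>
    obtain ⟨t, rfl⟩ := hx
    obtain ⟨t', rfl⟩ := hy
    exact ⟨t + t', map_add _ _ _⟩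
  | smul c x _ hx =>
    obtain ⟨t, rfl⟩ := hx
    exact ⟨c • t, map_smul _ _ _⟩

theorem mul_swap_of_mem_degree_one {ω ω' : DeRham D} (h : ω ∈ DeRham.degree D 1)
    (h' : ω' ∈ DeRham.degree D 1) : ω * ω' + ω' * ω = 0 := by
  obtain ⟨t, rfl⟩ := exists_oneForm h
  obtain ⟨t', rfl⟩ := exists_oneForm h'
  induction t with
  | zero => simp
  | add x y hx hy =>
    rw [map_add, add_mul, mul_add, add_add_add_comm, hx (oneForm_mem _), hy (oneForm_mem _), add_zero]
  | tmul p v =>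
    induction t' with
    | zero => simp
    | add x y hx hy =>
      rw [map_add, add_mul, mul_add, add_add_add_comm, hx (oneForm_mem _), hy (oneForm_mem _),
        add_zero]
    | tmul p' v' =>
      simp only [oneForm, TensorProduct.map_tmul, Algebra.TensorProduct.tmul_mul_tmul]
      rw [LinearMap.id_apply, LinearMap.id_apply, mul_comm p' p, ← TensorProduct.tmul_add,
        ExteriorAlgebra.ι_add_mul_swap, TensorProduct.tmul_zero]

theorem tmul_one_comm (p : FormPoly D) (ω : DeRham D) : (p ⊗ₜ 1 : DeRham D) * ω = ω * p ⊗ₜ 1 := by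
  induction ω using TensorProduct.induction_on with
  | zero => simp
  | add x y hx hy => rw [mul_add, add_mul, hx, hy]
  | tmul r η => simp [mul_comm]

theorem deRhamD_tmul_one_mul (p : FormPoly D) (ω : DeRham D) : deRhamD D (p ⊗ₜ 1 * ω)
    = deRhamD D (p ⊗ₜ 1) * ω + p ⊗ₜ 1 * deRhamD D ω := by
  induction ω using TensorProduct.induction_on with
  | zero => simp
  | add x y hx hy => rw [mul_add, map_add, hx, hy, map_add, mul_add, mul_add]; abel
  | tmul r η =>
    have h1 : (r ⊗ₜ η : DeRham D) = r ⊗ₜ 1 * 1 ⊗ₜ η := by simp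
    rw [Algebra.TensorProduct.tmul_mul_tmul, one_mul, deRhamD_tmul, deRhamD_tmul, deRhamD_tmul,
      Derivation.leibniz, map_add, oneForm_smul, oneForm_smul, h1, ← Algebra.TensorProduct.one_def,
      mul_one, tmul_one_comm r]
    noncomm_ring

theorem deRhamD_mul_of_mem_degree_one {ω : DeRham D} (h : ω ∈ DeRham.degree D 1) (z : DeRham D) :
    deRhamD D (ω * z) = deRhamD D ω * z - ω * deRhamD D z := by
  obtain ⟨t, rfl⟩ := exists_oneForm h
  clear h
  induction t with
  | zero => simp
  | add x y hx hy => rw [map_add, add_mul, map_add, hx, hy, map_add]; noncomm_ring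
  | tmul p v =>
    have hv : (1 ⊗ₜ ExteriorAlgebra.ι ℚ v : DeRham D) ∈ DeRham.degree D 1 := oneForm_mem (1 ⊗ₜ v)
    induction z using TensorProduct.induction_on with
    | zero => simp
    | add x y hx hy => rw [mul_add, map_add, hx, hy, map_add]; noncomm_ring
    | tmul r η =>
      have h1 : oneForm D (p ⊗ₜ v) = p ⊗ₜ 1 * 1 ⊗ₜ ExteriorAlgebra.ι ℚ v := by simp [oneForm]
      have h2 : (1 ⊗ₜ ExteriorAlgebra.ι ℚ v * r ⊗ₜ η : DeRham D)
          = r ⊗ₜ (ExteriorAlgebra.ι ℚ v * η) := by simp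
      have h3 := mul_swap_of_mem_degree_one hv (oneForm_mem (gradient D r))
      have h4 : (1 ⊗ₜ (ExteriorAlgebra.ι ℚ v * η) : DeRham D)
          = 1 ⊗ₜ ExteriorAlgebra.ι ℚ v * 1 ⊗ₜ η := by simp
      have h5 : deRhamD D (1 ⊗ₜ ExteriorAlgebra.ι ℚ v) = 0 := by
        rw [deRhamD_tmul, Derivation.map_one_eq_zero, map_zero, zero_mul]
      have key : ∀ {K : Type} [Ring K] (d x p v g e : K), v * g + g * v = 0 →
          d * x + p * (g * (v * e)) = d * x - p * v * (g * e) := by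
        intro K _ d x p v g e h
        rw [← mul_assoc g, eq_neg_of_add_eq_zero_right h]
        noncomm_ring
      rw [h1, mul_assoc, h2, deRhamD_tmul_one_mul, deRhamD_tmul_one_mul, h5, mul_zero, add_zero,
        deRhamD_tmul r, deRhamD_tmul r, mul_assoc (deRhamD D (p ⊗ₜ 1)), h2, h4]
      exact key _ _ _ _ _ _ h3

theorem funOf_eq (v : Hone D) : funOf D v
    = (Finsupp.linearCombination ℚ (MvPolynomial.X : FormVar D → FormPoly D) v) ⊗ₜ 1 := rfl

theorem dOf_mem (v : Hone D) : dOf D v ∈ DeRham.degree D 1 := oneForm_mem (1 ⊗ₜ v)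

theorem deRhamD_funOf (v : Hone D) : deRhamD D (funOf D v) = dOf D v := by
  have h : deRhamD D ∘ₗ funOf D = dOf D := by
    ext y
    simp only [LinearMap.comp_apply, Finsupp.lsingle_apply, funOf_eq, deRhamD_tmul]
    simp [gradient, oneForm, dOf, ← Algebra.TensorProduct.one_def]
  exact LinearMap.congr_fun h v

theorem deRhamD_dOf (v : Hone D) : deRhamD D (dOf D v) = 0 := by
  change deRhamD D (1 ⊗ₜ ExteriorAlgebra.ι ℚ v) = 0
  rw [deRhamD_tmul, Derivation.map_one_eq_zero, map_zero, zero_mul]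

theorem funOf_comm (v : Hone D) (ω : DeRham D) : funOf D v * ω = ω * funOf D v :=
  tmul_one_comm _ _

theorem deRhamD_funOf_mul (v : Hone D) (ω : DeRham D) :
    deRhamD D (funOf D v * ω) = dOf D v * ω + funOf D v * deRhamD D ω := by
  rw [← deRhamD_funOf]
  exact deRhamD_tmul_one_mul _ _

theorem deRhamD_mul_funOf {ω : DeRham D} (hω : ω ∈ DeRham.degree D 1) (v : Hone D) :
    deRhamD D (ω * funOf D v) = deRhamD D ω * funOf D v - ω * dOf D v := by
  rw [deRhamD_mul_of_mem_degree_one hω, deRhamD_funOf]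

end DeRham

/-! ### The homogeneous parts of `w` -/

section OneForms
open Coalgebra WithConv

variable {D : ℕ∞}

/-- The coordinates of the weight one part, as functions. -/
def convFun (D : ℕ∞) : WithConv (Hsymb D →ₗ[ℚ] DeRham D) := toConv (funOf D ∘ₗ projOne D)

/-- The coordinates of the weight one part, as differentials. -/
def convDiff (D : ℕ∞) : WithConv (Hsymb D →ₗ[ℚ] DeRham D) := toConv (dOf D ∘ₗ projOne D)

/-- The composite of `tensorForm` with the iterated coproduct `Δ_{1,…,1}` of weight `n`. -/
def wDeg (D : ℕ∞) (n : ℕ) : WithConv (Hsymb D →ₗ[ℚ] DeRham D) :=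
  toConv (tensorForm D ∘ₗ symbolAux D n)

theorem symbolAux_eq_pow (n : ℕ) : symbolAux D n
    = (toConv (TensorAlgebra.ι ℚ ∘ₗ projOne D) ^ n :
      WithConv (Hsymb D →ₗ[ℚ] TensorAlgebra ℚ (Hone D))).ofConv := by
  induction n with
  | zero =>
    refine hsymb_hom_ext fun m => ?_
    rw [pow_zero, LinearMap.convOne_apply, counit_eq]
    rfl
  | succ n ih => rw [symbolAux, ih, pow_succ']; rfl

theorem w_monomial (m : Gen D →₀ ℕ) : w D (MvPolynomial.monomial m 1)
    = wDeg D (Finsupp.weight Gen.weight m) (MvPolynomial.monomial m 1) := by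
  rw [w, LinearMap.comp_apply, symbol_monomial]
  rfl

theorem hasWeight_wDeg (n : ℕ) : HasWeight n (wDeg D n) := by
  intro x
  have h := (hasWeight_projOne (D := D) (TensorAlgebra.ι ℚ)).pow n x
  rw [one_mul] at h
  change tensorForm D (symbolAux D n _) = _ • tensorForm D (symbolAux D n _)
  rw [symbolAux_eq_pow, h, map_smul]

theorem wDeg_eq (n : ℕ) : wDeg D n = ((-1 : ℚ) ^ (n + 1) / (n.factorial : ℚ)) •
    ∑ i : Fin n, ((-1 : ℚ) ^ (i : ℕ) * ((n - 1).choose i : ℚ)) •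
      (convFun D ^ (i : ℕ) * convDiff D * convFun D ^ (n - 1 - i)) := by
  set c : Fin n → ℚ := fun i => ((-1 : ℚ) ^ (n + 1) / (n.factorial : ℚ)) *
    ((-1 : ℚ) ^ (i : ℕ) * ((n - 1).choose i : ℚ)) with hc
  have h := tensorLift_pow (projOne D) n (wordForm D) (fun i : Fin n => algebraMap ℚ _ (c i))
    (fun i j => if j = (i : ℕ) then dOf D else funOf D) (fun a => by
      simp only [wordForm, smul_apply, sum_apply, Finset.smul_sum,
        smul_smul, ← Algebra.smul_def, hc]
      refine Finset.sum_congr rfl fun i _ => ?_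
      rw [MultilinearMap.compLinearMap_apply, MultilinearMap.mkPiAlgebraFin_apply]
      congr 3
      funext j
      simp only [Fin.ext_iff])
  ext1
  refine LinearMap.ext fun x => ?_
  have h1 : wDeg D n x = tensorLift (wordForm D) ((toConv (TensorAlgebra.ι ℚ ∘ₗ projOne D) ^ n :
      WithConv (Hsymb D →ₗ[ℚ] TensorAlgebra ℚ (Hone D))) x) := by
    rw [← symbolAux_eq_pow]; rfl
  refine (h1.trans (h x)).trans ?_
  simp only [← Algebra.smul_def, ofConv_smul, ofConv_sum, LinearMap.smul_apply,
    LinearMap.sum_apply, Finset.smul_sum, smul_smul]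
  refine Finset.sum_congr rfl fun i _ => ?_
  rw [convSeq_ite _ _ _ i.2]
  rfl

theorem wDeg_zero : wDeg D 0 = 0 := by
  rw [wDeg_eq]; simp

theorem wDeg_one : wDeg D 1 = convDiff D := by
  rw [wDeg_eq]; simp

/-- The recursion for the homogeneous parts of `w`: up to the factor `n + 1`, the part of weight `n + 1` is
the convolution commutator of the coordinates with the part of weight `n`. -/
theorem commutator_wDeg {n : ℕ} (hn : 1 ≤ n) : convFun D * wDeg D n - wDeg D n * convFun D
    = ((n : ℚ) + 1) • wDeg D (n + 1) := by
  obtain ⟨n, rfl⟩ := Nat.exists_eq_add_of_le' hn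
  have h := sum_choose_commutator_succ (convFun D) (convDiff D) n
  rw [wDeg_eq (n + 1 + 1), wDeg_eq (n + 1), Nat.add_sub_cancel, Nat.add_sub_cancel, h]
  refine commutator_smul (K := WithConv (Hsymb D →ₗ[ℚ] DeRham D)) _ _ ?_
  rw [Nat.factorial_succ (n + 1), pow_succ]
  push_cast
  field_simp
  ring

theorem isInfinitesimal_convFun : IsInfinitesimal (convFun D) := IsInfinitesimal.comp projOne_mul _

theorem isInfinitesimal_convDiff : IsInfinitesimal (convDiff D) :=
  IsInfinitesimal.comp projOne_mul _

/-- The map `w` kills products: as functions commute with forms, the convolution commutator with the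
coordinates preserves infinitesimal maps. -/
theorem isInfinitesimal_wDeg (n : ℕ) : IsInfinitesimal (wDeg D n) := by
  induction n with
  | zero => rw [wDeg_zero]; intro a b; simp
  | succ n ih =>
    rcases Nat.eq_zero_or_pos n with rfl | hn
    · rw [wDeg_one]; exact isInfinitesimal_convDiff
    · have h := (isInfinitesimal_convFun.commutator ih fun a b => funOf_comm _ _).smul
        ((n : ℚ) + 1)⁻¹
      rwa [commutator_wDeg hn, smul_smul, inv_mul_cancel₀ (by positivity), one_smul] at h

theorem convMul_mem_degree {f g : WithConv (Hsymb D →ₗ[ℚ] DeRham D)} {k l : ℕ}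
    (hf : ∀ x, f x ∈ DeRham.degree D k) (hg : ∀ x, g x ∈ DeRham.degree D l) (x : Hsymb D) :
    (f * g) x ∈ DeRham.degree D (k + l) := by
  rw [(ℛ ℚ x).convMul_apply]
  exact Submodule.sum_mem _ fun i _ => mul_mem_degree (hf _) (hg _)

theorem convFun_mem (x : Hsymb D) : convFun D x ∈ DeRham.degree D 0 := by
  refine tmul_mem_degree _ ?_
  rw [ExteriorAlgebra.exteriorPower, pow_zero]
  exact Submodule.one_le.1 le_rfl

theorem wDeg_mem (n : ℕ) (x : Hsymb D) : wDeg D n x ∈ DeRham.degree D 1 := by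
  induction n generalizing x with
  | zero => rw [wDeg_zero]; simp
  | succ n ih =>
    rcases Nat.eq_zero_or_pos n with rfl | hn
    · rw [wDeg_one]; exact dOf_mem _
    · have h : wDeg D (n + 1) = ((n : ℚ) + 1)⁻¹ •
          (convFun D * wDeg D n - wDeg D n * convFun D) := by
        rw [commutator_wDeg hn, smul_smul, inv_mul_cancel₀ (by positivity), one_smul]
      rw [h]
      exact Submodule.smul_mem _ _ (Submodule.sub_mem _ (convMul_mem_degree convFun_mem ih x)
        (convMul_mem_degree ih convFun_mem x))

/-- The exterior derivative of the values. -/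
def convD (f : WithConv (Hsymb D →ₗ[ℚ] DeRham D)) : WithConv (Hsymb D →ₗ[ℚ] DeRham D) :=
  toConv (deRhamD D ∘ₗ f.ofConv)

theorem convD_convFun_mul (f : WithConv (Hsymb D →ₗ[ℚ] DeRham D)) :
    convD (convFun D * f) = convDiff D * f + convFun D * convD f := by
  ext1
  refine LinearMap.ext fun x => ?_
  rw [ofConv_add, LinearMap.add_apply]
  change deRhamD D ((convFun D * f) x) = _
  rw [(ℛ ℚ x).convMul_apply, (ℛ ℚ x).convMul_apply, (ℛ ℚ x).convMul_apply, map_sum,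
    ← Finset.sum_add_distrib]
  exact Finset.sum_congr rfl fun i _ => deRhamD_funOf_mul _ _

theorem convD_mul_convFun {f : WithConv (Hsymb D →ₗ[ℚ] DeRham D)}
    (hf : ∀ x, f x ∈ DeRham.degree D 1) :
    convD (f * convFun D) = convD f * convFun D - f * convDiff D := by
  ext1
  refine LinearMap.ext fun x => ?_
  rw [ofConv_sub, LinearMap.sub_apply]
  change deRhamD D ((f * convFun D) x) = _
  rw [(ℛ ℚ x).convMul_apply, (ℛ ℚ x).convMul_apply, (ℛ ℚ x).convMul_apply, map_sum,
    ← Finset.sum_sub_distrib]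
  exact Finset.sum_congr rfl fun i _ => deRhamD_mul_funOf (hf _) _

/-- The Maurer–Cartan equation for the forms of weight `N`. Both sides satisfy the same recursion in `N`,
the left one by the Leibniz rule for `commutator_wDeg`. -/
theorem convD_wDeg (N : ℕ) : convD (wDeg D N)
    = ∑ ij ∈ Finset.HasAntidiagonal.antidiagonal N, wDeg D ij.1 * wDeg D ij.2 := by
  have hsmul : ∀ (c : ℚ) f, convD (c • f) = c • convD (D := D) f := fun c f => by
    ext1; simp [convD, LinearMap.comp_smul]
  have hsub : ∀ f g, convD (f - g) = convD f - convD (D := D) g := fun f g => by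
    ext1; simp [convD, LinearMap.comp_sub]
  induction N with
  | zero => simp [wDeg_zero]; ext1; simp [convD]
  | succ N ih =>
    rcases Nat.eq_zero_or_pos N with rfl | hN
    · rw [Finset.Nat.sum_antidiagonal_succ]
      simp only [wDeg_zero, zero_mul, Finset.HasAntidiagonal.antidiagonal_zero, zero_add,
        Finset.sum_singleton, mul_zero, wDeg_one]
      ext1
      exact LinearMap.ext fun x => deRhamD_dOf _
    · have h := sum_antidiagonal_commutator (convFun D) (wDeg D) wDeg_zero
        (fun n => commutator_wDeg) (N := N)
      rw [← ih] at h
      have hne : (N : ℚ) + 1 ≠ 0 := by positivity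
      refine (smul_right_injective _ hne) ?_
      simp only
      rw [h, ← hsmul, ← commutator_wDeg hN, hsub, convD_convFun_mul, convD_mul_convFun (wDeg_mem N),
        wDeg_one]
      abel

end OneForms

/-! ### The chain map -/

section ChainMap
open Coalgebra WithConv Filter

variable {D : ℕ∞}

/-- An element has finitely many homogeneous parts, and `wDeg D n` only sees the part of weight `n`. -/
theorem eventually_w_eq_sum (x : Hsymb D) :
    ∀ᶠ M in atTop, w D x = ∑ n ∈ Finset.range M, wDeg D n x := by
  induction x using MvPolynomial.induction_on' with
  | monomial m c =>
    filter_upwards [eventually_gt_atTop (Finsupp.weight Gen.weight m)] with M hM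
    have hm : (MvPolynomial.monomial m c : Hsymb D) = c • MvPolynomial.monomial m 1 := by
      rw [MvPolynomial.smul_monomial, smul_eq_mul, mul_one]
    simp only [hm, map_smul, ← Finset.smul_sum]
    congr 1
    rw [w_monomial, Finset.sum_eq_single (Finsupp.weight Gen.weight m)]
    · exact fun n _ hn => (hasWeight_wDeg n).apply_monomial hn.symm
    · exact fun h => absurd (Finset.mem_range.2 hM) h
  | add p q hp hq =>
    filter_upwards [hp, hq] with M hp hq
    simp only [map_add, hp, hq, Finset.sum_add_distrib]

theorem w_mul (a b : Hsymb D) :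
    w D (a * b) = (counit a : ℚ) • w D b + (counit b : ℚ) • w D a := by
  obtain ⟨M, hab, ha, hb⟩ := ((eventually_w_eq_sum (a * b)).and
    ((eventually_w_eq_sum a).and (eventually_w_eq_sum b))).exists
  rw [hab, ha, hb, Finset.smul_sum, Finset.smul_sum, ← Finset.sum_add_distrib]
  exact Finset.sum_congr rfl fun n _ => isInfinitesimal_wDeg n a b

theorem w_mem (x : Hsymb D) : w D x ∈ DeRham.degree D 1 := by
  obtain ⟨M, hM⟩ := (eventually_w_eq_sum x).exists
  rw [hM]
  exact Submodule.sum_mem _ fun n _ => wDeg_mem n x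

/-- The Maurer–Cartan equation: `dw` is the convolution square of `w`. -/
theorem deRhamD_w (x : Hsymb D) :
    deRhamD D (w D x) = (toConv (w D) * toConv (w D) : WithConv _) x := by
  have h : deRhamD D ∘ₗ w D = (toConv (w D) * toConv (w D) : WithConv _).ofConv := by
    refine hsymb_hom_ext fun m => ?_
    set N := Finsupp.weight Gen.weight m with hN
    set y : Hsymb D := MvPolynomial.monomial m 1 with hy
    have h1 : deRhamD D (w D y) = ∑ ij ∈ Finset.HasAntidiagonal.antidiagonal N,
        (wDeg D ij.1 * wDeg D ij.2) y := by
      have h2 := congrArg (fun f : WithConv (Hsymb D →ₗ[ℚ] DeRham D) => f y) (convD_wDeg (D := D) N)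
      simp only [ofConv_sum, LinearMap.sum_apply] at h2
      rw [hy, w_monomial]
      exact h2
    rw [LinearMap.comp_apply, h1, (ℛ ℚ y).convMul_apply]
    obtain ⟨M, hM, hl, hr⟩ := ((eventually_gt_atTop N).and
      (((ℛ ℚ y).index.eventually_all.2 fun i _ => eventually_w_eq_sum ((ℛ ℚ y).left i)).and
      ((ℛ ℚ y).index.eventually_all.2 fun i _ => eventually_w_eq_sum ((ℛ ℚ y).right i)))).exists
    have h3 : ∀ i ∈ (ℛ ℚ y).index, w D ((ℛ ℚ y).left i) * w D ((ℛ ℚ y).right i)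
        = ∑ ab ∈ Finset.range M ×ˢ Finset.range M,
          wDeg D ab.1 ((ℛ ℚ y).left i) * wDeg D ab.2 ((ℛ ℚ y).right i) := fun i hi => by
      rw [hl i hi, hr i hi, Finset.sum_mul_sum, Finset.sum_product]
    refine Eq.trans ?_ (Finset.sum_congr rfl h3).symm
    rw [Finset.sum_comm]
    simp only [← (ℛ ℚ y).convMul_apply]
    refine Finset.sum_subset (fun ij hij => ?_) fun ij _ hij => ?_
    · rw [Finset.HasAntidiagonal.mem_antidiagonal] at hij
      rw [Finset.mem_product, Finset.mem_range, Finset.mem_range]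
      omega
    · rw [Finset.HasAntidiagonal.mem_antidiagonal] at hij
      exact ((hasWeight_wDeg ij.1).mul (hasWeight_wDeg ij.2)).apply_monomial (Ne.symm hij)
  exact LinearMap.congr_fun h x

/-- The map `w` on indecomposables. -/
def wLsymb (D : ℕ∞) : Lsymb D →ₗ[ℚ] DeRham D := liftLsymb (w D) w_mul

theorem wLsymb_toLsymb (x : Hsymb D) : wLsymb D (toLsymb D x) = w D x := liftLsymb_toLsymb _ x

theorem wLsymb_mem (a : Lsymb D) : wLsymb D a ∈ DeRham.degree D 1 := by
  obtain ⟨x, rfl⟩ := toLsymb_surjective D a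
  rw [wLsymb_toLsymb]
  exact w_mem x

/-- The multiplicative extension of `w` to the exterior algebra. -/
def wWedge (D : ℕ∞) : ExteriorAlgebra ℚ (Lsymb D) →ₐ[ℚ] DeRham D :=
  ExteriorAlgebra.lift ℚ ⟨wLsymb D, fun a => by
    have h := mul_swap_of_mem_degree_one (wLsymb_mem a) (wLsymb_mem a)
    rw [← two_smul ℚ, smul_eq_zero] at h
    exact h.resolve_left two_ne_zero⟩

theorem wWedge_ι (a : Lsymb D) : wWedge D (ExteriorAlgebra.ι ℚ a) = wLsymb D a := by
  simp [wWedge]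

theorem wWedge_cobracket (a : Lsymb D) :
    wWedge D (cobracket D a : ExteriorAlgebra ℚ (Lsymb D)) = deRhamD D (wLsymb D a) := by
  obtain ⟨x, rfl⟩ := toLsymb_surjective D a
  rw [coe_cobracket_toLsymb, cobracketH_eq, algHom_convMul, wLsymb_toLsymb, deRhamD_w]
  have h : (wWedge D).toLinearMap ∘ₗ (classMap D).ofConv = w D := by
    refine LinearMap.ext fun y => ?_
    exact (wWedge_ι _).trans (wLsymb_toLsymb y)
  rw [h]

theorem deRhamD_algebraMap (r : ℚ) : deRhamD D (algebraMap ℚ _ r) = 0 := by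
  rw [Algebra.algebraMap_eq_smul_one, map_smul, Algebra.TensorProduct.one_def, deRhamD_tmul,
    Derivation.map_one_eq_zero, map_zero, zero_mul, smul_zero]

theorem wWedge_ceDiff (z : ExteriorAlgebra ℚ (Lsymb D)) :
    wWedge D (ceDiff (cobracket D) z) = deRhamD D (wWedge D z) := by
  induction z using exteriorAlgebra_left_induction with
  | algebraMap r => rw [ceDiff_algebraMap, map_zero, AlgHom.commutes, deRhamD_algebraMap]
  | add x y hx hy => rw [map_add, map_add, hx, hy, map_add, map_add]
  | ι_mul a x hx =>
    rw [ceDiff_ι_mul, map_sub, map_mul, map_mul, map_mul, hx, wWedge_cobracket, wWedge_ι,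
      deRhamD_mul_of_mem_degree_one (wLsymb_mem a)]

theorem wWedge_mem {k : ℕ} {z : ExteriorAlgebra ℚ (Lsymb D)} (hz : z ∈ ⋀[ℚ]^k (Lsymb D)) :
    wWedge D z ∈ DeRham.degree D k := by
  induction k generalizing z with
  | zero =>
    rw [ExteriorAlgebra.exteriorPower, pow_zero, Submodule.mem_one] at hz
    obtain ⟨r, rfl⟩ := hz
    rw [AlgHom.commutes, Algebra.algebraMap_eq_smul_one, Algebra.TensorProduct.one_def]
    refine Submodule.smul_mem _ _ (tmul_mem_degree _ ?_)
    rw [ExteriorAlgebra.exteriorPower, pow_zero]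
    exact Submodule.one_le.1 le_rfl
  | succ k ih =>
    rw [ExteriorAlgebra.exteriorPower, pow_succ'] at hz
    refine Submodule.mul_induction_on hz ?_ fun a b ha hb => ?_
    · rintro _ ⟨a, rfl⟩ y hy
      rw [map_mul, wWedge_ι, add_comm]
      exact mul_mem_degree (wLsymb_mem a) (ih hy)
    · rw [map_add]
      exact Submodule.add_mem _ ha hb

end ChainMap

section Inclusion
open Coalgebra WithConv

variable {D : ℕ∞}

theorem Gen.weight_incl (g : Gen D) : g.incl.weight = g.weight := by cases g <;> rfl

theorem weight_mapDomain_incl (m : Gen D →₀ ℕ) :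
    Finsupp.weight Gen.weight (m.mapDomain Gen.incl) = Finsupp.weight Gen.weight m := by
  rw [Finsupp.weight_apply, Finsupp.weight_apply, Finsupp.sum_mapDomain_index (by simp)
    (by simp [add_mul])]
  simp only [Gen.weight_incl]

theorem leadGen_incl (g : Gen D) :
    leadGen ⊤ g.incl = Finsupp.lmapDomain ℚ ℚ FormVar.incl (leadGen D g) := by
  cases g with
  | log r => simp [leadGen, Gen.incl, FormVar.incl]
  | li s =>
    simp only [leadGen, Gen.incl]
    split_ifs with h
    · rw [map_neg]
      simp [FormVar.incl]
    · rw [map_zero]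

theorem incl_monomial (m : Gen D →₀ ℕ) : Hsymb.incl D (MvPolynomial.monomial m 1)
    = MvPolynomial.monomial (m.mapDomain Gen.incl) 1 := MvPolynomial.rename_monomial _ _ _

theorem projOne_incl (x : Hsymb D) : projOne ⊤ (Hsymb.incl D x)
    = Finsupp.lmapDomain ℚ ℚ FormVar.incl (projOne D x) := by
  have h : projOne ⊤ ∘ₗ (Hsymb.incl D).toLinearMap
      = Finsupp.lmapDomain ℚ ℚ FormVar.incl ∘ₗ projOne D := by
    refine hsymb_hom_ext fun m => ?_
    rw [LinearMap.comp_apply, LinearMap.comp_apply, AlgHom.toLinearMap_apply, incl_monomial,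
      projOne_monomial, projOne_monomial, weight_mapDomain_incl]
    split_ifs
    · rw [Finsupp.sum_mapDomain_index (by simp) (by simp [add_smul]), map_finsuppSum]
      simp only [leadGen_incl, map_nsmul]
    · rw [map_zero]
  exact LinearMap.congr_fun h x

theorem funOf_lmapDomain (v : Hone D) :
    funOf ⊤ (Finsupp.lmapDomain ℚ ℚ FormVar.incl v) = DeRham.incl D (funOf D v) := by
  have h : funOf ⊤ ∘ₗ Finsupp.lmapDomain ℚ ℚ FormVar.incl
      = (DeRham.incl D).toLinearMap ∘ₗ funOf D := by
    ext y
    simp [funOf, DeRham.incl]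
  exact LinearMap.congr_fun h v

theorem dOf_lmapDomain (v : Hone D) :
    dOf ⊤ (Finsupp.lmapDomain ℚ ℚ FormVar.incl v) = DeRham.incl D (dOf D v) := by
  simp [dOf, DeRham.incl]

theorem convMul_incl {f g : WithConv (Hsymb ⊤ →ₗ[ℚ] DeRham ⊤)}
    {f' g' : WithConv (Hsymb D →ₗ[ℚ] DeRham D)}
    (hf : ∀ x, f (Hsymb.incl D x) = DeRham.incl D (f' x))
    (hg : ∀ x, g (Hsymb.incl D x) = DeRham.incl D (g' x)) (x : Hsymb D) :
    (f * g) (Hsymb.incl D x) = DeRham.incl D ((f' * g') x) := by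
  have hF : f.ofConv ∘ₗ (Hsymb.incl D).toLinearMap = (DeRham.incl D).toLinearMap ∘ₗ f'.ofConv :=
    LinearMap.ext hf
  have hG : g.ofConv ∘ₗ (Hsymb.incl D).toLinearMap = (DeRham.incl D).toLinearMap ∘ₗ g'.ofConv :=
    LinearMap.ext hg
  have h := convMul_comp (Hsymb.incl D).toLinearMap (fun x => coproduct_incl D x) f g x
  rw [hF, hG, ← algHom_convMul] at h
  exact h

theorem wDeg_incl (n : ℕ) (x : Hsymb D) :
    wDeg ⊤ n (Hsymb.incl D x) = DeRham.incl D (wDeg D n x) := by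
  have hp : ∀ x, convFun ⊤ (Hsymb.incl D x) = DeRham.incl D (convFun D x) := fun x => by
    change funOf ⊤ (projOne ⊤ _) = DeRham.incl D (funOf D (projOne D x))
    rw [projOne_incl, funOf_lmapDomain]
  induction n generalizing x with
  | zero => simp [wDeg_zero]
  | succ n ih =>
    rcases Nat.eq_zero_or_pos n with rfl | hn
    · rw [wDeg_one, wDeg_one]
      change dOf ⊤ (projOne ⊤ _) = DeRham.incl D (dOf D (projOne D x))
      rw [projOne_incl, dOf_lmapDomain]
    · have h : ∀ E : ℕ∞, wDeg E (n + 1) = ((n : ℚ) + 1)⁻¹ •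
          (convFun E * wDeg E n - wDeg E n * convFun E) := fun E => by
        rw [commutator_wDeg hn, smul_smul, inv_mul_cancel₀ (by positivity), one_smul]
      rw [h, h, ofConv_smul, ofConv_smul, ofConv_sub, ofConv_sub, LinearMap.smul_apply,
        LinearMap.smul_apply, LinearMap.sub_apply, LinearMap.sub_apply, convMul_incl hp ih,
        convMul_incl ih hp, map_smul, map_sub]

theorem w_incl (x : Hsymb D) : w ⊤ (Hsymb.incl D x) = DeRham.incl D (w D x) := by
  have h : w ⊤ ∘ₗ (Hsymb.incl D).toLinearMap = (DeRham.incl D).toLinearMap ∘ₗ w D := by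
    refine hsymb_hom_ext fun m => ?_
    rw [LinearMap.comp_apply, LinearMap.comp_apply, AlgHom.toLinearMap_apply,
      AlgHom.toLinearMap_apply, w_monomial, ← wDeg_incl, incl_monomial, w_monomial,
      weight_mapDomain_incl]
  exact LinearMap.congr_fun h x

end Inclusion

/-! ### Integrality -/

section IntegralSeries

variable {R τ σ : Type} [CommRing R] (S : Subring R)

/-- The power series with coefficients in a subring. -/
def seriesSubring (τ : Type) (S : Subring R) : Subring (MvPowerSeries τ R) where
  carrier := {f | ∀ e, MvPowerSeries.coeff e f ∈ S}
  mul_mem' {f g} hf hg e := by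
    classical
    rw [MvPowerSeries.coeff_mul]
    exact S.sum_mem fun ij _ => S.mul_mem (hf _) (hg _)
  one_mem' e := by
    classical
    rw [MvPowerSeries.coeff_one]
    split_ifs
    exacts [S.one_mem, S.zero_mem]
  add_mem' {f g} hf hg e := by rw [map_add]; exact S.add_mem (hf e) (hg e)
  zero_mem' e := by rw [map_zero]; exact S.zero_mem
  neg_mem' {f} hf e := by rw [map_neg]; exact S.neg_mem (hf e)

variable {S}

theorem X_mem_seriesSubring (i : τ) : (MvPowerSeries.X i : MvPowerSeries τ R) ∈ seriesSubring τ S := by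
  classical
  intro e
  rw [MvPowerSeries.coeff_X]
  split_ifs
  exacts [S.one_mem, S.zero_mem]

theorem divVar_mem_seriesSubring (j : τ) {f : MvPowerSeries τ R} (hf : f ∈ seriesSubring τ S) :
    divVar j f ∈ seriesSubring τ S := fun e => hf (e + Finsupp.single j 1)

theorem subst_mem_seriesSubring {s : σ → MvPowerSeries τ R} (hs : MvPowerSeries.HasSubst s)
    (hS : ∀ i, s i ∈ seriesSubring τ S) {f : MvPowerSeries σ R} (hf : f ∈ seriesSubring σ S) :
    MvPowerSeries.subst s f ∈ seriesSubring τ S := by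
  intro e
  rw [MvPowerSeries.coeff_subst hs]
  refine finsum_induction (· ∈ S) S.zero_mem (fun _ _ => S.add_mem) fun d => ?_
  exact S.mul_mem (hf d) ((seriesSubring τ S).prod_mem (fun i _ =>
    (seriesSubring τ S).pow_mem (hS i) _) e)

theorem expSer_smul_mem_seriesSubring [Algebra ℚ R] {c : R}
    (hc : ∀ n : ℕ, (n.factorial : ℚ)⁻¹ • c ^ n ∈ S) {s : MvPowerSeries τ R}
    (hs : MvPowerSeries.constantCoeff s = 0) (hS : s ∈ seriesSubring τ S) :
    expSer (c • s) ∈ seriesSubring τ S := by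
  intro e
  rw [expSer, PowerSeries.coeff_subst (PowerSeries.HasSubst.of_constantCoeff_zero (by simp [hs]))]
  refine finsum_induction (· ∈ S) S.zero_mem (fun _ _ => S.add_mem) fun n => ?_
  have h : PowerSeries.coeff n (PowerSeries.exp R) • MvPowerSeries.coeff e ((c • s) ^ n)
      = ((n.factorial : ℚ)⁻¹ • c ^ n) * MvPowerSeries.coeff e (s ^ n) := by
    rw [PowerSeries.coeff_exp, smul_pow, map_smul, smul_eq_mul, smul_eq_mul, one_div,
      Algebra.smul_def, mul_assoc]
  rw [h]
  exact S.mul_mem (hc n) ((seriesSubring τ S).pow_mem hS n e)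

end IntegralSeries

section Integrality
open Coalgebra WithConv

variable {D : ℕ∞} {τ : Type}

/-- The classes of the generators span the integral form of the indecomposables. -/
def integralClasses (D : ℕ∞) : AddSubgroup (Lsymb D) :=
  AddSubgroup.closure (Set.range fun g : Gen D => toLsymb D (MvPolynomial.X g))

/-- The elements whose augmentation is an integer and whose class in the indecomposables is an
integral combination of the classes of the generators. -/
def integralElements (D : ℕ∞) : Subring (Hsymb D) where
  carrier := {x | (∃ n : ℤ, counit (R := ℚ) x = n) ∧ toLsymb D x ∈ integralClasses D}
  mul_mem' := by
    rintro x y ⟨⟨m, hm⟩, hx⟩ ⟨⟨n, hn⟩, hy⟩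
    refine ⟨⟨m * n, by rw [Bialgebra.counit_mul, hm, hn]; push_cast; rfl⟩, ?_⟩
    rw [toLsymb_mul, hm, hn, Int.cast_smul_eq_zsmul, Int.cast_smul_eq_zsmul]
    exact add_mem (zsmul_mem hy m) (zsmul_mem hx n)
  one_mem' := ⟨⟨1, by simp⟩, by
    rw [← MvPolynomial.C_1, toLsymb_C]; exact zero_mem _⟩
  add_mem' := by
    rintro x y ⟨⟨m, hm⟩, hx⟩ ⟨⟨n, hn⟩, hy⟩
    refine ⟨⟨m + n, by rw [map_add, hm, hn]; push_cast; rfl⟩, ?_⟩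
    rw [map_add]
    exact add_mem hx hy
  zero_mem' := ⟨⟨0, by simp⟩, by rw [map_zero]; exact zero_mem _⟩
  neg_mem' := by
    rintro x ⟨⟨m, hm⟩, hx⟩
    refine ⟨⟨-m, by rw [map_neg, hm]; push_cast; rfl⟩, ?_⟩
    rw [map_neg]
    exact neg_mem hx

theorem X_mem_integralElements (g : Gen D) : MvPolynomial.X g ∈ integralElements D :=
  ⟨⟨0, by rw [counit_eq]; simp⟩, AddSubgroup.subset_closure ⟨g, rfl⟩⟩

theorem bracket_mem_integralElements (m : ℕ) (p : ℕ → ℕ) (n : Fin m → ℕ+) :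
    bracket D m p n ∈ integralElements D := by
  rw [bracket]
  split_ifs
  exacts [one_mem _, X_mem_integralElements _, zero_mem _]

theorem counit_logBracket (i j : ℕ) : counit (R := ℚ) (logBracket D i j) = 0 := augHom_logBracket i j

theorem logBracket_mem_integralElements (i j : ℕ) : logBracket D i j ∈ integralElements D := by
  refine sum_mem fun r _ => ?_
  split_ifs
  exacts [X_mem_integralElements _, zero_mem _]

/-- The divided powers of an integral element of augmentation zero are integral: from the second
one on they are decomposable. -/
theorem dividedPower_mem_integralElements {x : Hsymb D} (hx : x ∈ integralElements D)
    (h0 : counit (R := ℚ) x = 0) (n : ℕ) : (n.factorial : ℚ)⁻¹ • x ^ n ∈ integralElements D := by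
  match n with
  | 0 => simp [one_mem]
  | 1 => simpa using hx
  | n + 2 =>
    have hc : counit (R := ℚ) (x ^ (n + 1)) = 0 := by
      rw [pow_succ, Bialgebra.counit_mul, h0, mul_zero]
    refine ⟨⟨0, ?_⟩, ?_⟩
    · rw [map_smul, pow_succ, Bialgebra.counit_mul, h0, mul_zero, smul_zero, Int.cast_zero]
    · rw [map_smul, pow_succ, toLsymb_mul, h0, hc, zero_smul, zero_smul, add_zero, smul_zero]
      exact zero_mem _

theorem liAt_mem_seriesSubring (m : ℕ) (p : ℕ → ℕ) {s : Fin m → MvPowerSeries τ (Hsymb D)}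
    (hs : ∀ i, MvPowerSeries.constantCoeff (s i) = 0)
    (hS : ∀ i, s i ∈ seriesSubring τ (integralElements D)) :
    liAt D m p s ∈ seriesSubring τ (integralElements D) :=
  subst_mem_seriesSubring (hasSubst_zero hs) hS fun _ => bracket_mem_integralElements _ _ _

theorem expAt_mem_seriesSubring (i j : ℕ) {s : MvPowerSeries τ (Hsymb D)}
    (hs : MvPowerSeries.constantCoeff s = 0) (hS : s ∈ seriesSubring τ (integralElements D)) :
    expAt D (logBracket D i j) s ∈ seriesSubring τ (integralElements D) :=
  expSer_smul_mem_seriesSubring (dividedPower_mem_integralElements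
    (logBracket_mem_integralElements i j) (counit_logBracket i j)) hs hS

theorem tvar_mem_seriesSubring (m i : ℕ) :
    tvar D m i ∈ seriesSubring (Fin m) (integralElements D) := by
  unfold tvar
  split_ifs
  exacts [X_mem_seriesSubring _, zero_mem _]

theorem invSeries_mem_seriesSubring (m : ℕ) (p : ℕ → ℕ) :
    invSeries D m p ∈ seriesSubring (Fin m) (integralElements D) := by
  induction m using Nat.strong_induction_on with
  | _ m ih =>
    rcases eq_or_ne m 0 with rfl | hm
    · rw [invSeries, if_pos rfl]
      exact one_mem _
    have ht := tvar_mem_seriesSubring (D := D) m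
    have ht0 := constantCoeff_tvar (D := D) m
    have hd : ∀ i j, tvar D m i - tvar D m j ∈ seriesSubring (Fin m) (integralElements D) :=
      fun i j => sub_mem (ht i) (ht j)
    have hd0 : ∀ i j, MvPowerSeries.constantCoeff (tvar D m i - tvar D m j) = 0 := fun i j => by
      rw [map_sub, ht0, ht0, sub_zero]
    have hsign : ∀ n : ℕ, (-1 : MvPowerSeries (Fin m) (Hsymb D)) ^ n
        ∈ seriesSubring (Fin m) (integralElements D) := fun n => pow_mem (neg_mem (one_mem _)) n
    have hinv : ∀ (j : Fin m) (s : Fin (j : ℕ) → MvPowerSeries (Fin m) (Hsymb D)),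
        (∀ i, MvPowerSeries.constantCoeff (s i) = 0) →
        (∀ i, s i ∈ seriesSubring (Fin m) (integralElements D)) →
        invAt D j p s ∈ seriesSubring (Fin m) (integralElements D) := fun j s hs hS =>
      subst_mem_seriesSubring (hasSubst_zero hs) hS (ih j j.2)
    rw [invSeries_eq hm]
    refine add_mem (sum_mem fun j _ => mul_mem (hsign _) (mul_mem ?_ ?_))
      (sum_mem fun j _ => mul_mem (hsign _) (divVar_mem_seriesSubring _ (sub_mem
        (mul_mem ?_ ?_) (mul_mem (mul_mem ?_ ?_) ?_))))
    · exact hinv _ _ (fun i => ht0 i) fun i => ht i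
    · exact liAt_mem_seriesSubring _ _ (fun i => ht0 _) fun i => ht _
    · exact hinv _ _ (fun i => ht0 i) fun i => ht i
    · exact liAt_mem_seriesSubring _ _ (fun i => ht0 _) fun i => ht _
    · exact hinv _ _ (fun i => hd0 _ _) fun i => hd _ _
    · exact expAt_mem_seriesSubring _ _ (ht0 j) (ht j)
    · exact liAt_mem_seriesSubring _ _ (fun i => hd0 _ _) fun i => hd _ _

theorem blockSeries_mem_seriesSubring (d : ℕ) (p : ℕ → ℕ) (a b c : ℕ) :
    blockSeries D d p a b c ∈ seriesSubring (Fin d) (integralElements D) := by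
  have ht := tvar_mem_seriesSubring (D := D) d
  have ht0 := constantCoeff_tvar (D := D) d
  have hd0 : ∀ i j, MvPowerSeries.constantCoeff (tvar D d i - tvar D d j) = 0 := fun i j => by
    rw [map_sub, ht0, ht0, sub_zero]
  refine mul_mem (mul_mem (mul_mem (pow_mem (neg_mem (one_mem _)) _)
    (expAt_mem_seriesSubring _ _ (ht0 b) (ht b))) ?_) ?_
  · exact subst_mem_seriesSubring (hasSubst_zero fun i => hd0 _ _) (fun i => sub_mem (ht _) (ht _))
      (invSeries_mem_seriesSubring _ _)
  · exact liAt_mem_seriesSubring _ _ (fun i => hd0 _ _) fun i => sub_mem (ht _) (ht _)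

theorem classMap_mem_integralForms {x : Hsymb D} (hx : x ∈ integralElements D) :
    classMap D x ∈ integralForms D := by
  change ExteriorAlgebra.ι ℚ (toLsymb D x) ∈ integralForms D
  obtain ⟨_, hx⟩ := hx
  generalize toLsymb D x = y at hx
  induction hx using AddSubgroup.closure_induction with
  | mem y hy =>
    obtain ⟨g, rfl⟩ := hy
    exact Subring.subset_closure ⟨g, rfl⟩
  | zero => rw [map_zero]; exact zero_mem _
  | add y z _ _ hy hz => rw [map_add]; exact add_mem hy hz
  | neg y _ hy => rw [map_neg]; exact neg_mem hy

/-- The map `x ⊗ y ↦ [x] ∧ [y]`. -/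
def classWedge (D : ℕ∞) : Hsymb D ⊗[ℚ] Hsymb D →ₗ[ℚ] ExteriorAlgebra ℚ (Lsymb D) :=
  LinearMap.mul' ℚ (ExteriorAlgebra ℚ (Lsymb D)) ∘ₗ
    TensorProduct.map (classMap D).ofConv (classMap D).ofConv

theorem classWedge_coeff_mem {d : ℕ} {F G : MvPowerSeries (Fin d) (Hsymb D)}
    (hF : F ∈ seriesSubring (Fin d) (integralElements D))
    (hG : G ∈ seriesSubring (Fin d) (integralElements D)) (e : Fin d →₀ ℕ) :
    classWedge D (MvPowerSeries.coeff e
      (MvPowerSeries.map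
          (Algebra.TensorProduct.includeLeft : Hsymb D →ₐ[ℚ] Hsymb D ⊗[ℚ] Hsymb D).toRingHom F *
        MvPowerSeries.map
          (Algebra.TensorProduct.includeRight : Hsymb D →ₐ[ℚ] Hsymb D ⊗[ℚ] Hsymb D).toRingHom G))
      ∈ integralForms D := by
  classical
  rw [MvPowerSeries.coeff_mul, map_sum]
  refine sum_mem fun ij _ => ?_
  rw [MvPowerSeries.coeff_map, MvPowerSeries.coeff_map]
  have h : ∀ x y : Hsymb D, classWedge D
      ((Algebra.TensorProduct.includeLeft : Hsymb D →ₐ[ℚ] Hsymb D ⊗[ℚ] Hsymb D).toRingHom x *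
        (Algebra.TensorProduct.includeRight : Hsymb D →ₐ[ℚ] Hsymb D ⊗[ℚ] Hsymb D).toRingHom y)
      = classMap D x * classMap D y := fun x y => by simp [classWedge]
  rw [h]
  exact mul_mem (classMap_mem_integralForms (hF _)) (classMap_mem_integralForms (hG _))

/-- The coefficients of the series in the coproduct formula are integral elements, so the cobracket of a
generator is an integral combination of wedges of classes of generators. -/
theorem cobracketH_X_mem (g : Gen D) : cobracketH D (MvPolynomial.X g) ∈ integralForms D := by
  have h : cobracketH D (MvPolynomial.X g) = classWedge D (coproductGen D g) := by
    change classWedge D (coproduct D _) = _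
    rw [coproduct, MvPolynomial.aeval_X]
  rw [h]
  cases g with
  | log r =>
    have h1 : classMap D 1 = 0 := (isInfinitesimal_classMap D).map_one
    rw [coproductGen, map_add]
    simp [classWedge, h1]
  | li s =>
    rw [coproductGen, coproductSeries]
    simp only [map_sum]
    have ht := tvar_mem_seriesSubring (D := D) s.depth
    have ht0 := constantCoeff_tvar (D := D) s.depth
    refine sum_mem fun k _ => sum_mem fun ij _ => classWedge_coeff_mem ?_ (mul_mem ?_ ?_) _
    · exact liAt_mem_seriesSubring _ _ (fun i => ht0 _) fun i => ht _
    · exact liAt_mem_seriesSubring _ _ (fun i => ht0 _) fun i => ht _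
    · exact prod_mem fun a _ => blockSeries_mem_seriesSubring _ _ _ _ _

theorem ceDiff_mem_integralForms {z : ExteriorAlgebra ℚ (Lsymb D)} (hz : z ∈ integralForms D) :
    ceDiff (cobracket D) z ∈ integralForms D := by
  have h : integralForms D = Subring.closure (ExteriorAlgebra.ι ℚ ''
      Set.range fun g : Gen D => toLsymb D (MvPolynomial.X g)) := by
    rw [← Set.range_comp]
    rfl
  rw [h] at hz ⊢
  refine ceDiff_mem_closure _ ?_ hz
  rintro _ ⟨g, rfl⟩
  rw [← h, coe_cobracket_toLsymb]
  exact cobracketH_X_mem g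

end Integrality

/-! ### Coordinates on the universal abelian cover -/

section HolomorphicForms
open Filter Topology

variable {D : ℕ∞} {d k : ℕ}

/-- A function with values in alternating forms on `ℂ^d` is analytic if its values at all tuples of
vectors are. -/
theorem analyticAt_of_apply {E : Type} [NormedAddCommGroup E] [NormedSpace ℂ E]
    {f : E → (Fin d → ℂ) [⋀^Fin k]→L[ℂ] ℂ} {x : E} (hf : ∀ X, AnalyticAt ℂ (fun y => f y X) x) :
    AnalyticAt ℂ f x := by
  -- a form is determined by its values at the basis vectors, so evaluation there has a linear
  -- left inverse, which is continuous because its source is finite-dimensional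
  let ev : ((Fin d → ℂ) [⋀^Fin k]→L[ℂ] ℂ) →ₗ[ℂ] ((Fin k → Fin d) → ℂ) :=
    { toFun := fun η s => η fun i => Pi.single (s i) 1
      map_add' := fun _ _ => rfl
      map_smul' := fun _ _ => rfl }
  have hev : LinearMap.ker ev = ⊥ := by
    refine LinearMap.ker_eq_bot'.2 fun η h => ?_
    apply ContinuousAlternatingMap.toAlternatingMap_injective
    refine Module.Basis.ext_alternating (Pi.basisFun ℂ (Fin d)) fun s _ => ?_
    have := congrFun h s
    simpa [ev] using this
  obtain ⟨g, hg⟩ := ev.exists_leftInverse_of_injective hev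
  have h1 : f = fun y => (LinearMap.toContinuousLinearMap g) (ev (f y)) := by
    funext y
    exact (LinearMap.congr_fun hg (f y)).symm
  rw [h1]
  refine ((LinearMap.toContinuousLinearMap g).analyticAt _).comp ?_
  exact analyticAt_pi_iff.2 fun s => hf _

theorem wedgeCovectors_apply (f : Fin k → ((Fin d → ℂ) →L[ℂ] ℂ)) (X : Fin k → Fin d → ℂ) :
    wedgeCovectors d k f X = (Matrix.of fun i j => f i (X j)).det := detForm_comp_apply f X

/-- Expansion of the determinant along the first row. -/
theorem wedgeCovectors_cons_apply (a : (Fin d → ℂ) →L[ℂ] ℂ) (f : Fin k → ((Fin d → ℂ) →L[ℂ] ℂ))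
    (X : Fin (k + 1) → Fin d → ℂ) : wedgeCovectors d (k + 1) (Fin.cons a f) X
      = ∑ j : Fin (k + 1), (-1) ^ (j : ℕ) * a (X j) * wedgeCovectors d k f fun l => X (j.succAbove l) := by
  rw [wedgeCovectors_apply, Matrix.det_succ_row_zero]
  refine Finset.sum_congr rfl fun j _ => ?_
  rw [wedgeCovectors_apply]
  rfl

/-- The form `x₀ dx₁ ∧ ⋯ ∧ dx_k` on `ℂ^(k+1)`. -/
def modelForm (k : ℕ) : (Fin (k + 1) → ℂ) →L[ℂ] (Fin (k + 1) → ℂ) [⋀^Fin k]→L[ℂ] ℂ :=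
  (ContinuousLinearMap.proj 0 : (Fin (k + 1) → ℂ) →L[ℂ] ℂ).smulRight
    ((detForm k).compContinuousLinearMap
      (ContinuousLinearMap.pi fun i : Fin k => ContinuousLinearMap.proj i.succ))

/-- `d(x₀ dx₁ ∧ ⋯ ∧ dx_k) = dx₀ ∧ dx₁ ∧ ⋯ ∧ dx_k`. -/
theorem extDeriv_modelForm (x : Fin (k + 1) → ℂ) :
    extDeriv (fun x => modelForm k x) x = detForm (k + 1) := by
  ext v
  have h : extDeriv (fun x => modelForm k x) x v
      = ∑ i : Fin (k + 1), (-1) ^ (i : ℕ) • modelForm k (v i) (i.removeNth v) := by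
    rw [extDeriv, ContinuousLinearMap.fderiv, ContinuousAlternatingMap.alternatizeUncurryFin_apply]
  have h' : detForm (k + 1) v = (Matrix.of fun i j => v j i).det := by
    rw [← Matrix.det_transpose]
    rfl
  rw [h, h', Matrix.det_succ_row_zero]
  refine Finset.sum_congr rfl fun i _ => ?_
  have h2 : modelForm k (v i) (i.removeNth v) = v i 0 * (Matrix.of fun a b => v (i.succAbove b) a.succ).det := by
    change v i 0 * _ = _
    congr 1
    exact detForm_comp_apply _ _
  rw [h2, zsmul_eq_mul]
  push_cast
  rw [mul_assoc]
  rfl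

/-- The linear form `∑_{i ≤ r < j} du_r`. -/
def uSumCLM (d i j : ℕ) : (Fin d → ℂ) →L[ℂ] ℂ :=
  ∑ r : Fin d, if i ≤ (r : ℕ) ∧ (r : ℕ) < j then ContinuousLinearMap.proj r else 0

theorem uSum_eq (i j : ℕ) (u : Fin d → ℂ) : uSum u i j = uSumCLM d i j u := by
  rw [uSum, uSumCLM, sum_apply]
  refine Finset.sum_congr rfl fun r _ => ?_
  split_ifs <;> rfl

/-- The points `u` at which the branch of the logarithm in `localParam q` is holomorphic. -/
def chart (q : Ambient d) : Set (Fin d → ℂ) :=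
  {u | ∀ ij : {ij : Fin (d + 1) × Fin (d + 1) // ij.1 < ij.2},
    (1 - Complex.exp (uSum u ij.1.1 ij.1.2)) / Complex.exp (q.2 ij) ∈ Complex.slitPlane}

theorem self_mem_chart {q : Ambient d} (hq : q ∈ Shat d) : q.1 ∈ chart q := fun ij => by
  have h : 1 - Complex.exp (uSum q.1 ij.1.1 ij.1.2) = Complex.exp (q.2 ij) := by
    rw [← hq ij]; ring
  rw [h, div_self (Complex.exp_ne_zero _)]
  exact Complex.one_mem_slitPlane

theorem isOpen_chart (q : Ambient d) : IsOpen (chart q) := by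
  have h : chart q = ⋂ ij : {ij : Fin (d + 1) × Fin (d + 1) // ij.1 < ij.2},
      (fun u : Fin d → ℂ => (1 - Complex.exp (uSum u ij.1.1 ij.1.2)) / Complex.exp (q.2 ij)) ⁻¹'
        Complex.slitPlane := by
    ext u; simp [chart]
  rw [h]
  refine isOpen_iInter_of_finite fun ij => Complex.isOpen_slitPlane.preimage ?_
  simp only [uSum_eq]
  fun_prop

theorem one_sub_exp_ne_zero {q : Ambient d} {u : Fin d → ℂ} (hu : u ∈ chart q)
    (ij : {ij : Fin (d + 1) × Fin (d + 1) // ij.1 < ij.2}) :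
    1 - Complex.exp (uSum u ij.1.1 ij.1.2) ≠ 0 := fun h => by
  have := hu ij
  rw [h, zero_div] at this
  exact Complex.slitPlane_ne_zero this rfl

theorem localParam_mem_Shat {q : Ambient d} {u : Fin d → ℂ} (hu : u ∈ chart q) :
    localParam q u ∈ Shat d :=
  localParam_mem q fun ij => (sub_ne_zero.1 (one_sub_exp_ne_zero hu ij)).symm

theorem exp_localParam {q : Ambient d} {u : Fin d → ℂ} (hu : u ∈ chart q)
    (ij : {ij : Fin (d + 1) × Fin (d + 1) // ij.1 < ij.2}) :
    Complex.exp ((localParam q u).2 ij) = 1 - Complex.exp (uSum u ij.1.1 ij.1.2) :=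
  eq_sub_of_add_eq' (localParam_mem_Shat hu ij)

theorem analyticAt_localParam {q : Ambient d} {u : Fin d → ℂ} (hu : u ∈ chart q)
    (ij : {ij : Fin (d + 1) × Fin (d + 1) // ij.1 < ij.2}) :
    AnalyticAt ℂ (fun u => (localParam q u).2 ij) u := by
  have h : AnalyticAt ℂ (fun u : Fin d → ℂ =>
      (1 - Complex.exp (uSum u ij.1.1 ij.1.2)) / Complex.exp (q.2 ij)) u := by
    simp only [uSum_eq]
    exact (analyticAt_const.sub ((uSumCLM d ij.1.1 ij.1.2).analyticAt u).cexp).div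
      analyticAt_const (Complex.exp_ne_zero _)
  exact analyticAt_const.add (h.clog (hu ij))

/-- Differentiating `exp(U) + exp(v) = 1` gives `dv = -exp(-v) exp(U) dU`. -/
theorem hasFDerivAt_localParam {q : Ambient d} {u : Fin d → ℂ} (hu : u ∈ chart q)
    (ij : {ij : Fin (d + 1) × Fin (d + 1) // ij.1 < ij.2}) :
    HasFDerivAt (fun u => (localParam q u).2 ij)
      (-((Complex.exp ((localParam q u).2 ij))⁻¹ * Complex.exp (uSum u ij.1.1 ij.1.2)) •
        uSumCLM d ij.1.1 ij.1.2) u := by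
  have h1 : HasFDerivAt (fun u : Fin d → ℂ => uSum u ij.1.1 ij.1.2) (uSumCLM d ij.1.1 ij.1.2) u := by
    simp only [uSum_eq]
    exact (uSumCLM d ij.1.1 ij.1.2).hasFDerivAt
  have h2 := (((h1.cexp.const_sub 1).mul_const (Complex.exp (q.2 ij))⁻¹).clog (hu ij)).const_add
    (q.2 ij)
  refine h2.congr_fderiv ?_
  rw [exp_localParam hu]
  have := one_sub_exp_ne_zero hu ij
  have := Complex.exp_ne_zero (q.2 ij)
  ext x
  simp
  field_simp

variable (hD : D ≤ d)

theorem analyticAt_coord {q : Ambient d} {u : Fin d → ℂ} (hu : u ∈ chart q) (y : FormVar D) :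
    AnalyticAt ℂ (fun u => coord hD (localParam q u) y) u := by
  cases y with
  | u r => exact (ContinuousLinearMap.proj (R := ℂ) (φ := fun _ : Fin d => ℂ)
      (⟨r.1, Nat.cast_lt.1 (r.2.trans_le hD)⟩ : Fin d)).analyticAt u
  | v i j hij hj => exact analyticAt_localParam hu _

theorem hasFDerivAt_coord {q : Ambient d} {u : Fin d → ℂ} (hu : u ∈ chart q) (y : FormVar D) :
    HasFDerivAt (fun u => coord hD (localParam q u) y) (dCoord hD (localParam q u) y) u := by
  have hu' : (localParam q u).1 ∈ chart (localParam q u) := self_mem_chart (localParam_mem_Shat hu)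
  cases y with
  | u r =>
    have h : ∀ q' : Ambient d, HasFDerivAt (fun u => coord hD (localParam q' u) (FormVar.u r))
        (ContinuousLinearMap.proj (⟨r.1, Nat.cast_lt.1 (r.2.trans_le hD)⟩ : Fin d)) u :=
      fun q' => (ContinuousLinearMap.proj (R := ℂ) (φ := fun _ : Fin d => ℂ)
        (⟨r.1, Nat.cast_lt.1 (r.2.trans_le hD)⟩ : Fin d)).hasFDerivAt
    rw [dCoord, show (localParam q u).1 = u from rfl, (h _).fderiv]
    exact h q
  | v i j hij hj =>
    have hjd : j ≤ d := Nat.cast_le.1 (hj.trans hD)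
    let ij : {ij : Fin (d + 1) × Fin (d + 1) // ij.1 < ij.2} :=
      ⟨(⟨i, by omega⟩, ⟨j, by omega⟩), hij⟩
    have h1 : HasFDerivAt (fun u => coord hD (localParam q u) (FormVar.v i j hij hj)) _ u :=
      hasFDerivAt_localParam hu ij
    have h2 : HasFDerivAt (fun u' => coord hD (localParam (localParam q u) u')
      (FormVar.v i j hij hj)) _ u := hasFDerivAt_localParam hu' ij
    rw [localParam_self (localParam_mem_Shat hu)] at h2
    rw [dCoord, show (localParam q u).1 = u from rfl, h2.fderiv]
    exact h1

/-- The covector at `q` given by the restriction to `Ŝ_d(ℂ)` of a polynomial one-form. -/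
def covector (q : Ambient d) : FormPoly D ⊗[ℚ] Hone D →ₗ[ℚ] ((Fin d → ℂ) →L[ℂ] ℂ) :=
  TensorProduct.lift (LinearMap.mk₂ ℚ
    (fun p v => (MvPolynomial.aeval (coord hD q) p : ℂ) •
      Finsupp.linearCombination ℚ (dCoord hD q) v)
    (fun p p' v => by ext X; simp [add_mul])
    (fun c p v => by ext X; simp [Rat.smul_def, mul_assoc])
    (fun p v v' => by ext X; simp)
    (fun c p v => by ext X; simp [Rat.smul_def, mul_left_comm]))

theorem covector_tmul (q : Ambient d) (p : FormPoly D) (v : Hone D) :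
    covector hD q (p ⊗ₜ v) = (MvPolynomial.aeval (coord hD q) p : ℂ) •
      Finsupp.linearCombination ℚ (dCoord hD q) v := rfl

theorem covector_smul (q : Ambient d) (p : FormPoly D) (t : FormPoly D ⊗[ℚ] Hone D) :
    covector hD q (p • t) = (MvPolynomial.aeval (coord hD q) p : ℂ) • covector hD q t := by
  induction t with
  | zero => ext X; simp
  | add x y hx hy => ext X; simp [smul_add, hx, hy]
  | tmul r v =>
    rw [TensorProduct.smul_tmul', covector_tmul, covector_tmul, smul_eq_mul, map_mul]
    ext X
    simp [mul_assoc]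

theorem analyticAt_aeval {q : Ambient d} {u : Fin d → ℂ} (hu : u ∈ chart q) (p : FormPoly D) :
    AnalyticAt ℂ (fun u => (MvPolynomial.aeval (coord hD (localParam q u)) p : ℂ)) u := by
  induction p using MvPolynomial.induction_on with
  | C c => simpa using analyticAt_const
  | add p p' hp hp' => 
    simp only [map_add]
    exact hp.add hp'
  | mul_X p y hp =>
    simp only [map_mul, MvPolynomial.aeval_X]
    exact hp.mul (analyticAt_coord hD hu y)

theorem hasFDerivAt_aeval {q : Ambient d} {u : Fin d → ℂ} (hu : u ∈ chart q) (p : FormPoly D) :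
    HasFDerivAt (fun u => (MvPolynomial.aeval (coord hD (localParam q u)) p : ℂ))
      (covector hD (localParam q u) (gradient D p)) u := by
  induction p using MvPolynomial.induction_on with
  | C c =>
    rw [show (MvPolynomial.C c : FormPoly D) = algebraMap ℚ _ c from rfl, Derivation.map_algebraMap,
      map_zero]
    simp only [AlgHom.commutes]
    exact hasFDerivAt_const _ _
  | add p p' hp hp' =>
    simp only [map_add]
    exact hp.add hp'
  | mul_X p y hp =>
    simp only [map_mul, MvPolynomial.aeval_X]
    refine (hp.mul (hasFDerivAt_coord hD hu y)).congr_fderiv ?_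
    rw [Derivation.leibniz, map_add, covector_smul, covector_smul, MvPolynomial.aeval_X, gradient,
      MvPolynomial.mkDerivation_X, covector_tmul, map_one, one_smul,
      Finsupp.linearCombination_single, one_smul]

end HolomorphicForms

/-! ### Holomorphic de Rham forms -/

section HolomorphicDeRham
open Filter Topology

variable {D : ℕ∞} {d k n : ℕ}

theorem gradient_linearCombination (v : Hone D) :
    gradient D (Finsupp.linearCombination ℚ MvPolynomial.X v) = 1 ⊗ₜ v := by
  induction v using Finsupp.induction_linear with
  | zero => simp
  | add v v' h h' => rw [map_add, map_add, h, h', TensorProduct.tmul_add]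
  | single y c =>
    rw [Finsupp.linearCombination_single, Derivation.map_smul, gradient,
      MvPolynomial.mkDerivation_X, ← TensorProduct.tmul_smul, Finsupp.smul_single, smul_eq_mul,
      mul_one]

variable (hD : D ≤ d)

theorem realize_tmul_ιMulti (p : FormPoly D) (v : Fin k → Hone D) (q : Shat d) :
    realize hD k (p ⊗ₜ ExteriorAlgebra.ιMulti ℚ k v) q = (MvPolynomial.aeval (coord hD q) p : ℂ) •
      wedgeCovectors d k fun i => Finsupp.linearCombination ℚ (dCoord hD q) (v i) := by
  change (MvPolynomial.aeval (coord hD q) p : ℂ) • constFormAt hD k q _ = _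
  rw [constFormAt, ExteriorAlgebra.liftAlternating_apply_ιMulti, Pi.single_eq_same]
  rfl

theorem realize_tmul_ιMulti_of_ne (h : n ≠ k) (p : FormPoly D) (v : Fin n → Hone D) :
    realize hD k (p ⊗ₜ ExteriorAlgebra.ιMulti ℚ n v) = 0 := by
  funext q
  change (MvPolynomial.aeval (coord hD q) p : ℂ) • constFormAt hD k q _ = 0
  rw [constFormAt, ExteriorAlgebra.liftAlternating_apply_ιMulti, Pi.single_eq_of_ne h]
  ext X
  simp

theorem realize_add (ω ω' : DeRham D) :
    realize hD k (ω + ω') = realize hD k ω + realize hD k ω' := by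
  funext q
  exact map_add _ _ _

theorem realize_zero : realize hD k (0 : DeRham D) = 0 := by
  funext q
  exact map_zero _

theorem oneForm_tmul_mul_ιMulti (p : FormPoly D) (a : Hone D) (v : Fin n → Hone D) :
    oneForm D (p ⊗ₜ a) * (1 ⊗ₜ ExteriorAlgebra.ιMulti ℚ n v)
      = p ⊗ₜ ExteriorAlgebra.ιMulti ℚ (n + 1) (Fin.cons a v : Fin (n + 1) → Hone D) := by
  rw [ExteriorAlgebra.ιMulti_succ_apply, oneForm, TensorProduct.map_tmul,
    Algebra.TensorProduct.tmul_mul_tmul, mul_one]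
  rfl

theorem realize_oneForm_mul_of_ne (h : n ≠ k) (t : FormPoly D ⊗[ℚ] Hone D) (v : Fin n → Hone D) :
    realize hD (k + 1) (oneForm D t * (1 ⊗ₜ ExteriorAlgebra.ιMulti ℚ n v)) = 0 := by
  induction t with
  | zero => rw [map_zero, zero_mul, realize_zero]
  | add x y hx hy => rw [map_add, add_mul, realize_add, hx, hy, add_zero]
  | tmul p a => rw [oneForm_tmul_mul_ιMulti, realize_tmul_ιMulti_of_ne hD (by omega)]

/-- The realization of `θ ∧ dv_0 ∧ ⋯ ∧ dv_(k-1)` for a polynomial one-form `θ`. -/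
theorem realize_oneForm_mul (t : FormPoly D ⊗[ℚ] Hone D) (v : Fin k → Hone D) (q : Shat d) :
    realize hD (k + 1) (oneForm D t * (1 ⊗ₜ ExteriorAlgebra.ιMulti ℚ k v)) q
      = wedgeCovectors d (k + 1) (Fin.cons (covector hD q t) fun i =>
          Finsupp.linearCombination ℚ (dCoord hD q) (v i)) := by
  ext X
  rw [wedgeCovectors_cons_apply]
  induction t with
  | zero => rw [map_zero, zero_mul, realize_zero, map_zero]; simp
  | add x y hx hy =>
    rw [map_add, add_mul, realize_add, Pi.add_apply, ContinuousAlternatingMap.add_apply, hx, hy,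
      map_add, ← Finset.sum_add_distrib]
    refine Finset.sum_congr rfl fun j _ => ?_
    rw [add_apply, mul_add, add_mul]
  | tmul p a =>
    have h : (fun i => Finsupp.linearCombination ℚ (dCoord hD q)
        ((Fin.cons a v : Fin (k + 1) → Hone D) i))
        = Fin.cons (Finsupp.linearCombination ℚ (dCoord hD q) a)
          fun i => Finsupp.linearCombination ℚ (dCoord hD q) (v i) := by
      funext i
      cases i using Fin.cases <;> rfl
    rw [oneForm_tmul_mul_ιMulti, realize_tmul_ιMulti, h, ContinuousAlternatingMap.smul_apply,
      wedgeCovectors_cons_apply, covector_tmul, smul_eq_mul, Finset.mul_sum]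
    refine Finset.sum_congr rfl fun j _ => ?_
    rw [smul_apply, smul_eq_mul]
    ring

/-- The map to `ℂ^(k+1)` whose coordinates are the coefficient `p` and the functions `v i`. The
restriction of `p dv_0 ∧ ⋯ ∧ dv_(k-1)` is the pullback of `modelForm k` along it. -/
def pullbackMap (p : FormPoly D) (v : Fin k → Hone D) (q : Ambient d) (u : Fin d → ℂ) :
    Fin (k + 1) → ℂ := fun j =>
  MvPolynomial.aeval (coord hD (localParam q u))
    ((Fin.cons p fun i => Finsupp.linearCombination ℚ MvPolynomial.X (v i) :
      Fin (k + 1) → FormPoly D) j)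

variable (p : FormPoly D) (v : Fin k → Hone D) {q : Ambient d} {u : Fin d → ℂ}

theorem analyticAt_pullbackMap (hu : u ∈ chart q) : AnalyticAt ℂ (pullbackMap hD p v q) u :=
  analyticAt_pi_iff.2 fun _ => analyticAt_aeval hD hu _

theorem fderiv_pullbackMap (hu : u ∈ chart q) :
    fderiv ℂ (pullbackMap hD p v q) u = ContinuousLinearMap.pi
      (Fin.cons (covector hD (localParam q u) (gradient D p)) fun i =>
        Finsupp.linearCombination ℚ (dCoord hD (localParam q u)) (v i)) := by
  refine HasFDerivAt.fderiv (hasFDerivAt_pi.2 fun j => ?_)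
  refine (hasFDerivAt_aeval hD hu _).congr_fderiv ?_
  cases j using Fin.cases with
  | zero => rfl
  | succ i =>
    rw [Fin.cons_succ, Fin.cons_succ, gradient_linearCombination, covector_tmul, map_one]
    ext X
    simp

theorem inCoords_realize (hu : u ∈ chart q) :
    (realize hD k (p ⊗ₜ ExteriorAlgebra.ιMulti ℚ k v)).inCoords q u
      = (modelForm k (pullbackMap hD p v q u)).compContinuousLinearMap
          (fderiv ℂ (pullbackMap hD p v q) u) := by
  rw [CoverForm.inCoords, dif_pos (localParam_mem_Shat hu), realize_tmul_ιMulti,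
    fderiv_pullbackMap hD p v hu]
  rfl

theorem inCoords_realize_eventuallyEq (hq : q ∈ Shat d) :
    (realize hD k (p ⊗ₜ ExteriorAlgebra.ιMulti ℚ k v)).inCoords q
      =ᶠ[𝓝 q.1] fun u => (modelForm k (pullbackMap hD p v q u)).compContinuousLinearMap
          (fderiv ℂ (pullbackMap hD p v q) u) :=
  Filter.eventually_of_mem ((isOpen_chart q).mem_nhds (self_mem_chart hq))
    fun _ hu => inCoords_realize hD p v hu

theorem isHolomorphic_realize_tmul_ιMulti :
    (realize hD k (p ⊗ₜ ExteriorAlgebra.ιMulti ℚ k v)).IsHolomorphic := by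
  intro q
  have hF := analyticAt_pullbackMap hD p v (self_mem_chart q.2)
  refine (analyticAt_of_apply fun X => ?_).congr (inCoords_realize_eventuallyEq hD p v q.2).symm
  have h : (fun u => (modelForm k (pullbackMap hD p v q u)).compContinuousLinearMap
      (fderiv ℂ (pullbackMap hD p v q) u) X) = fun u => pullbackMap hD p v q u 0 *
        ∑ σ : Equiv.Perm (Fin k), ((Equiv.Perm.sign σ : ℤ) : ℂ) *
          ∏ i, fderiv ℂ (pullbackMap hD p v q) u (X (σ i)) i.succ := by
    funext u
    exact congrArg (_ * ·) (Matrix.det_apply' (Matrix.of fun i j : Fin k =>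
      fderiv ℂ (pullbackMap hD p v q) u (X i) j.succ))
  rw [h]
  refine (analyticAt_pi_iff.1 hF 0).mul (Finset.analyticAt_fun_sum _ fun σ _ =>
    analyticAt_const.mul (Finset.analyticAt_fun_prod _ fun i _ => ?_))
  exact analyticAt_pi_iff.1 
    (((ContinuousLinearMap.apply ℂ (Fin (k + 1) → ℂ) (X (σ i))).analyticAt _).comp hF.fderiv) i.succ

/-- The exterior derivative commutes with the pullback along `pullbackMap`, and is known for `modelForm`. -/
theorem realize_deRhamD_tmul_ιMulti :
    realize hD (k + 1) (deRhamD D (p ⊗ₜ ExteriorAlgebra.ιMulti ℚ k v))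
      = (realize hD k (p ⊗ₜ ExteriorAlgebra.ιMulti ℚ k v)).extD := by
  funext q
  have hF := analyticAt_pullbackMap hD p v (self_mem_chart q.2)
  rw [CoverForm.extD, (inCoords_realize_eventuallyEq hD p v q.2).extDeriv_eq,
    extDeriv_pullback (modelForm k).differentiableAt (r := ⊤) hF.contDiffAt le_top,
    extDeriv_modelForm, fderiv_pullbackMap hD p v (self_mem_chart q.2), localParam_self q.2,
    deRhamD_tmul, realize_oneForm_mul]
  rfl

/-- The restriction of polynomial forms to `Ŝ_d(ℂ)` is a chain map to the holomorphic forms. -/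
theorem realize_isHolomorphic_and_deRhamD (ω : DeRham D) (k : ℕ) :
    (realize hD k ω).IsHolomorphic ∧ realize hD (k + 1) (deRhamD D ω) = (realize hD k ω).extD := by
  have inCoords_zero : ∀ q : Ambient d, (0 : CoverForm d k).inCoords q = 0 := fun q => by
    funext u; rw [CoverForm.inCoords]; split_ifs <;> rfl
  have zero : (0 : CoverForm d k).IsHolomorphic ∧ 0 = (0 : CoverForm d k).extD := by
    refine ⟨fun q => ?_, ?_⟩
    · rw [inCoords_zero]; exact analyticAt_const
    · funext q
      rw [CoverForm.extD, inCoords_zero]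
      ext X
      simp [extDeriv, ContinuousAlternatingMap.alternatizeUncurryFin_apply]
  have add : ∀ ω ω' : DeRham D,
      ((realize hD k ω).IsHolomorphic ∧
        realize hD (k + 1) (deRhamD D ω) = (realize hD k ω).extD) →
      ((realize hD k ω').IsHolomorphic ∧
        realize hD (k + 1) (deRhamD D ω') = (realize hD k ω').extD) →
      (realize hD k (ω + ω')).IsHolomorphic ∧
        realize hD (k + 1) (deRhamD D (ω + ω')) = (realize hD k (ω + ω')).extD := by
    intro ω ω' h h'
    have hadd : ∀ q : Ambient d, (realize hD k (ω + ω')).inCoords q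
        = (realize hD k ω).inCoords q + (realize hD k ω').inCoords q := fun q => by
      funext u
      rw [realize_add, Pi.add_apply, CoverForm.inCoords, CoverForm.inCoords, CoverForm.inCoords]
      split_ifs
      · rfl
      · rw [add_zero]
    refine ⟨fun q => ?_, ?_⟩
    · rw [hadd]; exact (h.1 q).add (h'.1 q)
    · rw [map_add, realize_add, h.2, h'.2]
      funext q
      rw [CoverForm.extD, hadd, extDeriv_add (h.1 q).differentiableAt (h'.1 q).differentiableAt]
      rfl
  induction ω using TensorProduct.induction_on with
  | zero => rw [map_zero, realize_zero, realize_zero]; exact zero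
  | add ω ω' h h' => exact add ω ω' h h'
  | tmul p η =>
    have hη : η ∈ Submodule.span ℚ (Set.range fun x : Σ n, (Fin n → Hone D) =>
        ExteriorAlgebra.ιMulti ℚ x.1 x.2) := by
      rw [ExteriorAlgebra.ιMulti_span]; trivial
    induction hη using Submodule.span_induction generalizing p with
    | zero => rw [TensorProduct.tmul_zero, map_zero, realize_zero, realize_zero]; exact zero
    | add η η' _ _ h h' => rw [TensorProduct.tmul_add]; exact add _ _ (h p) (h' p)
    | smul c η _ h => rw [← TensorProduct.smul_tmul]; exact h _
    | mem η h =>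
      obtain ⟨⟨n, v⟩, rfl⟩ := h
      by_cases hn : n = k
      · subst hn
        exact ⟨isHolomorphic_realize_tmul_ιMulti hD p v, realize_deRhamD_tmul_ιMulti hD p v⟩
      · dsimp only
        rw [realize_tmul_ιMulti_of_ne hD hn, deRhamD_tmul, realize_oneForm_mul_of_ne hD hn]
        exact zero

end HolomorphicDeRham

end SymbPolylog

end

open SymbPolylog in
theorem theorem1p1 :
    (∀ D : ℕ∞,
      -- `w` takes values in one-forms and kills products
      (∀ x : Hsymb D, w D x ∈ DeRham.degree D 1) ∧
      (∀ a ∈ Hpos D, ∀ b ∈ Hpos D, w D (a * b) = 0) ∧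
      -- the cobracket `δ` on `L` and the multiplicative extension `W` of `w` to `⋀ L`
      ∃ (δ : Lsymb D →ₗ[ℚ] ⋀[ℚ]^2 (Lsymb D))
        (W : ExteriorAlgebra ℚ (Lsymb D) →ₐ[ℚ] DeRham D),
        (∀ x : Hpos D, (δ ((Hpos D).toCotangent x) : ExteriorAlgebra ℚ (Lsymb D))
          = cobracketH D (x : Hsymb D)) ∧
        (∀ x : Hpos D, W (ExteriorAlgebra.ι ℚ ((Hpos D).toCotangent x)) = w D (x : Hsymb D)) ∧
        -- `⋀ L` is a complex, with an integral form
        (∀ z, ceDiff δ (ceDiff δ z) = 0) ∧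
        (∀ z ∈ integralForms D, ceDiff δ z ∈ integralForms D) ∧
        -- `W` is a chain map to the de Rham complex
        (∀ (k : ℕ), ∀ z ∈ ⋀[ℚ]^k (Lsymb D),
          ceDiff δ z ∈ ⋀[ℚ]^(k + 1) (Lsymb D) ∧ W z ∈ DeRham.degree D k) ∧
        (∀ z, W (ceDiff δ z) = deRhamD D (W z)) ∧
        -- with at most `d` variables it gives a chain map to the holomorphic de Rham complex
        (∀ (d : ℕ) (hD : D ≤ d) (k : ℕ) (z : ExteriorAlgebra ℚ (Lsymb D)),
          (realize hD k (W z)).IsHolomorphic ∧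
          realize hD (k + 1) (W (ceDiff δ z)) = (realize hD k (W z)).extD)) ∧
    -- everything is compatible with the inclusion of the part with fewer variables
    (∀ (D : ℕ∞) (x : Hsymb D),
      coproduct ⊤ (Hsymb.incl D x)
          = Algebra.TensorProduct.map (Hsymb.incl D) (Hsymb.incl D) (coproduct D x) ∧
        w ⊤ (Hsymb.incl D x) = DeRham.incl D (w D x)) := by

  refine ⟨fun D => ⟨w_mem, fun a ha b hb => ?_, cobracket D, wWedge D, fun x => ?_, fun x => ?_,
    ceDiff_ceDiff _ ceDiff_cobracket, fun z hz => ceDiff_mem_integralForms hz,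
    fun k z hz => ⟨ceDiff_mem _ hz, wWedge_mem hz⟩, wWedge_ceDiff, fun d hD k z => ?_⟩,
    fun D x => ⟨coproduct_incl D x, w_incl x⟩⟩
  · rw [w_mul, mem_Hpos_iff.1 ha, mem_Hpos_iff.1 hb, zero_smul, zero_smul, add_zero]
  · rw [← toLsymb_coe, coe_cobracket_toLsymb]
  · rw [wWedge_ι, ← toLsymb_coe, wLsymb_toLsymb]
  · rw [wWedge_ceDiff]
    exact realize_isHolomorphic_and_deRhamD hD _ k
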